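/- **Lemma ($L^2$-type FVM estimate).** Let $d\in\{2,3\}$ and $\sigma,D,C_{\rm bil},C_{\rm dual}>0$. There is a constant $C_{\rm aux}>0$, depending only on $d,\sigma,D,C_{\rm bil},C_{\rm dual}$, such that the following holds. *Mesh.* Let $\Omega\subset\mathbb R^d$ be a bounded Lipschitz domain with ${\rm diam}(\Omega)\le D$, and let $\mathcal T_\times$ be a conforming triangulation of $\overline\Omega$ into finitely many non-degenerate closed triangles ($d=2$) or tetrahedra ($d=3$) with ${\rm diam}(T)\le\sigma h_T$ for all $T\in\mathcal T_\times$, where $h_T:=|T|^{1/d}$. Put $\|h_\times\|_{\infty}:=\max_{T}h_T$ and $\Gamma:=\partial\Omega$. *Problem.* Let $\mathbf A$ be symmetric with $\lambda_{\min}|\mathbf v|^2\le\mathbf v^T\mathbf A(x)\mathbf v\le\lambda_{\max}|\mathbf v|^2$ for all $\mathbf v\in\mathbb R^d$ and a.a. $x\in\Omega$, for some $\lambda_{\min},\lambda_{\max}>0$, and $\mathbf A\in W^{1,\infty}(T)^{d\times d}$ for all $T\in\mathcal T_\times$; let $\mathbf b\in W^{1,\infty}(\Omega)^d$ and $c\in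 L^\infty(\Omega)$ with $\frac12{\rm div}\,\mathbf b+c\ge0$ a.e. in $\Omega$. (Functions in $W^{1,\infty}$ are identified with their Lipschitz representatives.) Let $$\mathcal A(v,w):=(\mathbf A\nabla v-\mathbf b v,\nabla w)_{L^2(\Omega)}+(cv,w)_{L^2(\Omega)},$$ and suppose that $|\mathcal A(v,w)|\le C_{\rm bil}\|v\|_{H^1(\Omega)}\|w\|_{H^1(\Omega)}$ for all $v,w\in H^1_0(\Omega)$. *Regularity of the dual problem.* Let $0<s\le1$ and suppose that the dual problem is $H^{1+s}$-regular with constant $C_{\rm dual}$: for all $g\in L^2(\Omega)$, the solution $\phi\in H^1_0(\Omega)$ of $\mathcal A(v,\phi)=(g,v)_{L^2(\Omega)}$ for all $v\in H^1_0(\Omega)$ satisfies $\phi\in H^{1+s}(\Omega)$ and $\|\phi\|_{H^{1+s}(\Omega)}\le C_{\rm dual}\|g\|_{L^2(\Omega)}$. Here $\|\phi\|_{H^{1+s}}^2=\|\phi\|_{H^1}^2+|\nabla\phi|_{s}^2$ with $|\nabla\phi|_s^2=\int_\Omega\int_\Omega\frac{|\nabla\phi(x)-\nabla\phi(y)|^2}{|x-y|^{d+2s}}\,dy\,dx$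 for $s<1$, and $|\nabla\phi|_1=\|D^2\phi\|_{L^2(\Omega)}$. *Exact and FVM solution.* Let $f\in L^2(\Omega)$ and let $u\in H^1_0(\Omega)$ solve $\mathcal A(u,w)=(f,w)_{L^2(\Omega)}$ for all $w\in H^1_0(\Omega)$. For a node $a$ of $\mathcal T_\times$, let the control volume $V_a$ be the union, over the elements $T$ with vertex $a$, of the convex hulls of the centers of gravity of all faces of $T$ (of dimensions $0,\dots,d$) that contain $a$. Let $u_\times$ be a function in $H^1_0(\Omega)$ that is continuous on $\overline\Omega$ and affine on each $T\in\mathcal T_\times$ and that satisfies, for every node $a\in\Omega$, $$\int_{\partial V_a}(-\mathbf A\nabla u_\times+\mathbf b u_\times)\cdot\mathbf n\,ds+\int_{V_a}c\,u_\times\,dx=\int_{V_a}f\,dx .$$ *Oscillations.* Let $R:=f-{\rm div}(-\mathbf A\nabla u_\times+\mathbf b u_\times)-c\,u_\times$ elementwise, let $J$ be the jump of the normal component of $\mathbf A\nabla u_\times$ across a facet common to two elements, let $\Pi_\times$ denote the integral mean over each element, respectively facet, and $${\rm osc}_\times^2:=\sum_{T\in\mathcal T_\times}\Big(h_T^2\,\|(1-\Pi_\times)R\|_{L^2(T)}^2+h_T\,\|(1-\Pi_\times)J\|_{L^2(\partial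 T\setminus\Gamma)}^2\Big).$$ *Conclusion.* $$C_{\rm aux}^{-1}\,\|u-u_\times\|_{L^2(\Omega)}^2\le\|h_\times\|_{\infty}^{2s}\,\|u-u_\times\|_{H^1(\Omega)}^2+{\rm osc}_\times^2 .$$ -/

import Mathlib

open MeasureTheory Set Filter Topology
open scoped ENNReal NNReal ContDiff

namespace FVM

noncomputable section

/-- The space `ℝ^d` with its Euclidean norm. -/
abbrev Vec (d : ℕ) : Type := EuclideanSpace ℝ (Fin d)

/-- The `i`-th standard unit vector. -/
def unitVec {d : ℕ} (i : Fin d) : Vec d := EuclideanSpace.single i 1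

/-! ### Lipschitz domains -/

/-- A bounded Lipschitz domain: nonempty, open, connected, bounded, and near every boundary point
the strict epigraph, in some direction `e`, of a Lipschitz function `γ` of the variables
orthogonal to `e`. -/
structure IsLipschitzDomain {d : ℕ} (Ω : Set (Vec d)) : Prop where
  isOpen : IsOpen Ω
  isConnected : IsConnected Ω
  isBounded : Bornology.IsBounded Ω
  boundary : ∀ x₀ ∈ frontier Ω, ∃ U ∈ 𝓝 x₀, ∃ (e : Vec d) (γ : Vec d → ℝ) (K : ℝ≥0),
    ‖e‖ = 1 ∧ LipschitzWith K γ ∧ (∀ (x : Vec d) (τ : ℝ), γ (x + τ • e) = γ x) ∧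
      ∀ x ∈ U, (x ∈ Ω ↔ γ x < inner ℝ e x)

/-! ### Sobolev spaces -/

/-- Test functions: elements of `C_c^∞(Ω)`. -/
def IsTest {d : ℕ} (Ω : Set (Vec d)) (φ : Vec d → ℝ) : Prop :=
  ContDiff ℝ ∞ φ ∧ HasCompactSupport φ ∧ tsupport φ ⊆ Ω

/-- `w` is the `i`-th weak partial derivative of `v` on `Ω` (used for `v, w ∈ L²(Ω)` only). -/
def IsWeakPartial {d : ℕ} (Ω : Set (Vec d)) (i : Fin d) (v w : Vec d → ℝ) : Prop :=
  ∀ φ : Vec d → ℝ, IsTest Ω φ →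
    ∫ x in Ω, v x * fderiv ℝ φ x (unitVec i) = -∫ x in Ω, w x * φ x

/-- An element of `H¹(Ω)`: a square integrable function together with its square integrable weak
gradient (unique up to null sets). -/
structure H1 {d : ℕ} (Ω : Set (Vec d)) where
  val : Vec d → ℝ
  grad : Vec d → Vec d
  memLp_val : MemLp val 2 (volume.restrict Ω)
  memLp_grad : MemLp grad 2 (volume.restrict Ω)
  weak : ∀ i : Fin d, IsWeakPartial Ω i val (fun x => grad x i)

/-- `v ∈ H¹₀(Ω)`, the closure of `C_c^∞(Ω)` in `H¹(Ω)`. -/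
def H1.InH10 {d : ℕ} {Ω : Set (Vec d)} (v : H1 Ω) : Prop :=
  ∃ φ : ℕ → Vec d → ℝ, (∀ n, IsTest Ω (φ n)) ∧
    Tendsto (fun n => eLpNorm (fun x => v.val x - φ n x) 2 (volume.restrict Ω)) atTop (𝓝 0) ∧
    Tendsto (fun n => eLpNorm (fun x => v.grad x - gradient (φ n) x) 2 (volume.restrict Ω))
      atTop (𝓝 0)

/-- The squared norm `‖v‖²` of `L²(Ω)`. -/
def l2NormSq {d : ℕ} (Ω : Set (Vec d)) (v : Vec d → ℝ) : ℝ := ∫ x in Ω, v x ^ 2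

/-- The squared norm `‖v‖² + ‖G‖²` of `H¹(Ω)` of a function `v` with weak gradient `G`. -/
def h1NormSq {d : ℕ} (Ω : Set (Vec d)) (v : Vec d → ℝ) (G : Vec d → Vec d) : ℝ :=
  (∫ x in Ω, v x ^ 2) + ∫ x in Ω, ‖G x‖ ^ 2

/-- The squared seminorm `|v|²` of `H^{1+s}(Ω)`, for `0 < s ≤ 1`, in terms of the weak gradient `G`
of `v`: the Sobolev-Slobodeckij double integral of `G` if `s < 1`, the `L²`-norm of the weak
Hessian if `s = 1` (and `∞` if there is none in `L²(Ω)`). -/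
def sobolevSeminormSq {d : ℕ} (Ω : Set (Vec d)) (s : ℝ) (G : Vec d → Vec d) : ℝ≥0∞ :=
  open Classical in
  if s = 1 then
    ⨅ (H : Fin d → Fin d → Vec d → ℝ)
      (_ : ∀ i j, MemLp (H i j) 2 (volume.restrict Ω) ∧
        IsWeakPartial Ω i (fun x => G x j) (H i j)),
      ∑ i, ∑ j, ∫⁻ x in Ω, ‖H i j x‖ₑ ^ 2
  else
    ∫⁻ x in Ω, ∫⁻ y in Ω, ‖G x - G y‖ₑ ^ 2 / ‖x - y‖ₑ ^ ((d : ℝ) + 2 * s)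

/-- The squared norm of `H^{1+s}(Ω)`, which is `∞` exactly if `v ∉ H^{1+s}(Ω)`. -/
def H1.sobolevNormSq {d : ℕ} {Ω : Set (Vec d)} (s : ℝ) (v : H1 Ω) : ℝ≥0∞ :=
  ENNReal.ofReal (h1NormSq Ω v.val v.grad) + sobolevSeminormSq Ω s v.grad

/-! ### Triangulations -/

/-- A conforming triangulation of `Ω`: a finite simplicial complex in `ℝ^d` with underlying
space `closure Ω`, all of whose simplices are faces of `d`-dimensional ones. -/
structure Triangulation {d : ℕ} (Ω : Set (Vec d)) where
  complex : Geometry.SimplicialComplex ℝ (Vec d)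
  finite : complex.faces.Finite
  pure : ∀ s ∈ complex.faces, ∃ t ∈ complex.faces, s ⊆ t ∧ t.card = d + 1
  space_eq : complex.space = closure Ω

namespace Triangulation

variable {d : ℕ} {Ω : Set (Vec d)} (𝒯 : Triangulation Ω)

/-- The elements (triangles or tetrahedra), each given by the set of its `d + 1` vertices. -/
def elements : Finset (Finset (Vec d)) :=
  𝒯.finite.toFinset.filter (fun t => t.card = d + 1)

open Classical in
/-- The nodes in `Ω`. -/
def interiorNodes : Finset (Vec d) :=
  (𝒯.elements.biUnion id).filter (fun a => a ∈ Ω)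

open Classical in
/-- The elements that contain the node `a`. -/
def star (a : Vec d) : Finset (Finset (Vec d)) := 𝒯.elements.filter (fun t => a ∈ t)

open Classical in
/-- The elements that share a facet with `t`. The facets of `t` which do not lie on the boundary of
`Ω` are spanned by the sets `t ∩ t'`, with `t'` in `neighbours t`. -/
def neighbours (t : Finset (Vec d)) : Finset (Finset (Vec d)) :=
  𝒯.elements.filter (fun t' => (t ∩ t').card = d)

end Triangulation

/-- The closed simplex with the vertices `t`. -/
def simplex {d : ℕ} (t : Finset (Vec d)) : Set (Vec d) := convexHull ℝ (t : Set (Vec d))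

/-- The local mesh size `|T|^{1/d}`. -/
def meshSize {d : ℕ} (t : Finset (Vec d)) : ℝ := volume.real (simplex t) ^ (1 / (d : ℝ))

/-- The maximum of the mesh-size function. -/
def Triangulation.maxMeshSize {d : ℕ} {Ω : Set (Vec d)} (𝒯 : Triangulation Ω) : ℝ :=
  ⨆ t : 𝒯.elements, meshSize t.1

/-- Shape regularity: `diam T ≤ σ |T|^{1/d}` for all elements. -/
def Triangulation.IsShapeRegular {d : ℕ} {Ω : Set (Vec d)} (𝒯 : Triangulation Ω) (σ : ℝ) : Prop :=
  ∀ t ∈ 𝒯.elements, Metric.diam (simplex t) ≤ σ * meshSize t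

/-! ### The dual mesh -/

/-- The part in the element `t` of the control volume of the node `a`. It is the convex polytope
spanned by the centers of gravity of all faces of `t` that contain `a`: `a` itself,
midpoints of edges, centers of gravity of the faces, and the center of gravity of `t`. -/
def dualCell {d : ℕ} (a : Vec d) (t : Finset (Vec d)) : Set (Vec d) :=
  convexHull ℝ {x | ∃ s : Finset (Vec d), s ⊆ t ∧ a ∈ s ∧ x = s.centroid ℝ id}

/-- The interface in the element `t` between the control volumes of the vertices `a` and `b`
of `t`. For `d = 2`, it is the segment from the midpoint of `ab` to the center of gravity of `t`;
for `d = 3`, it is the plane quadrilateral spanned by the midpoint of `ab`, the centers of gravity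
of the two faces of `t` that contain `ab`, and that of `t`. -/
def dualFace {d : ℕ} (a b : Vec d) (t : Finset (Vec d)) : Set (Vec d) :=
  convexHull ℝ {x | ∃ s : Finset (Vec d), s ⊆ t ∧ a ∈ s ∧ b ∈ s ∧ x = s.centroid ℝ id}

/-- The control volume of the node `a`. -/
def controlVolume {d : ℕ} {Ω : Set (Vec d)} (𝒯 : Triangulation Ω) (a : Vec d) : Set (Vec d) :=
  ⋃ t ∈ 𝒯.star a, dualCell a t

/-- The unit normal of the flat `(d-1)`-dimensional set `F` that points to the same side
as `v`. -/
def unitNormal {d : ℕ} (F : Set (Vec d)) (v : Vec d) : Vec d :=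
  let p : Vec d := (vectorSpan ℝ F)ᗮ.starProjection v
  ‖p‖⁻¹ • p

/-- The flux `∫_{∂V} q ⬝ n ds` over the boundary of the control volume `V` of an interior node
`a`. This boundary consists of the interfaces with the control volumes of the other vertices `b`
of the elements that contain `a`. -/
def boundaryFlux {d : ℕ} {Ω : Set (Vec d)} (𝒯 : Triangulation Ω) (q : Vec d → Vec d)
    (a : Vec d) : ℝ :=
  open Classical in
  ∑ t ∈ 𝒯.star a, ∑ b ∈ t.erase a,
    ∫ x in dualFace a b t, inner ℝ (q x) (unitNormal (dualFace a b t) (b - a)) ∂μHE[d - 1]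

/-! ### The model problem -/

/-- Diffusion matrix, convection field and reaction coefficient. -/
structure Coefficients (d : ℕ) where
  A : Vec d → Vec d →L[ℝ] Vec d
  b : Vec d → Vec d
  c : Vec d → ℝ

/-- The (a.e. defined) classical divergence, which is also the weak one for Lipschitz
fields. -/
def divergence {d : ℕ} (q : Vec d → Vec d) (x : Vec d) : ℝ :=
  ∑ i : Fin d, (fderiv ℝ q x (unitVec i)) i

/-- The assumptions on the coefficients. `A` is symmetric, uniformly positive definite, bounded,
and `W^{1,∞}` on every element; `b` is `W^{1,∞}` on `Ω`; `c` is bounded and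
`div b / 2 + c ≥ 0`. Functions in `W^{1,∞}` are given by their Lipschitz continuous
representatives. -/
structure Coefficients.Admissible {d : ℕ} (κ : Coefficients d) {Ω : Set (Vec d)}
    (𝒯 : Triangulation Ω) : Prop where
  A_symm : ∀ᵐ x ∂volume.restrict Ω, ∀ v w : Vec d, inner ℝ (κ.A x v) w = inner ℝ v (κ.A x w)
  A_bounds : ∃ lmin > 0, ∃ lmax > 0, ∀ᵐ x ∂volume.restrict Ω, ∀ v : Vec d,
    lmin * ‖v‖ ^ 2 ≤ inner ℝ v (κ.A x v) ∧ inner ℝ v (κ.A x v) ≤ lmax * ‖v‖ ^ 2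
  A_lipschitz : ∀ t ∈ 𝒯.elements, ∃ K : ℝ≥0, LipschitzOnWith K κ.A (interior (simplex t))
  b_lipschitz : ∃ K : ℝ≥0, LipschitzOnWith K κ.b Ω
  c_memLp : MemLp κ.c ∞ (volume.restrict Ω)
  nonneg : ∀ᵐ x ∂volume.restrict Ω, 0 ≤ (1 / 2) * divergence κ.b x + κ.c x

/-- The bilinear form `(A∇v - b v, ∇w)_Ω + (c v, w)_Ω`. -/
def Coefficients.form {d : ℕ} (κ : Coefficients d) {Ω : Set (Vec d)} (v w : H1 Ω) : ℝ :=
  (∫ x in Ω, inner ℝ (κ.A x (v.grad x) - v.val x • κ.b x) (w.grad x)) +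
    ∫ x in Ω, κ.c x * v.val x * w.val x

/-- `M` is a continuity constant of the bilinear form on `H¹₀(Ω)`. -/
def Coefficients.IsFormBound {d : ℕ} (κ : Coefficients d) (Ω : Set (Vec d)) (M : ℝ) : Prop :=
  ∀ v w : H1 Ω, v.InH10 → w.InH10 →
    |κ.form v w| ≤ M * √(h1NormSq Ω v.val v.grad) * √(h1NormSq Ω w.val w.grad)

/-- `u` is the weak solution of the model problem. -/
def Coefficients.IsWeakSolution {d : ℕ} (κ : Coefficients d) {Ω : Set (Vec d)} (f : Vec d → ℝ)
    (u : H1 Ω) : Prop :=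
  u.InH10 ∧ ∀ w : H1 Ω, w.InH10 → κ.form u w = ∫ x in Ω, f x * w.val x

/-- `φ` is the solution of the dual problem with right-hand side `g`. -/
def Coefficients.IsDualSolution {d : ℕ} (κ : Coefficients d) {Ω : Set (Vec d)} (g : Vec d → ℝ)
    (φ : H1 Ω) : Prop :=
  φ.InH10 ∧ ∀ v : H1 Ω, v.InH10 → κ.form v φ = ∫ x in Ω, g x * v.val x

/-- The dual problem is `H^{1+s}`-regular with constant `Cdual`: for all `g ∈ L²(Ω)`, the dual
solution `φ` satisfies `φ ∈ H^{1+s}(Ω)` and `‖φ‖_{H^{1+s}} ≤ Cdual ‖g‖_{L²}`. -/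
def Coefficients.IsDualRegular {d : ℕ} (κ : Coefficients d) (Ω : Set (Vec d))
    (s Cdual : ℝ) : Prop :=
  ∀ g : Vec d → ℝ, MemLp g 2 (volume.restrict Ω) →
    ∀ φ : H1 Ω, κ.IsDualSolution g φ →
      φ.sobolevNormSq s ≤ ENNReal.ofReal (Cdual ^ 2 * l2NormSq Ω g)

/-! ### The finite volume method and the oscillations -/

/-- `v ∈ S¹₀`: `v` is in `H¹₀(Ω)`, continuous, and affine on every element. -/
def InS10 {d : ℕ} {Ω : Set (Vec d)} (𝒯 : Triangulation Ω) (v : H1 Ω) : Prop :=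
  v.InH10 ∧ ContinuousOn v.val (closure Ω) ∧
    ∀ t ∈ 𝒯.elements, ∃ ℓ : Vec d →ᵃ[ℝ] ℝ, EqOn v.val ℓ (simplex t)

/-- The flux `-A∇v + b v`, with the classical gradient in the interior of the elements. -/
def Coefficients.flux {d : ℕ} (κ : Coefficients d) (v : Vec d → ℝ) (x : Vec d) : Vec d :=
  -κ.A x (gradient v x) + v x • κ.b x

/-- The bilinear form of the finite volume scheme. A piecewise constant function on the dual mesh
that vanishes on the control volumes which touch the boundary is given by its values `w a` on the
control volumes of the interior nodes `a`. -/
def Coefficients.fvmForm {d : ℕ} (κ : Coefficients d) {Ω : Set (Vec d)} (𝒯 : Triangulation Ω)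
    (v w : Vec d → ℝ) : ℝ :=
  ∑ a ∈ 𝒯.interiorNodes,
    w a * (boundaryFlux 𝒯 (κ.flux v) a + ∫ x in controlVolume 𝒯 a, κ.c x * v x)

/-- `u ∈ S¹₀` solves the finite volume scheme with right-hand side `f`. -/
def Coefficients.IsFVMSolution {d : ℕ} (κ : Coefficients d) {Ω : Set (Vec d)}
    (𝒯 : Triangulation Ω) (f : Vec d → ℝ) (u : H1 Ω) : Prop :=
  InS10 𝒯 u ∧ ∀ w : Vec d → ℝ,
    κ.fvmForm 𝒯 u.val w = ∑ a ∈ 𝒯.interiorNodes, w a * ∫ x in controlVolume 𝒯 a, f x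

/-- The volume residual `f - div (-A∇v + b v) - c v`, in the interior of the elements. -/
def Coefficients.residual {d : ℕ} (κ : Coefficients d) (f v : Vec d → ℝ) (x : Vec d) : ℝ :=
  f x - divergence (κ.flux v) x - κ.c x * v x

/-- The trace on the boundary of the element `t`, from inside `t`, of the field `q`. -/
def traceFrom {d : ℕ} (t : Finset (Vec d)) (q : Vec d → Vec d) : Vec d → Vec d :=
  extendFrom (interior (simplex t)) q

open Classical in
/-- The common facet of two neighbouring elements. -/
def commonFacet {d : ℕ} (t t' : Finset (Vec d)) : Set (Vec d) := simplex (t ∩ t')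

/-- The jump of `A∇v` across the common facet of `t` and `t'` in the direction of the normal that
points from `t` to `t'`. -/
def Coefficients.jump {d : ℕ} (κ : Coefficients d) (t t' : Finset (Vec d)) (v : Vec d → ℝ)
    (x : Vec d) : ℝ :=
  let q : Vec d → Vec d := fun y => κ.A y (gradient v y)
  inner ℝ (traceFrom t q x - traceFrom t' q x)
    (unitNormal (commonFacet t t') (t'.centroid ℝ id - t.centroid ℝ id))

/-- The squared distance in `L²(τ, μ)` of `v` to its integral mean over `τ`. -/
def meanDeviationSq {d : ℕ} (μ : Measure (Vec d)) (τ : Set (Vec d)) (v : Vec d → ℝ) : ℝ :=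
  ∫ x in τ, (v x - ⨍ y in τ, v y ∂μ) ^ 2 ∂μ

/-- The squared local oscillations on the element `t`. -/
def Coefficients.localOscSq {d : ℕ} (κ : Coefficients d) {Ω : Set (Vec d)} (𝒯 : Triangulation Ω)
    (f v : Vec d → ℝ) (t : Finset (Vec d)) : ℝ :=
  meshSize t ^ 2 * meanDeviationSq volume (simplex t) (κ.residual f v) +
    meshSize t * ∑ t' ∈ 𝒯.neighbours t,
      meanDeviationSq μHE[d - 1] (commonFacet t t') (κ.jump t t' v)

/-- The squared oscillations. -/
def Coefficients.oscSq {d : ℕ} (κ : Coefficients d) {Ω : Set (Vec d)} (𝒯 : Triangulation Ω)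
    (f v : Vec d → ℝ) : ℝ :=
  ∑ t ∈ 𝒯.elements, κ.localOscSq 𝒯 f v t

end

end FVM

/-!
The estimate is proved by duality. Let `e = u - u×`, let `φ` solve the dual problem with data `e`
(`Coefficients.exists_isDualSolution`, by coercivity and the Riesz representation), and let
`w ∈ H¹₀` be continuous and affine on each element. Then `‖e‖² = 𝒜(e, φ - w) + 𝒜(e, w)`.

* The first term is at most `M ‖e‖ ‖φ - w‖` in `H¹`, so `w` has to approximate `φ` to order `hˢ`.
  On each element `φ` is close to an affine function (`Triangulation.exists_affine_approx`); the
  value of `w` at an interior node is taken from one element of its star, and is `0` at a boundary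
  node. The affine functions of two elements with a common facet nearly agree at its vertices, and
  chains of such elements connect the star; at a boundary node a chain ends at a boundary facet,
  where `φ` has trace zero (`Triangulation.component_dichotomy`). This gives
  `H1.InH10.exists_interpolant`, and the regularity of `φ` enters through
  `Triangulation.sum_deviation_le`.
* The second term is the residual of `u×` at `w`. The finite volume equations, with the divergence
  theorem on elements and on the pieces of control volumes, show that it tests `R` and `J`
  with `∑ w a • χ a`, where `χ a` is the hat function minus the indicator of `V_a`
  (`residual_identity`). As `χ a` has mean zero on every element and every facet, by symmetry under
  the affine maps that exchange two vertices, `R` and `J` may be replaced by their deviations from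
  their means (`sq_residual_le`), and these are the oscillations.

The divergence theorem `integral_divergence_polytope` is obtained by integrating against Lipschitz
cutoffs whose gradients concentrate in thin layers above the facets. Continuous piecewise affine
functions vanishing on the boundary lie in `H¹₀` by `H1.inH10_ofLipschitz`.
-/

namespace FVM

open Finset (sum_congr mul_sum mem_erase sum_le_sum sum_sub_distrib sum_add_distrib
  mem_of_mem_erase sum_comm erase_subset sum_nonneg sum_eq_zero card_erase_of_mem sum_const
  single_le_sum sum_eq_single sum_coe_sort sum_subset sum_mul sum_neg_distrib)
open Metric (diam closedBall ball dist_le_diam_of_mem diam_nonneg)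

/-! ### The divergence theorem on polytopes -/

/-- The gradient of an affine function. -/
noncomputable def agrad {d : ℕ} (f : Vec d →ᵃ[ℝ] ℝ) : Vec d :=
  (InnerProductSpace.toDual ℝ (Vec d)).symm (LinearMap.toContinuousLinearMap f.linear)

variable {d : ℕ} {Ω : Set (Vec d)} {𝒯 : Triangulation Ω} {κ : Coefficients d} {σ : ℝ}
  {t t' s : Finset (Vec d)} {a b c v x z : Vec d}

theorem inner_agrad (f : Vec d →ᵃ[ℝ] ℝ) (v : Vec d) : inner ℝ (agrad f) v = f.linear v := by
  simp [agrad]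

theorem affine_sub_eq_inner (f : Vec d →ᵃ[ℝ] ℝ) (x y : Vec d) :
    f x - f y = inner ℝ (agrad f) (x - y) := by
  rw [inner_agrad]
  simpa using (f.linearMap_vsub x y).symm

theorem affine_add (f : Vec d →ᵃ[ℝ] ℝ) (x v : Vec d) :
    f (x + v) = f x + inner ℝ (agrad f) v := by
  have := affine_sub_eq_inner f (x + v) x
  rw [add_sub_cancel_left] at this
  linarith

theorem affine_continuous (f : Vec d →ᵃ[ℝ] ℝ) : Continuous f :=
  f.continuous_of_finiteDimensional

/-- A property that holds near `x` holds at some point of every segment starting at `x`. -/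
theorem exists_small_of_eventually {P : Vec d → Prop} (h : ∀ᶠ y in 𝓝 x, P y) (v : Vec d) :
    ∃ ε : ℝ, 0 < ε ∧ ε < 1 ∧ P (x + ε • v) := by
  have hc : ContinuousAt (fun ε : ℝ => x + ε • v) 0 := by fun_prop
  rw [ContinuousAt, zero_smul, add_zero] at hc
  obtain ⟨ε, ⟨h1, h2⟩, h3⟩ := (((hc.eventually h).and (gt_mem_nhds zero_lt_one)).filter_mono
    nhdsWithin_le_nhds |>.and (self_mem_nhdsWithin (s := Ioi 0))).exists
  exact ⟨ε, h3, h2, h1⟩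

theorem affine_lipschitz (f : Vec d →ᵃ[ℝ] ℝ) : LipschitzWith ‖agrad f‖₊ f := by
  refine LipschitzWith.of_dist_le_mul fun x y => ?_
  rw [Real.dist_eq, affine_sub_eq_inner, dist_eq_norm]
  exact abs_real_inner_le_norm _ _

theorem hasFDerivAt_affine (f : Vec d →ᵃ[ℝ] ℝ) (x : Vec d) :
    HasFDerivAt f (LinearMap.toContinuousLinearMap f.linear) x := by
  have h : (f : Vec d → ℝ) = fun y => LinearMap.toContinuousLinearMap f.linear y + f 0 := by
    ext y
    have := affine_sub_eq_inner f y 0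
    rw [inner_agrad, sub_zero] at this
    simp only [LinearMap.coe_toContinuousLinearMap']
    linarith
  rw [h]
  exact (ContinuousLinearMap.hasFDerivAt _).add_const _

theorem hasGradientAt_affine (f : Vec d →ᵃ[ℝ] ℝ) (x : Vec d) :
    HasGradientAt f (agrad f) x := by
  rw [hasGradientAt_iff_hasFDerivAt]
  simpa [agrad] using hasFDerivAt_affine f x

theorem exists_affine_eq_zero {f : Vec d →ᵃ[ℝ] ℝ} (hf : agrad f ≠ 0) : ∃ p, f p = 0 := by
  refine ⟨0 + (-(f 0) / ‖agrad f‖ ^ 2) • agrad f, ?_⟩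
  rw [affine_add, inner_smul_right, real_inner_self_eq_norm_sq]
  have : ‖agrad f‖ ≠ 0 := norm_ne_zero_iff.2 hf
  field_simp
  ring

theorem volume_affine_eq_zero {f : Vec d →ᵃ[ℝ] ℝ} (hf : agrad f ≠ 0) (c : ℝ) :
    volume {x | f x = c} = 0 := by
  let S : AffineSubspace ℝ (Vec d) := (AffineSubspace.mk' c ⊥ : AffineSubspace ℝ ℝ).comap f
  have hS : (S : Set (Vec d)) = {x | f x = c} := by
    ext x
    simp [S, sub_eq_zero]
  rw [← hS]
  refine Measure.addHaar_affineSubspace _ _ fun h => hf ?_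
  have h1 : ∀ x, f x = c := fun x => by
    have : x ∈ (S : Set (Vec d)) := by rw [h]; trivial
    rwa [hS] at this
  have := affine_add f 0 (agrad f)
  rw [h1, h1, real_inner_self_eq_norm_sq] at this
  have : ‖agrad f‖ ^ 2 = 0 := by linarith
  simpa using this

theorem ae_affine_ne_const {f : Vec d →ᵃ[ℝ] ℝ} (hf : agrad f ≠ 0) (c : ℝ) : ∀ᵐ x, f x ≠ c := by
  rw [ae_iff]
  simpa using volume_affine_eq_zero hf c

/-- The level set `f = 0` is an isometric copy of the orthogonal complement of the gradient. -/
theorem integral_hyperplane {f : Vec d →ᵃ[ℝ] ℝ} (hf : agrad f ≠ 0) {p : Vec d} (hp : f p = 0) :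
    (μHE[d - 1]).restrict {x | f x = 0} =
      (volume : Measure (ℝ ∙ agrad f)ᗮ).map (fun y : (ℝ ∙ agrad f)ᗮ => (y : Vec d) + p) := by
  have hiso : Isometry (fun y : (ℝ ∙ agrad f)ᗮ => (y : Vec d) + p) := by
    intro x y
    rw [edist_add_right]
    rfl
  have hrank : Module.finrank ℝ (ℝ ∙ agrad f)ᗮ = d - 1 := by
    have h := (ℝ ∙ agrad f).finrank_add_finrank_orthogonal
    rw [finrank_span_singleton hf, finrank_euclideanSpace_fin] at h
    omega
  have hrange : range (fun y : (ℝ ∙ agrad f)ᗮ => (y : Vec d) + p) = {x | f x = 0} := by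
    ext x
    simp only [mem_range, mem_ofPred_eq]
    constructor
    · rintro ⟨y, rfl⟩
      rw [add_comm, affine_add, hp, zero_add]
      exact Submodule.mem_orthogonal_singleton_iff_inner_right.1 y.2
    · intro hx
      refine ⟨⟨x - p, ?_⟩, by simp⟩
      rw [Submodule.mem_orthogonal_singleton_iff_inner_right, ← affine_sub_eq_inner, hx, hp,
        sub_zero]
  rw [← hrange, ← hiso.map_euclideanHausdorffMeasure, ← hrank,
    InnerProductSpace.euclideanHausdorffMeasure_eq_volume]

theorem measurable_add_const_coe (S : Submodule ℝ (Vec d)) (p : Vec d) :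
    MeasurableEmbedding (fun y : S => (y : Vec d) + p) := by
  have h1 : MeasurableEmbedding (fun y : S => (y : Vec d)) :=
    MeasurableEmbedding.subtype_coe S.closed_of_finiteDimensional.measurableSet
  exact (measurableEmbedding_addRight p).comp h1

/-- Two hyperplanes which are not parallel intersect in a null set of the first one. -/
theorem ae_hyperplane_ne {f g : Vec d →ᵃ[ℝ] ℝ} (hf : agrad f ≠ 0)
    (h : ∃ v, f.linear v = 0 ∧ g.linear v ≠ 0) :
    ∀ᵐ x ∂(μHE[d - 1]).restrict {x | f x = 0}, g x ≠ 0 := by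
  obtain ⟨p, hp⟩ := exists_affine_eq_zero hf
  obtain ⟨v, hv, hgv⟩ := h
  rw [integral_hyperplane hf hp, (measurable_add_const_coe _ _).ae_map_iff]
  let v' : (ℝ ∙ agrad f)ᗮ := ⟨v, by
    rw [Submodule.mem_orthogonal_singleton_iff_inner_right, inner_agrad, hv]⟩
  let G : (ℝ ∙ agrad f)ᗮ →ᵃ[ℝ] ℝ :=
    g.comp ((AffineEquiv.constVAdd ℝ (Vec d) p).toAffineMap.comp
      (ℝ ∙ agrad f)ᗮ.subtype.toAffineMap)
  have hG : ∀ y, G y = g ((y : Vec d) + p) := fun y => by simp [G, add_comm]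
  let S : AffineSubspace ℝ (ℝ ∙ agrad f)ᗮ := (AffineSubspace.mk' 0 ⊥ : AffineSubspace ℝ ℝ).comap G
  have hS : (S : Set (ℝ ∙ agrad f)ᗮ) = {y | G y = 0} := by
    ext x
    simp [S]
  have : volume (S : Set (ℝ ∙ agrad f)ᗮ) = 0 := by
    refine Measure.addHaar_affineSubspace _ _ fun h => hgv ?_
    have h1 : ∀ x, G x = 0 := fun x => by
      have : x ∈ (S : Set _) := by rw [h]; trivial
      rwa [hS] at this
    have h2 := h1 v'
    have h3 := h1 0
    rw [hG] at h2 h3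
    have h4 := affine_add g p v
    rw [inner_agrad, add_comm p v] at h4
    simp only [v', ZeroMemClass.coe_zero, zero_add] at h2 h3
    rw [h2, h3] at h4
    linarith
  rw [hS] at this
  rw [ae_iff]
  convert this using 2
  ext y
  simp [hG]

/-- Integrals over `ℝ^d` in coordinates along and orthogonal to the gradient of `f`, with the
height scaled by `c`. -/
theorem integral_eq_integral_height {f : Vec d →ᵃ[ℝ] ℝ} (hf : agrad f ≠ 0) (p : Vec d)
    {c : ℝ} (hc : 0 < c) (u : Vec d → ℝ) :
    ∫ x, u x = c * ∫ z : ℝ × (ℝ ∙ agrad f)ᗮ,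
      u ((c * z.1) • (‖agrad f‖⁻¹ • agrad f) + (z.2 : Vec d) + p) := by
  set ν : Vec d := ‖agrad f‖⁻¹ • agrad f with hν
  have hν1 : ‖ν‖ = 1 := by
    rw [hν, norm_smul, norm_inv, norm_norm, inv_mul_cancel₀ (norm_ne_zero_iff.2 hf)]
  have hspan : (ℝ ∙ agrad f) = (ℝ ∙ ν) := by
    rw [hν, Submodule.span_singleton_smul_eq (IsUnit.mk0 _ (by simpa using hf))]
  rw [hspan]
  have h1 := (ℝ ∙ ν).measurePreserving_measurableEquivProd (p : Vec d)
  rw [InnerProductSpace.euclideanHausdorffMeasure_eq_volume] at h1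
  let I : ℝ ≃ₗᵢ[ℝ] (ℝ ∙ ν) := LinearIsometryEquiv.toSpanUnitSingleton ν hν1
  have hI : MeasurePreserving I := I.measurePreserving
  have h2 : MeasurePreserving (fun z : ℝ × (ℝ ∙ ν)ᗮ => (I z.1, z.2)) :=
    hI.prod (MeasurePreserving.id volume)
  have h3 := h1.symm.comp h2
  have hemb : MeasurableEmbedding ((((ℝ ∙ ν).measurableEquivProd (p : Vec d)).symm) ∘
      fun z : ℝ × (ℝ ∙ ν)ᗮ => (I z.1, z.2)) := by
    refine (MeasurableEquiv.measurableEmbedding _).comp ?_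
    exact (I.toMeasurableEquiv.prodCongr (MeasurableEquiv.refl _)).measurableEmbedding
  have h4 := h3.integral_comp hemb u
  rw [← h4]
  have h5 : ∀ z : ℝ × (ℝ ∙ ν)ᗮ, ((((ℝ ∙ ν).measurableEquivProd (p : Vec d)).symm) ∘
      fun z : ℝ × (ℝ ∙ ν)ᗮ => (I z.1, z.2)) z = z.1 • ν + z.2 + p := by
    intro z
    simp [I]
  simp only [h5]
  -- scale the height
  let e : ℝ ≃ᵐ ℝ := (Homeomorph.mulLeft₀ c hc.ne').toMeasurableEquiv
  have he : (volume : Measure ℝ).map e = ENNReal.ofReal (c⁻¹) • volume := by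
    have := Real.map_volume_mul_left hc.ne'
    rw [abs_of_pos (by positivity)] at this
    exact this
  have h6 : ((volume : Measure (ℝ × (ℝ ∙ ν)ᗮ))).map (Prod.map e id) =
      ENNReal.ofReal (c⁻¹) • volume := by
    rw [Measure.volume_eq_prod, ← Measure.map_prod_map _ _ e.measurable measurable_id, he,
      Measure.map_id, Measure.prod_smul_left]
  have hemb2 : MeasurableEmbedding (Prod.map e id : ℝ × (ℝ ∙ ν)ᗮ → ℝ × (ℝ ∙ ν)ᗮ) :=
    (e.prodCongr (MeasurableEquiv.refl _)).measurableEmbedding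
  have h7 := hemb2.integral_map (μ := volume) (fun z : ℝ × (ℝ ∙ ν)ᗮ => u (z.1 • ν + z.2 + p))
  rw [h6, integral_smul_measure, ENNReal.toReal_ofReal (by positivity)] at h7
  have h8 : ∀ z : ℝ × (ℝ ∙ ν)ᗮ, (Prod.map e id z).1 = c * z.1 := fun z => rfl
  have h9 : ∀ z : ℝ × (ℝ ∙ ν)ᗮ, (Prod.map e id z).2 = z.2 := fun z => rfl
  simp only [h8, h9] at h7
  rw [← h7, smul_eq_mul, ← mul_assoc, mul_inv_cancel₀ hc.ne', one_mul]

/-- The layer of width proportional to `1 / (n + 1)` above the hyperplane `f = 0`. -/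
abbrev layer (f : Vec d →ᵃ[ℝ] ℝ) (n : ℕ) : Set (Vec d) :=
  {x | 0 < f x ∧ f x < ((n : ℝ) + 1)⁻¹}

/-- Integral means over thin layers above a hyperplane converge to the surface integral. -/
theorem tendsto_integral_layer {f : Vec d →ᵃ[ℝ] ℝ} (hf : agrad f ≠ 0) {u u₀ : Vec d → ℝ}
    (hu : Measurable u) {C R : ℝ} (hC : ∀ x, |u x| ≤ C) (hR : ∀ x, R < ‖x‖ → u x = 0)
    (hlim : ∀ᵐ y ∂(μHE[d - 1]).restrict {x | f x = 0},
      Tendsto u (𝓝[{x | 0 < f x}] y) (𝓝 (u₀ y))) :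
    Tendsto (fun n : ℕ => ((n : ℝ) + 1) *
        ∫ x, (layer f n).indicator u x) atTop
      (𝓝 (‖agrad f‖⁻¹ * ∫ x in {x | f x = 0}, u₀ x ∂μHE[d - 1])) := by
  obtain ⟨p, hp⟩ := exists_affine_eq_zero hf
  have hg : 0 < ‖agrad f‖ := norm_pos_iff.2 hf
  set ν : Vec d := ‖agrad f‖⁻¹ • agrad f with hν
  have hν1 : ‖ν‖ = 1 := by
    rw [hν, norm_smul, norm_inv, norm_norm, inv_mul_cancel₀ (norm_ne_zero_iff.2 hf)]
  have hgν : inner ℝ (agrad f) ν = ‖agrad f‖ := by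
    rw [hν, inner_smul_right, real_inner_self_eq_norm_sq]
    field_simp
  have hfx : ∀ (s : ℝ) (y : (ℝ ∙ agrad f)ᗮ), f (s • ν + (y : Vec d) + p) = s * ‖agrad f‖ := by
    intro s y
    rw [add_comm, affine_add, hp, zero_add, inner_add_right, inner_smul_right, hgν,
      Submodule.mem_orthogonal_singleton_iff_inner_right.1 y.2, add_zero]
  rw [integral_hyperplane hf hp] at hlim ⊢
  rw [(measurable_add_const_coe _ _).integral_map]
  rw [(measurable_add_const_coe _ _).ae_map_iff] at hlim
  -- in the scaled coordinates, the integrals are those of `w n`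
  let w : ℕ → ℝ × (ℝ ∙ agrad f)ᗮ → ℝ := fun n z =>
    (Ioo (0 : ℝ) 1).indicator (fun _ => (1 : ℝ)) z.1 *
      u (((((n : ℝ) + 1) * ‖agrad f‖)⁻¹ * z.1) • ν + (z.2 : Vec d) + p)
  have hw : ∀ n : ℕ, ((n : ℝ) + 1) *
      ∫ x, (layer f n).indicator u x =
      ‖agrad f‖⁻¹ * ∫ z, w n z := by
    intro n
    rw [integral_eq_integral_height hf p (c := (((n : ℝ) + 1) * ‖agrad f‖)⁻¹) (by positivity),
      ← mul_assoc]
    congr 1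
    · field_simp
    · refine integral_congr_ae (.of_forall fun z => ?_)
      simp only [w]
      have hz : (((n : ℝ) + 1) * ‖agrad f‖)⁻¹ * z.1 * ‖agrad f‖ = ((n : ℝ) + 1)⁻¹ * z.1 := by
        field_simp
      by_cases hmem : z.1 ∈ Ioo (0 : ℝ) 1
      · rw [indicator_of_mem hmem, one_mul, indicator_of_mem]
        simp only [mem_ofPred_eq, ← hν]
        rw [hfx, hz]
        refine ⟨by have := hmem.1; positivity, ?_⟩
        exact mul_lt_of_lt_one_right (by positivity) hmem.2
      · rw [indicator_of_notMem hmem, zero_mul, indicator_of_notMem]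
        simp only [mem_ofPred_eq, ← hν]
        rw [hfx, hz]
        rintro ⟨h1, h2⟩
        refine hmem ⟨pos_of_mul_pos_right h1 (by positivity), ?_⟩
        by_contra hlt
        push Not at hlt
        have : ((n : ℝ) + 1)⁻¹ * 1 ≤ ((n : ℝ) + 1)⁻¹ * z.1 := by gcongr
        linarith
  simp only [hw]
  refine Tendsto.const_mul _ ?_
  have hlim0 : ∫ y : (ℝ ∙ agrad f)ᗮ, u₀ ((y : Vec d) + p) =
      ∫ z : ℝ × (ℝ ∙ agrad f)ᗮ, (Ioo (0 : ℝ) 1).indicator (fun _ => (1 : ℝ)) z.1 *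
        u₀ ((z.2 : Vec d) + p) := by
    rw [Measure.volume_eq_prod, integral_prod_mul (μ := volume) (ν := volume)
      (fun a : ℝ => (Ioo (0 : ℝ) 1).indicator (fun _ => (1 : ℝ)) a)
      (fun y : (ℝ ∙ agrad f)ᗮ => u₀ ((y : Vec d) + p)),
      integral_indicator measurableSet_Ioo]
    simp
  rw [hlim0]
  let R' : ℝ := R + ‖p‖ + ‖agrad f‖⁻¹
  refine tendsto_integral_of_dominated_convergence
    (fun z => (Ioo (0 : ℝ) 1).indicator (fun _ => (1 : ℝ)) z.1 *
      (closedBall (0 : (ℝ ∙ agrad f)ᗮ) R').indicator (fun _ => C) z.2) ?_ ?_ ?_ ?_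
  · intro n
    refine (Measurable.mul ?_ (hu.comp ?_)).aestronglyMeasurable
    · exact (measurable_const.indicator measurableSet_Ioo).comp measurable_fst
    · fun_prop
  · rw [Measure.volume_eq_prod]
    refine Integrable.mul_prod (f := (Ioo (0 : ℝ) 1).indicator (fun _ => (1 : ℝ)))
      (g := (closedBall (0 : (ℝ ∙ agrad f)ᗮ) R').indicator (fun _ => C)) ?_ ?_
    · rw [integrable_indicator_iff measurableSet_Ioo]
      simp
    · rw [integrable_indicator_iff Metric.isClosed_closedBall.measurableSet]
      exact integrableOn_const Metric.isBounded_closedBall.measure_lt_top.ne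
  · intro n
    refine .of_forall fun z => ?_
    simp only [w]
    by_cases hmem : z.1 ∈ Ioo (0 : ℝ) 1
    · rw [indicator_of_mem hmem, one_mul, one_mul]
      by_cases hz2 : z.2 ∈ closedBall (0 : (ℝ ∙ agrad f)ᗮ) R'
      · rw [indicator_of_mem hz2]
        exact hC _
      · rw [indicator_of_notMem hz2, hR, norm_zero]
        have hz3 : R' < ‖(z.2 : Vec d)‖ := by
          simpa using hz2
        have hs : ‖((((n : ℝ) + 1) * ‖agrad f‖)⁻¹ * z.1) • ν‖ ≤ ‖agrad f‖⁻¹ := by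
          rw [norm_smul, hν1, mul_one, Real.norm_eq_abs, abs_of_nonneg
            (by have := hmem.1; positivity), mul_inv]
          have h1 : ((n : ℝ) + 1)⁻¹ ≤ 1 := inv_le_one_of_one_le₀ (by simp)
          have h2 : ((n : ℝ) + 1)⁻¹ * ‖agrad f‖⁻¹ ≤ 1 * ‖agrad f‖⁻¹ := by gcongr
          have h3 := hmem.2.le
          have h0 := hmem.1.le
          calc ((n : ℝ) + 1)⁻¹ * ‖agrad f‖⁻¹ * z.1 ≤ 1 * ‖agrad f‖⁻¹ * 1 := by gcongr
            _ = _ := by ring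
        have h5 : ‖(z.2 : Vec d)‖ ≤ ‖((((n : ℝ) + 1) * ‖agrad f‖)⁻¹ * z.1) • ν + (z.2 : Vec d) + p‖
            + ‖((((n : ℝ) + 1) * ‖agrad f‖)⁻¹ * z.1) • ν‖ + ‖p‖ := by
          set a := ((((n : ℝ) + 1) * ‖agrad f‖)⁻¹ * z.1) • ν
          have : (z.2 : Vec d) = (a + z.2 + p) - a - p := by abel
          calc ‖(z.2 : Vec d)‖ = ‖(a + z.2 + p) - a - p‖ := by rw [← this]
            _ ≤ _ := (norm_sub_le _ _).trans (by gcongr; exact norm_sub_le _ _)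
        simp only [R'] at hz3
        linarith
    · rw [indicator_of_notMem hmem]; simp
  · have hae : ∀ᵐ z : ℝ × (ℝ ∙ agrad f)ᗮ, Tendsto u (𝓝[{x | 0 < f x}] ((z.2 : Vec d) + p))
        (𝓝 (u₀ ((z.2 : Vec d) + p))) := by
      rw [Measure.volume_eq_prod]
      exact Measure.quasiMeasurePreserving_snd.ae hlim
    filter_upwards [hae] with z hz
    by_cases hmem : z.1 ∈ Ioo (0 : ℝ) 1
    · simp only [w, indicator_of_mem hmem, one_mul]
      refine hz.comp ?_
      rw [tendsto_nhdsWithin_iff]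
      constructor
      · have h1 : Tendsto (fun n : ℕ => (((n : ℝ) + 1) * ‖agrad f‖)⁻¹ * z.1) atTop
            (𝓝 (0 * z.1)) := by
          refine Tendsto.mul_const _ (Tendsto.inv_tendsto_atTop ?_)
          exact Tendsto.atTop_mul_const hg
            (tendsto_atTop_add_const_right _ _ tendsto_natCast_atTop_atTop)
        have h2 := ((h1.smul_const ν).add_const (z.2 : Vec d)).add_const p
        simpa using h2
      · refine .of_forall fun n => ?_
        have := hmem.1
        simp only [mem_ofPred_eq]
        rw [hfx]
        positivity
    · simp [w, indicator_of_notMem hmem]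

theorem lineDeriv_fun_const {c : ℝ} : lineDeriv ℝ (fun _ : Vec d => c) x v = 0 := by
  simp [lineDeriv]

theorem unitVec_inner (i : Fin d) (x : Vec d) : inner ℝ (unitVec i) x = x i := by
  simp [unitVec, EuclideanSpace.inner_single_left]

theorem sum_mul_unitVec (x : Vec d) : ∑ i, x i • unitVec i = x := by
  ext j
  simp [unitVec, Pi.single_apply]

theorem inner_eq_sum (x y : Vec d) : inner ℝ x y = ∑ i, x i * y i := by
  simp [PiLp.inner_apply, mul_comm]

theorem norm_unitVec (i : Fin d) : ‖unitVec i‖ = 1 := by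
  simp [unitVec]

theorem lipschitzWith_coord {q : Vec d → Vec d} {K : ℝ≥0} (hq : LipschitzWith K q) (k : Fin d) :
    LipschitzWith K (fun x => q x k) := by
  refine LipschitzWith.of_dist_le_mul fun x y => (?_ : _ ≤ _)
  refine le_trans ?_ (hq.dist_le_mul x y)
  rw [Real.dist_eq, dist_eq_norm]
  simpa using PiLp.norm_apply_le (q x - q y) k

/-- A.e., the divergence of a Lipschitz field is the sum of the partial derivatives of its
components. -/
theorem ae_divergence_eq_sum {q : Vec d → Vec d} {K : ℝ≥0} (hq : LipschitzWith K q) :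
    ∀ᵐ x, divergence q x = ∑ k, lineDeriv ℝ (fun x => q x k) x (unitVec k) := by
  filter_upwards [hq.ae_differentiableAt (μ := volume)] with x hx
  refine sum_congr rfl fun k _ => ?_
  have h1 : HasFDerivAt (fun x => q x k)
      ((EuclideanSpace.proj k : Vec d →L[ℝ] ℝ).comp (fderiv ℝ q x)) x :=
    (EuclideanSpace.proj k : Vec d →L[ℝ] ℝ).hasFDerivAt.comp x hx.hasFDerivAt
  rw [(h1.hasLineDerivAt (unitVec k)).lineDeriv]
  simp

theorem abs_divergence_le {q : Vec d → Vec d} {K : ℝ≥0} (hq : LipschitzWith K q)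
    (x : Vec d) : |divergence q x| ≤ d * K := by
  refine (Finset.abs_sum_le_sum_abs _ _).trans ?_
  calc ∑ i : Fin d, |(fderiv ℝ q x (unitVec i)) i| ≤ ∑ _i : Fin d, (K : ℝ) := by
        refine sum_le_sum fun i _ => ?_
        calc |(fderiv ℝ q x (unitVec i)) i| ≤ ‖fderiv ℝ q x (unitVec i)‖ := by
              simpa using PiLp.norm_apply_le (fderiv ℝ q x (unitVec i)) i
          _ ≤ ‖fderiv ℝ q x‖ * ‖unitVec i‖ := ContinuousLinearMap.le_opNorm _ _
          _ ≤ K * 1 := by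
              rw [norm_unitVec]
              gcongr
              exact norm_fderiv_le_of_lipschitz ℝ hq
          _ = K := mul_one _
    _ = d * K := by simp

theorem measurable_divergence (q : Vec d → Vec d) : Measurable (divergence q) := by
  refine Finset.measurable_sum _ fun i _ => ?_
  have : Measurable (fun x => fderiv ℝ q x (unitVec i)) := measurable_fderiv_apply_const ℝ q _
  fun_prop

/-- Integration by parts for Lipschitz functions. -/
theorem integral_divergence_mul {q : Vec d → Vec d} {K : ℝ≥0} (hq : LipschitzWith K q)
    {ψ : Vec d → ℝ} {L : ℝ≥0} (hψ : LipschitzWith L ψ) (hc : HasCompactSupport ψ) :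
    ∫ x, divergence q x * ψ x = -∫ x, ∑ k, lineDeriv ℝ ψ x (unitVec k) * q x k := by
  have hint : ∀ k : Fin d,
      Integrable (fun x => lineDeriv ℝ (fun x => q x k) x (unitVec k) * ψ x) := by
    intro k
    have := (lipschitzWith_coord hq k).locallyIntegrable_lineDeriv (μ := volume) (unitVec k)
    exact this.integrable_smul_right_of_hasCompactSupport hψ.continuous hc
  have hint2 : ∀ (k : Fin d), Integrable (fun x => lineDeriv ℝ ψ x (unitVec k) * q x k) := by
    intro k
    have hsupp : HasCompactSupport (fun x => lineDeriv ℝ ψ x (unitVec k)) := by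
      refine hc.mono' ?_
      intro x hx
      by_contra hx'
      refine hx ?_
      have h0 : ψ =ᶠ[𝓝 x] fun _ => 0 := notMem_tsupport_iff_eventuallyEq.1 hx'
      have := h0.lineDeriv_eq (𝕜 := ℝ) (v := unitVec k)
      simp only [this]
      exact lineDeriv_fun_const
    have h1 := (hψ.locallyIntegrable_lineDeriv (μ := volume) (unitVec k)).integrableOn_isCompact
      hsupp.isCompact
    have h2 : Integrable (fun x => lineDeriv ℝ ψ x (unitVec k)) :=
      (integrableOn_iff_integrable_of_support_subset (subset_tsupport _)).1 h1
    have h3 : Continuous fun x => q x k := (lipschitzWith_coord hq k).continuous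
    have h4 := IntegrableOn.mul_continuousOn h1 h3.continuousOn hsupp.isCompact
    refine (integrableOn_iff_integrable_of_support_subset ?_).1 h4
    refine (Function.support_mul_subset_left _ _).trans (subset_tsupport _)
  have h1 : ∫ x, divergence q x * ψ x =
      ∫ x, ∑ k, lineDeriv ℝ (fun x => q x k) x (unitVec k) * ψ x := by
    refine integral_congr_ae ?_
    filter_upwards [ae_divergence_eq_sum hq] with x hx
    rw [hx, sum_mul]
  rw [h1, integral_finsetSum _ (fun k _ => hint k), integral_finsetSum _ (fun k _ => hint2 k),
    ← sum_neg_distrib]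
  refine sum_congr rfl fun k _ => ?_
  rw [LipschitzWith.integral_lineDeriv_mul_eq (lipschitzWith_coord hq k) hψ hc, ← integral_neg]
  refine integral_congr_ae ?_
  filter_upwards with x
  rw [lineDeriv_neg, neg_mul]

/-- The polytope described by finitely many affine inequalities. -/
def polytope {ι : Type*} (ℓ : ι → Vec d →ᵃ[ℝ] ℝ) : Set (Vec d) := {x | ∀ i, 0 ≤ ℓ i x}

section Polytope

variable {ι : Type*} [Fintype ι] [Nonempty ι] (ℓ : ι → Vec d →ᵃ[ℝ] ℝ)

theorem isClosed_polytope {ι : Type*} (ℓ : ι → Vec d →ᵃ[ℝ] ℝ) : IsClosed (polytope ℓ) := by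
  have : polytope ℓ = ⋂ i, {x | 0 ≤ ℓ i x} := by ext; simp [polytope]
  rw [this]
  exact isClosed_iInter fun i => isClosed_le continuous_const (affine_continuous _)

theorem convex_polytope {ι : Type*} (ℓ : ι → Vec d →ᵃ[ℝ] ℝ) : Convex ℝ (polytope ℓ) := by
  have : polytope ℓ = ⋂ i, (ℓ i) ⁻¹' (Ici 0) := by ext; simp [polytope]
  rw [this]
  exact convex_iInter fun i => (convex_Ici 0).affine_preimage _

/-- The minimum of finitely many affine functions. -/
noncomputable def affMin (x : Vec d) : ℝ := Finset.univ.inf' Finset.univ_nonempty (fun i => ℓ i x)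

theorem exists_affMin_eq (x : Vec d) : ∃ i, affMin ℓ x = ℓ i x := by
  obtain ⟨i, _, hi⟩ := Finset.exists_mem_eq_inf' Finset.univ_nonempty (fun i => ℓ i x)
  exact ⟨i, hi⟩

theorem affMin_le (x : Vec d) (i : ι) : affMin ℓ x ≤ ℓ i x :=
  Finset.inf'_le _ (Finset.mem_univ i)

theorem affMin_lipschitz : LipschitzWith (∑ i, ‖agrad (ℓ i)‖₊) (affMin ℓ) := by
  refine LipschitzWith.of_le_add_mul _ fun x y => ?_
  obtain ⟨i, hi⟩ := exists_affMin_eq ℓ y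
  have h1 := affMin_le ℓ x i
  have h2 := (affine_lipschitz (ℓ i)).le_add_mul x y
  have h3 : (‖agrad (ℓ i)‖₊ : ℝ) ≤ ((∑ i, ‖agrad (ℓ i)‖₊ : ℝ≥0) : ℝ) := by
    exact_mod_cast single_le_sum (f := fun i => ‖agrad (ℓ i)‖₊) (fun _ _ => zero_le)
      (Finset.mem_univ i)
  have h4 : (‖agrad (ℓ i)‖₊ : ℝ) * dist x y ≤ ((∑ i, ‖agrad (ℓ i)‖₊ : ℝ≥0) : ℝ) * dist x y := by
    gcongr
  linarith

/-- A Lipschitz cut-off function of the polytope, with the gradient concentrated in a layer of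
relative width `1 / (n + 1)` at the boundary. -/
noncomputable def cutoff (n : ℕ) (x : Vec d) : ℝ := max 0 (min 1 (((n : ℝ) + 1) * affMin ℓ x))

theorem cutoff_nonneg (n : ℕ) (x : Vec d) : 0 ≤ cutoff ℓ n x := le_max_left _ _

theorem cutoff_le_one (n : ℕ) (x : Vec d) : cutoff ℓ n x ≤ 1 :=
  max_le zero_le_one (min_le_left _ _)

theorem cutoff_lipschitz (n : ℕ) : ∃ L, LipschitzWith L (cutoff ℓ n) :=
  ⟨_, ((((lipschitzWith_smul ((n : ℝ) + 1)).comp (affMin_lipschitz ℓ)).const_min 1).const_max 0)⟩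

theorem cutoff_eq_zero (n : ℕ) (hx : affMin ℓ x ≤ 0) : cutoff ℓ n x = 0 := by
  refine max_eq_left ((min_le_right _ _).trans ?_)
  exact mul_nonpos_of_nonneg_of_nonpos (by positivity) hx

theorem cutoff_compactSupport (hb : Bornology.IsBounded (polytope ℓ)) (n : ℕ) :
    HasCompactSupport (cutoff ℓ n) := by
  refine HasCompactSupport.intro (Metric.isCompact_of_isClosed_isBounded (isClosed_polytope ℓ) hb)
    fun x hx => cutoff_eq_zero ℓ n ?_
  simp only [polytope, mem_ofPred_eq, not_forall, not_le] at hx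
  obtain ⟨i, hi⟩ := hx
  exact (affMin_le ℓ x i).trans hi.le

/-- The region in which the `i`-th affine function is the smallest one. -/
def argminRegion {ι : Type*} (ℓ : ι → Vec d →ᵃ[ℝ] ℝ) (i : ι) : Set (Vec d) :=
  {x | ∀ j, j ≠ i → ℓ i x < ℓ j x}

theorem isOpen_argminRegion (i : ι) : IsOpen (argminRegion ℓ i) := by
  have : argminRegion ℓ i = ⋂ j, {x | j ≠ i → ℓ i x < ℓ j x} := by
    ext; simp [argminRegion]
  rw [this]
  refine isOpen_iInter_of_finite fun j => ?_
  by_cases h : j = i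
  · simp [h]
  · simpa [h] using isOpen_lt (affine_continuous (ℓ i)) (affine_continuous (ℓ j))

theorem affMin_eq_of_mem {i : ι} (hx : x ∈ argminRegion ℓ i) :
    affMin ℓ x = ℓ i x := by
  refine le_antisymm (affMin_le ℓ x i) (Finset.le_inf' _ _ fun j _ => ?_)
  by_cases h : j = i
  · rw [h]
  · exact (hx j h).le

/-- Two affine functions with linearly independent gradients differ almost everywhere. -/
theorem ae_affine_ne {f g : Vec d →ᵃ[ℝ] ℝ} (h : ∃ v, f.linear v = 0 ∧ g.linear v ≠ 0) :
    ∀ᵐ x, f x ≠ g x := by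
  obtain ⟨v, hv, hgv⟩ := h
  have hne : agrad (f - g) ≠ 0 := by
    intro h0
    have := inner_agrad (f - g) v
    rw [h0, inner_zero_left, AffineMap.sub_linear, LinearMap.sub_apply, hv] at this
    exact hgv (by linarith)
  filter_upwards [ae_affine_ne_const hne 0] with x hx h
  exact hx (by simp [h])

/-- Almost everywhere the cutoff is locally `0`, `(n + 1) * ℓ i` or `1`. -/
theorem ae_lineDeriv_cutoff (hne : ∀ i, agrad (ℓ i) ≠ 0)
    (hind : ∀ i j, i ≠ j → ∃ v, (ℓ i).linear v = 0 ∧ (ℓ j).linear v ≠ 0) (n : ℕ) :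
    ∀ᵐ x, ∀ v, lineDeriv ℝ (cutoff ℓ n) x v =
      ∑ i, (((n : ℝ) + 1) * (layer (ℓ i) n).indicator
        ((argminRegion ℓ i).indicator fun _ => inner ℝ (agrad (ℓ i)) v) x) := by
  have hn : (0 : ℝ) < (n : ℝ) + 1 := by positivity
  have h1 : ∀ᵐ x, ∀ i j, i ≠ j → ℓ i x ≠ ℓ j x := by
    rw [ae_all_iff]; intro i
    rw [ae_all_iff]; intro j
    by_cases h : i = j
    · simp [h]
    · filter_upwards [ae_affine_ne (hind i j h)] with x hx _ using hx
  have h2 : ∀ c, ∀ᵐ x, ∀ i, ℓ i x ≠ c := fun c =>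
    ae_all_iff.2 fun i => ae_affine_ne_const (hne i) c
  filter_upwards [h1, h2 0, h2 ((n : ℝ) + 1)⁻¹] with x hx1 hx2 hx3 v
  obtain ⟨i, hi⟩ := exists_affMin_eq ℓ x
  have hmem : x ∈ argminRegion ℓ i := fun j hj =>
    lt_of_le_of_ne (hi ▸ affMin_le ℓ x j) (hx1 i j hj.symm)
  have hnot : ∀ j, j ≠ i → x ∉ argminRegion ℓ j := fun j hj hx =>
    absurd (hx i hj.symm) (not_lt.2 (hmem j hj).le)
  rw [sum_eq_single i]
  rotate_left
  · intro j _ hj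
    have : (argminRegion ℓ j).indicator (fun _ => inner ℝ (agrad (ℓ j)) v) x = 0 :=
      indicator_of_notMem (hnot j hj) _
    simp only [indicator_apply] at this ⊢
    rw [this]; simp
  · simp
  have hev : ∀ᶠ y in 𝓝 x, affMin ℓ y = ℓ i y := by
    filter_upwards [(isOpen_argminRegion ℓ i).mem_nhds hmem] with y hy
      using affMin_eq_of_mem ℓ hy
  have hcont := (affine_continuous (ℓ i)).continuousAt (x := x)
  rcases lt_trichotomy (ℓ i x) 0 with h0 | h0 | h0
  · have : cutoff ℓ n =ᶠ[𝓝 x] fun _ => 0 := by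
      filter_upwards [hev, hcont.eventually_lt_const h0] with y hy hy0
      exact cutoff_eq_zero ℓ n (hy ▸ hy0.le)
    rw [this.lineDeriv_eq, lineDeriv_fun_const, indicator_of_notMem, mul_zero]
    exact fun h => absurd h.1 (not_lt.2 h0.le)
  · exact absurd h0 (hx2 i)
  rcases lt_trichotomy (ℓ i x) ((n : ℝ) + 1)⁻¹ with h3 | h3 | h3
  · have : cutoff ℓ n =ᶠ[𝓝 x] fun y => ((n : ℝ) + 1) * ℓ i y := by
      filter_upwards [hev, hcont.eventually_lt_const h3, hcont.eventually_const_lt h0]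
        with y hy hy1 hy0
      have : ((n : ℝ) + 1) * ℓ i y ≤ 1 := by
        calc _ ≤ ((n : ℝ) + 1) * ((n : ℝ) + 1)⁻¹ := by gcongr
          _ = 1 := mul_inv_cancel₀ hn.ne'
      rw [cutoff, hy, min_eq_right this, max_eq_right (by positivity)]
    rw [this.lineDeriv_eq, indicator_of_mem (show x ∈ layer (ℓ i) n from ⟨h0, h3⟩),
      indicator_of_mem hmem]
    have hd := ((hasFDerivAt_affine (ℓ i) x).const_mul ((n : ℝ) + 1)).hasLineDerivAt v
    rw [hd.lineDeriv, inner_agrad]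
    simp
  · exact absurd h3 (hx3 i)
  · have : cutoff ℓ n =ᶠ[𝓝 x] fun _ => 1 := by
      filter_upwards [hev, hcont.eventually_const_lt h3] with y hy hy1
      have : 1 ≤ ((n : ℝ) + 1) * ℓ i y := by
        calc 1 = ((n : ℝ) + 1) * ((n : ℝ) + 1)⁻¹ := (mul_inv_cancel₀ hn.ne').symm
          _ ≤ _ := by gcongr
      rw [cutoff, hy, min_eq_left this, max_eq_right zero_le_one]
    rw [this.lineDeriv_eq, lineDeriv_fun_const, indicator_of_notMem, mul_zero]
    exact fun h => absurd h.2 (not_lt.2 h3.le)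

/-- The divergence theorem for Lipschitz fields on a bounded polytope `{x | ∀ i, 0 ≤ ℓ i x}`, whose
defining functions `ℓ i` have pairwise linearly independent gradients. The inner normal on
`ℓ i = 0` is the normalized gradient of `ℓ i`. -/
theorem integral_divergence_polytope (hb : Bornology.IsBounded (polytope ℓ))
    (hne : ∀ i, agrad (ℓ i) ≠ 0)
    (hind : ∀ i j, i ≠ j → ∃ v, (ℓ i).linear v = 0 ∧ (ℓ j).linear v ≠ 0)
    {q : Vec d → Vec d} {K : ℝ≥0} (hq : LipschitzWith K q) :
    ∫ x in polytope ℓ, divergence q x =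
      -∑ i, ‖agrad (ℓ i)‖⁻¹ *
        ∫ x in polytope ℓ ∩ {x | ℓ i x = 0}, inner ℝ (agrad (ℓ i)) (q x) ∂μHE[d - 1] := by
  classical
  have hcl := isClosed_polytope ℓ
  have hcomp : IsCompact (polytope ℓ) := Metric.isCompact_of_isClosed_isBounded hcl hb
  obtain ⟨R, hR⟩ := hb.exists_norm_le
  obtain ⟨B, hB⟩ := (hcomp.image hq.continuous).isBounded.exists_norm_le
  have hB : ∀ x ∈ polytope ℓ, ‖q x‖ ≤ B := fun x hx => hB _ (mem_image_of_mem _ hx)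
  -- the limit of the volume term
  have hL : Tendsto (fun n => ∫ x, divergence q x * cutoff ℓ n x) atTop
      (𝓝 (∫ x in polytope ℓ, divergence q x)) := by
    rw [← integral_indicator hcl.measurableSet]
    refine tendsto_integral_of_dominated_convergence
      ((polytope ℓ).indicator fun _ => (d * K : ℝ)) ?_ ?_ ?_ ?_
    · intro n
      obtain ⟨L, hL⟩ := cutoff_lipschitz ℓ n
      exact ((measurable_divergence q).mul hL.continuous.measurable).aestronglyMeasurable
    · rw [integrable_indicator_iff hcl.measurableSet]
      exact integrableOn_const hcomp.measure_lt_top.ne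
    · intro n
      refine .of_forall fun x => ?_
      by_cases hx : x ∈ polytope ℓ
      · rw [indicator_of_mem hx, norm_mul, Real.norm_eq_abs, Real.norm_eq_abs,
          abs_of_nonneg (cutoff_nonneg ℓ n x)]
        calc _ ≤ (d * K : ℝ) * 1 := mul_le_mul (abs_divergence_le hq x)
              (cutoff_le_one ℓ n x) (cutoff_nonneg ℓ n x) (by positivity)
          _ = _ := mul_one _
      · rw [indicator_of_notMem hx, cutoff_eq_zero, mul_zero, norm_zero]
        simp only [polytope, mem_ofPred_eq, not_forall, not_le] at hx
        obtain ⟨i, hi⟩ := hx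
        exact (affMin_le ℓ x i).trans hi.le
    · filter_upwards [ae_all_iff.2 fun i => ae_affine_ne_const (hne i) 0] with x hx
      obtain ⟨i, hi⟩ := exists_affMin_eq ℓ x
      rcases lt_or_gt_of_ne (hx i) with h0 | h0
      · rw [indicator_of_notMem (fun h : x ∈ polytope ℓ => absurd (h i) (not_le.2 h0))]
        refine tendsto_const_nhds.congr fun n => ?_
        rw [cutoff_eq_zero ℓ n (hi ▸ h0.le), mul_zero]
      · have hmem : x ∈ polytope ℓ := fun j => h0.le.trans (hi ▸ affMin_le ℓ x j)
        rw [indicator_of_mem hmem]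
        refine tendsto_const_nhds.congr' ?_
        have h3 : Tendsto (fun n : ℕ => ((n : ℝ) + 1) * affMin ℓ x) atTop atTop :=
          (tendsto_atTop_add_const_right _ _ tendsto_natCast_atTop_atTop).atTop_mul_const
            (hi ▸ h0)
        filter_upwards [h3.eventually_ge_atTop 1] with n hn
        rw [cutoff, min_eq_left hn, max_eq_right zero_le_one, mul_one]
  -- the limit of the layer terms
  let u : ι → Vec d → ℝ := fun i =>
    (polytope ℓ ∩ argminRegion ℓ i).indicator fun x => inner ℝ (agrad (ℓ i)) (q x)
  have hmeas : ∀ i, MeasurableSet (polytope ℓ ∩ argminRegion ℓ i) := fun i =>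
    hcl.measurableSet.inter (isOpen_argminRegion ℓ i).measurableSet
  have hum : ∀ i, Measurable (u i) := fun i =>
    (continuous_const.inner hq.continuous).measurable.indicator (hmeas i)
  have huC : ∀ i x, |u i x| ≤ ‖agrad (ℓ i)‖ * |B| := by
    intro i x
    by_cases hx : x ∈ polytope ℓ ∩ argminRegion ℓ i
    · simp only [u, indicator_of_mem hx]
      exact (abs_real_inner_le_norm _ _).trans
        (by gcongr; exact (hB x hx.1).trans (le_abs_self _))
    · simp only [u, indicator_of_notMem hx, abs_zero]
      positivity
  have huR : ∀ i x, R < ‖x‖ → u i x = 0 := fun i x hx =>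
    indicator_of_notMem (fun h => absurd (hR x h.1) (not_le.2 hx)) _
  have hS : ∀ i, Tendsto (fun n : ℕ => ((n : ℝ) + 1) *
        ∫ x, (layer (ℓ i) n).indicator (u i) x) atTop
      (𝓝 (‖agrad (ℓ i)‖⁻¹ * ∫ x in {x | ℓ i x = 0},
        (polytope ℓ).indicator (fun x => inner ℝ (agrad (ℓ i)) (q x)) x ∂μHE[d - 1])) := by
    intro i
    refine tendsto_integral_layer (hne i) (hum i) (huC i) (huR i) ?_
    have hae : ∀ᵐ y ∂(μHE[d - 1]).restrict {x | ℓ i x = 0}, ∀ j, j ≠ i → ℓ j y ≠ 0 := by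
      rw [ae_all_iff]; intro j
      by_cases h : j = i
      · simp [h]
      · filter_upwards [ae_hyperplane_ne (hne i) (hind i j (Ne.symm h))] with y hy _ using hy
    have hmem : ∀ᵐ y ∂(μHE[d - 1]).restrict {x | ℓ i x = 0}, ℓ i y = 0 := by
      exact ae_restrict_mem (isClosed_eq (affine_continuous _) continuous_const).measurableSet
    filter_upwards [hae, hmem] with y hy hy0
    by_cases hP : y ∈ polytope ℓ
    · rw [indicator_of_mem hP]
      have hcont : Tendsto (fun x => inner ℝ (agrad (ℓ i)) (q x)) (𝓝[{x | 0 < ℓ i x}] y)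
          (𝓝 (inner ℝ (agrad (ℓ i)) (q y))) :=
        ((continuous_const.inner hq.continuous).tendsto y).mono_left nhdsWithin_le_nhds
      refine hcont.congr' ?_
      have hreg : y ∈ argminRegion ℓ i := fun j hj => by
        rw [hy0]; exact lt_of_le_of_ne (hP j) (Ne.symm (hy j hj))
      filter_upwards [self_mem_nhdsWithin,
        nhdsWithin_le_nhds ((isOpen_argminRegion ℓ i).mem_nhds hreg)] with x hx1 hx2
      have : x ∈ polytope ℓ ∩ argminRegion ℓ i := by
        refine ⟨fun j => ?_, hx2⟩
        by_cases h : j = i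
        · rw [h]; exact le_of_lt hx1
        · exact (le_of_lt hx1).trans (hx2 j h).le
      simp only [u, indicator_of_mem this]
    · rw [indicator_of_notMem hP]
      refine tendsto_const_nhds.congr' ?_
      filter_upwards [nhdsWithin_le_nhds (hcl.isOpen_compl.mem_nhds hP)] with x hx
      exact (indicator_of_notMem (fun h => hx h.1) _).symm
  have hS2 := tendsto_finsetSum Finset.univ fun i _ => hS i
  -- both sides agree for each `n`
  have heq : ∀ n : ℕ, ∫ x, divergence q x * cutoff ℓ n x = -∑ i, ((n : ℝ) + 1) *
        ∫ x, (layer (ℓ i) n).indicator (u i) x := by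
    intro n
    obtain ⟨L, hL⟩ := cutoff_lipschitz ℓ n
    rw [integral_divergence_mul hq hL (cutoff_compactSupport ℓ hb n)]
    congr 1
    have hint : ∀ i, Integrable
        ((layer (ℓ i) n).indicator (u i)) := by
      intro i
      refine Integrable.indicator ?_ ?_
      · refine Integrable.mono' (g := (polytope ℓ).indicator fun _ => ‖agrad (ℓ i)‖ * |B|) ?_
          (hum i).aestronglyMeasurable (.of_forall fun x => ?_)
        · rw [integrable_indicator_iff hcl.measurableSet]
          exact integrableOn_const hcomp.measure_lt_top.ne
        · by_cases hx : x ∈ polytope ℓ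
          · rw [indicator_of_mem hx]; exact huC i x
          · rw [indicator_of_notMem hx]
            simp only [u, indicator_of_notMem (fun h : x ∈ polytope ℓ ∩ argminRegion ℓ i => hx h.1),
              norm_zero, le_refl]
      · exact ((isOpen_lt continuous_const (affine_continuous _)).inter
          (isOpen_lt (affine_continuous _) continuous_const)).measurableSet
    simp_rw [← integral_const_mul]
    rw [← integral_finsetSum _ fun i _ => (hint i).const_mul _]
    refine integral_congr_ae ?_
    filter_upwards [ae_lineDeriv_cutoff ℓ hne hind n] with x hx
    simp only [hx]
    simp_rw [sum_mul]
    rw [sum_comm]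
    refine sum_congr rfl fun i _ => ?_
    by_cases h1 : x ∈ layer (ℓ i) n
    · by_cases h2 : x ∈ argminRegion ℓ i
      · have h3 : x ∈ polytope ℓ ∩ argminRegion ℓ i := by
          refine ⟨fun j => ?_, h2⟩
          by_cases h : j = i
          · rw [h]; exact h1.1.le
          · exact h1.1.le.trans (h2 j h).le
        simp only [u, indicator_of_mem h1, indicator_of_mem h2, indicator_of_mem h3, mul_assoc]
        rw [← mul_sum]
        congr 1
        rw [inner_eq_sum]
        refine sum_congr rfl fun k _ => ?_
        rw [real_inner_comm, unitVec_inner]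
      · have h3 : x ∉ polytope ℓ ∩ argminRegion ℓ i := fun h => h2 h.2
        simp only [u, indicator_of_mem h1, indicator_of_notMem h2, indicator_of_notMem h3]
        simp
    · simp only [indicator_of_notMem h1]
      simp
  simp only [heq] at hL
  have := tendsto_nhds_unique hL hS2.neg
  rw [this]
  congr 1
  refine sum_congr rfl fun i _ => ?_
  rw [integral_indicator hcl.measurableSet, Measure.restrict_restrict hcl.measurableSet]

end Polytope

theorem integrable_norm_sq {α E : Type*} [MeasurableSpace α] {μ : Measure α}
    [NormedAddCommGroup E] {F : α → E} (hF : MemLp F 2 μ) : Integrable (fun x => ‖F x‖ ^ 2) μ :=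
  MemLp.integrable_norm_pow (p := 2) (by exact_mod_cast hF) (by norm_num)

/-! ### Barycentric coordinates -/

/-- `t` is the vertex set of a nondegenerate `d`-dimensional simplex. -/
structure IsElement (t : Finset (Vec d)) : Prop where
  indep : AffineIndependent ℝ ((↑) : t → Vec d)
  card : t.card = d + 1

namespace IsElement

/-- The vertices of an element as an affine basis of `ℝ^d`. -/
noncomputable def basis (h : IsElement t) : AffineBasis t ℝ (Vec d) :=
  ⟨(↑), h.indep, by
    rw [h.indep.affineSpan_eq_top_iff_card_eq_finrank_add_one]
    simp [h.card]⟩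

theorem basis_apply (h : IsElement t) (a : t) : h.basis a = a := rfl

theorem nonempty (h : IsElement t) : t.Nonempty := by
  rw [← Finset.card_pos, h.card]; omega

end IsElement

open Classical in
/-- The barycentric coordinate, with respect to the element `t`, that belongs to the vertex `a`,
as an affine function on `ℝ^d`. -/
noncomputable def bary (t : Finset (Vec d)) (a : Vec d) : Vec d →ᵃ[ℝ] ℝ :=
  if h : IsElement t ∧ a ∈ t then h.1.basis.coord ⟨a, h.2⟩ else 0

theorem affine_sum_smul (f : Vec d →ᵃ[ℝ] ℝ) {w : Vec d → ℝ}
    (hw : ∑ a ∈ s, w a = 1) : f (∑ a ∈ s, w a • a) = ∑ a ∈ s, w a * f a := by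
  have h1 : ∀ y, f y = inner ℝ (agrad f) y + f 0 := fun y => by
    have := affine_add f 0 y
    rw [zero_add] at this
    linarith
  rw [h1, inner_sum]
  simp_rw [inner_smul_right]
  have h2 : f 0 = ∑ a ∈ s, w a * f 0 := by rw [← sum_mul, hw, one_mul]
  conv_lhs => rw [h2]
  rw [← sum_add_distrib]
  refine sum_congr rfl fun a _ => ?_
  rw [h1 a]
  ring

namespace IsElement

theorem bary_eq (ht : IsElement t) (ha : a ∈ t) : bary t a = ht.basis.coord ⟨a, ha⟩ :=
  dif_pos ⟨ht, ha⟩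

theorem bary_self (ht : IsElement t) (ha : a ∈ t) : bary t a a = 1 := by
  rw [ht.bary_eq ha]
  exact ht.basis.coord_apply_eq ⟨a, ha⟩

theorem bary_of_ne (ht : IsElement t) (ha : a ∈ t) (hb : b ∈ t) (hab : a ≠ b) :
    bary t a b = 0 := by
  rw [ht.bary_eq ha]
  exact ht.basis.coord_apply_ne (i := ⟨a, ha⟩) (j := ⟨b, hb⟩) (by simpa using hab)

theorem sum_bary (ht : IsElement t) (x : Vec d) : ∑ a ∈ t, bary t a x = 1 := by
  rw [← ht.basis.sum_coord_apply_eq_one x, ← sum_coe_sort]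
  exact sum_congr rfl fun a _ => by rw [ht.bary_eq a.2]

theorem sum_bary_smul (ht : IsElement t) (x : Vec d) : ∑ a ∈ t, bary t a x • a = x := by
  conv_rhs => rw [← ht.basis.linear_combination_coord_eq_self x]
  rw [← sum_coe_sort]
  exact sum_congr rfl fun a _ => by rw [ht.bary_eq a.2, ht.basis_apply]

theorem mem_simplex (ht : IsElement t) :
    x ∈ simplex t ↔ ∀ a ∈ t, 0 ≤ bary t a x := by
  have h1 : simplex t = convexHull ℝ (range ht.basis) := by
    have : range ht.basis = (t : Set (Vec d)) := Subtype.range_coe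
    rw [this, simplex]
  rw [h1, ht.basis.convexHull_eq_nonneg_coord]
  constructor
  · intro h a ha
    rw [ht.bary_eq ha]
    exact h ⟨a, ha⟩
  · intro h a
    rw [← ht.bary_eq a.2]
    exact h a a.2

theorem mem_interior_simplex (ht : IsElement t) :
    x ∈ interior (simplex t) ↔ ∀ a ∈ t, 0 < bary t a x := by
  have h1 : simplex t = convexHull ℝ (range ht.basis) := by
    have : range ht.basis = (t : Set (Vec d)) := Subtype.range_coe
    rw [this, simplex]
  rw [h1, ht.basis.interior_convexHull]
  constructor
  · intro h a ha
    rw [ht.bary_eq ha]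
    exact h ⟨a, ha⟩
  · intro h a
    rw [← ht.bary_eq a.2]
    exact h a a.2

theorem affine_eq_sum (ht : IsElement t) (f : Vec d →ᵃ[ℝ] ℝ) (x : Vec d) :
    f x = ∑ a ∈ t, f a * bary t a x := by
  conv_lhs => rw [← ht.sum_bary_smul x, affine_sum_smul f (ht.sum_bary x)]
  exact sum_congr rfl fun a _ => mul_comm _ _

theorem affine_ext (ht : IsElement t) {f g : Vec d →ᵃ[ℝ] ℝ} (h : ∀ a ∈ t, f a = g a) : f = g := by
  ext x
  rw [ht.affine_eq_sum f, ht.affine_eq_sum g]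
  exact sum_congr rfl fun a ha => by rw [h a ha]

theorem bary_linear_sub (ht : IsElement t) (x y : Vec d) :
    (bary t c).linear (x - y) = bary t c x - bary t c y := by
  rw [affine_sub_eq_inner, inner_agrad]

theorem exists_ne (ht : IsElement t) (hd : 1 ≤ d) (a : Vec d) : ∃ b ∈ t, b ≠ a := by
  refine Finset.exists_mem_ne ?_ a
  rw [ht.card]; omega

theorem exists_ne₂ (ht : IsElement t) (hd : 2 ≤ d) (a b : Vec d) :
    ∃ c ∈ t, c ≠ a ∧ c ≠ b := by
  classical
  have : ((t.erase a).erase b).Nonempty := by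
    rw [← Finset.card_pos]
    have h1 := Finset.pred_card_le_card_erase (s := t) (a := a)
    have h2 := Finset.pred_card_le_card_erase (s := t.erase a) (a := b)
    have := ht.card
    omega
  obtain ⟨c, hc⟩ := this
  simp only [mem_erase] at hc
  exact ⟨c, hc.2.2, hc.2.1, hc.1⟩

theorem agrad_bary_ne_zero (ht : IsElement t) (hd : 1 ≤ d) (ha : a ∈ t) : agrad (bary t a) ≠ 0 := by
  obtain ⟨b, hb, hba⟩ := ht.exists_ne hd a
  intro h
  have := affine_sub_eq_inner (bary t a) a b
  rw [h, inner_zero_left, ht.bary_self ha, ht.bary_of_ne ha hb hba.symm] at this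
  norm_num at this

theorem isCompact_simplex (t : Finset (Vec d)) : IsCompact (simplex t) :=
  t.finite_toSet.isCompact_convexHull (𝕜 := ℝ)

instance (t : Finset (Vec d)) : IsFiniteMeasure (volume.restrict (simplex t)) :=
  ⟨by simpa using (isCompact_simplex t).measure_lt_top⟩

theorem isClosed_simplex (t : Finset (Vec d)) : IsClosed (simplex t) :=
  (isCompact_simplex t).isClosed

theorem convex_simplex (t : Finset (Vec d)) : Convex ℝ (simplex t) := convex_convexHull ℝ _

theorem bary_le_one (ht : IsElement t) (hx : x ∈ simplex t) (ha : a ∈ t) :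
    bary t a x ≤ 1 := by
  rw [← ht.sum_bary x]
  exact single_le_sum (f := fun a => bary t a x) (fun b hb => ht.mem_simplex.1 hx b hb) ha

theorem bary_centroid (ht : IsElement t) (hs : s ⊆ t) (hne : s.Nonempty)
    (ha : a ∈ t) [Decidable (a ∈ s)] :
    bary t a (s.centroid ℝ id) = if a ∈ s then (s.card : ℝ)⁻¹ else 0 := by
  have h1 : s.centroid ℝ id = ∑ b ∈ s, (s.card : ℝ)⁻¹ • b := by
    rw [Finset.centroid_eq_centerMass _ hne, Finset.centerMass]
    have : (s.card : ℝ) ≠ 0 := by exact_mod_cast hne.card_pos.ne'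
    simp [Finset.centroidWeights, this]
  have hc : (s.card : ℝ) ≠ 0 := by exact_mod_cast hne.card_pos.ne'
  have h2 := affine_sum_smul (s := s) (bary t a) (w := fun _ => (s.card : ℝ)⁻¹) (by simp [hc])
  rw [h1, h2]
  split_ifs with has
  · rw [sum_eq_single a, ht.bary_self ha, mul_one]
    · intro b hb hba
      rw [ht.bary_of_ne ha (hs hb) hba.symm, mul_zero]
    · exact fun h => absurd has h
  · refine sum_eq_zero fun b hb => ?_
    rw [ht.bary_of_ne ha (hs hb) (fun h => has (h ▸ hb)), mul_zero]

theorem centroid_mem_interior (ht : IsElement t) : t.centroid ℝ id ∈ interior (simplex t) := by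
  classical
  rw [ht.mem_interior_simplex]
  intro a ha
  rw [ht.bary_centroid (Finset.Subset.refl _) ht.nonempty ha, if_pos ha]
  have := ht.nonempty.card_pos
  positivity

theorem volume_simplex_pos (ht : IsElement t) : 0 < volume.real (simplex t) := by
  rw [measureReal_def, ENNReal.toReal_pos_iff]
  refine ⟨?_, (isCompact_simplex t).measure_lt_top⟩
  exact Measure.measure_pos_of_nonempty_interior _ ⟨_, ht.centroid_mem_interior⟩

theorem mem_convexHull_face (ht : IsElement t) (hs : s ⊆ t) :
    x ∈ convexHull ℝ (s : Set (Vec d)) ↔ x ∈ simplex t ∧ ∀ a ∈ t, a ∉ s → bary t a x = 0 := by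
  classical
  constructor
  · intro hx
    refine ⟨convexHull_mono (by exact_mod_cast hs) hx, fun a ha has => ?_⟩
    have : convexHull ℝ (s : Set (Vec d)) ⊆ (bary t a) ⁻¹' {0} := by
      refine convexHull_min (fun b hb => ?_) ((convex_singleton 0).affine_preimage _)
      exact ht.bary_of_ne ha (hs hb) (fun h => has (h ▸ hb))
    exact this hx
  · rintro ⟨hx, h0⟩
    have h1 : ∑ a ∈ s, bary t a x = 1 := by
      rw [← ht.sum_bary x]
      exact sum_subset hs fun a ha has => h0 a ha has
    have h2 : ∑ a ∈ s, bary t a x • a = x := by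
      conv_rhs => rw [← ht.sum_bary_smul x]
      exact sum_subset hs fun a ha has => by rw [h0 a ha has, zero_smul]
    rw [← h2]
    exact (convex_convexHull ℝ _).sum_mem (fun a ha => ht.mem_simplex.1 hx a (hs ha)) h1
      fun a ha => subset_convexHull ℝ _ ha

end IsElement

/-- A nonnegative function on `t` which is maximal on `A` is a nonnegative combination of
indicator functions of sets that contain `A`. -/
theorem exists_layer_decomposition {α : Type*} [DecidableEq α] {t A : Finset α} (hA : A ⊆ t)
    (f : α → ℝ) (h0 : ∀ b ∈ t, 0 ≤ f b) (hmax : ∀ a ∈ A, ∀ b ∈ t, f b ≤ f a) :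
    ∃ c : Finset α → ℝ, (∀ s, 0 ≤ c s) ∧
      ∀ b ∈ t, f b = ∑ s ∈ t.powerset.filter (A ⊆ ·), if b ∈ s then c s else 0 := by
  induction hn : (t.filter (fun b => 0 < f b)).card using Nat.strong_induction_on
    generalizing f with
  | _ n ih =>
    set S := t.filter (fun b => 0 < f b) with hS
    rcases S.eq_empty_or_nonempty with he | hne
    · refine ⟨fun _ => 0, fun _ => le_rfl, fun b hb => ?_⟩
      have : b ∉ S := by simp [he]
      simp only [hS, Finset.mem_filter, not_and, not_lt] at this
      simp [le_antisymm (this hb) (h0 b hb)]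
    · obtain ⟨b₀, hb₀, hmin⟩ := S.exists_min_image f hne
      have hb₀' := Finset.mem_filter.1 hb₀
      have hAS : A ⊆ S := fun a ha =>
        Finset.mem_filter.2 ⟨hA ha, hb₀'.2.trans_le (hmax a ha b₀ hb₀'.1)⟩
      -- peel off the smallest positive value, a multiple of the indicator of `S`
      let f' : α → ℝ := fun b => if b ∈ S then f b - f b₀ else 0
      have hf'0 : ∀ b ∈ t, 0 ≤ f' b := fun b _ => by
        simp only [f']
        split_ifs with h
        · linarith [hmin b h]
        · exact le_rfl
      have hf'max : ∀ a ∈ A, ∀ b ∈ t, f' b ≤ f' a := fun a ha b hb => by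
        simp only [f', if_pos (hAS ha)]
        split_ifs with h
        · linarith [hmax a ha b hb]
        · linarith [hmin a (hAS ha)]
      have hcard : (t.filter (fun b => 0 < f' b)).card < n := by
        rw [← hn]
        refine Finset.card_lt_card ⟨fun b hb => ?_, fun h => ?_⟩
        · have hb2 := (Finset.mem_filter.1 hb).2
          simp only [f'] at hb2
          split_ifs at hb2 with h
          · exact h
          · exact absurd hb2 (lt_irrefl _)
        · have := (Finset.mem_filter.1 (h hb₀)).2
          simp only [f', if_pos hb₀, sub_self] at this
          exact absurd this (lt_irrefl _)
      obtain ⟨c, hc0, hc⟩ := ih _ hcard f' hf'0 hf'max rfl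
      refine ⟨fun s => c s + if s = S then f b₀ else 0, fun s => ?_, fun b hb => ?_⟩
      · have := hc0 s
        simp only
        split_ifs
        · linarith [hb₀'.2]
        · linarith
      · have h1 : ∀ s : Finset α, (if b ∈ s then c s + (if s = S then f b₀ else 0) else 0) =
            (if b ∈ s then c s else 0) + if s = S then (if b ∈ S then f b₀ else 0) else 0 := by
          intro s
          by_cases hs : s = S
          · subst hs; split_ifs <;> simp
          · simp [hs]
        rw [sum_congr rfl fun s _ => h1 s, sum_add_distrib, ← hc b hb,
          Finset.sum_ite_eq' _ S, if_pos]
        · simp only [f']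
          split_ifs with h
          · ring
          · simp only [hS, Finset.mem_filter, not_and, not_lt] at h
            linarith [h hb, h0 b hb]
        · simp only [Finset.mem_filter, Finset.mem_powerset]
          exact ⟨Finset.filter_subset _ _, hAS⟩

namespace IsElement

/-- The convex hull of the centers of gravity of the faces that contain `A` consists of the points
whose barycentric coordinates are maximal on `A`. -/
theorem convexHull_centroids (ht : IsElement t) {A : Finset (Vec d)} (hA : A ⊆ t)
    (hAne : A.Nonempty) :
    convexHull ℝ {x | ∃ s : Finset (Vec d), s ⊆ t ∧ A ⊆ s ∧ x = s.centroid ℝ id} =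
      {x ∈ simplex t | ∀ a ∈ A, ∀ b ∈ t, bary t b x ≤ bary t a x} := by
  classical
  apply Subset.antisymm
  · refine convexHull_min ?_ ?_
    · rintro x ⟨s, hs, hAs, rfl⟩
      have hne := hAne.mono hAs
      refine ⟨ht.mem_simplex.2 fun b hb => ?_, fun a ha b hb => ?_⟩
      · rw [ht.bary_centroid hs hne hb]; split_ifs <;> simp
      · rw [ht.bary_centroid hs hne hb, ht.bary_centroid hs hne (hA ha), if_pos (hAs ha)]
        split_ifs <;> simp
    · have : {x ∈ simplex t | ∀ a ∈ A, ∀ b ∈ t, bary t b x ≤ bary t a x} =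
          simplex t ∩ ⋂ a ∈ A, ⋂ b ∈ t, (bary t a - bary t b) ⁻¹' Ici 0 := by
        ext x; simp
      rw [this]
      refine (convex_simplex t).inter (convex_iInter₂ fun a _ => convex_iInter₂ fun b _ => ?_)
      exact (convex_Ici 0).affine_preimage _
  · rintro x ⟨hx, hmax⟩
    -- each level set contributes a multiple of its centroid
    obtain ⟨c, hc0, hc⟩ := exists_layer_decomposition hA (fun b => bary t b x)
      (fun b hb => ht.mem_simplex.1 hx b hb) hmax
    set F := t.powerset.filter (A ⊆ ·) with hF
    have hFne : ∀ s ∈ F, s ⊆ t ∧ A ⊆ s ∧ s.Nonempty := fun s hs => by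
      simp only [hF, Finset.mem_filter, Finset.mem_powerset] at hs
      exact ⟨hs.1, hs.2, hAne.mono hs.2⟩
    have hsum : ∑ s ∈ F, c s * s.card = 1 := by
      rw [← ht.sum_bary x, sum_congr rfl fun b hb => hc b hb, sum_comm]
      refine sum_congr rfl fun s hs => ?_
      rw [← Finset.sum_filter, Finset.filter_mem_eq_inter,
        Finset.inter_eq_right.2 (hFne s hs).1, sum_const, nsmul_eq_mul, mul_comm]
    have hx2 : ∑ s ∈ F, (c s * s.card) • s.centroid ℝ id = x := by
      conv_rhs => rw [← ht.sum_bary_smul x]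
      have h0 : ∀ b ∈ t, bary t b x • b = ∑ s ∈ F, (if b ∈ s then c s else 0) • b := fun b hb => by
        rw [hc b hb, Finset.sum_smul]
      rw [sum_congr rfl h0, sum_comm]
      refine sum_congr rfl fun s hs => ?_
      have hne := (hFne s hs).2.2
      have hcard : (s.card : ℝ) ≠ 0 := by exact_mod_cast hne.card_pos.ne'
      have h1 : s.centroid ℝ id = (s.card : ℝ)⁻¹ • ∑ b ∈ s, b := by
        rw [Finset.centroid_eq_centerMass _ hne, Finset.centerMass]
        simp [Finset.centroidWeights, hcard, Finset.smul_sum]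
      have h2 : ∀ b, (if b ∈ s then c s else 0) • b = if b ∈ s then c s • b else 0 := fun b => by
        split_ifs <;> simp
      simp_rw [h2]
      rw [← Finset.sum_filter, Finset.filter_mem_eq_inter,
        Finset.inter_eq_right.2 (hFne s hs).1, h1, smul_smul, ← Finset.smul_sum]
      congr 1
      field_simp
    rw [← hx2]
    refine (convex_convexHull ℝ _).sum_mem (fun s _ => mul_nonneg (hc0 s) (by positivity)) hsum
      fun s hs => subset_convexHull ℝ _ ⟨s, (hFne s hs).1, (hFne s hs).2.1, rfl⟩

theorem mem_dualCell (ht : IsElement t) (ha : a ∈ t) :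
    x ∈ dualCell a t ↔ x ∈ simplex t ∧ ∀ b ∈ t, bary t b x ≤ bary t a x := by
  have := ht.convexHull_centroids (A := {a}) (by simpa using ha) (by simp)
  simp only [Finset.singleton_subset_iff, Finset.mem_singleton, forall_eq] at this
  rw [dualCell, this, mem_sep_iff]

theorem mem_dualFace (ht : IsElement t) (ha : a ∈ t) (hb : b ∈ t) :
    x ∈ dualFace a b t ↔ x ∈ dualCell a t ∧ bary t a x = bary t b x := by
  classical
  have := ht.convexHull_centroids (A := {a, b}) (by simp [Finset.insert_subset_iff, ha, hb])
    (by simp)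
  simp only [Finset.insert_subset_iff, Finset.singleton_subset_iff, Finset.mem_insert,
    Finset.mem_singleton, forall_eq_or_imp, forall_eq, and_assoc] at this
  rw [dualFace, this, mem_sep_iff, ht.mem_dualCell ha]
  constructor
  · rintro ⟨h1, h2, h3⟩
    exact ⟨⟨h1, h2⟩, le_antisymm (h3 a ha) (h2 b hb)⟩
  · rintro ⟨⟨h1, h2⟩, h3⟩
    exact ⟨h1, h2, fun c hc => h3 ▸ h2 c hc⟩

end IsElement

/-- The unit normal of a flat set which contains, near one of its points, all points of the
hyperplane in which it lies. -/
theorem unitNormal_eq {F : Set (Vec d)} {f : Vec d →ᵃ[ℝ] ℝ} (hf : agrad f ≠ 0)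
    (hF : ∀ x ∈ F, f x = 0) {x₀ : Vec d} (hx₀ : x₀ ∈ F)
    (hopen : ∀ v, f.linear v = 0 → ∃ ε : ℝ, ε ≠ 0 ∧ x₀ + ε • v ∈ F)
    (hv : 0 < f.linear v) : unitNormal F v = ‖agrad f‖⁻¹ • agrad f := by
  have hspan : vectorSpan ℝ F = (ℝ ∙ agrad f)ᗮ := by
    apply le_antisymm
    · rw [vectorSpan, Submodule.span_le]
      rintro _ ⟨x, hx, y, hy, rfl⟩
      change x - y ∈ (ℝ ∙ agrad f)ᗮ
      rw [Submodule.mem_orthogonal_singleton_iff_inner_right, ← affine_sub_eq_inner, hF x hx,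
        hF y hy, sub_zero]
    · intro w hw
      rw [Submodule.mem_orthogonal_singleton_iff_inner_right, inner_agrad] at hw
      obtain ⟨ε, hε, hmem⟩ := hopen w hw
      have h1 : (x₀ + ε • w) -ᵥ x₀ ∈ vectorSpan ℝ F := vsub_mem_vectorSpan ℝ hmem hx₀
      have h2 := (vectorSpan ℝ F).smul_mem ε⁻¹ h1
      simpa [smul_smul, inv_mul_cancel₀ hε] using h2
  have horth : (vectorSpan ℝ F)ᗮ = (ℝ ∙ agrad f) := by
    rw [hspan, Submodule.orthogonal_orthogonal]
  have hcongr : ∀ S T : Submodule ℝ (Vec d), S = T →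
      S.starProjection v = T.starProjection v := by rintro S _ rfl; rfl
  rw [unitNormal, hcongr _ _ horth]
  rw [Submodule.starProjection_singleton, inner_agrad]
  have h3 : 0 < f.linear v / ‖agrad f‖ ^ 2 := by positivity
  simp only [RCLike.ofReal_real_eq_id, id]
  rw [norm_smul, Real.norm_eq_abs, abs_of_pos h3, smul_smul]
  congr 1
  field_simp

/-! ### Integrals over simplices and their facets -/

theorem divergence_congr_of_eqOn {q q' : Vec d → Vec d} {P : Set (Vec d)} (h : EqOn q q' P)
    (hx : x ∈ interior P) : divergence q x = divergence q' x := by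
  have : q =ᶠ[𝓝 x] q' := by
    filter_upwards [mem_interior_iff_mem_nhds.1 hx] with y hy using h hy
  simp [divergence, this.fderiv_eq]

theorem ae_mem_interior_of_convex {P : Set (Vec d)} (hP : Convex ℝ P) (hm : MeasurableSet P) :
    ∀ᵐ x ∂volume.restrict P, x ∈ interior P := by
  have h1 := hP.addHaar_frontier volume
  have h2 : ∀ᵐ x ∂volume.restrict P, x ∉ frontier P :=
    ae_restrict_of_ae (measure_eq_zero_iff_ae_notMem.1 h1)
  filter_upwards [h2, ae_restrict_mem hm] with x hx hxP
  by_contra h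
  exact hx ⟨subset_closure hxP, h⟩

/-- A field on the polytope has a Lipschitz extension. -/
theorem integral_divergence_polytope_of_lipschitzOn {ι : Type*} [Fintype ι] [Nonempty ι]
    (ℓ : ι → Vec d →ᵃ[ℝ] ℝ) (hb : Bornology.IsBounded (polytope ℓ))
    (hne : ∀ i, agrad (ℓ i) ≠ 0)
    (hind : ∀ i j, i ≠ j → ∃ v, (ℓ i).linear v = 0 ∧ (ℓ j).linear v ≠ 0)
    {q : Vec d → Vec d} {K : ℝ≥0} (hq : LipschitzOnWith K q (polytope ℓ)) :
    ∫ x in polytope ℓ, divergence q x =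
      -∑ i, ‖agrad (ℓ i)‖⁻¹ *
        ∫ x in polytope ℓ ∩ {x | ℓ i x = 0}, inner ℝ (agrad (ℓ i)) (q x) ∂μHE[d - 1] := by
  obtain ⟨q', hq', heq⟩ := hq.extend_finite_dimension
  have h := integral_divergence_polytope ℓ hb hne hind hq'
  have hm := (isClosed_polytope ℓ).measurableSet
  have h1 : ∫ x in polytope ℓ, divergence q x = ∫ x in polytope ℓ, divergence q' x := by
    refine integral_congr_ae ?_
    filter_upwards [ae_mem_interior_of_convex (convex_polytope ℓ) hm] with x hx
    exact divergence_congr_of_eqOn heq hx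
  rw [h1, h]
  congr 1
  refine sum_congr rfl fun i _ => ?_
  congr 1
  refine setIntegral_congr_fun (hm.inter
    (isClosed_eq (affine_continuous _) continuous_const).measurableSet) fun x hx => ?_
  simp only [heq hx.1]

/-- The part of the simplex in which the barycentric coordinate of `a` dominates those of the
vertices in `s`. -/
def maxRegion (t s : Finset (Vec d)) (a : Vec d) : Set (Vec d) :=
  {x ∈ simplex t | ∀ b ∈ s, bary t b x ≤ bary t a x}

/-- The affine functions that define `maxRegion t s a`. -/
noncomputable def regionFun (t s : Finset (Vec d)) (a : Vec d) : t ⊕ s → Vec d →ᵃ[ℝ] ℝ :=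
  Sum.elim (fun c => bary t c) (fun b => bary t a - bary t b)

namespace IsElement

theorem maxRegion_eq_polytope (ht : IsElement t) :
    maxRegion t s a = polytope (regionFun t s a) := by
  ext x
  simp only [maxRegion, mem_ofPred_eq, ht.mem_simplex, polytope, regionFun, Sum.forall,
    Sum.elim_inl, Sum.elim_inr, Subtype.forall, AffineMap.coe_sub, Pi.sub_apply, sub_nonneg]

theorem maxRegion_empty : maxRegion t ∅ a = simplex t := by
  ext x; simp [maxRegion]

theorem isClosed_maxRegion (ht : IsElement t) : IsClosed (maxRegion t s a) := by
  rw [ht.maxRegion_eq_polytope]; exact isClosed_polytope _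

theorem dualCell_eq_maxRegion (ht : IsElement t) (ha : a ∈ t) :
    dualCell a t = maxRegion t t a := by
  ext x
  rw [ht.mem_dualCell ha]; rfl

theorem bary_vertex [DecidableEq (Vec d)] (ht : IsElement t) (ha : a ∈ t) (hb : b ∈ t) :
    bary t a b = if a = b then 1 else 0 := by
  split_ifs with h
  · subst h; exact ht.bary_self ha
  · exact ht.bary_of_ne ha hb h

/-- The directions that witness the independence are found along the edges of `t`. -/
theorem regionFun_indep (hd : 2 ≤ d) (ht : IsElement t) (hs : s ⊆ t) (ha : a ∈ t) (has : a ∉ s)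
    (i j : t ⊕ s) (hij : i ≠ j) :
    ∃ w, (regionFun t s a i).linear w = 0 ∧ (regionFun t s a j).linear w ≠ 0 := by
  classical
  rcases i with ⟨c, hc⟩ | ⟨b, hb⟩ <;> rcases j with ⟨c', hc'⟩ | ⟨b', hb'⟩
  · have hcc : c ≠ c' := fun h => hij (by simp [h])
    obtain ⟨x, hx, hxc, hxc'⟩ := ht.exists_ne₂ hd c c'
    refine ⟨c' - x, ?_⟩
    simp [regionFun, ht.bary_linear_sub, ht.bary_vertex, hc, hc', hx, hcc, hxc.symm, hxc'.symm]
  · have hbt := hs hb'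
    have hab : a ≠ b' := fun h => has (h ▸ hb')
    obtain ⟨x, hx, hxa, hxb⟩ := ht.exists_ne₂ hd a b'
    by_cases hca : c = a
    · subst hca
      refine ⟨b' - x, ?_⟩
      simp [regionFun, ht.bary_linear_sub, ht.bary_vertex, ha, hbt, hx, hab, hxa.symm, hxb.symm]
    · by_cases hcb : c = b'
      · subst hcb
        refine ⟨a - x, ?_⟩
        simp [regionFun, ht.bary_linear_sub, ht.bary_vertex, ha, hc, hx, hab.symm, hxa.symm,
          hxb.symm]
      · refine ⟨a - b', ?_⟩
        simp [regionFun, ht.bary_linear_sub, ht.bary_vertex, ha, hbt, hc, hab, hab.symm, hca, hcb]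
  · have hbt := hs hb
    have hab : a ≠ b := fun h => has (h ▸ hb)
    have key : ∀ x ∈ t, x ≠ a → x ≠ b → (c' = x ∨ c' = a ∨ c' = b) →
        ∃ w, (regionFun t s a (Sum.inr ⟨b, hb⟩)).linear w = 0 ∧
          (regionFun t s a (Sum.inl ⟨c', hc'⟩)).linear w ≠ 0 := by
      intro x hx hxa hxb hor
      refine ⟨(a - x) + (b - x), ?_⟩
      simp only [regionFun, Sum.elim_inl, Sum.elim_inr, AffineMap.sub_linear, LinearMap.sub_apply,
        map_add, ht.bary_linear_sub, ht.bary_vertex, ha, hbt, hc', hx]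
      rcases hor with rfl | rfl | rfl
      · simp [hab, hab.symm, hxa, hxb, hxa.symm, hxb.symm]
      · simp [hab, hab.symm, hxa.symm, hxb.symm]
      · simp [hab, hab.symm, hxa.symm, hxb.symm]
    obtain ⟨x, hx, hxa, hxb⟩ := ht.exists_ne₂ hd a b
    by_cases hca : c' = a
    · exact key x hx hxa hxb (by simp [hca])
    · by_cases hcb : c' = b
      · exact key x hx hxa hxb (by simp [hcb])
      · exact key c' hc' hca hcb (by simp)
  · have hbt := hs hb
    have hbt' := hs hb'
    have hab : a ≠ b := fun h => has (h ▸ hb)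
    have hab' : a ≠ b' := fun h => has (h ▸ hb')
    have hbb : b ≠ b' := fun h => hij (by simp [h])
    refine ⟨(a - b') + (b - b'), ?_⟩
    simp only [regionFun, Sum.elim_inr, AffineMap.sub_linear, LinearMap.sub_apply,
        map_add, ht.bary_linear_sub, ht.bary_vertex, ha, hbt, hbt']
    simp [hab, hab.symm, hab', hab'.symm, hbb, hbb.symm]
    norm_num

theorem agrad_ne_zero_of_linear {f : Vec d →ᵃ[ℝ] ℝ} {w : Vec d} (h : f.linear w ≠ 0) :
    agrad f ≠ 0 := by
  rintro h0
  rw [← inner_agrad, h0, inner_zero_left] at h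
  exact h rfl

theorem regionFun_agrad_ne (hd : 2 ≤ d) (ht : IsElement t) (hs : s ⊆ t) (ha : a ∈ t)
    (has : a ∉ s) (i : t ⊕ s) : agrad (regionFun t s a i) ≠ 0 := by
  obtain ⟨b, hb, hba⟩ := ht.exists_ne (by omega) a
  have : Nontrivial (t ⊕ s) :=
    ⟨⟨Sum.inl ⟨a, ha⟩, Sum.inl ⟨b, hb⟩, by simpa using hba.symm⟩⟩
  obtain ⟨j, hj⟩ := _root_.exists_ne i
  obtain ⟨w, _, hw⟩ := ht.regionFun_indep hd hs ha has j i hj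
  exact agrad_ne_zero_of_linear hw

/-- The divergence theorem on the region of a simplex in which one barycentric coordinate
dominates some others. -/
theorem integral_divergence_maxRegion (hd : 2 ≤ d) (ht : IsElement t) (hs : s ⊆ t) (ha : a ∈ t)
    (has : a ∉ s) {q : Vec d → Vec d} {K : ℝ≥0} (hq : LipschitzOnWith K q (maxRegion t s a)) :
    ∫ x in maxRegion t s a, divergence q x =
      -((∑ c ∈ t, ‖agrad (bary t c)‖⁻¹ * ∫ x in maxRegion t s a ∩ {x | bary t c x = 0},
            inner ℝ (agrad (bary t c)) (q x) ∂μHE[d - 1]) +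
        ∑ b ∈ s, ‖agrad (bary t a - bary t b)‖⁻¹ *
          ∫ x in maxRegion t s a ∩ {x | (bary t a - bary t b) x = 0},
            inner ℝ (agrad (bary t a - bary t b)) (q x) ∂μHE[d - 1]) := by
  rw [ht.maxRegion_eq_polytope] at hq ⊢
  have : Nonempty (t ⊕ s) := ⟨Sum.inl ⟨a, ha⟩⟩
  have hb : Bornology.IsBounded (polytope (regionFun t s a)) := by
    rw [← ht.maxRegion_eq_polytope]
    exact (isCompact_simplex t).isBounded.subset fun x hx => hx.1
  rw [integral_divergence_polytope_of_lipschitzOn _ hb (ht.regionFun_agrad_ne hd hs ha has)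
    (ht.regionFun_indep hd hs ha has) hq, Fintype.sum_sum_type,
    ← sum_coe_sort t, ← sum_coe_sort s]
  rfl

/-- The divergence theorem on a simplex. -/
theorem integral_divergence_simplex (hd : 2 ≤ d) (ht : IsElement t)
    {q : Vec d → Vec d} {K : ℝ≥0} (hq : LipschitzOnWith K q (simplex t)) :
    ∫ x in simplex t, divergence q x =
      -∑ c ∈ t, ‖agrad (bary t c)‖⁻¹ * ∫ x in simplex t ∩ {x | bary t c x = 0},
            inner ℝ (agrad (bary t c)) (q x) ∂μHE[d - 1] := by
  obtain ⟨a, ha⟩ := ht.nonempty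
  have := ht.integral_divergence_maxRegion (s := ∅) (a := a) hd (by simp) ha (by simp)
    (q := q) (K := K) (by rwa [maxRegion_empty])
  simpa [maxRegion_empty] using this

/-- The divergence theorem for fields `g(x) (x - v)` on the cone with apex `v` over a part of the
facet opposite to `v`: only this facet contributes. -/
theorem integral_divergence_cone (hd : 2 ≤ d) (ht : IsElement t) (hs : s ⊆ t) (ha : a ∈ t)
    (has : a ∉ s) (hv : v ∈ t) (hvs : v ∉ s) (hva : s.Nonempty → v ≠ a) {g : Vec d → ℝ} {K : ℝ≥0}
    (hq : LipschitzOnWith K (fun x => g x • (x - v)) (maxRegion t s a)) :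
    ∫ x in maxRegion t s a, divergence (fun x => g x • (x - v)) x =
      ‖agrad (bary t v)‖⁻¹ * ∫ x in maxRegion t s a ∩ {x | bary t v x = 0}, g x ∂μHE[d - 1] := by
  classical
  have hm := ht.isClosed_maxRegion (s := s) (a := a)
  rw [ht.integral_divergence_maxRegion hd hs ha has hq]
  have h1 : ∀ b ∈ s, ‖agrad (bary t a - bary t b)‖⁻¹ *
          ∫ x in maxRegion t s a ∩ {x | (bary t a - bary t b) x = 0},
            inner ℝ (agrad (bary t a - bary t b)) (g x • (x - v)) ∂μHE[d - 1] = 0 := by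
    intro b hb
    have hvb : v ≠ b := fun h => hvs (h ▸ hb)
    rw [setIntegral_eq_zero_of_forall_eq_zero, mul_zero]
    rintro x ⟨_, hx⟩
    rw [inner_smul_right, ← affine_sub_eq_inner]
    have h2 : (bary t a - bary t b) v = 0 := by
      simp [ht.bary_vertex, ha, hs hb, hv, (hva ⟨b, hb⟩).symm, hvb.symm]
    rw [h2, (hx : _ = _)]
    simp
  rw [sum_eq_zero h1, add_zero, sum_eq_single v]
  · rw [← mul_neg, ← integral_neg]
    congr 1
    refine setIntegral_congr_fun (hm.measurableSet.inter
      (isClosed_eq (affine_continuous _) continuous_const).measurableSet) fun x hx => ?_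
    rw [inner_smul_right, ← affine_sub_eq_inner, ht.bary_self hv, (hx.2 : _ = _)]
    simp
  · intro c hc hcv
    rw [setIntegral_eq_zero_of_forall_eq_zero, mul_zero]
    rintro x ⟨_, hx⟩
    rw [inner_smul_right, ← affine_sub_eq_inner, ht.bary_of_ne hc hv hcv, (hx : _ = _)]
    simp
  · exact fun h => absurd hv h

end IsElement

/-! ### The symmetry of a simplex that exchanges two vertices -/

/-- The affine reflection of `ℝ^d` that exchanges the vertices `a` and `b` of `t` and fixes the
other vertices. -/
noncomputable def swapMap (t : Finset (Vec d)) (a b x : Vec d) : Vec d :=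
  x + (bary t a x - bary t b x) • (b - a)

namespace IsElement

theorem bary_swapMap [DecidableEq (Vec d)] (ht : IsElement t) (ha : a ∈ t) (hb : b ∈ t)
    (hc : c ∈ t) (x : Vec d) :
    bary t c (swapMap t a b x) = bary t (Equiv.swap a b c) x := by
  by_cases hab : a = b
  · subst hab; simp [swapMap]
  rw [swapMap, affine_add, inner_smul_right, inner_agrad, ht.bary_linear_sub]
  by_cases hca : c = a
  · subst hca
    rw [Equiv.swap_apply_left, ht.bary_self ha, ht.bary_of_ne ha hb hab]; ring
  · by_cases hcb : c = b
    · subst hcb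
      rw [Equiv.swap_apply_right, ht.bary_self hb, ht.bary_of_ne hb ha hca]; ring
    · rw [Equiv.swap_apply_of_ne_of_ne hca hcb, ht.bary_of_ne hc hb hcb, ht.bary_of_ne hc ha hca]
      ring

theorem ext_bary (ht : IsElement t) {x y : Vec d} (h : ∀ c ∈ t, bary t c x = bary t c y) :
    x = y := by
  rw [← ht.sum_bary_smul x, ← ht.sum_bary_smul y]
  exact sum_congr rfl fun c hc => by rw [h c hc]

theorem swap_mem [DecidableEq (Vec d)] (ha : a ∈ t) (hb : b ∈ t) (hc : c ∈ t) :
    Equiv.swap a b c ∈ t := by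
  rw [Equiv.swap_apply_def]; split_ifs <;> assumption

theorem swapMap_involutive (ht : IsElement t) (ha : a ∈ t) (hb : b ∈ t) :
    Function.Involutive (swapMap t a b) := by
  classical
  intro x
  refine ht.ext_bary fun c hc => ?_
  rw [ht.bary_swapMap ha hb hc, ht.bary_swapMap ha hb (swap_mem ha hb hc), Equiv.swap_apply_self]

theorem continuous_swapMap : Continuous (swapMap t a b) :=
  continuous_id.add
    (((affine_continuous _).sub (affine_continuous _)).smul continuous_const)

/-- An affine involution has determinant `±1`. -/
theorem measurePreserving_swapMap (ht : IsElement t) (ha : a ∈ t) (hb : b ∈ t) :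
    MeasurePreserving (swapMap t a b) := by
  let L : Vec d →ₗ[ℝ] Vec d :=
    LinearMap.id + ((bary t a).linear - (bary t b).linear).smulRight (b - a)
  have hL : ∀ x, swapMap t a b x = swapMap t a b 0 + L x := by
    intro x
    have h1 := ht.bary_linear_sub (c := a) x 0
    have h2 := ht.bary_linear_sub (c := b) x 0
    rw [sub_zero] at h1 h2
    simp only [swapMap, L, LinearMap.add_apply, LinearMap.id_apply, LinearMap.smulRight_apply,
      LinearMap.sub_apply, h1, h2]
    module
  have hLL : L ∘ₗ L = LinearMap.id := by
    ext1 x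
    have h1 := ht.swapMap_involutive ha hb x
    have h0 := ht.swapMap_involutive ha hb 0
    rw [hL (swapMap t a b x), hL x, map_add, ← add_assoc, ← hL, h0, zero_add] at h1
    exact h1
  have hdet : LinearMap.det L * LinearMap.det L = 1 := by
    rw [← LinearMap.det_comp, hLL, LinearMap.det_id]
  have habs : |(LinearMap.det L)⁻¹| = 1 := by
    rw [abs_inv, inv_eq_one]
    have : |LinearMap.det L| * |LinearMap.det L| = 1 := by rw [← abs_mul, hdet, abs_one]
    nlinarith [abs_nonneg (LinearMap.det L)]
  have hLm : MeasurePreserving L := by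
    refine ⟨L.continuous_of_finiteDimensional.measurable, ?_⟩
    rw [Measure.map_linearMap_addHaar_eq_smul_addHaar _ (fun h => by simp [h] at hdet), habs]
    simp
  have : swapMap t a b = (fun y => swapMap t a b 0 + y) ∘ L := funext hL
  rw [this]
  exact (measurePreserving_add_left volume _).comp hLm

theorem measurableEmbedding_swapMap (ht : IsElement t) (ha : a ∈ t) (hb : b ∈ t) :
    MeasurableEmbedding (swapMap t a b) :=
  (Homeomorph.mk (ht.swapMap_involutive ha hb).toPerm continuous_swapMap
    continuous_swapMap).measurableEmbedding

theorem swapMap_preimage_simplex (ht : IsElement t) (ha : a ∈ t) (hb : b ∈ t) :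
    swapMap t a b ⁻¹' simplex t = simplex t := by
  classical
  ext x
  rw [mem_preimage, ht.mem_simplex, ht.mem_simplex]
  constructor
  · intro h c hc
    have := h _ (swap_mem ha hb hc)
    rwa [ht.bary_swapMap ha hb (swap_mem ha hb hc), Equiv.swap_apply_self] at this
  · intro h c hc
    rw [ht.bary_swapMap ha hb hc]
    exact h _ (swap_mem ha hb hc)

theorem setIntegral_swapMap (ht : IsElement t) (ha : a ∈ t) (hb : b ∈ t) (g : Vec d → ℝ) :
    ∫ x in simplex t, g (swapMap t a b x) = ∫ x in simplex t, g x := by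
  have := (ht.measurePreserving_swapMap ha hb).setIntegral_preimage_emb
    (ht.measurableEmbedding_swapMap ha hb) g (simplex t)
  rwa [ht.swapMap_preimage_simplex ha hb] at this

theorem integrableOn_simplex {g : Vec d → ℝ} (hg : ContinuousOn g (simplex t)) :
    IntegrableOn g (simplex t) :=
  hg.integrableOn_compact (isCompact_simplex t)

theorem integral_bary (ht : IsElement t) (ha : a ∈ t) :
    ∫ x in simplex t, bary t a x = volume.real (simplex t) / (d + 1) := by
  classical
  have h1 : ∀ b ∈ t, ∫ x in simplex t, bary t b x = ∫ x in simplex t, bary t a x := by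
    intro b hb
    rw [← ht.setIntegral_swapMap ha hb (bary t b)]
    refine setIntegral_congr_fun (isClosed_simplex t).measurableSet fun x _ => ?_
    rw [ht.bary_swapMap ha hb hb, Equiv.swap_apply_right]
  have h2 : ∑ b ∈ t, ∫ x in simplex t, bary t b x = volume.real (simplex t) := by
    rw [← integral_finsetSum _ fun b _ => integrableOn_simplex (affine_continuous _).continuousOn]
    simp [ht.sum_bary]
  rw [sum_congr rfl h1, sum_const, ht.card, nsmul_eq_mul] at h2
  push_cast at h2
  rw [← h2]
  field_simp

theorem ae_bary_ne (ht : IsElement t) (ha : a ∈ t) (hb : b ∈ t) (hab : a ≠ b) :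
    ∀ᵐ x, bary t a x ≠ bary t b x := by
  have h : agrad (bary t a - bary t b) ≠ 0 := by
    refine agrad_ne_zero_of_linear (w := a - b) ?_
    rw [AffineMap.sub_linear, LinearMap.sub_apply, ht.bary_linear_sub, ht.bary_linear_sub,
      ht.bary_self ha, ht.bary_self hb, ht.bary_of_ne ha hb hab, ht.bary_of_ne hb ha hab.symm]
    norm_num
  simpa [sub_eq_zero] using ae_affine_ne_const h 0

/-- The regions in which one of the barycentric coordinates of vertices in `s` is the largest
have the same volume. -/
theorem volume_maxRegion (ht : IsElement t) (hd : 1 ≤ d) (hs : s ⊆ t) (ha : a ∈ s) :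
    volume.real (maxRegion t s a) = volume.real (simplex t) / s.card := by
  classical
  have hcl : ∀ b, IsClosed (maxRegion t s b) := fun b => ht.isClosed_maxRegion
  have hfin : ∀ b, volume (maxRegion t s b) ≠ ⊤ := fun b =>
    ((measure_mono fun x (hx : x ∈ maxRegion t s b) => hx.1).trans_lt
      (isCompact_simplex t).measure_lt_top).ne
  -- exchanging `a` and `b` maps the regions onto each other
  have h1 : ∀ b ∈ s, volume (maxRegion t s b) = volume (maxRegion t s a) := by
    intro b hb
    have hpre : swapMap t a b ⁻¹' (maxRegion t s b) = maxRegion t s a := by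
      ext x
      have h0 : swapMap t a b x ∈ simplex t ↔ x ∈ simplex t := by
        rw [← mem_preimage, ht.swapMap_preimage_simplex (hs ha) (hs hb)]
      simp only [mem_preimage, maxRegion, mem_ofPred_eq, h0]
      refine and_congr_right fun _ => ?_
      constructor
      · intro h c hc
        have := h _ (swap_mem ha hb hc)
        rwa [ht.bary_swapMap (hs ha) (hs hb) (hs (swap_mem ha hb hc)), Equiv.swap_apply_self,
          ht.bary_swapMap (hs ha) (hs hb) (hs hb), Equiv.swap_apply_right] at this
      · intro h c hc
        rw [ht.bary_swapMap (hs ha) (hs hb) (hs hc), ht.bary_swapMap (hs ha) (hs hb) (hs hb),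
          Equiv.swap_apply_right]
        exact h _ (swap_mem ha hb hc)
    rw [← hpre, (ht.measurePreserving_swapMap (hs ha) (hs hb)).measure_preimage
      (hcl b).measurableSet.nullMeasurableSet]
  -- the regions tile the simplex
  have h2 : volume (simplex t) = ∑ b ∈ s, volume (maxRegion t s b) := by
    rw [← measure_biUnion_finset₀]
    · congr 1
      ext x
      simp only [mem_iUnion, exists_prop]
      constructor
      · intro hx
        obtain ⟨b, hb, hmax⟩ := s.exists_max_image (fun b => bary t b x) ⟨a, ha⟩
        exact ⟨b, hb, hx, hmax⟩
      · rintro ⟨b, _, hx⟩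
        exact hx.1
    · intro b hb c hc hbc
      have := ht.ae_bary_ne (hs hb) (hs hc) hbc
      refine measure_mono_null ?_ (ae_iff.1 this)
      rintro x ⟨hxb, hxc⟩
      simp only [mem_ofPred_eq, not_not]
      exact le_antisymm (hxc.2 b hb) (hxb.2 c hc)
    · exact fun b _ => (hcl b).measurableSet.nullMeasurableSet
  have hcard : (s.card : ℝ) ≠ 0 := by
    exact_mod_cast (Finset.card_pos.2 ⟨a, ha⟩).ne'
  rw [sum_congr rfl h1, sum_const, nsmul_eq_mul] at h2
  rw [measureReal_def, measureReal_def, h2, ENNReal.toReal_mul, ENNReal.toReal_natCast]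
  field_simp

end IsElement

theorem divergence_smul_sub {g : Vec d → ℝ} (hg : DifferentiableAt ℝ g x) :
    divergence (fun x => g x • (x - v)) x = d * g x + fderiv ℝ g x (x - v) := by
  have h1 : HasFDerivAt (fun x => g x • (x - v))
      (g x • ContinuousLinearMap.id ℝ (Vec d) + (fderiv ℝ g x).smulRight (x - v)) x :=
    hg.hasFDerivAt.smul ((hasFDerivAt_id x).sub_const v)
  rw [divergence, h1.fderiv]
  simp only [add_apply, smul_apply,
    ContinuousLinearMap.id_apply, ContinuousLinearMap.smulRight_apply, PiLp.add_apply,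
    PiLp.smul_apply, smul_eq_mul, sum_add_distrib]
  congr 1
  · simp [unitVec, mul_comm]
  · conv_rhs => rw [← sum_mul_unitVec (x - v), map_sum]
    refine sum_congr rfl fun i _ => ?_
    rw [map_smul, smul_eq_mul, mul_comm]

theorem exists_lipschitzOnWith_of_contDiff {E : Type*} [NormedAddCommGroup E] [NormedSpace ℝ E]
    {q : Vec d → E} (hq : ContDiff ℝ 1 q) {P : Set (Vec d)} (hP : IsCompact P) :
    ∃ K, LipschitzOnWith K q P :=
  hq.locallyLipschitz.locallyLipschitzOn.exists_lipschitzOnWith_of_compact hP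

theorem contDiff_affine {n : WithTop ℕ∞} (f : Vec d →ᵃ[ℝ] ℝ) : ContDiff ℝ n f := by
  have h : (f : Vec d → ℝ) = fun y => LinearMap.toContinuousLinearMap f.linear y + f 0 := by
    ext y
    have := affine_sub_eq_inner f y 0
    rw [inner_agrad, sub_zero] at this
    simp only [LinearMap.coe_toContinuousLinearMap']
    linarith
  rw [h]
  exact (ContinuousLinearMap.contDiff _).add contDiff_const

theorem fderiv_affine (f : Vec d →ᵃ[ℝ] ℝ) (x v : Vec d) : fderiv ℝ f x v = f.linear v := by
  rw [(hasFDerivAt_affine f x).fderiv]; rfl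

/-- The facet of the simplex `t` opposite to the vertex `v`. -/
def facet (t : Finset (Vec d)) (v : Vec d) : Set (Vec d) := simplex t ∩ {x | bary t v x = 0}

/-- The difference between the barycentric coordinate of `a` and the indicator function of the
part of the control volume of `a` in `t`. -/
noncomputable def chi (t : Finset (Vec d)) (a x : Vec d) : ℝ :=
  bary t a x - (dualCell a t).indicator (fun _ => 1) x

namespace IsElement

theorem isClosed_facet : IsClosed (facet t v) :=
  (isClosed_simplex t).inter (isClosed_eq (affine_continuous _) continuous_const)

theorem isCompact_facet : IsCompact (facet t v) :=
  (isCompact_simplex t).inter_right (isClosed_eq (affine_continuous _) continuous_const)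

theorem facet_eq_simplex_erase [DecidableEq (Vec d)] (ht : IsElement t) (hv : v ∈ t) :
    facet t v = simplex (t.erase v) := by
  ext x
  rw [simplex, ht.mem_convexHull_face (erase_subset _ _), facet]
  refine and_congr_right fun _ => ⟨fun h a ha hav => ?_, fun h => h v hv (by simp)⟩
  have : a = v := by simpa [ha] using hav
  rwa [this]

/-- Integrals over facets in terms of integrals over the simplex. -/
theorem integral_facet (hd : 2 ≤ d) (ht : IsElement t) (hv : v ∈ t) {g : Vec d → ℝ}
    (hg : ContDiff ℝ 1 g) :
    ∫ x in facet t v, g x ∂μHE[d - 1] =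
      ‖agrad (bary t v)‖ * ∫ x in simplex t, (d * g x + fderiv ℝ g x (x - v)) := by
  obtain ⟨K, hK⟩ := exists_lipschitzOnWith_of_contDiff
    (q := fun x => g x • (x - v)) (hg.smul (contDiff_id.sub contDiff_const)) (isCompact_simplex t)
  have h := ht.integral_divergence_cone (s := ∅) (a := v) (v := v) (g := g) (K := K) hd (by simp)
    hv (by simp) hv (by simp) (by simp) (by rwa [maxRegion_empty])
  rw [maxRegion_empty] at h
  simp_rw [divergence_smul_sub (hg.differentiable one_ne_zero _)] at h
  have hne : ‖agrad (bary t v)‖ ≠ 0 := norm_ne_zero_iff.2 (ht.agrad_bary_ne_zero (by omega) hv)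
  rw [h, facet]
  field_simp

theorem measure_facet (hd : 2 ≤ d) (ht : IsElement t) (hv : v ∈ t) :
    (μHE[d - 1] : Measure (Vec d)).real (facet t v) =
      ‖agrad (bary t v)‖ * (d * volume.real (simplex t)) := by
  have := ht.integral_facet hd hv (g := fun _ => 1) contDiff_const
  simpa [mul_comm] using this

theorem norm_agrad_bary_pos (hd : 1 ≤ d) (ht : IsElement t) (hv : v ∈ t) :
    0 < ‖agrad (bary t v)‖ := norm_pos_iff.2 (ht.agrad_bary_ne_zero hd hv)

theorem measure_facet_lt_top (hd : 2 ≤ d) (ht : IsElement t) (hv : v ∈ t) :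
    (μHE[d - 1] : Measure (Vec d)) (facet t v) < ⊤ := by
  have h1 := ht.norm_agrad_bary_pos (by omega) hv
  have h2 := ht.volume_simplex_pos
  have h3 : 0 < (μHE[d - 1] : Measure (Vec d)).real (facet t v) := by
    rw [ht.measure_facet hd hv]
    have : (0 : ℝ) < d := by exact_mod_cast (by omega : 0 < d)
    positivity
  exact (ENNReal.toReal_pos_iff.1 h3).2

theorem integrableOn_facet (hd : 2 ≤ d) (ht : IsElement t) (hv : v ∈ t) {g : Vec d → ℝ}
    (hg : ContinuousOn g (facet t v)) : IntegrableOn g (facet t v) μHE[d - 1] := by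
  obtain ⟨C, hC⟩ := isCompact_facet.exists_bound_of_continuousOn hg
  refine IntegrableOn.of_bound (ht.measure_facet_lt_top hd hv)
    (hg.aestronglyMeasurable isClosed_facet.measurableSet) C ?_
  filter_upwards [ae_restrict_mem isClosed_facet.measurableSet] with x hx using hC x hx

theorem integral_facet_bary (hd : 2 ≤ d) (ht : IsElement t) (hv : v ∈ t) (ha : a ∈ t)
    (hav : a ≠ v) : ∫ x in facet t v, bary t a x ∂μHE[d - 1] =
      ‖agrad (bary t v)‖ * volume.real (simplex t) := by
  rw [ht.integral_facet hd hv (contDiff_affine _)]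
  congr 1
  have h1 : ∀ x, (d * bary t a x + fderiv ℝ (bary t a) x (x - v)) = (d + 1) * bary t a x := by
    intro x
    rw [fderiv_affine, ht.bary_linear_sub, ht.bary_of_ne ha hv hav]; ring
  simp_rw [h1]
  rw [integral_const_mul, ht.integral_bary ha]
  field_simp

/-- By the divergence theorem for `x ↦ x - v` on the cone over the set with apex `v`. -/
theorem measure_facet_inter_dualCell (hd : 2 ≤ d) (ht : IsElement t) (hv : v ∈ t) (ha : a ∈ t)
    (hav : a ≠ v) : (μHE[d - 1] : Measure (Vec d)).real (dualCell a t ∩ facet t v) =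
      ‖agrad (bary t v)‖ * volume.real (simplex t) := by
  classical
  have hne : ‖agrad (bary t v)‖ ≠ 0 := (ht.norm_agrad_bary_pos (by omega) hv).ne'
  have hd0 : (d : ℝ) ≠ 0 := by exact_mod_cast (by omega : d ≠ 0)
  set s := (t.erase v).erase a with hs
  have hsub : s ⊆ t := (erase_subset _ _).trans (erase_subset _ _)
  obtain ⟨K, hK⟩ := exists_lipschitzOnWith_of_contDiff (P := maxRegion t s a)
    (q := fun x : Vec d => (1 : ℝ) • (x - v)) ((contDiff_id.sub contDiff_const).const_smul 1)
    ((isCompact_simplex t).of_isClosed_subset ht.isClosed_maxRegion fun x hx => hx.1)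
  have h := ht.integral_divergence_cone (s := s) (a := a) (v := v) (g := fun _ => 1) (K := K) hd
    hsub ha (by simp [hs]) hv (by simp [hs]) (fun _ => hav.symm) hK
  have h2 : ∀ x, divergence (fun x : Vec d => (1 : ℝ) • (x - v)) x = d := fun x => by
    rw [divergence_smul_sub (differentiableAt_const _)]; simp
  simp_rw [h2] at h
  have h3 : maxRegion t s a = maxRegion t (t.erase v) a := by
    ext x
    simp only [maxRegion, hs, mem_ofPred_eq, mem_erase]
    refine and_congr_right fun _ => ⟨fun h b hb => ?_, fun h b hb => h b hb.2⟩
    by_cases hba : b = a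
    · rw [hba]
    · exact h b ⟨hba, hb⟩
  have h4 : dualCell a t ∩ facet t v = maxRegion t s a ∩ {x | bary t v x = 0} := by
    rw [h3, ht.dualCell_eq_maxRegion ha]
    ext x
    simp only [facet, maxRegion, mem_inter_iff, mem_ofPred_eq, mem_erase]
    constructor
    · rintro ⟨⟨h1, h2⟩, _, h3⟩
      exact ⟨⟨h1, fun b hb => h2 b hb.2⟩, h3⟩
    · rintro ⟨⟨h1, h2⟩, h3⟩
      refine ⟨⟨h1, fun b hb => ?_⟩, h1, h3⟩
      by_cases hbv : b = v
      · rw [hbv, h3]; exact ht.mem_simplex.1 h1 a ha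
      · exact h2 b ⟨hbv, hb⟩
  have h5 := ht.volume_maxRegion (s := t.erase v) (a := a) (by omega) (erase_subset _ _)
    (by simp [hav, ha])
  rw [card_erase_of_mem hv, ht.card, Nat.add_sub_cancel] at h5
  rw [setIntegral_const, setIntegral_const, h3, h5, ← h3, ← h4] at h
  simp only [smul_eq_mul, mul_one] at h
  field_simp at h
  linarith

theorem isClosed_dualCell (ht : IsElement t) (ha : a ∈ t) : IsClosed (dualCell a t) := by
  rw [ht.dualCell_eq_maxRegion ha]; exact ht.isClosed_maxRegion

theorem measurable_chi (ht : IsElement t) (ha : a ∈ t) : Measurable (chi t a) :=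
  (affine_continuous _).measurable.sub
    (measurable_const.indicator (ht.isClosed_dualCell ha).measurableSet)

theorem dualCell_subset (ht : IsElement t) (ha : a ∈ t) : dualCell a t ⊆ simplex t :=
  fun _ hx => ((ht.mem_dualCell ha).1 hx).1

/-- The hat function and the dual cell both have the share `1 / (d + 1)` of the simplex. -/
theorem integral_chi (hd : 1 ≤ d) (ht : IsElement t) (ha : a ∈ t) :
    ∫ x in simplex t, chi t a x = 0 := by
  have h1 := ht.volume_maxRegion hd (Finset.Subset.refl t) ha
  rw [← ht.dualCell_eq_maxRegion ha, ht.card] at h1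
  have hfin : volume (simplex t) ≠ ⊤ := (isCompact_simplex t).measure_lt_top.ne
  simp only [chi]
  rw [integral_sub (integrableOn_simplex (affine_continuous _).continuousOn)
    ((integrableOn_const hfin).indicator (ht.isClosed_dualCell ha).measurableSet),
    ht.integral_bary ha, setIntegral_indicator (ht.isClosed_dualCell ha).measurableSet,
    inter_eq_right.2 (ht.dualCell_subset ha), setIntegral_const, h1]
  simp

/-- Both terms of `chi` have the share `1 / d` of each facet at `a`. -/
theorem integral_facet_chi (hd : 2 ≤ d) (ht : IsElement t) (hv : v ∈ t) (ha : a ∈ t) :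
    ∫ x in facet t v, chi t a x ∂μHE[d - 1] = 0 := by
  by_cases hav : a = v
  · subst hav
    refine setIntegral_eq_zero_of_forall_eq_zero fun x hx => ?_
    have h0 : bary t a x = 0 := hx.2
    rw [chi, h0, indicator_of_notMem, sub_zero]
    intro hmem
    have h1 := ht.sum_bary x
    have h2 := ((ht.mem_dualCell ha).1 hmem).2
    rw [sum_eq_zero fun b hb =>
      le_antisymm (h0 ▸ h2 b hb) (ht.mem_simplex.1 hx.1 b hb)] at h1
    norm_num at h1
  · have hm := (ht.isClosed_dualCell ha).measurableSet
    simp only [chi]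
    rw [integral_sub (ht.integrableOn_facet hd hv (affine_continuous _).continuousOn)
      ((integrableOn_const (ht.measure_facet_lt_top hd hv).ne).indicator hm),
      ht.integral_facet_bary hd hv ha hav, setIntegral_indicator hm, setIntegral_const,
      inter_comm, ht.measure_facet_inter_dualCell hd hv ha hav]
    simp

theorem abs_chi_le_one (ht : IsElement t) (ha : a ∈ t) (hx : x ∈ simplex t) :
    |chi t a x| ≤ 1 := by
  classical
  have h0 := ht.mem_simplex.1 hx a ha
  have h1 := ht.bary_le_one hx ha
  rw [chi, abs_le, indicator_apply]
  split_ifs <;> constructor <;> linarith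

theorem sum_chi_nonpos (ht : IsElement t) (hx : x ∈ simplex t) :
    ∑ a ∈ t, chi t a x ≤ 0 := by
  obtain ⟨b, hb, hmax⟩ := t.exists_max_image (fun b => bary t b x) ht.nonempty
  have hxb : x ∈ dualCell b t := (ht.mem_dualCell hb).2 ⟨hx, hmax⟩
  simp only [chi]
  rw [sum_sub_distrib, ht.sum_bary]
  have := single_le_sum (f := fun a => (dualCell a t).indicator (fun _ => (1 : ℝ)) x)
    (fun a _ => indicator_nonneg (fun _ _ => zero_le_one) x) hb
  simp only [indicator_of_mem hxb] at this
  linarith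

/-- On a set on which all `chi t a` have integral zero, the difference of an affine function and
the piecewise constant function with the same nodal values is bounded by the oscillation of the
nodal values. -/
theorem ae_abs_sum_chi_le (ht : IsElement t) {μ : Measure (Vec d)} {S : Set (Vec d)}
    (hS : MeasurableSet S) (hSt : S ⊆ simplex t) (hμ : μ S < ⊤)
    (h0 : ∀ a ∈ t, ∫ x in S, chi t a x ∂μ = 0) (w : Vec d → ℝ) {δ : ℝ}
    (hδ : ∀ a ∈ t, ∀ b ∈ t, |w a - w b| ≤ δ) :
    ∀ᵐ x ∂μ.restrict S, |∑ a ∈ t, w a * chi t a x| ≤ (d + 1) * δ := by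
  have hint : ∀ a ∈ t, IntegrableOn (chi t a) S μ := fun a ha => by
    refine IntegrableOn.of_bound hμ (ht.measurable_chi ha).aestronglyMeasurable 1 ?_
    filter_upwards [ae_restrict_mem hS] with x hx using ht.abs_chi_le_one ha (hSt hx)
  have h1 : ∀ᵐ x ∂μ.restrict S, -∑ a ∈ t, chi t a x = 0 := by
    refine (setIntegral_eq_zero_iff_of_nonneg_ae ?_ (integrable_finsetSum _ hint).neg).1 ?_
    · filter_upwards [ae_restrict_mem hS] with x hx
      exact neg_nonneg.2 (ht.sum_chi_nonpos (hSt hx))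
    · have := integral_finsetSum (μ := μ.restrict S) t hint
      rw [sum_eq_zero h0] at this
      simp only [Pi.neg_apply]
      rw [integral_neg, this, neg_zero]
  obtain ⟨a₀, ha₀⟩ := ht.nonempty
  have hδ0 : 0 ≤ δ := (abs_nonneg _).trans (hδ a₀ ha₀ a₀ ha₀)
  filter_upwards [h1, ae_restrict_mem hS] with x hx hxS
  have h2 : ∑ a ∈ t, w a * chi t a x = ∑ a ∈ t, (w a - w a₀) * chi t a x := by
    simp_rw [sub_mul]
    rw [sum_sub_distrib, ← mul_sum, neg_eq_zero.1 hx, mul_zero, sub_zero]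
  rw [h2]
  refine (Finset.abs_sum_le_sum_abs _ _).trans ?_
  calc ∑ a ∈ t, |(w a - w a₀) * chi t a x| ≤ ∑ _a ∈ t, δ := by
        refine sum_le_sum fun a ha => ?_
        rw [abs_mul]
        calc _ ≤ δ * 1 := mul_le_mul (hδ a ha a₀ ha₀) (ht.abs_chi_le_one ha (hSt hxS))
              (abs_nonneg _) hδ0
          _ = δ := mul_one _
    _ = (d + 1) * δ := by rw [sum_const, ht.card]; simp

/-- Differences of vertex values of an affine function are controlled by its `L²`-mean. -/
theorem sq_sub_vertex_le (ht : IsElement t) (ha : a ∈ t) (hb : b ∈ t)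
    (p : Vec d →ᵃ[ℝ] ℝ) :
    volume.real (simplex t) * (p a - p b) ^ 2 ≤ 16 * 4 ^ d * ∫ x in simplex t, p x ^ 2 := by
  by_cases hab : a = b
  · subst hab
    rw [sub_self]
    have : 0 ≤ ∫ x in simplex t, p x ^ 2 := integral_nonneg fun x => sq_nonneg _
    simp only [ne_eq, OfNat.ofNat_ne_zero, not_false_eq_true, zero_pow, mul_zero]
    positivity
  have hswap : ∀ x, p (swapMap t a b x) = p x + (bary t a x - bary t b x) * (p b - p a) := by
    intro x
    rw [swapMap, affine_add, inner_smul_right, ← affine_sub_eq_inner]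
  have hcont : ∀ f : Vec d → ℝ, Continuous f → IntegrableOn f (simplex t) := fun f hf =>
    integrableOn_simplex hf.continuousOn
  have hp := affine_continuous p
  have hla := affine_continuous (bary t a)
  have hlb := affine_continuous (bary t b)
  have hS : Continuous (swapMap t a b) := continuous_swapMap
  -- the symmetric image of `p` differs from `p` by a multiple of `λ_a - λ_b`
  have h1 : (∫ x in simplex t, (bary t a x - bary t b x) ^ 2) * (p a - p b) ^ 2 ≤
      4 * ∫ x in simplex t, p x ^ 2 := by
    have h2 : ∫ x in simplex t, (bary t a x - bary t b x) ^ 2 * (p a - p b) ^ 2 ≤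
        ∫ x in simplex t, (2 * p (swapMap t a b x) ^ 2 + 2 * p x ^ 2) := by
      refine integral_mono (hcont _ (by fun_prop)) (hcont _ (by fun_prop)) fun x => ?_
      have := hswap x
      have h3 : (bary t a x - bary t b x) ^ 2 * (p a - p b) ^ 2 =
          (p (swapMap t a b x) - p x) ^ 2 := by rw [this]; ring
      simp only [h3]
      nlinarith [sq_nonneg (p (swapMap t a b x) + p x)]
    rw [integral_mul_const, integral_add (hcont _ (by fun_prop)) (hcont _ (by fun_prop)),
      integral_const_mul, integral_const_mul,
      ht.setIntegral_swapMap ha hb (fun x => p x ^ 2)] at h2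
    linarith
  -- near `a`, the difference `λ_a - λ_b` is at least `1 / 2`
  have h2 : volume.real (simplex t) * (4 ^ d)⁻¹ * 4⁻¹ ≤
      ∫ x in simplex t, (bary t a x - bary t b x) ^ 2 := by
    set S := AffineMap.homothety a (4⁻¹ : ℝ) '' simplex t with hSdef
    have hvol : volume.real S = (4 ^ d)⁻¹ * volume.real (simplex t) := by
      rw [measureReal_def, hSdef, Measure.addHaar_image_homothety, ENNReal.toReal_mul,
        ENNReal.toReal_ofReal (abs_nonneg _), finrank_euclideanSpace_fin, measureReal_def,
        abs_of_nonneg (by positivity), inv_pow]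
    have hmem : ∀ x ∈ S, x ∈ simplex t ∧ 4⁻¹ ≤ (bary t a x - bary t b x) ^ 2 := by
      rintro _ ⟨y, hy, rfl⟩
      have hval : ∀ c ∈ t, bary t c (AffineMap.homothety a (4⁻¹ : ℝ) y) =
          4⁻¹ * (bary t c y - bary t c a) + bary t c a := by
        intro c hc
        rw [AffineMap.homothety_apply, vsub_eq_sub, vadd_eq_add, add_comm, affine_add,
          inner_smul_right, ← affine_sub_eq_inner]; ring
      refine ⟨ht.mem_simplex.2 fun c hc => ?_, ?_⟩
      · rw [hval c hc]
        have h1 := ht.mem_simplex.1 hy c hc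
        have h2 : 0 ≤ bary t c a := by
          classical
          rw [ht.bary_vertex hc ha]; split_ifs <;> norm_num
        linarith
      · rw [hval a ha, hval b hb, ht.bary_self ha, ht.bary_of_ne hb ha (Ne.symm hab)]
        have h1 := ht.mem_simplex.1 hy a ha
        have h2 := ht.bary_le_one hy hb
        have h3 : (2⁻¹ : ℝ) ≤ 4⁻¹ * (bary t a y - 1) + 1 - (4⁻¹ * (bary t b y - 0) + 0) := by
          linarith
        calc (4⁻¹ : ℝ) = 2⁻¹ ^ 2 := by norm_num
          _ ≤ _ := by gcongr
    have hSm : MeasurableSet S :=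
      ((isCompact_simplex t).image (AffineMap.homothety_continuous a _)).isClosed.measurableSet
    have hSfin : volume S ≠ ⊤ :=
      ((isCompact_simplex t).image (AffineMap.homothety_continuous a _)).measure_lt_top.ne
    calc volume.real (simplex t) * (4 ^ d)⁻¹ * 4⁻¹ = ∫ _x in S, (4⁻¹ : ℝ) := by
          rw [setIntegral_const, hvol, smul_eq_mul]; ring
      _ ≤ ∫ x in S, (bary t a x - bary t b x) ^ 2 := by
          refine setIntegral_mono_on (integrableOn_const hSfin)
            ((hcont _ (by fun_prop)).mono_set fun x hx => (hmem x hx).1) hSm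
            fun x hx => (hmem x hx).2
      _ ≤ _ := setIntegral_mono_set (hcont _ (by fun_prop))
          (.of_forall fun x => sq_nonneg _)
          (.of_forall fun x hx => (hmem x hx).1)
  have h3 := mul_le_mul_of_nonneg_right h2 (sq_nonneg (p a - p b))
  have h4 := h3.trans h1
  have h5 : (0 : ℝ) < 4 ^ d := by positivity
  calc volume.real (simplex t) * (p a - p b) ^ 2
      = 4 * 4 ^ d * (volume.real (simplex t) * (4 ^ d)⁻¹ * 4⁻¹ * (p a - p b) ^ 2) := by
        field_simp
    _ ≤ 4 * 4 ^ d * (4 * ∫ x in simplex t, p x ^ 2) := by gcongr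
    _ = _ := by ring

/-- Vertex values of an affine function on a facet are controlled by its `L²`-mean over the
facet. -/
theorem sq_vertex_le_facet (hd : 2 ≤ d) (ht : IsElement t) (hv : v ∈ t) (hz : z ∈ t)
    (hzv : z ≠ v) (p : Vec d →ᵃ[ℝ] ℝ) :
    ‖agrad (bary t v)‖ * volume.real (simplex t) * p z ^ 2 ≤
      16 * 4 ^ d * ∫ x in facet t v, p x ^ 2 ∂μHE[d - 1] := by
  -- the extension of the values on the facet which vanishes at `v`
  set r : Vec d →ᵃ[ℝ] ℝ := p - p v • bary t v with hr
  have hrv : r v = 0 := by simp [hr, ht.bary_self hv]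
  have hrz : r z = p z := by simp [hr, ht.bary_of_ne hv hz hzv.symm]
  have h1 : ∫ x in facet t v, p x ^ 2 ∂μHE[d - 1] = ∫ x in facet t v, r x ^ 2 ∂μHE[d - 1] := by
    refine setIntegral_congr_fun isClosed_facet.measurableSet fun x hx => ?_
    have : bary t v x = 0 := hx.2
    simp [hr, this]
  have h2 : ∀ x, d * r x ^ 2 + fderiv ℝ (fun y => r y ^ 2) x (x - v) = (d + 2) * r x ^ 2 := by
    intro x
    have h3 := (hasFDerivAt_affine r x).pow 2
    rw [h3.fderiv]
    have h4 := affine_sub_eq_inner r x v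
    rw [inner_agrad, hrv, sub_zero] at h4
    simp only [smul_apply, LinearMap.coe_toContinuousLinearMap', ← h4]
    simp
    ring
  rw [h1, ht.integral_facet hd hv ((contDiff_affine r).pow 2)]
  simp_rw [h2]
  rw [integral_const_mul]
  have h5 := ht.sq_sub_vertex_le hz hv r
  rw [hrv, hrz, sub_zero] at h5
  have h6 : 0 ≤ ∫ x in simplex t, r x ^ 2 := integral_nonneg fun x => sq_nonneg _
  have hg := (ht.norm_agrad_bary_pos (by omega) hv).le
  calc _ = ‖agrad (bary t v)‖ * (volume.real (simplex t) * p z ^ 2) := by ring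
    _ ≤ ‖agrad (bary t v)‖ * (16 * 4 ^ d * ∫ x in simplex t, r x ^ 2) := by gcongr
    _ ≤ ‖agrad (bary t v)‖ * (16 * 4 ^ d * ((d + 2) * ∫ x in simplex t, r x ^ 2)) := by
        gcongr
        have : (0 : ℝ) ≤ d := by positivity
        nlinarith
    _ = _ := by ring

/-- The trace inequality. -/
theorem integral_facet_sq_le (hd : 2 ≤ d) (ht : IsElement t) (hv : v ∈ t) {ψ : Vec d → ℝ}
    (hψ : ContDiff ℝ 1 ψ) :
    ∫ x in facet t v, ψ x ^ 2 ∂μHE[d - 1] ≤ ‖agrad (bary t v)‖ *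
      ((d + 1) * (∫ x in simplex t, ψ x ^ 2) +
        diam (simplex t) ^ 2 * ∫ x in simplex t, ‖fderiv ℝ ψ x‖ ^ 2) := by
  rw [ht.integral_facet hd hv (hψ.pow 2)]
  gcongr
  have hc1 := hψ.continuous
  have hc2 : Continuous (fderiv ℝ ψ) := hψ.continuous_fderiv one_ne_zero
  have hcont : ∀ f : Vec d → ℝ, Continuous f → IntegrableOn f (simplex t) := fun f hf =>
    integrableOn_simplex hf.continuousOn
  have h2 : ∀ x, fderiv ℝ (fun y => ψ y ^ 2) x (x - v) = 2 * ψ x * fderiv ℝ ψ x (x - v) := by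
    intro x
    have h3 := (hψ.differentiable one_ne_zero x).hasFDerivAt.pow 2
    rw [h3.fderiv]
    simp
  simp_rw [h2]
  rw [← integral_const_mul, ← integral_const_mul,
    ← integral_add (hcont _ (by fun_prop)) (hcont _ (by fun_prop))]
  refine setIntegral_mono_on (hcont _ ?_) (hcont _ (by fun_prop))
    (isClosed_simplex t).measurableSet fun x hx => ?_
  · refine (continuous_const.mul (hc1.pow 2)).add ((continuous_const.mul hc1).mul ?_)
    exact hc2.clm_apply (continuous_id.sub continuous_const)
  · have h4 : |fderiv ℝ ψ x (x - v)| ≤ ‖fderiv ℝ ψ x‖ * diam (simplex t) := by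
      refine ((fderiv ℝ ψ x).le_opNorm (x - v)).trans ?_
      gcongr
      rw [← dist_eq_norm]
      exact dist_le_diam_of_mem (isCompact_simplex t).isBounded hx
        (subset_convexHull ℝ _ hv)
    have h5 : (fderiv ℝ ψ x (x - v)) ^ 2 ≤
        diam (simplex t) ^ 2 * ‖fderiv ℝ ψ x‖ ^ 2 := by
      rw [← sq_abs, ← mul_pow, mul_comm (diam _)]
      gcongr
    nlinarith [sq_nonneg (ψ x - fderiv ℝ ψ x (x - v))]

end IsElement

/-- The volume of the unit ball of `ℝ^{d-1}`. -/
noncomputable def crossConst (d : ℕ) : ℝ :=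
  volume.real (closedBall (0 : Vec (d - 1)) 1)

theorem crossConst_nonneg : 0 ≤ crossConst d := measureReal_nonneg

namespace IsElement

/-- The simplex lies in a layer orthogonal to the gradient of a barycentric coordinate, which
bounds the gradient. -/
theorem norm_agrad_mul_volume_le (hd : 2 ≤ d) (ht : IsElement t) (ha : a ∈ t) :
    ‖agrad (bary t a)‖ * volume.real (simplex t) ≤
      crossConst d * diam (simplex t) ^ (d - 1) := by
  obtain ⟨b, hb, hba⟩ := ht.exists_ne (by omega) a
  have hne := ht.agrad_bary_ne_zero (by omega) ha
  have hg := ht.norm_agrad_bary_pos (by omega) ha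
  have hfb := ht.bary_of_ne ha hb hba.symm
  have hf01 : ∀ x ∈ simplex t, bary t a x ∈ Icc (0 : ℝ) 1 := fun x hx =>
    ⟨ht.mem_simplex.1 hx a ha, ht.bary_le_one hx ha⟩
  generalize bary t a = f at hne hg hfb hf01 ⊢
  set R := diam (simplex t) with hR
  have hR0 : 0 ≤ R := diam_nonneg
  let H := (ℝ ∙ agrad f)ᗮ
  have hrank : Module.finrank ℝ H = d - 1 := by
    change Module.finrank ℝ (ℝ ∙ agrad f)ᗮ = d - 1
    have h := (ℝ ∙ agrad f).finrank_add_finrank_orthogonal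
    rw [finrank_span_singleton hne, finrank_euclideanSpace_fin] at h
    omega
  -- in height coordinates with origin `b`, the simplex lies in `[0, 1] ×` a ball
  have h1 := integral_eq_integral_height hne b (c := ‖agrad f‖⁻¹) (by positivity)
    ((simplex t).indicator fun _ => (1 : ℝ))
  rw [integral_indicator (isClosed_simplex t).measurableSet, setIntegral_const, smul_eq_mul,
    mul_one] at h1
  rw [h1, ← mul_assoc, mul_inv_cancel₀ hg.ne', one_mul]
  have hball : volume.real (closedBall (0 : H) R) = crossConst d * R ^ (d - 1) := by
    let e : H ≃ₗᵢ[ℝ] Vec (d - 1) :=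
      ((stdOrthonormalBasis ℝ H).reindex (finCongr hrank)).repr
    have he : MeasurePreserving e := e.measurePreserving
    have h2 : e ⁻¹' (closedBall 0 R) = closedBall 0 R := by
      rw [e.preimage_closedBall]; simp
    rw [← h2, measureReal_def,
      he.measure_preimage Metric.isClosed_closedBall.measurableSet.nullMeasurableSet,
      Measure.addHaar_closedBall' _ _ hR0, finrank_euclideanSpace_fin, ENNReal.toReal_mul,
      ENNReal.toReal_ofReal (by positivity), crossConst, measureReal_def, mul_comm]
  have hprod : ∫ z : ℝ × H, (Icc (0 : ℝ) 1).indicator (fun _ => (1 : ℝ)) z.1 *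
      (closedBall (0 : H) R).indicator (fun _ => (1 : ℝ)) z.2 = crossConst d * R ^ (d - 1) := by
    rw [Measure.volume_eq_prod, integral_prod_mul (μ := volume) (ν := volume)
      (fun a : ℝ => (Icc (0 : ℝ) 1).indicator (fun _ => (1 : ℝ)) a)
      (fun y : H => (closedBall (0 : H) R).indicator (fun _ => (1 : ℝ)) y),
      integral_indicator measurableSet_Icc,
      integral_indicator Metric.isClosed_closedBall.measurableSet,
      setIntegral_const, setIntegral_const, hball]
    simp
  rw [← hprod]
  have hint : Integrable (fun z : ℝ × H => (Icc (0 : ℝ) 1).indicator (fun _ => (1 : ℝ)) z.1 *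
      (closedBall (0 : H) R).indicator (fun _ => (1 : ℝ)) z.2) := by
    rw [Measure.volume_eq_prod]
    refine Integrable.mul_prod (f := (Icc (0 : ℝ) 1).indicator (fun _ => (1 : ℝ)))
      (g := (closedBall (0 : H) R).indicator (fun _ => (1 : ℝ))) ?_ ?_
    · rw [integrable_indicator_iff measurableSet_Icc]
      exact integrableOn_const (by simp)
    · rw [integrable_indicator_iff Metric.isClosed_closedBall.measurableSet]
      exact integrableOn_const Metric.isBounded_closedBall.measure_lt_top.ne
  refine integral_mono_of_nonneg (.of_forall fun z =>
    indicator_nonneg (fun _ _ => zero_le_one) _) hint (.of_forall fun z => ?_)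
  simp only
  by_cases hz : (‖agrad f‖⁻¹ * z.1) • (‖agrad f‖⁻¹ • agrad f) + (z.2 : Vec d) + b ∈ simplex t
  · rw [indicator_of_mem hz]
    set x := (‖agrad f‖⁻¹ * z.1) • (‖agrad f‖⁻¹ • agrad f) + (z.2 : Vec d) + b with hx
    have horth : inner ℝ (agrad f) (z.2 : Vec d) = 0 :=
      Submodule.mem_orthogonal_singleton_iff_inner_right.1 z.2.2
    have h3 : f x = z.1 := by
      rw [hx, add_comm, affine_add, inner_add_right, horth, inner_smul_right, inner_smul_right,
        real_inner_self_eq_norm_sq, hfb]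
      field_simp
      ring
    have h4 : z.1 ∈ Icc (0 : ℝ) 1 := by
      rw [← h3]
      exact hf01 x hz
    have h5 : z.2 ∈ closedBall (0 : H) R := by
      rw [mem_closedBall_zero_iff]
      have h6 : ‖x - b‖ ≤ R := by
        rw [← dist_eq_norm]
        exact dist_le_diam_of_mem (isCompact_simplex t).isBounded hz
          (subset_convexHull ℝ _ hb)
      have h7 : ‖(z.2 : Vec d)‖ * ‖(z.2 : Vec d)‖ ≤ ‖(z.2 : Vec d)‖ * ‖x - b‖ := by
        rw [← real_inner_self_eq_norm_mul_norm]
        have : inner ℝ (z.2 : Vec d) (z.2 : Vec d) = inner ℝ (z.2 : Vec d) (x - b) := by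
          rw [hx, add_sub_cancel_right, inner_add_right, inner_smul_right, inner_smul_right,
            real_inner_comm (agrad f), horth]
          simp
        rw [this]
        exact real_inner_le_norm _ _
      rcases (norm_nonneg (z.2 : Vec d)).eq_or_lt with h8 | h8
      · rw [Submodule.coe_norm, ← h8]; exact hR0
      · exact (le_of_mul_le_mul_left h7 h8).trans h6
    rw [indicator_of_mem h4, indicator_of_mem h5, mul_one]
  · rw [indicator_of_notMem hz]
    exact mul_nonneg (indicator_nonneg (fun _ _ => zero_le_one) _)
      (indicator_nonneg (fun _ _ => zero_le_one) _)

theorem meshSize_pos (ht : IsElement t) : 0 < meshSize t :=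
  Real.rpow_pos_of_pos ht.volume_simplex_pos _

theorem meshSize_pow (hd : 1 ≤ d) (ht : IsElement t) :
    meshSize t ^ d = volume.real (simplex t) := by
  rw [meshSize, ← Real.rpow_natCast, ← Real.rpow_mul ht.volume_simplex_pos.le, one_div,
    inv_mul_cancel₀ (by exact_mod_cast (by omega : d ≠ 0)), Real.rpow_one]

/-- The gradients of the barycentric coordinates of a shape regular simplex. -/
theorem norm_agrad_mul_meshSize_le (hd : 2 ≤ d) (ht : IsElement t) (ha : a ∈ t)
    (hσ : diam (simplex t) ≤ σ * meshSize t) :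
    ‖agrad (bary t a)‖ * meshSize t ≤ crossConst d * σ ^ (d - 1) := by
  have h := ht.norm_agrad_mul_volume_le hd ha
  have hh := ht.meshSize_pos
  have hC := crossConst_nonneg (d := d)
  rw [← ht.meshSize_pow (by omega)] at h
  have h2 : diam (simplex t) ^ (d - 1) ≤ (σ * meshSize t) ^ (d - 1) := by
    gcongr
  have h3 : meshSize t ^ d = meshSize t * meshSize t ^ (d - 1) := by
    rw [← pow_succ', Nat.sub_add_cancel (by omega)]
  rw [h3, ← mul_assoc] at h
  have h4 : crossConst d * diam (simplex t) ^ (d - 1) ≤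
      crossConst d * σ ^ (d - 1) * meshSize t ^ (d - 1) := by
    calc _ ≤ crossConst d * (σ * meshSize t) ^ (d - 1) := by gcongr
      _ = _ := by rw [mul_pow]; ring
  exact le_of_mul_le_mul_right (h.trans h4) (by positivity)

theorem one_le_norm_agrad_mul_dist (ht : IsElement t) (ha : a ∈ t) (hb : b ∈ t)
    (hab : a ≠ b) : 1 ≤ ‖agrad (bary t a)‖ * dist a b := by
  have h := affine_sub_eq_inner (bary t a) a b
  rw [ht.bary_self ha, ht.bary_of_ne ha hb hab, sub_zero] at h
  rw [h, dist_eq_norm]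
  exact real_inner_le_norm _ _

end IsElement

open IsElement (isCompact_simplex isClosed_simplex convex_simplex isClosed_facet)

/-! ### Geometry of triangulations -/

/-- A Lipschitz domain lies locally on one side of its boundary. -/
theorem IsLipschitzDomain.interior_closure_subset (hΩ : IsLipschitzDomain Ω) :
    interior (closure Ω) ⊆ Ω := by
  intro x hx
  by_contra hxΩ
  have hfr : x ∈ frontier Ω := ⟨interior_subset hx, fun h => hxΩ (interior_subset h)⟩
  obtain ⟨U, hU, e, γ, K, he, hγ, hinv, hiff⟩ := hΩ.boundary x hfr
  have hge : inner ℝ e x ≤ γ x := by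
    by_contra h
    exact hxΩ ((hiff x (mem_of_mem_nhds hU)).2 (not_le.1 h))
  -- moving against the direction `e` leads out of the closure of the domain
  have hlim : Tendsto (fun τ : ℝ => x + (-τ) • e) (𝓝[>] 0) (𝓝 x) := by
    have : Continuous (fun τ : ℝ => x + (-τ) • e) := by fun_prop
    have h := this.tendsto 0
    simp only [neg_zero, zero_smul, add_zero] at h
    exact h.mono_left nhdsWithin_le_nhds
  have hev := hlim.eventually (inter_mem (interior_mem_nhds.2 hU) (isOpen_interior.mem_nhds hx))
  obtain ⟨τ, ⟨hτU, hτΩ⟩, hτ⟩ := (hev.and self_mem_nhdsWithin).exists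
  set y := x + (-τ) • e
  have hy : inner ℝ e y < γ y := by
    rw [hinv, inner_add_right, inner_smul_right, real_inner_self_eq_norm_sq, he]
    nlinarith
  have hopen : IsOpen {z | inner ℝ e z < γ z} :=
    isOpen_lt (continuous_const.inner continuous_id) hγ.continuous
  obtain ⟨z, hz, hzΩ⟩ := mem_closure_iff.1 (interior_subset hτΩ) _
    (hopen.inter isOpen_interior) ⟨hy, hτU⟩
  exact absurd ((hiff z (interior_subset hz.2)).1 hzΩ) (not_lt.2 (le_of_lt hz.1))

namespace Triangulation

theorem mem_elements : t ∈ 𝒯.elements ↔ t ∈ 𝒯.complex.faces ∧ t.card = d + 1 := by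
  simp [elements]

theorem isElement (ht : t ∈ 𝒯.elements) : IsElement t :=
  ⟨𝒯.complex.indep (mem_elements.1 ht).1, (mem_elements.1 ht).2⟩

theorem simplex_subset_closure (ht : t ∈ 𝒯.elements) : simplex t ⊆ closure Ω := by
  rw [← 𝒯.space_eq]
  exact 𝒯.complex.convexHull_subset_space (mem_elements.1 ht).1

theorem exists_mem_simplex (hx : x ∈ closure Ω) : ∃ t ∈ 𝒯.elements, x ∈ simplex t := by
  rw [← 𝒯.space_eq, Geometry.SimplicialComplex.mem_space_iff] at hx
  obtain ⟨s, hs, hxs⟩ := hx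
  obtain ⟨t, ht, hst, hcard⟩ := 𝒯.pure s hs
  exact ⟨t, mem_elements.2 ⟨ht, hcard⟩, convexHull_mono (by exact_mod_cast hst) hxs⟩

theorem closure_eq_iUnion : closure Ω = ⋃ t ∈ 𝒯.elements, simplex t := by
  ext x
  simp only [mem_iUnion, exists_prop]
  exact ⟨exists_mem_simplex, fun ⟨t, ht, hx⟩ => simplex_subset_closure ht hx⟩

theorem mem_star : t ∈ 𝒯.star a ↔ t ∈ 𝒯.elements ∧ a ∈ t := by
  simp [star]

theorem vertex_mem_simplex (ha : a ∈ t) : a ∈ simplex t := subset_convexHull ℝ _ ha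

/-- In the intersection of two elements, their barycentric coordinates agree. -/
theorem bary_inter (ht : t ∈ 𝒯.elements) (ht' : t' ∈ 𝒯.elements) (hx : x ∈ simplex t)
    (hx' : x ∈ simplex t') (ha : a ∈ t) :
    (a ∈ t' → bary t a x = bary t' a x) ∧ (a ∉ t' → bary t a x = 0) := by
  classical
  have h := 𝒯.complex.inter_subset_convexHull (mem_elements.1 ht).1 (mem_elements.1 ht').1 ⟨hx, hx'⟩
  rw [← Finset.coe_inter] at h
  have e := isElement ht
  have e' := isElement ht'
  have hb := (e.mem_convexHull_face Finset.inter_subset_left).1 h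
  have hb' := (e'.mem_convexHull_face Finset.inter_subset_right).1 h
  refine ⟨fun ha' => ?_, fun ha' => hb.2 a ha (by simp [ha'])⟩
  have h1 : ∑ c ∈ t ∩ t', bary t' c x = 1 := by
    rw [← e'.sum_bary x]
    exact sum_subset Finset.inter_subset_right fun c hc hcs => hb'.2 c hc hcs
  have h2 : ∑ c ∈ t ∩ t', bary t' c x • c = x := by
    conv_rhs => rw [← e'.sum_bary_smul x]
    exact sum_subset Finset.inter_subset_right fun c hc hcs => by
      rw [hb'.2 c hc hcs, zero_smul]
  have h3 := affine_sum_smul (bary t a) h1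
  rw [h2] at h3
  rw [h3, sum_eq_single a, e.bary_self ha, mul_one]
  · intro c hc hca
    rw [e.bary_of_ne ha (Finset.mem_inter.1 hc).1 hca.symm, mul_zero]
  · intro h
    exact absurd (Finset.mem_inter.2 ⟨ha, ha'⟩) h

theorem vertex_mem_of_mem_simplex (ht : t ∈ 𝒯.elements) (ht' : t' ∈ 𝒯.elements) (ha : a ∈ t')
    (h : a ∈ simplex t) : a ∈ t := by
  by_contra hat
  have := (bary_inter ht' ht (vertex_mem_simplex ha) h ha).2 hat
  rw [(isElement ht').bary_self ha] at this
  norm_num at this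

theorem eq_of_mem_interior (ht : t ∈ 𝒯.elements) (ht' : t' ∈ 𝒯.elements)
    (hx : x ∈ interior (simplex t)) (hx' : x ∈ simplex t') : t = t' := by
  refine Finset.eq_of_subset_of_card_le (fun a ha => ?_) ?_
  · by_contra hat
    have h1 := (isElement ht).mem_interior_simplex.1 hx a ha
    rw [(bary_inter ht ht' (interior_subset hx) hx' ha).2 hat] at h1
    exact lt_irrefl _ h1
  · rw [(isElement ht).card, (isElement ht').card]

theorem volume_inter_eq_zero (ht : t ∈ 𝒯.elements) (ht' : t' ∈ 𝒯.elements) (hne : t ≠ t') :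
    volume (simplex t ∩ simplex t') = 0 := by
  refine measure_mono_null ?_ ((convex_simplex t).addHaar_frontier volume)
  rintro x ⟨hx, hx'⟩
  exact ⟨subset_closure hx, fun h => hne (eq_of_mem_interior ht ht' h hx')⟩

/-- Points near a point of `Ω` lie in elements that contain this point. -/
theorem eventually_exists_simplex (hΩ : IsOpen Ω) (hx : x ∈ Ω) :
    ∀ᶠ y in 𝓝 x, ∃ t ∈ 𝒯.elements, y ∈ simplex t ∧ x ∈ simplex t := by
  have h1 : ∀ᶠ y in 𝓝 x, ∀ t ∈ 𝒯.elements, x ∉ simplex t → y ∉ simplex t := by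
    rw [eventually_all_finset]
    intro t _
    by_cases h : x ∈ simplex t
    · simp [h]
    · filter_upwards [(isClosed_simplex t).isOpen_compl.mem_nhds h] with y hy _ using hy
  filter_upwards [h1, hΩ.mem_nhds hx] with y hy hyΩ
  obtain ⟨t, ht, hyt⟩ := exists_mem_simplex (𝒯 := 𝒯) (subset_closure hyΩ)
  exact ⟨t, ht, hyt, by_contra fun h => hy t ht h hyt⟩

/-- Two elements with a common facet lie on different sides of it. -/
theorem exists_apex [DecidableEq (Vec d)] (hd : 1 ≤ d) (ht : t ∈ 𝒯.elements)
    (ht' : t' ∈ 𝒯.elements) (hne : t' ≠ t) (hv : v ∈ t) (hsub : t.erase v ⊆ t') :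
    ∃ v' ∈ t', v' ∉ t ∧ t'.erase v' = t.erase v ∧ t ∩ t' = t.erase v ∧
      ∃ κ : ℝ, 0 < κ ∧ bary t' v' = -κ • bary t v := by
  have e := isElement ht
  have e' := isElement ht'
  have hcard : (t.erase v).card = d := by rw [card_erase_of_mem hv, e.card]; rfl
  have hvt' : v ∉ t' := fun h => hne (Finset.eq_of_subset_of_card_le (fun a ha => by
    by_cases hav : a = v
    · exact hav ▸ h
    · exact hsub (mem_erase.2 ⟨hav, ha⟩)) (by rw [e.card, e'.card])).symm
  obtain ⟨v', hv', hv'n⟩ : ∃ v' ∈ t', v' ∉ t.erase v := by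
    by_contra! h
    have := Finset.card_le_card h
    rw [e'.card, hcard] at this
    omega
  have hv't : v' ∉ t := fun h => hv'n (mem_erase.2 ⟨fun h' => hvt' (h' ▸ hv'), h⟩)
  have herase : t'.erase v' = t.erase v := by
    symm
    refine Finset.eq_of_subset_of_card_le (fun a ha => mem_erase.2
      ⟨fun h => hv'n (h ▸ ha), hsub ha⟩) ?_
    rw [card_erase_of_mem hv', e'.card, hcard]; rfl
  have hinter : t ∩ t' = t.erase v := by
    ext a
    simp only [Finset.mem_inter, mem_erase]
    constructor
    · rintro ⟨h1, h2⟩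
      exact ⟨fun h => hvt' (h ▸ h2), h1⟩
    · rintro ⟨h1, h2⟩
      exact ⟨h2, hsub (mem_erase.2 ⟨h1, h2⟩)⟩
  -- both functions vanish on the common facet, hence are proportional
  set m := bary t' v' v with hm
  have hbm : bary t' v' = m • bary t v := by
    refine e.affine_ext fun a ha => ?_
    by_cases hav : a = v
    · subst hav
      simp [e.bary_self hv, hm]
    · have ha' : a ∈ t' := hsub (mem_erase.2 ⟨hav, ha⟩)
      have hav' : v' ≠ a := fun h => hv't (h ▸ ha)
      simp [e.bary_of_ne hv ha (Ne.symm hav), e'.bary_of_ne hv' ha' hav']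
  refine ⟨v', hv', hv't, herase, hinter, -m, ?_, by rw [neg_neg]; exact hbm⟩
  by_contra hneg
  have hm0 : 0 ≤ m := by linarith
  rcases hm0.eq_or_lt with h0 | hpos
  · have := e'.bary_self hv'
    rw [hbm, ← h0] at this
    simp at this
  · -- points slightly inside of `t` near the center of the facet would be interior to both
    have hFne : (t.erase v).Nonempty := by rw [← Finset.card_pos, hcard]; omega
    set c := (t.erase v).centroid ℝ id with hc
    have hcpos : ∀ b ∈ t.erase v, 0 < bary t b c := fun b hb => by
      rw [hc, e.bary_centroid (erase_subset _ _) hFne (mem_of_mem_erase hb),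
        if_pos hb]
      exact inv_pos.2 (by exact_mod_cast hFne.card_pos)
    have hcpos' : ∀ b ∈ t.erase v, 0 < bary t' b c := fun b hb => by
      rw [hc, e'.bary_centroid hsub hFne (hsub hb), if_pos hb]
      exact inv_pos.2 (by exact_mod_cast hFne.card_pos)
    have hcv : bary t v c = 0 := by
      rw [hc, e.bary_centroid (erase_subset _ _) hFne hv, if_neg (by simp)]
    have h1 : ∀ᶠ y in 𝓝 c, ∀ b ∈ t.erase v, 0 < bary t b y ∧ 0 < bary t' b y := by
      rw [eventually_all_finset]
      exact fun b hb => ((affine_continuous _).continuousAt.eventually_const_lt (hcpos b hb)).and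
        ((affine_continuous _).continuousAt.eventually_const_lt (hcpos' b hb))
    obtain ⟨ε, hε0, -, hε⟩ := exists_small_of_eventually h1 (v - c)
    set y := c + ε • (v - c)
    have hyv : bary t v y = ε := by
      rw [affine_add, inner_smul_right, ← affine_sub_eq_inner, e.bary_self hv, hcv]; ring
    refine hne (eq_of_mem_interior ht ht' (x := y) (e.mem_interior_simplex.2 fun b hb => ?_)
      (e'.mem_simplex.2 fun b hb => ?_)).symm
    · by_cases hbv : b = v
      · rw [hbv, hyv]; exact hε0
      · exact (hε b (mem_erase.2 ⟨hbv, hb⟩)).1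
    · by_cases hbv : b = v'
      · rw [hbv, hbm]
        simp only [AffineMap.coe_smul, Pi.smul_apply, smul_eq_mul, hyv]
        positivity
      · exact (hε b (herase ▸ mem_erase.2 ⟨hbv, hb⟩)).2.le

/-- At most two elements share a facet. -/
theorem neighbour_unique [DecidableEq (Vec d)] (hd : 1 ≤ d) (ht : t ∈ 𝒯.elements)
    {t₁ t₂ : Finset (Vec d)} (ht₁ : t₁ ∈ 𝒯.elements) (ht₂ : t₂ ∈ 𝒯.elements) (hne₁ : t₁ ≠ t)
    (hne₂ : t₂ ≠ t) (hv : v ∈ t) (h₁ : t.erase v ⊆ t₁) (h₂ : t.erase v ⊆ t₂) : t₁ = t₂ := by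
  by_contra hne
  obtain ⟨v₁, hv₁, -, he₁, -, κ₁, hκ₁, hb₁⟩ := exists_apex hd ht ht₁ hne₁ hv h₁
  obtain ⟨v₂, hv₂, hvn₂, he₂, -, κ₂, hκ₂, hb₂⟩ := exists_apex hd ht ht₂ hne₂ hv h₂
  obtain ⟨v₃, hv₃, -, he₃, -, κ₃, hκ₃, hb₃⟩ :=
    exists_apex hd ht₁ ht₂ (Ne.symm hne) hv₁ (he₁ ▸ h₂)
  have hv23 : v₃ = v₂ := by
    by_contra h
    have : v₃ ∈ t₂.erase v₃ := by
      rw [he₃, he₁, ← he₂]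
      exact mem_erase.2 ⟨h, hv₃⟩
    simp at this
  rw [hv23, hb₂, hb₁] at hb₃
  have := congrArg (fun f : Vec d →ᵃ[ℝ] ℝ => f v) hb₃
  simp [(isElement ht).bary_self hv] at this
  nlinarith [mul_pos hκ₃ hκ₁]

/-- A facet which belongs to one element only lies on the boundary. -/
theorem facet_disjoint_of_unshared [DecidableEq (Vec d)] (hΩ : IsOpen Ω) (hd : 1 ≤ d)
    (ht : t ∈ 𝒯.elements) (hv : v ∈ t)
    (hun : ∀ t' ∈ 𝒯.elements, t.erase v ⊆ t' → t' = t) : Disjoint (facet t v) Ω := by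
  have e := isElement ht
  have hcard : (t.erase v).card = d := by rw [card_erase_of_mem hv, e.card]; rfl
  have hFne : (t.erase v).Nonempty := by rw [← Finset.card_pos, hcard]; omega
  -- relatively interior points of the facet
  have key : ∀ x ∈ Ω, bary t v x = 0 → ¬ ∀ b ∈ t.erase v, 0 < bary t b x := by
    intro x hx hxv hpos
    obtain ⟨ε, hε, -, t', ht', hyt', hxt'⟩ :=
      exists_small_of_eventually (eventually_exists_simplex (𝒯 := 𝒯) hΩ hx) (x - v)
    have hxt : x ∈ simplex t := e.mem_simplex.2 fun b hb => by
      by_cases hbv : b = v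
      · rw [hbv, hxv]
      · exact (hpos b (mem_erase.2 ⟨hbv, hb⟩)).le
    have : t' = t := hun t' ht' fun b hb => by
      by_contra hbt'
      have h1 := hpos b hb
      rw [(bary_inter ht ht' hxt hxt' (mem_of_mem_erase hb)).2 hbt'] at h1
      exact lt_irrefl _ h1
    subst this
    have h2 := e.mem_simplex.1 hyt' v hv
    rw [affine_add, inner_smul_right, ← affine_sub_eq_inner, e.bary_self hv, hxv] at h2
    linarith
  rw [Set.disjoint_left]
  rintro x ⟨hxt, hxv⟩ hxΩ
  have hxv : bary t v x = 0 := hxv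
  set c := (t.erase v).centroid ℝ id with hc
  obtain ⟨ε, hε, hε1, hyΩ⟩ := exists_small_of_eventually (hΩ.mem_nhds hxΩ) (c - x)
  refine key _ hyΩ ?_ fun b hb => ?_
  · rw [affine_add, inner_smul_right, ← affine_sub_eq_inner, hxv, hc,
      e.bary_centroid (erase_subset _ _) hFne hv, if_neg (by simp)]
    ring
  · have h0 := e.mem_simplex.1 hxt b (mem_of_mem_erase hb)
    rw [affine_add, inner_smul_right, ← affine_sub_eq_inner, hc,
      e.bary_centroid (erase_subset _ _) hFne (mem_of_mem_erase hb), if_pos hb]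
    have h1 : (0 : ℝ) < ((t.erase v).card : ℝ)⁻¹ := by
      have := hFne.card_pos
      positivity
    have h2 : (0 : ℝ) ≤ (1 - ε) * bary t b x := mul_nonneg (by linarith) h0
    have h3 := mul_pos hε h1
    linarith

/-- The open star of an interior node is contained in the interior of its closed star. -/
theorem mem_interior_star (hΩ : IsOpen Ω) (haΩ : a ∈ Ω) (ht : t ∈ 𝒯.elements) (ha : a ∈ t)
    (hx : x ∈ simplex t) (hpos : 0 < bary t a x) :
    x ∈ interior (⋃ t' ∈ 𝒯.star a, simplex t') := by
  have e := isElement ht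
  rw [mem_interior_iff_mem_nhds]
  have hnear := eventually_exists_simplex (𝒯 := 𝒯) hΩ haΩ
  -- shrink a neighbourhood of the segment from `a` to `x` towards `a`
  obtain ⟨ε, hε, hε1, hev⟩ := exists_small_of_eventually hnear.eventually_nhds (x - a)
  set xε := a + ε • (x - a) with hxε
  have hxεt : xε ∈ simplex t := by
    have := (convex_simplex t) (vertex_mem_simplex ha) hx
      (show 0 ≤ 1 - ε by linarith) hε.le (by ring)
    convert this using 1
    rw [hxε]; module
  have hcont : Tendsto (fun y : Vec d => a + ε • (y - a)) (𝓝 x) (𝓝 xε) := by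
    have : Continuous (fun y : Vec d => a + ε • (y - a)) := by fun_prop
    exact this.tendsto x
  have h1 := hcont.eventually hev
  have h2 : ∀ᶠ y in 𝓝 x, ∀ t' ∈ 𝒯.elements, xε ∉ simplex t' → a + ε • (y - a) ∉ simplex t' := by
    rw [eventually_all_finset]
    intro t' _
    by_cases h : xε ∈ simplex t'
    · simp [h]
    · filter_upwards [hcont.eventually ((isClosed_simplex t').isOpen_compl.mem_nhds h)]
        with y hy _ using hy
  have hval : ∀ t' ∈ 𝒯.elements, a ∈ t' → ∀ c ∈ t', ∀ y, bary t' c (a + ε • (y - a)) =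
      bary t' c a + ε * (bary t' c y - bary t' c a) := by
    intro t' _ _ c _ y
    rw [affine_add, inner_smul_right, ← affine_sub_eq_inner]
  have h3 : ∀ᶠ y in 𝓝 x, ∀ t' ∈ 𝒯.elements, a ∈ t' → xε ∈ simplex t' → 0 < bary t' a y := by
    rw [eventually_all_finset]
    intro t' ht'
    by_cases h : a ∈ t' ∧ xε ∈ simplex t'
    · have h4 := (bary_inter ht ht' hxεt h.2 ha).1 h.1
      rw [hxε, hval t ht ha a ha, hval t' ht' h.1 a h.1, e.bary_self ha,
        (isElement ht').bary_self h.1] at h4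
      have h5 : 0 < bary t' a x := by
        have h6 := mul_left_cancel₀ hε.ne' (add_left_cancel h4)
        linarith
      filter_upwards [(affine_continuous (bary t' a)).continuousAt.eventually_const_lt h5]
        with y hy _ _ using hy
    · push Not at h
      exact .of_forall fun y h1 h2 => absurd h2 (h h1)
  filter_upwards [h1, h2, h3] with y hy1 hy2 hy3
  obtain ⟨t', ht', hyt', hat'⟩ := hy1
  have ha' : a ∈ t' := vertex_mem_of_mem_simplex ht' ht ha hat'
  have hxt' : xε ∈ simplex t' := by_contra fun h => hy2 t' ht' h hyt'
  refine mem_iUnion₂.2 ⟨t', mem_star.2 ⟨ht', ha'⟩, ?_⟩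
  refine (isElement ht').mem_simplex.2 fun c hc => ?_
  by_cases hca : c = a
  · rw [hca]; exact (hy3 t' ht' ha' hxt').le
  · have h4 := (isElement ht').mem_simplex.1 hyt' c hc
    rw [hval t' ht' ha' c hc, (isElement ht').bary_of_ne hc ha' hca] at h4
    have : 0 ≤ ε * bary t' c y := by linarith
    exact nonneg_of_mul_nonneg_right this hε

theorem mem_of_bary_pos (hΩ : IsLipschitzDomain Ω) (haΩ : a ∈ Ω) (ht : t ∈ 𝒯.elements)
    (ha : a ∈ t) (hx : x ∈ simplex t) (hpos : 0 < bary t a x) : x ∈ Ω := by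
  refine hΩ.interior_closure_subset
    (interior_mono ?_ (mem_interior_star hΩ.isOpen haΩ ht ha hx hpos))
  exact iUnion₂_subset fun t' ht' => simplex_subset_closure (mem_star.1 ht').1

/-- If a set `S` of elements with the vertex `z` has the property that all facets with the vertex
`z` of its members are shared with another member, then `S` covers a neighbourhood of `z`. The
reason is that the faces of codimension two do not disconnect the space. -/
theorem star_eq_of_closed [DecidableEq (Vec d)] (hd : 2 ≤ d) {S : Finset (Finset (Vec d))}
    (hS : S ⊆ 𝒯.star z) (hne : S.Nonempty)
    (hcl : ∀ t ∈ S, ∀ v ∈ t, v ≠ z → ∃ t' ∈ S, t' ≠ t ∧ t.erase v ⊆ t') :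
    (⋃ t ∈ S, simplex t) ∈ 𝓝 z ∧ S = 𝒯.star z := by
  have hel : ∀ t ∈ S, t ∈ 𝒯.elements := fun t ht => (mem_star.1 (hS ht)).1
  have hz : ∀ t ∈ S, z ∈ t := fun t ht => (mem_star.1 (hS ht)).2
  set C := ⋃ t ∈ S, simplex t with hC
  have hCcl : IsClosed C := S.finite_toSet.isClosed_biUnion fun t _ => isClosed_simplex t
  have hev : ∀ᶠ y in 𝓝 z, ∀ t ∈ 𝒯.star z, 0 < bary t z y := by
    rw [eventually_all_finset]
    intro t ht
    refine (affine_continuous _).continuousAt.eventually_const_lt ?_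
    rw [(isElement (mem_star.1 ht).1).bary_self (mem_star.1 ht).2]
    exact zero_lt_one
  obtain ⟨r, hr, hB⟩ := Metric.eventually_nhds_iff_ball.1 hev
  -- elements of the star have interior points close to `z`
  have hint : ∀ t ∈ 𝒯.star z, (interior (simplex t) ∩ ball z r).Nonempty := by
    intro t ht
    have h1 : z ∈ closure (interior (simplex t)) := by
      rw [(convex_simplex t).closure_interior_eq_closure_of_nonempty_interior
        ⟨_, (isElement (mem_star.1 ht).1).centroid_mem_interior⟩]
      exact subset_closure (vertex_mem_simplex (mem_star.1 ht).2)
    rw [inter_comm]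
    exact mem_closure_iff.1 h1 _ Metric.isOpen_ball (Metric.mem_ball_self hr)
  obtain ⟨t₀, ht₀⟩ := hne
  -- a generic starting point
  obtain ⟨x₀, hx₀, hx₀g⟩ : ∃ x₀ ∈ interior (simplex t₀) ∩ ball z r,
      ∀ t ∈ S, ∀ b ∈ t, bary t b x₀ ≠ 0 := by
    have hae : ∀ᵐ x : Vec d, ∀ t ∈ S, ∀ b ∈ t, bary t b x ≠ 0 := by
      rw [eventually_all_finset]; intro t ht
      rw [eventually_all_finset]; intro b hb
      exact ae_affine_ne_const ((isElement (hel t ht)).agrad_bary_ne_zero (by omega) hb) 0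
    exact (Measure.dense_of_ae hae).inter_open_nonempty _ (isOpen_interior.inter Metric.isOpen_ball)
      (hint t₀ (hS ht₀))
  -- generic end points
  have hae : ∀ᵐ y : Vec d, ∀ t ∈ S, ∀ b ∈ t, ∀ c ∈ t, b ≠ c →
      bary t b x₀ * bary t c y - bary t c x₀ * bary t b y ≠ 0 := by
    rw [eventually_all_finset]; intro t ht
    rw [eventually_all_finset]; intro b hb
    rw [eventually_all_finset]; intro c hc
    by_cases hbc : b = c
    · simp [hbc]
    have e := isElement (hel t ht)
    obtain ⟨v, hv, hvb, hvc⟩ := e.exists_ne₂ hd b c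
    have hne : agrad (bary t b x₀ • bary t c - bary t c x₀ • bary t b) ≠ 0 := by
      refine IsElement.agrad_ne_zero_of_linear (w := c - v) ?_
      rw [AffineMap.sub_linear, LinearMap.sub_apply, AffineMap.smul_linear, AffineMap.smul_linear,
        LinearMap.smul_apply, LinearMap.smul_apply, e.bary_linear_sub, e.bary_linear_sub,
        e.bary_self hc, e.bary_of_ne hc hv hvc.symm, e.bary_of_ne hb hc hbc,
        e.bary_of_ne hb hv hvb.symm]
      simpa using hx₀g t ht b hb
    filter_upwards [ae_affine_ne_const hne 0] with y hy _ using hy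
  have hseg : ∀ y ∈ ball z r, (∀ t ∈ S, ∀ b ∈ t, ∀ c ∈ t, b ≠ c →
      bary t b x₀ * bary t c y - bary t c x₀ * bary t b y ≠ 0) → y ∈ C := by
    intro y hy hyg
    let γ : ℝ → Vec d := fun τ => x₀ + τ • (y - x₀)
    have hγ : Continuous γ := by fun_prop
    have hγB : ∀ τ ∈ Icc (0 : ℝ) 1, γ τ ∈ ball z r := by
      intro τ hτ
      have := (convex_ball z r) hx₀.2 hy (show 0 ≤ 1 - τ by linarith [hτ.2]) hτ.1 (by ring)
      convert this using 1
      simp only [γ]; module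
    have hsub : Icc (0 : ℝ) 1 ⊆ γ ⁻¹' C := by
      refine IsClosed.Icc_subset_of_forall_mem_nhdsWithin
        ((hCcl.preimage hγ).inter isClosed_Icc) ?_ ?_
      · simp only [γ, mem_preimage, zero_smul, add_zero]
        exact mem_iUnion₂.2 ⟨t₀, ht₀, interior_subset hx₀.1⟩
      · rintro τ ⟨hτC, hτ⟩
        refine nhdsWithin_le_nhds (hγ.continuousAt.preimage_mem_nhds ?_)
        obtain ⟨t, ht, hxt⟩ := mem_iUnion₂.1 hτC
        have e := isElement (hel t ht)
        have hval : ∀ b ∈ t, bary t b (γ τ) = (1 - τ) * bary t b x₀ + τ * bary t b y := by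
          intro b hb
          simp only [γ]
          rw [affine_add, inner_smul_right, ← affine_sub_eq_inner]; ring
        have huniq : ∀ b ∈ t, ∀ c ∈ t, b ≠ c → bary t b (γ τ) = 0 → bary t c (γ τ) ≠ 0 := by
          intro b hb c hc hbc hb0 hc0
          rw [hval b hb] at hb0
          rw [hval c hc] at hc0
          have hτ0 : τ ≠ 0 := by
            rintro rfl
            simp only [sub_zero, one_mul, zero_mul, add_zero] at hb0
            exact hx₀g t ht b hb hb0
          refine hyg t ht b hb c hc hbc (mul_left_cancel₀ hτ0 ?_)
          rw [mul_zero]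
          linear_combination bary t b x₀ * hc0 - bary t c x₀ * hb0
        by_cases hex : ∃ b ∈ t, bary t b (γ τ) = 0
        · obtain ⟨b, hb, hb0⟩ := hex
          have hbz : b ≠ z := by
            rintro rfl
            have := hB _ (hγB τ ⟨hτ.1, hτ.2.le⟩) t (hS ht)
            rw [hb0] at this
            exact lt_irrefl _ this
          obtain ⟨t', ht', hne', hsub'⟩ := hcl t ht b hb hbz
          have e' := isElement (hel t' ht')
          obtain ⟨v', hv', -, he', -, κ, hκ, hbar⟩ :=
            exists_apex (by omega) (hel t ht) (hel t' ht') hne' hb hsub'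
          have hxt' : γ τ ∈ simplex t' := by
            have h1 : γ τ ∈ facet t b := ⟨hxt, hb0⟩
            rw [e.facet_eq_simplex_erase hb] at h1
            exact convexHull_mono (by exact_mod_cast hsub') h1
          have hpos : ∀ c ∈ t.erase b, 0 < bary t c (γ τ) ∧ 0 < bary t' c (γ τ) := by
            intro c hc
            have hct := mem_of_mem_erase hc
            have h1 := lt_of_le_of_ne (e.mem_simplex.1 hxt c hct)
              (huniq b hb c hct (Finset.ne_of_mem_erase hc).symm hb0).symm
            exact ⟨h1, (bary_inter (hel t ht) (hel t' ht') hxt hxt' hct).1 (hsub' hc) ▸ h1⟩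
          have hev : ∀ᶠ y in 𝓝 (γ τ), ∀ c ∈ t.erase b, 0 < bary t c y ∧ 0 < bary t' c y := by
            rw [eventually_all_finset]
            exact fun c hc =>
              ((affine_continuous _).continuousAt.eventually_const_lt (hpos c hc).1).and
              ((affine_continuous _).continuousAt.eventually_const_lt (hpos c hc).2)
          filter_upwards [hev] with y hy
          rcases le_total 0 (bary t b y) with h | h
          · refine mem_iUnion₂.2 ⟨t, ht, e.mem_simplex.2 fun c hc => ?_⟩
            by_cases hcb : c = b
            · rw [hcb]; exact h
            · exact (hy c (mem_erase.2 ⟨hcb, hc⟩)).1.le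
          · refine mem_iUnion₂.2 ⟨t', ht', e'.mem_simplex.2 fun c hc => ?_⟩
            by_cases hcv : c = v'
            · rw [hcv, hbar]
              simp only [AffineMap.coe_smul, Pi.smul_apply, smul_eq_mul]
              nlinarith
            · exact (hy c (he' ▸ mem_erase.2 ⟨hcv, hc⟩)).2.le
        · push Not at hex
          have hmem : γ τ ∈ interior (simplex t) := e.mem_interior_simplex.2 fun b hb =>
            lt_of_le_of_ne (e.mem_simplex.1 hxt b hb) (hex b hb).symm
          filter_upwards [mem_interior_iff_mem_nhds.1 hmem] with y hy
            using mem_iUnion₂.2 ⟨t, ht, hy⟩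
    have := hsub (right_mem_Icc.2 zero_le_one)
    simpa [γ] using this
  have hBC : ball z r ⊆ C := by
    have hdense := Measure.dense_of_ae hae
    refine (hdense.open_subset_closure_inter Metric.isOpen_ball).trans
      (closure_minimal ?_ hCcl)
    rintro y ⟨hy1, hy2⟩
    exact hseg y hy1 hy2
  refine ⟨mem_of_superset (Metric.ball_mem_nhds z hr) hBC, hS.antisymm fun t ht => ?_⟩
  obtain ⟨x, hx1, hx2⟩ := hint t ht
  obtain ⟨t', ht', hxt'⟩ := mem_iUnion₂.1 (hBC hx2)
  rw [eq_of_mem_interior (mem_star.1 ht).1 (hel t' ht') hx1 hxt']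
  exact ht'

end Triangulation

/-! ### The residual identity of the finite volume method -/

theorem restrict_biUnion_finset_ae {α ι : Type*} [MeasurableSpace α] {μ : Measure α}
    (S : Finset ι) {D : ι → Set α} (hD : ∀ i ∈ S, MeasurableSet (D i))
    (hdis : ∀ i ∈ S, ∀ j ∈ S, i ≠ j → μ (D i ∩ D j) = 0) :
    μ.restrict (⋃ i ∈ S, D i) = ∑ i ∈ S, μ.restrict (D i) := by
  have h : (⋃ i ∈ S, D i) = ⋃ i : {i // i ∈ S}, D i.1 := by ext; simp
  rw [h, Measure.restrict_iUnion_ae (ι := {i // i ∈ S}) (s := fun i => D i.1)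
    (fun i j hij => hdis i.1 i.2 j.1 j.2 fun h => hij (Subtype.ext h))
    (fun i => (hD i.1 i.2).nullMeasurableSet), Measure.sum_fintype]
  exact sum_coe_sort S fun i => μ.restrict (D i)

namespace Triangulation

theorem interior_simplex_subset (hΩ : IsLipschitzDomain Ω) (ht : t ∈ 𝒯.elements) :
    interior (simplex t) ⊆ Ω :=
  (interior_mono (simplex_subset_closure ht)).trans hΩ.interior_closure_subset

theorem ae_mem_interior_simplex : ∀ᵐ x ∂volume.restrict (simplex t), x ∈ interior (simplex t) :=
  ae_mem_interior_of_convex (convex_simplex t) (isClosed_simplex t).measurableSet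

theorem restrict_eq_sum (hΩ : IsLipschitzDomain Ω) :
    volume.restrict Ω = ∑ t ∈ 𝒯.elements, volume.restrict (simplex t) := by
  rw [← restrict_biUnion_finset_ae 𝒯.elements
    (fun t _ => (isClosed_simplex t).measurableSet)
    (fun t ht t' ht' h => volume_inter_eq_zero ht ht' h), ← closure_eq_iUnion]
  refine Measure.restrict_congr_set ?_
  refine (LE.le.eventuallyLE subset_closure).antisymm ?_
  have h1 : ∀ᵐ x : Vec d, ∀ t ∈ 𝒯.elements, x ∉ frontier (simplex t) := by
    rw [eventually_all_finset]
    exact fun t _ => measure_eq_zero_iff_ae_notMem.1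
      ((convex_simplex t).addHaar_frontier volume)
  filter_upwards [h1] with x hx (hxc : x ∈ closure Ω)
  obtain ⟨t, ht, hxt⟩ := exists_mem_simplex (𝒯 := 𝒯) hxc
  refine interior_simplex_subset hΩ ht ?_
  by_contra h
  exact hx t ht ⟨subset_closure hxt, h⟩

theorem restrict_simplex_le (hΩ : IsLipschitzDomain Ω) (ht : t ∈ 𝒯.elements) :
    volume.restrict (simplex t) ≤ volume.restrict Ω := by
  rw [restrict_eq_sum (𝒯 := 𝒯) hΩ]
  exact single_le_sum (f := fun t => volume.restrict (simplex t))
    (fun _ _ => Measure.zero_le _) ht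

theorem integral_eq_sum (hΩ : IsLipschitzDomain Ω) {g : Vec d → ℝ}
    (hg : Integrable g (volume.restrict Ω)) :
    ∫ x in Ω, g x = ∑ t ∈ 𝒯.elements, ∫ x in simplex t, g x := by
  rw [restrict_eq_sum (𝒯 := 𝒯) hΩ]
  exact integral_finsetSum_measure fun t ht => hg.mono_measure (restrict_simplex_le hΩ ht)

theorem lintegral_eq_sum (hΩ : IsLipschitzDomain Ω) (g : Vec d → ℝ≥0∞) :
    ∫⁻ x in Ω, g x = ∑ t ∈ 𝒯.elements, ∫⁻ x in simplex t, g x := by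
  rw [restrict_eq_sum (𝒯 := 𝒯) hΩ, lintegral_finsetSum_measure]

theorem integral_controlVolume {g : Vec d → ℝ}
    (hg : ∀ t ∈ 𝒯.star a, IntegrableOn g (simplex t)) :
    ∫ x in controlVolume 𝒯 a, g x = ∑ t ∈ 𝒯.star a, ∫ x in dualCell a t, g x := by
  have hs : ∀ t ∈ 𝒯.star a, dualCell a t ⊆ simplex t := fun t ht =>
    (isElement (mem_star.1 ht).1).dualCell_subset (mem_star.1 ht).2
  rw [controlVolume, restrict_biUnion_finset_ae (𝒯.star a)]
  · exact integral_finsetSum_measure fun t ht => (hg t ht).mono_set (hs t ht)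
  · exact fun t ht =>
      ((isElement (mem_star.1 ht).1).isClosed_dualCell (mem_star.1 ht).2).measurableSet
  · exact fun t ht t' ht' hne => measure_mono_null (inter_subset_inter (hs t ht) (hs t' ht'))
      (volume_inter_eq_zero (mem_star.1 ht).1 (mem_star.1 ht').1 hne)

end Triangulation

/-- A function in `H¹` that is affine on an open set has there the gradient of the affine
function. -/
theorem H1.ae_grad_eq_of_affine (v : H1 Ω) (hΩ : IsOpen Ω) {U : Set (Vec d)}
    (hU : IsOpen U) (hUΩ : U ⊆ Ω) {ℓ : Vec d →ᵃ[ℝ] ℝ} (hℓ : EqOn v.val ℓ U) :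
    ∀ᵐ x, x ∈ U → v.grad x = agrad ℓ := by
  have key : ∀ i : Fin d, ∀ᵐ x, x ∈ U → v.grad x i - agrad ℓ i = 0 := by
    intro i
    have hgi : LocallyIntegrableOn (fun x => v.grad x i) U := by
      have h1 : MemLp (fun x => v.grad x i) 2 (volume.restrict Ω) :=
        v.memLp_grad.eval_piLp i
      have h2 : LocallyIntegrable (fun x => v.grad x i) (volume.restrict Ω) :=
        h1.locallyIntegrable (by norm_num)
      exact (locallyIntegrableOn_of_locallyIntegrable_restrict h2).mono_set hUΩ
    refine hU.ae_eq_zero_of_integral_contDiff_smul_eq_zero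
      (hgi.sub ((locallyIntegrable_const _).locallyIntegrableOn _)) fun g hg hgc hgU => ?_
    have hw := v.weak i g ⟨hg, hgc, hgU.trans hUΩ⟩
    have hout : ∀ x, x ∉ tsupport g → g x = 0 ∧ fderiv ℝ g x = 0 := fun x hx =>
      ⟨image_eq_zero_of_notMem_tsupport hx, by
        have := notMem_subset (support_fderiv_subset ℝ) hx
        simpa using this⟩
    have e1 : ∫ x in Ω, v.val x * fderiv ℝ g x (unitVec i) =
        ∫ x, ℓ x * fderiv ℝ g x (unitVec i) := by
      rw [← setIntegral_eq_integral_of_forall_compl_eq_zero (s := Ω)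
        (f := fun x => ℓ x * fderiv ℝ g x (unitVec i))]
      · refine setIntegral_congr_fun hΩ.measurableSet fun x _ => ?_
        by_cases hxg : x ∈ tsupport g
        · simp only [hℓ (hgU hxg)]
        · simp [(hout x hxg).2]
      · intro x hx
        simp [(hout x fun h => hx (hUΩ (hgU h))).2]
    have e2 : ∫ x, ℓ x * fderiv ℝ g x (unitVec i) = -∫ x, fderiv ℝ ℓ x (unitVec i) * g x := by
      have hgd : ContDiff ℝ 1 g := hg.of_le (by exact_mod_cast le_top)
      have hc1 : Continuous fun x => fderiv ℝ g x (unitVec i) :=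
        (hgd.continuous_fderiv (by norm_num)).clm_apply continuous_const
      have hs1 : HasCompactSupport fun x => fderiv ℝ g x (unitVec i) :=
        (hgc.fderiv ℝ).comp_left (g := fun L : Vec d →L[ℝ] ℝ => L (unitVec i)) (by simp)
      refine integral_mul_fderiv_eq_neg_fderiv_mul_of_integrable ?_ ?_ ?_ ?_ ?_
      · simp only [fderiv_affine]
        exact (continuous_const.mul hg.continuous).integrable_of_hasCompactSupport hgc.mul_left
      · exact ((affine_continuous ℓ).mul hc1).integrable_of_hasCompactSupport hs1.mul_left
      · exact ((affine_continuous ℓ).mul hg.continuous).integrable_of_hasCompactSupport hgc.mul_left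
      · exact fun x _ => (hasFDerivAt_affine ℓ x).differentiableAt
      · exact fun x _ => (hgd.differentiable (by norm_num)).differentiableAt
    have e3 : ∫ x in Ω, v.grad x i * g x = ∫ x, v.grad x i * g x := by
      refine setIntegral_eq_integral_of_forall_compl_eq_zero fun x hx => ?_
      rw [(hout x fun h => hx (hUΩ (hgU h))).1, mul_zero]
    have hai : ∀ x, fderiv ℝ ℓ x (unitVec i) = agrad ℓ i := fun x => by
      rw [fderiv_affine, ← inner_agrad, real_inner_comm, unitVec_inner]
    have hint1 : Integrable fun x => v.grad x i * g x := by
      have h1 : IntegrableOn (fun x => v.grad x i * g x) Ω :=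
        MemLp.integrable_mul (p := 2) (q := 2) (v.memLp_grad.eval_piLp i)
          ((hg.continuous.memLp_of_hasCompactSupport hgc).restrict _)
      refine (integrableOn_iff_integrable_of_support_subset fun x hx => ?_).1 h1
      by_contra h
      exact hx (by simp [(hout x fun h' => h (hUΩ (hgU h'))).1])
    have hint2 : Integrable fun x => agrad ℓ i * g x :=
      (hg.continuous.integrable_of_hasCompactSupport hgc).const_mul _
    simp only [hai] at e2
    have e4 : ∫ x, (v.grad x i * g x - agrad ℓ i * g x) = 0 := by
      rw [integral_sub hint1 hint2, ← e3]
      rw [e1, e2] at hw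
      linarith
    rw [← e4]
    refine integral_congr_ae (.of_forall fun x => ?_)
    simp only [smul_eq_mul]
    ring
  filter_upwards [ae_all_iff.2 key] with x hx hxU
  ext i
  linarith [hx i hxU]

open Triangulation (isElement ae_mem_interior_simplex mem_star interior_simplex_subset
  vertex_mem_simplex)

theorem exists_lipschitzOnWith_smul {E F : Type*} [PseudoMetricSpace E] [NormedAddCommGroup F]
    [NormedSpace ℝ F] {S : Set E} {f : E → ℝ} {q : E → F} {K L : ℝ≥0}
    (hf : LipschitzOnWith K f S) (hq : LipschitzOnWith L q S) {C M : ℝ}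
    (hC : ∀ x ∈ S, |f x| ≤ C) (hM : ∀ x ∈ S, ‖q x‖ ≤ M) :
    ∃ K' : ℝ≥0, LipschitzOnWith K' (fun x => f x • q x) S := by
  refine ⟨(C * L + M * K).toNNReal, LipschitzOnWith.of_dist_le_mul fun x hx y hy => ?_⟩
  have h1 := hf.dist_le_mul x hx y hy
  have h2 := hq.dist_le_mul x hx y hy
  rw [Real.dist_eq] at h1
  rw [dist_eq_norm] at h2 ⊢
  have h3 : f x • q x - f y • q y = f x • (q x - q y) + (f x - f y) • q y := by module
  rw [h3]
  refine (norm_add_le _ _).trans ?_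
  rw [norm_smul, norm_smul, Real.norm_eq_abs, Real.norm_eq_abs]
  have hC0 : 0 ≤ C := (abs_nonneg _).trans (hC x hx)
  calc |f x| * ‖q x - q y‖ + |f x - f y| * ‖q y‖
      ≤ C * (L * dist x y) + (K * dist x y) * M :=
        add_le_add (mul_le_mul (hC x hx) h2 (norm_nonneg _) hC0)
          (mul_le_mul h1 (hM y hy) (norm_nonneg _) (by positivity))
    _ = (C * L + M * K) * dist x y := by ring
    _ ≤ _ := mul_le_mul_of_nonneg_right (Real.le_coe_toNNReal _) dist_nonneg

theorem agrad_neg (f : Vec d →ᵃ[ℝ] ℝ) : agrad (-f) = -agrad f := by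
  refine ext_inner_right ℝ fun v => ?_
  rw [inner_neg_left, inner_agrad, inner_agrad]; rfl

theorem divergence_smul {f : Vec d → ℝ} {q : Vec d → Vec d} {g : Vec d}
    (hf : HasGradientAt f g x) (hq : DifferentiableAt ℝ q x) :
    divergence (fun x => f x • q x) x = f x * divergence q x + inner ℝ g (q x) := by
  have h := hf.hasFDerivAt.smul hq.hasFDerivAt
  have h' : fderiv ℝ (fun x => f x • q x) x = _ := h.fderiv
  rw [divergence, h', divergence, inner_eq_sum, mul_sum, ← sum_add_distrib]
  refine sum_congr rfl fun i _ => ?_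
  have : inner ℝ g (unitVec i) = g i := by rw [real_inner_comm, unitVec_inner]
  simp [this]

/-- A field that is Lipschitz on a simplex is almost everywhere differentiable there. -/
theorem ae_differentiableAt_simplex {q : Vec d → Vec d} {K : ℝ≥0}
    (hq : LipschitzOnWith K q (simplex t)) :
    ∀ᵐ x ∂volume.restrict (simplex t), DifferentiableAt ℝ q x := by
  obtain ⟨q', hq', heq⟩ := hq.extend_finite_dimension
  have h1 := ae_restrict_of_ae (s := simplex t) (hq'.ae_differentiableAt (μ := volume))
  filter_upwards [h1, ae_mem_interior_simplex] with x hx hxi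
  refine hx.congr_of_eventuallyEq ?_
  filter_upwards [mem_interior_iff_mem_nhds.1 hxi] with y hy using heq hy

theorem exists_abs_divergence_le {q : Vec d → Vec d} {K : ℝ≥0}
    (hq : LipschitzOnWith K q (simplex t)) :
    ∃ C, ∀ᵐ x ∂volume.restrict (simplex t), |divergence q x| ≤ C := by
  obtain ⟨q', hq', heq⟩ := hq.extend_finite_dimension
  refine ⟨d * ((lipschitzExtensionConstant (Vec d) * K : ℝ≥0) : ℝ), ?_⟩
  filter_upwards [ae_mem_interior_simplex] with x hxi
  rw [divergence_congr_of_eqOn heq hxi]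
  exact abs_divergence_le hq' x

theorem integrableOn_of_ae_le {g : Vec d → ℝ} (hg : Measurable g) {C : ℝ}
    (h : ∀ᵐ x ∂volume.restrict (simplex t), |g x| ≤ C) : IntegrableOn g (simplex t) :=
  Measure.integrableOn_of_bounded (isCompact_simplex t).measure_lt_top.ne
    hg.aestronglyMeasurable h

namespace IsElement

theorem exists_small {g : Vec d → Vec d →ᵃ[ℝ] ℝ} {x₀ : Vec d}
    (h : ∀ c ∈ s, 0 < g c x₀) (v : Vec d) :
    ∃ ε : ℝ, ε ≠ 0 ∧ ∀ c ∈ s, 0 < g c (x₀ + ε • v) := by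
  have h1 : ∀ᶠ y in 𝓝 x₀, ∀ c ∈ s, 0 < g c y := by
    rw [eventually_all_finset]
    exact fun c hc => (affine_continuous _).continuousAt.eventually_const_lt (h c hc)
  obtain ⟨ε, hε, -, h2⟩ := exists_small_of_eventually h1 v
  exact ⟨ε, hε.ne', h2⟩

/-- The normal of the interface between the control volumes of `a` and `b`. -/
theorem unitNormal_dualFace (ht : IsElement t) (ha : a ∈ t) (hb : b ∈ t) (hab : a ≠ b) :
    unitNormal (dualFace a b t) (b - a) =
      -(‖agrad (bary t a - bary t b)‖⁻¹ • agrad (bary t a - bary t b)) := by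
  classical
  have hlin : 0 < (bary t b - bary t a).linear (b - a) := by
    rw [AffineMap.sub_linear, LinearMap.sub_apply, ht.bary_linear_sub, ht.bary_linear_sub,
      ht.bary_self ha, ht.bary_self hb, ht.bary_of_ne ha hb hab, ht.bary_of_ne hb ha hab.symm]
    norm_num
  -- a point of the interface at which no other barycentric coordinate is extremal
  set x₀ : Vec d := t.centroid ℝ id + (1 / 2 : ℝ) • (({a, b} : Finset (Vec d)).centroid ℝ id
    - t.centroid ℝ id) with hx₀
  have hsub : ({a, b} : Finset (Vec d)) ⊆ t := by
    intro c hc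
    rcases Finset.mem_insert.1 hc with h | h
    · exact h ▸ ha
    · exact Finset.mem_singleton.1 h ▸ hb
  have hcp : (0 : ℝ) < (t.card : ℝ)⁻¹ := inv_pos.2 (by exact_mod_cast ht.nonempty.card_pos)
  have hval : ∀ c ∈ t, bary t c x₀ = (t.card : ℝ)⁻¹ / 2 +
      (1 / 2) * (if c ∈ ({a, b} : Finset (Vec d)) then (2 : ℝ)⁻¹ else 0) := by
    intro c hc
    rw [hx₀, affine_add, inner_smul_right, ← affine_sub_eq_inner,
      ht.bary_centroid Finset.Subset.rfl ht.nonempty hc, if_pos hc,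
      ht.bary_centroid hsub ⟨a, Finset.mem_insert_self _ _⟩ hc, Finset.card_pair hab]
    push_cast
    ring
  have hva : bary t a x₀ = (t.card : ℝ)⁻¹ / 2 + 1 / 4 := by
    rw [hval a ha, if_pos (Finset.mem_insert_self _ _)]; norm_num
  have hvb : bary t b x₀ = (t.card : ℝ)⁻¹ / 2 + 1 / 4 := by
    rw [hval b hb, if_pos (Finset.mem_insert_of_mem (Finset.mem_singleton_self _))]; norm_num
  have hvc : ∀ c ∈ (t.erase a).erase b, bary t c x₀ = (t.card : ℝ)⁻¹ / 2 := by
    intro c hc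
    have h1 := mem_erase.1 hc
    have h2 := mem_erase.1 h1.2
    have h3 : c ∉ ({a, b} : Finset (Vec d)) := by
      rw [Finset.mem_insert, Finset.mem_singleton]
      exact fun h => h.elim h2.1 h1.1
    rw [hval c h2.2, if_neg h3]; ring
  have hmem : ∀ x : Vec d, bary t a x = bary t b x → (∀ c ∈ (t.erase a).erase b,
      0 < bary t c x ∧ bary t c x < bary t a x) → 0 < bary t a x → x ∈ dualFace a b t := by
    intro x hxab hx hpos
    have hcase : ∀ c ∈ t, c = a ∨ c = b ∨ c ∈ (t.erase a).erase b := by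
      intro c hc
      by_cases h1 : c = a
      · exact Or.inl h1
      by_cases h2 : c = b
      · exact Or.inr (Or.inl h2)
      exact Or.inr (Or.inr (mem_erase.2 ⟨h2, mem_erase.2 ⟨h1, hc⟩⟩))
    refine (ht.mem_dualFace ha hb).2 ⟨(ht.mem_dualCell ha).2 ⟨ht.mem_simplex.2 fun c hc => ?_,
      fun c hc => ?_⟩, hxab⟩
    · rcases hcase c hc with rfl | rfl | h
      · exact hpos.le
      · exact hxab ▸ hpos.le
      · exact (hx c h).1.le
    · rcases hcase c hc with rfl | rfl | h
      · exact le_rfl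
      · exact hxab.ge
      · exact (hx c h).2.le
  have hflip : bary t a - bary t b = -(bary t b - bary t a) := (neg_sub _ _).symm
  rw [hflip, agrad_neg, norm_neg, smul_neg, neg_neg]
  refine unitNormal_eq (x₀ := x₀) (agrad_ne_zero_of_linear hlin.ne') (fun x hx => ?_) ?_ ?_ hlin
  · have := ((ht.mem_dualFace ha hb).1 hx).2
    simp [this]
  · refine hmem _ (hva.trans hvb.symm) (fun c hc => ?_) (by rw [hva]; linarith)
    rw [hvc c hc, hva]
    exact ⟨by linarith, by linarith⟩
  · intro w hw
    have h1 : ∀ᶠ y in 𝓝 x₀, (∀ c ∈ (t.erase a).erase b, 0 < bary t c y ∧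
        bary t c y < bary t a y) ∧ 0 < bary t a y := by
      refine Filter.Eventually.and ?_
        ((affine_continuous _).continuousAt.eventually_const_lt (by rw [hva]; linarith))
      rw [eventually_all_finset]
      exact fun c hc => ((affine_continuous _).continuousAt.eventually_const_lt
        (by rw [hvc c hc]; linarith)).and ((affine_continuous _).continuousAt.eventually_lt
          (affine_continuous _).continuousAt (by rw [hvc c hc, hva]; linarith))
    obtain ⟨ε, hε, -, h2⟩ := exists_small_of_eventually h1 w
    refine ⟨ε, hε.ne', hmem _ ?_ h2.1 h2.2⟩
    rw [AffineMap.sub_linear, LinearMap.sub_apply, sub_eq_zero] at hw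
    rw [affine_add (bary t a) x₀, affine_add (bary t b) x₀, hva, hvb, inner_agrad, inner_agrad,
      map_smul, map_smul, hw]

/-- The normal of a facet that points away from the opposite vertex. -/
theorem unitNormal_facet (hd : 1 ≤ d) (ht : IsElement t) (hv : v ∈ t) {w : Vec d}
    (hw : (bary t v).linear w < 0) :
    unitNormal (facet t v) w = -(‖agrad (bary t v)‖⁻¹ • agrad (bary t v)) := by
  classical
  have hcard : (t.erase v).card = d := by rw [card_erase_of_mem hv, ht.card]; rfl
  have hFne : (t.erase v).Nonempty := by rw [← Finset.card_pos, hcard]; omega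
  have hc0 : bary t v ((t.erase v).centroid ℝ id) = 0 := by
    rw [ht.bary_centroid (erase_subset _ _) hFne hv, if_neg (Finset.notMem_erase v t)]
  have hcp : ∀ b ∈ t.erase v, 0 < bary t b ((t.erase v).centroid ℝ id) := fun b hb => by
    rw [ht.bary_centroid (erase_subset _ _) hFne (mem_of_mem_erase hb), if_pos hb]
    exact inv_pos.2 (by exact_mod_cast hFne.card_pos)
  have hmem : ∀ x, bary t v x = 0 → (∀ b ∈ t.erase v, 0 < bary t b x) → x ∈ facet t v := by
    intro x hx hpos
    refine ⟨ht.mem_simplex.2 fun b hb => ?_, hx⟩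
    by_cases hbv : b = v
    · rw [hbv, hx]
    · exact (hpos b (mem_erase.2 ⟨hbv, hb⟩)).le
  have hneg : -(‖agrad (bary t v)‖⁻¹ • agrad (bary t v)) =
      ‖agrad (-bary t v)‖⁻¹ • agrad (-bary t v) := by
    rw [agrad_neg, norm_neg, smul_neg]
  rw [hneg]
  refine unitNormal_eq (x₀ := (t.erase v).centroid ℝ id) ?_ ?_ (hmem _ hc0 hcp) ?_ ?_
  · rw [agrad_neg]; exact neg_ne_zero.2 (ht.agrad_bary_ne_zero hd hv)
  · intro x hx
    have : bary t v x = 0 := hx.2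
    simp [this]
  · intro u hu
    obtain ⟨ε, hε, h1⟩ := exists_small (g := fun c => bary t c) hcp u
    refine ⟨ε, hε, hmem _ ?_ h1⟩
    have hu' : (bary t v).linear u = 0 := by
      have : -(bary t v).linear u = 0 := hu
      linarith
    rw [affine_add, hc0, inner_agrad, map_smul, hu', smul_zero, add_zero]
  · have : (-bary t v).linear w = -(bary t v).linear w := rfl
    rw [this]; linarith

theorem dualCell_eq_maxRegion_erase [DecidableEq (Vec d)] (ht : IsElement t) (ha : a ∈ t) :
    dualCell a t = maxRegion t (t.erase a) a := by
  rw [ht.dualCell_eq_maxRegion ha]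
  ext x
  constructor
  · exact fun h => ⟨h.1, fun b hb => h.2 b (mem_of_mem_erase hb)⟩
  · refine fun h => ⟨h.1, fun b hb => ?_⟩
    by_cases hba : b = a
    · rw [hba]
    · exact h.2 b (mem_erase.2 ⟨hba, hb⟩)

/-- The divergence theorem on the part of a control volume in an element. -/
theorem sum_integral_dualFace [DecidableEq (Vec d)] (hd : 2 ≤ d) (ht : IsElement t) (ha : a ∈ t)
    {q : Vec d → Vec d} {K : ℝ≥0} (hq : LipschitzOnWith K q (simplex t)) :
    ∑ b ∈ t.erase a, ∫ x in dualFace a b t,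
        inner ℝ (q x) (unitNormal (dualFace a b t) (b - a)) ∂μHE[d - 1] =
      (∫ x in dualCell a t, divergence q x) +
        ∑ c ∈ t, ‖agrad (bary t c)‖⁻¹ * ∫ x in dualCell a t ∩ facet t c,
          inner ℝ (agrad (bary t c)) (q x) ∂μHE[d - 1] := by
  have hsub : maxRegion t (t.erase a) a ⊆ simplex t := fun x hx => hx.1
  have h := integral_divergence_maxRegion hd ht (erase_subset a t) ha
    (Finset.notMem_erase a t) (hq.mono hsub)
  rw [ht.dualCell_eq_maxRegion_erase ha, h]
  have h1 : ∀ c ∈ t, maxRegion t (t.erase a) a ∩ {x | bary t c x = 0} =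
      maxRegion t (t.erase a) a ∩ facet t c := by
    intro c _
    ext x
    exact ⟨fun hx => ⟨hx.1, hx.1.1, hx.2⟩, fun hx => ⟨hx.1, hx.2.2⟩⟩
  have h2 : ∀ b ∈ t.erase a, ∫ x in dualFace a b t,
        inner ℝ (q x) (unitNormal (dualFace a b t) (b - a)) ∂μHE[d - 1] =
      -(‖agrad (bary t a - bary t b)‖⁻¹ *
        ∫ x in maxRegion t (t.erase a) a ∩ {x | (bary t a - bary t b) x = 0},
          inner ℝ (agrad (bary t a - bary t b)) (q x) ∂μHE[d - 1]) := by
    intro b hb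
    have hbt := mem_of_mem_erase hb
    have hset : maxRegion t (t.erase a) a ∩ {x | (bary t a - bary t b) x = 0} =
        dualFace a b t := by
      ext x
      rw [ht.mem_dualFace ha hbt, ht.dualCell_eq_maxRegion_erase ha]
      refine and_congr Iff.rfl ?_
      change bary t a x - bary t b x = 0 ↔ _
      rw [sub_eq_zero]
    rw [hset, ht.unitNormal_dualFace ha hbt (Finset.ne_of_mem_erase hb).symm, ← integral_const_mul,
      ← integral_neg]
    refine integral_congr_ae (.of_forall fun x => ?_)
    simp only [inner_neg_right, inner_smul_right]
    rw [real_inner_comm]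
  have h3 := sum_congr rfl fun c hc =>
    congrArg (fun S => ‖agrad (bary t c)‖⁻¹ *
      ∫ x in S, inner ℝ (agrad (bary t c)) (q x) ∂μHE[d - 1]) (h1 c hc)
  rw [sum_congr rfl h2, sum_neg_distrib, ← h3]
  ring

theorem integral_mul_chi {S : Set (Vec d)} {g : Vec d → ℝ} {μ : Measure (Vec d)}
    (hm : MeasurableSet (dualCell a t)) (hg : IntegrableOn g S μ)
    (hb : IntegrableOn (fun x => g x * bary t a x) S μ) :
    ∫ x in S, g x * chi t a x ∂μ =
      (∫ x in S, g x * bary t a x ∂μ) - ∫ x in dualCell a t ∩ S, g x ∂μ := by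
  rw [inter_comm, ← setIntegral_indicator hm, ← integral_sub hb (hg.indicator hm)]
  refine integral_congr_ae (.of_forall fun x => ?_)
  by_cases hx : x ∈ dualCell a t
  · simp [chi, hx, mul_sub]
  · simp [chi, hx]

/-- The residual identity on an element: the fluxes through the interfaces between the control
volumes are traded for integrals against the oscillating function `chi`. -/
theorem integral_inner_add_sum_dualFace [DecidableEq (Vec d)] (hd : 2 ≤ d) (ht : IsElement t)
    (ha : a ∈ t) {q : Vec d → Vec d} {K : ℝ≥0} (hq : LipschitzOnWith K q (simplex t)) :
    (∫ x in simplex t, inner ℝ (agrad (bary t a)) (q x)) +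
      ∑ b ∈ t.erase a, ∫ x in dualFace a b t,
        inner ℝ (q x) (unitNormal (dualFace a b t) (b - a)) ∂μHE[d - 1] =
      -(∫ x in simplex t, divergence q x * chi t a x) -
        ∑ c ∈ t, ‖agrad (bary t c)‖⁻¹ * ∫ x in facet t c,
          inner ℝ (agrad (bary t c)) (q x) * chi t a x ∂μHE[d - 1] := by
  obtain ⟨M, hM⟩ := (isCompact_simplex t).exists_bound_of_continuousOn hq.continuousOn
  have hL1 : ∀ x ∈ simplex t, |bary t a x| ≤ 1 := fun x hx =>
    abs_le.2 ⟨by linarith [ht.mem_simplex.1 hx a ha], ht.bary_le_one hx ha⟩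
  obtain ⟨K', hK'⟩ := exists_lipschitzOnWith_smul ((affine_lipschitz (bary t a)).lipschitzOnWith)
    hq hL1 hM
  have h1 := integral_divergence_simplex hd ht hK'
  have hm := measurable_divergence q
  obtain ⟨C, hC⟩ := exists_abs_divergence_le hq
  have hdivi : IntegrableOn (divergence q) (simplex t) := integrableOn_of_ae_le hm hC
  have hqi : IntegrableOn (fun x => inner ℝ (agrad (bary t a)) (q x)) (simplex t) :=
    integrableOn_simplex (continuousOn_const.inner hq.continuousOn)
  have hbdi : IntegrableOn (fun x => bary t a x * divergence q x) (simplex t) := by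
    refine integrableOn_of_ae_le ((affine_continuous _).measurable.mul hm) (C := C) ?_
    filter_upwards [hC, ae_restrict_mem (isClosed_simplex t).measurableSet] with x hx hxt
    rw [abs_mul]
    calc |bary t a x| * |divergence q x| ≤ 1 * |divergence q x| :=
          mul_le_mul_of_nonneg_right (hL1 x hxt) (abs_nonneg _)
      _ ≤ C := by rw [one_mul]; exact hx
  have h2 : ∫ x in simplex t, divergence (fun x => bary t a x • q x) x =
      (∫ x in simplex t, bary t a x * divergence q x) +
        ∫ x in simplex t, inner ℝ (agrad (bary t a)) (q x) := by
    rw [← integral_add hbdi hqi]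
    refine integral_congr_ae ?_
    filter_upwards [ae_differentiableAt_simplex hq] with x hx
    exact divergence_smul (hasGradientAt_affine _ x) hx
  have hcell := ht.isClosed_dualCell ha
  have h3 := integral_mul_chi hcell.measurableSet hdivi (by simpa only [mul_comm] using hbdi)
  simp_rw [mul_comm _ (bary t a _), inter_eq_self_of_subset_left (ht.dualCell_subset ha)] at h3
  have h4 : ∀ c ∈ t, ∫ x in facet t c, inner ℝ (agrad (bary t c)) (q x) * chi t a x ∂μHE[d - 1] =
      (∫ x in facet t c, inner ℝ (agrad (bary t c)) (bary t a x • q x) ∂μHE[d - 1]) -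
        ∫ x in dualCell a t ∩ facet t c, inner ℝ (agrad (bary t c)) (q x) ∂μHE[d - 1] := by
    intro c hc
    have hqc : ContinuousOn q (facet t c) := hq.continuousOn.mono fun x hx => hx.1
    have i2 := integrableOn_facet hd ht hc (g := fun x => inner ℝ (agrad (bary t c)) (q x))
      (continuousOn_const.inner hqc)
    rw [integral_mul_chi hcell.measurableSet i2 (integrableOn_facet hd ht hc
      ((continuousOn_const.inner hqc).mul (affine_continuous _).continuousOn))]
    simp only [inner_smul_right, mul_comm (bary t a _)]
  have h5 : ∑ c ∈ t, ‖agrad (bary t c)‖⁻¹ * ∫ x in facet t c,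
      inner ℝ (agrad (bary t c)) (q x) * chi t a x ∂μHE[d - 1] =
      (∑ c ∈ t, ‖agrad (bary t c)‖⁻¹ * ∫ x in simplex t ∩ {x | bary t c x = 0},
        inner ℝ (agrad (bary t c)) (bary t a x • q x) ∂μHE[d - 1]) -
      ∑ c ∈ t, ‖agrad (bary t c)‖⁻¹ * ∫ x in dualCell a t ∩ facet t c,
          inner ℝ (agrad (bary t c)) (q x) ∂μHE[d - 1] := by
    rw [← sum_sub_distrib]
    refine sum_congr rfl fun c hc => ?_
    rw [h4 c hc, mul_sub]; rfl
  rw [ht.sum_integral_dualFace hd ha hq, h5, h3]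
  rw [h2] at h1
  linarith

end IsElement

namespace Triangulation

theorem integral_eq_sum_of_integrableOn (hΩ : IsLipschitzDomain Ω) {g : Vec d → ℝ}
    (hg : ∀ t ∈ 𝒯.elements, IntegrableOn g (simplex t)) :
    ∫ x in Ω, g x = ∑ t ∈ 𝒯.elements, ∫ x in simplex t, g x := by
  rw [restrict_eq_sum (𝒯 := 𝒯) hΩ]
  exact integral_finsetSum_measure hg

/-- Sums over the interior nodes and the elements around them, for summands that vanish at the
other nodes. -/
theorem sum_interiorNodes_star {θ : Vec d → ℝ} (hθ : ∀ a, a ∉ Ω → θ a = 0)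
    (F : Vec d → Finset (Vec d) → ℝ) :
    ∑ a ∈ 𝒯.interiorNodes, θ a * ∑ t ∈ 𝒯.star a, F a t =
      ∑ t ∈ 𝒯.elements, ∑ a ∈ t, θ a * F a t := by
  classical
  simp_rw [mul_sum]
  rw [Finset.sum_comm' (t' := 𝒯.elements) (s' := fun t => t.filter (· ∈ Ω))]
  · refine sum_congr rfl fun t _ => ?_
    rw [Finset.sum_filter]
    refine sum_congr rfl fun a _ => ?_
    by_cases ha : a ∈ Ω
    · rw [if_pos ha]
    · rw [if_neg ha, hθ a ha, zero_mul]
  · intro a t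
    rw [mem_star, Finset.mem_filter, interiorNodes, Finset.mem_filter, Finset.mem_biUnion]
    constructor
    · rintro ⟨⟨-, h1⟩, h2, h3⟩
      exact ⟨⟨h3, h1⟩, h2⟩
    · rintro ⟨⟨h3, h1⟩, h2⟩
      exact ⟨⟨⟨t, h2, h3⟩, h1⟩, h2, h3⟩

end Triangulation

theorem gradient_eq_of_eqOn_affine {v : Vec d → ℝ} {S : Set (Vec d)} {ℓ : Vec d →ᵃ[ℝ] ℝ}
    (h : EqOn v ℓ S) (hx : x ∈ interior S) : gradient v x = agrad ℓ := by
  refine HasGradientAt.gradient ((hasGradientAt_affine ℓ x).congr_of_eventuallyEq ?_)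
  filter_upwards [mem_interior_iff_mem_nhds.1 hx] with y hy using h hy

/-- Lipschitz continuous extensions from the elements of the diffusive flux of a piecewise affine
function, and of the convection field. -/
theorem exists_flux_extension
    (hκ : κ.Admissible 𝒯) {u : H1 Ω} (hu : InS10 𝒯 u) :
    ∃ (p : Finset (Vec d) → Vec d → Vec d) (β : Vec d → Vec d),
      (∀ t ∈ 𝒯.elements, ∃ K, LipschitzWith K (p t)) ∧ (∃ K, LipschitzWith K β) ∧ EqOn κ.b β Ω ∧
      ∀ t ∈ 𝒯.elements, ∀ x ∈ interior (simplex t), κ.A x (gradient u.val x) = p t x := by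
  obtain ⟨Kb, hKb⟩ := hκ.b_lipschitz
  obtain ⟨β, hβ, hβe⟩ := hKb.extend_finite_dimension
  have key : ∀ t ∈ 𝒯.elements, ∃ p : Vec d → Vec d, (∃ K, LipschitzWith K p) ∧
      ∀ x ∈ interior (simplex t), κ.A x (gradient u.val x) = p x := by
    intro t ht
    obtain ⟨ℓ, hℓ⟩ := hu.2.2 t ht
    obtain ⟨K, hK⟩ := hκ.A_lipschitz t ht
    have h1 : LipschitzOnWith (K * ‖agrad ℓ‖₊) (fun x => κ.A x (agrad ℓ))
        (interior (simplex t)) := by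
      refine LipschitzOnWith.of_dist_le_mul fun x hx y hy => ?_
      rw [dist_eq_norm, ← sub_apply]
      refine ((κ.A x - κ.A y).le_opNorm _).trans ?_
      have h2 := hK.dist_le_mul x hx y hy
      rw [dist_eq_norm] at h2
      calc ‖κ.A x - κ.A y‖ * ‖agrad ℓ‖ ≤ (K * dist x y) * ‖agrad ℓ‖ :=
            mul_le_mul_of_nonneg_right h2 (norm_nonneg _)
        _ = _ := by push_cast; ring
    obtain ⟨p, hp, hpe⟩ := h1.extend_finite_dimension
    refine ⟨p, ⟨_, hp⟩, fun x hx => ?_⟩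
    rw [gradient_eq_of_eqOn_affine hℓ hx]
    exact hpe hx
  choose! p hp using key
  exact ⟨p, β, fun t ht => (hp t ht).1, ⟨_, hβ⟩, hβe, fun t ht => (hp t ht).2⟩

theorem lipschitzOnWith_flux {u : H1 Ω} (hu : InS10 𝒯 u) (ht : t ∈ 𝒯.elements) {p β : Vec d → Vec d}
    (hp : ∃ K, LipschitzWith K p) (hβ : ∃ K, LipschitzWith K β) :
    ∃ K, LipschitzOnWith K (fun x => -p x + u.val x • β x) (simplex t) := by
  obtain ⟨K, hK⟩ := hp
  obtain ⟨L, hL⟩ := hβ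
  obtain ⟨ℓ, hℓ⟩ := hu.2.2 t ht
  have hc := isCompact_simplex t
  obtain ⟨C, hC⟩ := hc.exists_bound_of_continuousOn (affine_continuous ℓ).continuousOn
  obtain ⟨M, hM⟩ := hc.exists_bound_of_continuousOn hL.continuous.continuousOn
  obtain ⟨K', hK'⟩ := exists_lipschitzOnWith_smul (affine_lipschitz ℓ).lipschitzOnWith
    hL.lipschitzOnWith hC hM
  refine ⟨K + K', ?_⟩
  have h1 : LipschitzOnWith (K + K') (fun x => -p x + ℓ x • β x) (simplex t) := by
    refine LipschitzOnWith.of_dist_le_mul fun x hx y hy => ?_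
    have h2 := hK.dist_le_mul x y
    have h3 := hK'.dist_le_mul x hx y hy
    calc dist (-p x + ℓ x • β x) (-p y + ℓ y • β y)
        ≤ dist (-p x) (-p y) + dist (ℓ x • β x) (ℓ y • β y) := dist_add_add_le _ _ _ _
      _ ≤ K * dist x y + K' * dist x y := by rw [dist_neg_neg]; exact add_le_add h2 h3
      _ = _ := by push_cast; ring
  intro x hx y hy
  simp only [hℓ hx, hℓ hy]
  exact h1 hx hy

theorem IsElement.dualFace_subset_ae (hd : 2 ≤ d) (ht : IsElement t) (ha : a ∈ t) (hb : b ∈ t)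
    (hab : a ≠ b) :
    ∀ᵐ x ∂(μHE[d - 1] : Measure (Vec d)).restrict (dualFace a b t), x ∈ interior (simplex t) := by
  have hs : ({b} : Finset (Vec d)) ⊆ t := Finset.singleton_subset_iff.2 hb
  have has : a ∉ ({b} : Finset (Vec d)) := by rwa [Finset.mem_singleton]
  have hne := regionFun_agrad_ne hd ht hs ha has (Sum.inr ⟨b, Finset.mem_singleton_self b⟩)
  have hsub : dualFace a b t ⊆ {x | (bary t a - bary t b) x = 0} := fun x hx => by
    have := ((ht.mem_dualFace ha hb).1 hx).2
    simp [this]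
  have h1 : ∀ᵐ x ∂(μHE[d - 1] : Measure (Vec d)).restrict (dualFace a b t),
      ∀ c ∈ t, bary t c x ≠ 0 := by
    rw [eventually_all_finset]
    intro c hc
    refine ae_restrict_of_ae_restrict_of_subset hsub ?_
    exact ae_hyperplane_ne hne (regionFun_indep hd ht hs ha has
      (Sum.inr ⟨b, Finset.mem_singleton_self b⟩) (Sum.inl ⟨c, hc⟩) (by simp))
  have hm : MeasurableSet (dualFace a b t) := by
    have : dualFace a b t = dualCell a t ∩ {x | bary t a x = bary t b x} := by
      ext x; exact ht.mem_dualFace ha hb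
    rw [this]
    exact ((ht.isClosed_dualCell ha).inter
      (isClosed_eq (affine_continuous _) (affine_continuous _))).measurableSet
  filter_upwards [h1, ae_restrict_mem hm] with x hx hxF
  refine ht.mem_interior_simplex.2 fun c hc => lt_of_le_of_ne ?_ (hx c hc).symm
  exact ht.mem_simplex.1 (((ht.mem_dualCell ha).1 ((ht.mem_dualFace ha hb).1 hxF).1).1) c hc

theorem memLp_top_mul {α : Type*} [MeasurableSpace α] {μ : Measure α} {g v : α → ℝ}
    (hg : MemLp g ⊤ μ) (hv : MemLp v 2 μ) : MemLp (fun x => g x * v x) 2 μ := by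
  exact hv.mul hg (r := 2)

theorem memLp_source
    (hκ : κ.Admissible 𝒯) {f : Vec d → ℝ} (hf : MemLp f 2 (volume.restrict Ω)) (u : H1 Ω) :
    MemLp (fun x => f x - κ.c x * u.val x) 2 (volume.restrict Ω) :=
  hf.sub (memLp_top_mul hκ.c_memLp u.memLp_val)

theorem memLp_simplex (hΩ : IsLipschitzDomain Ω) (ht : t ∈ 𝒯.elements) {g : Vec d → ℝ}
    (hg : MemLp g 2 (volume.restrict Ω)) : MemLp g 2 (volume.restrict (simplex t)) :=
  hg.mono_measure (Triangulation.restrict_simplex_le hΩ ht)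

theorem integrableOn_of_memLp {g : Vec d → ℝ}
    (hg : MemLp g 2 (volume.restrict (simplex t))) : IntegrableOn g (simplex t) := by
  exact hg.integrable (by norm_num)

theorem integrableOn_mul_of_bounded {g h : Vec d → ℝ} {μ : Measure (Vec d)}
    {S : Set (Vec d)}
    (hg : IntegrableOn g S μ) (hh : Measurable h) {C : ℝ}
    (hC : ∀ᵐ x ∂μ.restrict S, |h x| ≤ C) : IntegrableOn (fun x => g x * h x) S μ :=
  Integrable.mul_bdd (c := C) hg hh.aestronglyMeasurable hC

theorem integral_mul_sum {S : Set (Vec d)} {μ : Measure (Vec d)} {g : Vec d → ℝ}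
    {h : Vec d → Vec d → ℝ} (hi : ∀ a ∈ t, IntegrableOn (fun x => g x * h a x) S μ)
    (θ : Vec d → ℝ) :
    ∫ x in S, g x * ∑ a ∈ t, θ a * h a x ∂μ = ∑ a ∈ t, θ a * ∫ x in S, g x * h a x ∂μ := by
  simp_rw [mul_sum, ← integral_const_mul, mul_left_comm (g _)]
  exact integral_finsetSum _ fun a ha => (hi a ha).const_mul _

open Classical in
/-- The residual of the finite volume solution, tested with a piecewise affine function with the
nodal values `θ`, only sees the oscillating functions `∑ a, θ a * chi t a`. -/
theorem residual_identity (hd : 2 ≤ d) (hΩ : IsLipschitzDomain Ω) (hκ : κ.Admissible 𝒯)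
    {f : Vec d → ℝ} (hf : MemLp f 2 (volume.restrict Ω)) {u : H1 Ω} (hu : κ.IsFVMSolution 𝒯 f u)
    {p : Finset (Vec d) → Vec d → Vec d} {β : Vec d → Vec d}
    (hp : ∀ t ∈ 𝒯.elements, ∃ K, LipschitzWith K (p t)) (hβ : ∃ K, LipschitzWith K β)
    (hβe : EqOn κ.b β Ω)
    (hpe : ∀ t ∈ 𝒯.elements, ∀ x ∈ interior (simplex t), κ.A x (gradient u.val x) = p t x)
    {w : H1 Ω} {θ : Vec d → ℝ} (hθ : ∀ a, a ∉ Ω → θ a = 0)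
    (hval : ∀ t ∈ 𝒯.elements, ∀ᵐ x ∂volume.restrict (simplex t),
      w.val x = ∑ a ∈ t, θ a * bary t a x)
    (hgrad : ∀ t ∈ 𝒯.elements, ∀ᵐ x ∂volume.restrict (simplex t),
      w.grad x = ∑ a ∈ t, θ a • agrad (bary t a)) :
    (∫ x in Ω, f x * w.val x) - κ.form u w =
      ∑ t ∈ 𝒯.elements,
        ((∫ x in simplex t, κ.residual f u.val x * ∑ a ∈ t, θ a * chi t a x) -
          ∑ c ∈ t, ‖agrad (bary t c)‖⁻¹ * ∫ x in facet t c,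
            inner ℝ (agrad (bary t c)) (-p t x + u.val x • β x) *
              (∑ a ∈ t, θ a * chi t a x) ∂μHE[d - 1]) := by
  set q : Finset (Vec d) → Vec d → Vec d := fun t x => -p t x + u.val x • β x with hq
  set g : Vec d → ℝ := fun x => f x - κ.c x * u.val x with hg
  have hqL : ∀ t ∈ 𝒯.elements, ∃ K, LipschitzOnWith K (q t) (simplex t) := fun t ht =>
    lipschitzOnWith_flux hu.1 ht (hp t ht) hβ
  have hqe : ∀ t ∈ 𝒯.elements, ∀ x ∈ interior (simplex t), κ.flux u.val x = q t x := by
    intro t ht x hx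
    simp only [Coefficients.flux, hq, hpe t ht x hx,
      hβe (interior_simplex_subset hΩ ht hx)]
  have hgL := memLp_source hκ hf u
  have hgi : ∀ t ∈ 𝒯.elements, IntegrableOn g (simplex t) := fun t ht =>
    integrableOn_of_memLp (memLp_simplex hΩ ht hgL)
  have hgb : ∀ t ∈ 𝒯.elements, ∀ a ∈ t, IntegrableOn (fun x => g x * bary t a x) (simplex t) := by
    intro t ht a ha
    refine integrableOn_mul_of_bounded (hgi t ht) (affine_continuous _).measurable (C := 1) ?_
    filter_upwards [ae_restrict_mem (isClosed_simplex t).measurableSet] with x hx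
    have e := isElement ht
    exact abs_le.2 ⟨by linarith [e.mem_simplex.1 hx a ha], e.bary_le_one hx ha⟩
  have hqi : ∀ t ∈ 𝒯.elements, ∀ a ∈ t,
      IntegrableOn (fun x => inner ℝ (agrad (bary t a)) (q t x)) (simplex t) := by
    intro t ht a ha
    obtain ⟨K, hK⟩ := hqL t ht
    exact IsElement.integrableOn_simplex (continuousOn_const.inner hK.continuousOn)
  -- the variational residual, element by element
  have h1 : (∫ x in Ω, f x * w.val x) - κ.form u w = ∑ t ∈ 𝒯.elements, ∑ a ∈ t,
      θ a * ((∫ x in simplex t, g x * bary t a x) +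
        ∫ x in simplex t, inner ℝ (agrad (bary t a)) (q t x)) := by
    have e2 : ∀ t ∈ 𝒯.elements, (fun x => inner ℝ (κ.A x (u.grad x) - u.val x • κ.b x) (w.grad x))
        =ᵐ[volume.restrict (simplex t)]
          fun x => -∑ a ∈ t, θ a * inner ℝ (agrad (bary t a)) (q t x) := by
      intro t ht
      obtain ⟨ℓ, hℓ⟩ := hu.1.2.2 t ht
      have hg1 := ae_restrict_of_ae (s := simplex t) (u.ae_grad_eq_of_affine hΩ.isOpen
        isOpen_interior (interior_simplex_subset hΩ ht)
        (hℓ.mono interior_subset))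
      filter_upwards [hg1, hgrad t ht, ae_mem_interior_simplex] with x hx hxw hxi
      have h3 : κ.A x (u.grad x) - u.val x • κ.b x = -q t x := by
        rw [hx hxi, ← gradient_eq_of_eqOn_affine hℓ hxi, hpe t ht x hxi,
          hβe (interior_simplex_subset hΩ ht hxi)]
        simp only [hq]; module
      rw [h3, hxw, inner_neg_left, inner_sum]
      simp only [inner_smul_right]
      congr 1
      exact sum_congr rfl fun a _ => by rw [real_inner_comm]
    have i2 : ∀ t ∈ 𝒯.elements, IntegrableOn
        (fun x => inner ℝ (κ.A x (u.grad x) - u.val x • κ.b x) (w.grad x)) (simplex t) := by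
      intro t ht
      refine Integrable.congr ?_ (e2 t ht).symm
      exact (integrable_finsetSum _ fun a ha => (hqi t ht a ha).const_mul _).neg
    have i1 : Integrable (fun x => f x * w.val x) (volume.restrict Ω) :=
      MemLp.integrable_mul (p := 2) (q := 2) hf w.memLp_val
    have i3 : Integrable (fun x => κ.c x * u.val x * w.val x) (volume.restrict Ω) :=
      MemLp.integrable_mul (p := 2) (q := 2) (memLp_top_mul hκ.c_memLp u.memLp_val) w.memLp_val
    have e1 : (∫ x in Ω, f x * w.val x) - ∫ x in Ω, κ.c x * u.val x * w.val x =
        ∫ x in Ω, g x * w.val x := by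
      rw [← integral_sub i1 i3]
      exact integral_congr_ae (.of_forall fun x => by simp only [hg]; ring)
    have i4 : Integrable (fun x => g x * w.val x) (volume.restrict Ω) :=
      MemLp.integrable_mul (p := 2) (q := 2) hgL w.memLp_val
    rw [Coefficients.form, sub_add_eq_sub_sub, sub_right_comm, e1,
      Triangulation.integral_eq_sum (𝒯 := 𝒯) hΩ i4,
      Triangulation.integral_eq_sum_of_integrableOn (𝒯 := 𝒯) hΩ i2, ← sum_sub_distrib]
    refine sum_congr rfl fun t ht => ?_
    have e3 : ∫ x in simplex t, g x * w.val x =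
        ∑ a ∈ t, θ a * ∫ x in simplex t, g x * bary t a x := by
      rw [← integral_mul_sum (hgb t ht)]
      refine integral_congr_ae ?_
      filter_upwards [hval t ht] with x hx using by rw [hx]
    rw [e3, integral_congr_ae (e2 t ht), integral_neg,
      integral_finsetSum _ fun a ha => (hqi t ht a ha).const_mul _, sub_neg_eq_add,
      ← sum_add_distrib]
    exact sum_congr rfl fun a _ => by rw [integral_const_mul]; ring
  -- the finite volume equations, element by element
  have h2 : 0 = ∑ t ∈ 𝒯.elements, ∑ a ∈ t, θ a * ((∑ b ∈ t.erase a, ∫ x in dualFace a b t,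
        inner ℝ (q t x) (unitNormal (dualFace a b t) (b - a)) ∂μHE[d - 1]) -
          ∫ x in dualCell a t, g x) := by
    rw [← Triangulation.sum_interiorNodes_star hθ fun a t => (∑ b ∈ t.erase a,
      ∫ x in dualFace a b t, inner ℝ (q t x) (unitNormal (dualFace a b t) (b - a)) ∂μHE[d - 1]) -
          ∫ x in dualCell a t, g x]
    have h3 := hu.2 θ
    rw [Coefficients.fvmForm, ← sub_eq_zero, ← sum_sub_distrib] at h3
    rw [← h3]
    refine sum_congr rfl fun a ha => ?_
    have hel : ∀ t ∈ 𝒯.star a, t ∈ 𝒯.elements := fun t ht => (mem_star.1 ht).1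
    have hat : ∀ t ∈ 𝒯.star a, a ∈ t := fun t ht => (mem_star.1 ht).2
    have e1 : boundaryFlux 𝒯 (κ.flux u.val) a = ∑ t ∈ 𝒯.star a, ∑ b ∈ t.erase a,
        ∫ x in dualFace a b t, inner ℝ (q t x) (unitNormal (dualFace a b t) (b - a))
          ∂μHE[d - 1] := by
      rw [boundaryFlux]
      refine sum_congr rfl fun t ht => sum_congr rfl fun b hb => ?_
      refine integral_congr_ae ?_
      filter_upwards [(isElement (hel t ht)).dualFace_subset_ae hd (hat t ht)
        (mem_of_mem_erase hb) (Finset.ne_of_mem_erase hb).symm] with x hx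
      rw [hqe t (hel t ht) x hx]
    have if' : ∀ t ∈ 𝒯.star a, IntegrableOn f (simplex t) := fun t ht =>
      integrableOn_of_memLp (memLp_simplex hΩ (hel t ht) hf)
    have ic : ∀ t ∈ 𝒯.star a, IntegrableOn (fun x => κ.c x * u.val x) (simplex t) := fun t ht =>
      integrableOn_of_memLp (memLp_simplex hΩ (hel t ht)
        (memLp_top_mul hκ.c_memLp u.memLp_val))
    rw [e1, Triangulation.integral_controlVolume if', Triangulation.integral_controlVolume ic,
      sum_sub_distrib]
    have e4 : ∑ t ∈ 𝒯.star a, ∫ x in dualCell a t, g x =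
        (∑ t ∈ 𝒯.star a, ∫ x in dualCell a t, f x) -
          ∑ t ∈ 𝒯.star a, ∫ x in dualCell a t, κ.c x * u.val x := by
      rw [← sum_sub_distrib]
      refine sum_congr rfl fun t ht => ?_
      have hs := (isElement (hel t ht)).dualCell_subset (hat t ht)
      exact integral_sub ((if' t ht).mono_set hs) ((ic t ht).mono_set hs)
    rw [e4]; ring
  rw [← add_zero (_ - _), h2, h1, ← sum_add_distrib]
  refine sum_congr rfl fun t ht => ?_
  have e := isElement ht
  obtain ⟨K, hK⟩ := hqL t ht
  have hdm := measurable_divergence (q t)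
  obtain ⟨C, hC⟩ := exists_abs_divergence_le hK
  have hdi : IntegrableOn (divergence (q t)) (simplex t) := integrableOn_of_ae_le hdm hC
  have hchi : ∀ a ∈ t, ∀ᵐ x ∂volume.restrict (simplex t), |chi t a x| ≤ 1 := fun a ha => by
    filter_upwards [ae_restrict_mem (isClosed_simplex t).measurableSet] with x hx
      using e.abs_chi_le_one ha hx
  have hgc : ∀ a ∈ t, IntegrableOn (fun x => g x * chi t a x) (simplex t) := fun a ha =>
    integrableOn_mul_of_bounded (hgi t ht) (e.measurable_chi ha) (hchi a ha)
  have hdc : ∀ a ∈ t, IntegrableOn (fun x => divergence (q t) x * chi t a x) (simplex t) :=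
    fun a ha => integrableOn_mul_of_bounded hdi (e.measurable_chi ha) (hchi a ha)
  have r1 : ∫ x in simplex t, κ.residual f u.val x * ∑ a ∈ t, θ a * chi t a x =
      ∑ a ∈ t, θ a * ((∫ x in simplex t, g x * chi t a x) -
        ∫ x in simplex t, divergence (q t) x * chi t a x) := by
    have e1 : ∀ a ∈ t, IntegrableOn (fun x => (g x - divergence (q t) x) * chi t a x)
        (simplex t) := fun a ha => by
      simp only [sub_mul]; exact (hgc a ha).sub (hdc a ha)
    have e2 := integral_mul_sum e1 θ
    rw [sum_congr rfl fun a ha => by simp_rw [sub_mul]; rw [integral_sub (hgc a ha) (hdc a ha)]]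
      at e2
    rw [← e2]
    refine integral_congr_ae ?_
    filter_upwards [ae_mem_interior_simplex] with x hx
    have hdiv : divergence (κ.flux u.val) x = divergence (q t) x := by
      refine divergence_congr_of_eqOn (P := interior (simplex t)) (fun y hy => hqe t ht y hy) ?_
      rwa [interior_interior]
    simp only [Coefficients.residual, hdiv, hg]
    ring
  have hfc : ∀ c ∈ t, ∀ a ∈ t, IntegrableOn
      (fun x => inner ℝ (agrad (bary t c)) (q t x) * chi t a x) (facet t c) μHE[d - 1] := by
    intro c hc a ha
    have i1 := e.integrableOn_facet hd hc (g := fun x => inner ℝ (agrad (bary t c)) (q t x))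
      (continuousOn_const.inner (hK.continuousOn.mono fun x hx => hx.1))
    refine integrableOn_mul_of_bounded i1 (e.measurable_chi ha) (C := 1) ?_
    filter_upwards [ae_restrict_mem isClosed_facet.measurableSet] with x hx
      using e.abs_chi_le_one ha hx.1
  have r2 : ∑ c ∈ t, ‖agrad (bary t c)‖⁻¹ * ∫ x in facet t c,
      inner ℝ (agrad (bary t c)) (q t x) * (∑ a ∈ t, θ a * chi t a x) ∂μHE[d - 1] =
      ∑ a ∈ t, θ a * ∑ c ∈ t, ‖agrad (bary t c)‖⁻¹ * ∫ x in facet t c,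
        inner ℝ (agrad (bary t c)) (q t x) * chi t a x ∂μHE[d - 1] := by
    simp_rw [mul_sum _ _ (θ _)]
    rw [sum_comm]
    refine sum_congr rfl fun c hc => ?_
    rw [integral_mul_sum (hfc c hc), mul_sum]
    exact sum_congr rfl fun a _ => by ring
  rw [r1, r2, ← sum_add_distrib, ← sum_sub_distrib]
  refine sum_congr rfl fun a ha => ?_
  have r3 := e.integral_inner_add_sum_dualFace hd ha hK
  have hcell := e.isClosed_dualCell ha
  have r4 := IsElement.integral_mul_chi hcell.measurableSet (hgi t ht) (hgb t ht a ha)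
  rw [inter_eq_self_of_subset_left (e.dualCell_subset ha)] at r4
  rw [r4]
  linear_combination θ a * r3

/-! ### The oscillation bound -/

theorem sq_integral_mul_le {α : Type*} [MeasurableSpace α] {μ : Measure α} {f g : α → ℝ}
    (hf : MemLp f 2 μ) (hg : MemLp g 2 μ) :
    (∫ x, f x * g x ∂μ) ^ 2 ≤ (∫ x, f x ^ 2 ∂μ) * ∫ x, g x ^ 2 ∂μ := by
  have hfg : Integrable (fun x => f x * g x) μ := MemLp.integrable_mul (p := 2) (q := 2) hf hg
  have h : ∀ y : ℝ, 0 ≤ (∫ x, f x ^ 2 ∂μ) * (y * y) + (2 * ∫ x, f x * g x ∂μ) * y +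
      ∫ x, g x ^ 2 ∂μ := by
    intro y
    have h1 : 0 ≤ ∫ x, (y * f x + g x) ^ 2 ∂μ := integral_nonneg fun x => sq_nonneg _
    have h2 : ∫ x, (y * f x + g x) ^ 2 ∂μ =
        ∫ x, (y ^ 2 * f x ^ 2 + (2 * y) * (f x * g x) + g x ^ 2) ∂μ :=
      integral_congr_ae (.of_forall fun x => by ring)
    have i1 : Integrable (fun x => y ^ 2 * f x ^ 2 + (2 * y) * (f x * g x)) μ :=
      (hf.integrable_sq.const_mul _).add (hfg.const_mul _)
    rw [h2, integral_add i1 hg.integrable_sq,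
      integral_add (hf.integrable_sq.const_mul _) (hfg.const_mul _), integral_const_mul,
      integral_const_mul] at h1
    linarith
  have := discrim_le_zero h
  rw [discrim] at this
  linarith

/-- Functions with vanishing mean only see the deviation from the mean. -/
theorem sq_integral_mul_le_meanDeviationSq {μ : Measure (Vec d)} {S : Set (Vec d)}
    (hμ : μ S < ⊤) {R W : Vec d → ℝ} (hR : MemLp R 2 (μ.restrict S))
    (hW : AEStronglyMeasurable W (μ.restrict S)) {B : ℝ} (hB : ∀ᵐ x ∂μ.restrict S, |W x| ≤ B)
    (h0 : ∫ x in S, W x ∂μ = 0) :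
    (∫ x in S, R x * W x ∂μ) ^ 2 ≤ meanDeviationSq μ S R * (B ^ 2 * μ.real S) := by
  have : IsFiniteMeasure (μ.restrict S) := ⟨by simpa using hμ⟩
  have hWL : MemLp W 2 (μ.restrict S) := MemLp.of_bound hW B hB
  set m := ⨍ y in S, R y ∂μ
  have hRm : MemLp (fun x => R x - m) 2 (μ.restrict S) := hR.sub (memLp_const m)
  have h1 : ∫ x in S, R x * W x ∂μ = ∫ x in S, (R x - m) * W x ∂μ := by
    have : ∫ x in S, (R x - m) * W x ∂μ = ∫ x in S, (R x * W x - m * W x) ∂μ :=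
      integral_congr_ae (.of_forall fun x => by ring)
    have i1 : Integrable (fun x => R x * W x) (μ.restrict S) :=
      MemLp.integrable_mul (p := 2) (q := 2) hR hWL
    rw [this, integral_sub i1
      ((hWL.integrable (by norm_num)).const_mul _), integral_const_mul, h0, mul_zero, sub_zero]
  rw [h1]
  refine (sq_integral_mul_le hRm hWL).trans ?_
  refine mul_le_mul_of_nonneg_left ?_ (integral_nonneg fun x => sq_nonneg _)
  calc ∫ x in S, W x ^ 2 ∂μ ≤ ∫ _ in S, B ^ 2 ∂μ := by
        refine integral_mono_ae hWL.integrable_sq (integrable_const _) ?_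
        filter_upwards [hB] with x hx
        exact sq_le_sq' (by linarith [neg_abs_le (W x)]) ((le_abs_self _).trans hx)
    _ = B ^ 2 * μ.real S := by simp [mul_comm]

namespace Triangulation

open Classical in
theorem mem_neighbours : t' ∈ 𝒯.neighbours t ↔ t' ∈ 𝒯.elements ∧ (t ∩ t').card = d := by
  simp [neighbours]

open Classical in
theorem mem_neighbours_iff (hd : 1 ≤ d) (ht : t ∈ 𝒯.elements) : t' ∈ 𝒯.neighbours t ↔
    t' ∈ 𝒯.elements ∧ t' ≠ t ∧ ∃ v ∈ t, t.erase v ⊆ t' := by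
  rw [mem_neighbours]
  refine and_congr_right fun ht' => ⟨fun h => ?_, ?_⟩
  · have hne : t' ≠ t := by
      rintro rfl
      rw [Finset.inter_self, (isElement ht).card] at h
      omega
    obtain ⟨v, hv, hvn⟩ : ∃ v ∈ t, v ∉ t' := by
      by_contra! hsub
      exact hne (Finset.eq_of_subset_of_card_le hsub
        (by rw [(isElement ht).card, (isElement ht').card])).symm
    have heq : t ∩ t' = t.erase v := by
      refine Finset.eq_of_subset_of_card_le (fun a ha => ?_) ?_
      · have := Finset.mem_inter.1 ha
        exact mem_erase.2 ⟨fun h => hvn (h ▸ this.2), this.1⟩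
      · rw [h, card_erase_of_mem hv, (isElement ht).card]; rfl
    exact ⟨hne, v, hv, heq ▸ Finset.inter_subset_right⟩
  · rintro ⟨hne, v, hv, hsub⟩
    obtain ⟨-, -, -, -, h, -⟩ := exists_apex hd ht ht' hne hv hsub
    rw [h, card_erase_of_mem hv, (isElement ht).card]; rfl

theorem neighbours_symm (hmem : t ∈ 𝒯.elements) (h : t' ∈ 𝒯.neighbours t) :
    t ∈ 𝒯.neighbours t' := by
  classical
  rw [mem_neighbours] at h ⊢
  exact ⟨hmem, by rw [Finset.inter_comm]; exact h.2⟩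

theorem commonFacet_comm : commonFacet t t' = commonFacet t' t := by
  classical
  simp only [commonFacet]
  congr 1
  ext a
  simp [and_comm]

/-- The normal of the common facet of two elements. -/
theorem neighbour_normal [DecidableEq (Vec d)] (hd : 1 ≤ d) (ht : t ∈ 𝒯.elements)
    (ht' : t' ∈ 𝒯.elements) (hne : t' ≠ t) (hv : v ∈ t) (hsub : t.erase v ⊆ t') :
    commonFacet t t' = facet t v ∧
    unitNormal (commonFacet t t') (t'.centroid ℝ id - t.centroid ℝ id) =
      -(‖agrad (bary t v)‖⁻¹ • agrad (bary t v)) ∧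
    unitNormal (commonFacet t' t) (t.centroid ℝ id - t'.centroid ℝ id) =
      ‖agrad (bary t v)‖⁻¹ • agrad (bary t v) := by
  have e := isElement ht
  have e' := isElement ht'
  obtain ⟨v', hv', -, he', hinter, κ, hκ, hb⟩ := exists_apex hd ht ht' hne hv hsub
  have hF : commonFacet t t' = facet t v := by
    rw [e.facet_eq_simplex_erase hv, ← hinter, commonFacet]
    congr 1
    ext a; simp
  have hF' : commonFacet t' t = facet t' v' := by
    rw [← commonFacet_comm, hF, e.facet_eq_simplex_erase hv, e'.facet_eq_simplex_erase hv', he']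
  have h1 : 0 < bary t v (t.centroid ℝ id) := e.mem_interior_simplex.1 e.centroid_mem_interior v hv
  have h2 : 0 < bary t' v' (t'.centroid ℝ id) :=
    e'.mem_interior_simplex.1 e'.centroid_mem_interior v' hv'
  have hb1 : ∀ x, bary t' v' x = -κ * bary t v x := fun x => by rw [hb]; rfl
  have hag : agrad (bary t' v') = -(κ • agrad (bary t v)) := by
    refine ext_inner_right ℝ fun w => ?_
    rw [inner_agrad, hb, inner_neg_left, real_inner_smul_left, inner_agrad]
    change -κ * _ = _
    ring
  refine ⟨hF, ?_, ?_⟩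
  · rw [hF]
    refine e.unitNormal_facet hd hv ?_
    rw [e.bary_linear_sub]
    have := hb1 (t'.centroid ℝ id)
    nlinarith
  · rw [hF', e'.unitNormal_facet hd hv', hag, norm_neg, smul_neg, neg_neg, norm_smul,
      Real.norm_of_nonneg hκ.le, mul_inv, smul_smul]
    · congr 1
      field_simp
    · rw [e'.bary_linear_sub]
      have := hb1 (t.centroid ℝ id)
      nlinarith

theorem chi_apex_facet (ht : t ∈ 𝒯.elements) (hv : v ∈ t) (hx : x ∈ facet t v) :
    chi t v x = 0 := by
  have e := isElement ht
  have hx0 : bary t v x = 0 := hx.2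
  rw [chi, hx0, indicator_of_notMem, sub_zero]
  intro h
  have h1 := ((e.mem_dualCell hv).1 h).2
  have h2 := e.sum_bary x
  have h3 : ∑ a ∈ t, bary t a x ≤ ∑ _a ∈ t, 0 := sum_le_sum fun a ha => hx0 ▸ h1 a ha
  rw [h2, Finset.sum_const_zero] at h3
  linarith

/-- The oscillating functions of neighbours agree on the common facet. -/
theorem sum_chi_eq [DecidableEq (Vec d)] (hd : 1 ≤ d) (ht : t ∈ 𝒯.elements)
    (ht' : t' ∈ 𝒯.elements) (hne : t' ≠ t) (hv : v ∈ t) (hsub : t.erase v ⊆ t')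
    (hx : x ∈ facet t v) (θ : Vec d → ℝ) :
    ∑ a ∈ t, θ a * chi t a x = ∑ a ∈ t', θ a * chi t' a x := by
  have e := isElement ht
  have e' := isElement ht'
  obtain ⟨v', hv', hv't, he', hinter, -⟩ := exists_apex hd ht ht' hne hv hsub
  have hxt' : x ∈ facet t' v' := by
    rwa [e'.facet_eq_simplex_erase hv', he', ← e.facet_eq_simplex_erase hv]
  have hx0 : bary t v x = 0 := hx.2
  have hx0' : bary t' v' x = 0 := hxt'.2
  rw [← Finset.add_sum_erase t _ hv, ← Finset.add_sum_erase t' _ hv', he', chi_apex_facet ht hv hx,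
    chi_apex_facet ht' hv' hxt', mul_zero, mul_zero]
  congr 1
  refine sum_congr rfl fun a ha => ?_
  have hat := mem_of_mem_erase ha
  have hat' := hsub ha
  have hbar : ∀ c ∈ t.erase v, bary t c x = bary t' c x := fun c hc =>
    (bary_inter ht ht' hx.1 hxt'.1 (mem_of_mem_erase hc)).1 (hsub hc)
  have hcell : x ∈ dualCell a t ↔ x ∈ dualCell a t' := by
    rw [e.mem_dualCell hat, e'.mem_dualCell hat']
    have h0 : 0 ≤ bary t a x := e.mem_simplex.1 hx.1 a hat
    constructor
    · rintro ⟨-, h⟩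
      refine ⟨hxt'.1, fun b hb => ?_⟩
      by_cases hbv : b = v'
      · rw [hbv, hx0', ← hbar a ha]; exact h0
      · have hb' : b ∈ t.erase v := he' ▸ mem_erase.2 ⟨hbv, hb⟩
        rw [← hbar a ha, ← hbar b hb']
        exact h b (mem_of_mem_erase hb')
    · rintro ⟨-, h⟩
      refine ⟨hx.1, fun b hb => ?_⟩
      by_cases hbv : b = v
      · rw [hbv, hx0]; exact h0
      · have hb' : b ∈ t.erase v := mem_erase.2 ⟨hbv, hb⟩
        rw [hbar a ha, hbar b hb']
        exact h b (hsub hb')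
  congr 1
  rw [chi, chi, hbar a ha]
  congr 1
  by_cases hc : x ∈ dualCell a t
  · rw [indicator_of_mem hc, indicator_of_mem (hcell.1 hc)]
  · rw [indicator_of_notMem hc, indicator_of_notMem fun h => hc (hcell.2 h)]

/-- Sums over the facets of an element are sums over its neighbours, if the facets on the boundary
do not contribute. -/
theorem sum_facets_eq [DecidableEq (Vec d)] (hd : 1 ≤ d) (ht : t ∈ 𝒯.elements)
    {G : Vec d → ℝ} {H : Finset (Vec d) → ℝ}
    (h0 : ∀ v ∈ t, (∀ t' ∈ 𝒯.elements, t.erase v ⊆ t' → t' = t) → G v = 0)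
    (hGH : ∀ v ∈ t, ∀ t' ∈ 𝒯.elements, t' ≠ t → t.erase v ⊆ t' → G v = H t') :
    ∑ v ∈ t, G v = ∑ t' ∈ 𝒯.neighbours t, H t' := by
  have key : ∀ t' ∈ 𝒯.neighbours t, ∃ v ∈ t, t' ∈ 𝒯.elements ∧ t' ≠ t ∧ t.erase v ⊆ t' := by
    intro t' h
    rw [mem_neighbours_iff hd ht] at h
    obtain ⟨h1, h2, v, hv, h3⟩ := h
    exact ⟨v, hv, h1, h2, by convert h3⟩
  choose! e he using key
  symm
  refine Finset.sum_of_injOn e ?_ (fun t' h => (he t' h).1) ?_ fun t' h =>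
    (hGH _ (he t' h).1 t' (he t' h).2.1 (he t' h).2.2.1 (he t' h).2.2.2).symm
  · intro t₁ h₁ t₂ h₂ h
    exact neighbour_unique hd ht (he t₁ h₁).2.1 (he t₂ h₂).2.1 (he t₁ h₁).2.2.1 (he t₂ h₂).2.2.1
      (he t₁ h₁).1 (he t₁ h₁).2.2.2 (h ▸ (he t₂ h₂).2.2.2)
  · intro v hv hvn
    refine h0 v hv fun t' ht' hsub => ?_
    by_contra hne
    have hn : t' ∈ 𝒯.neighbours t := by
      rw [mem_neighbours_iff hd ht]
      exact ⟨ht', hne, v, hv, by convert hsub⟩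
    refine hvn ⟨t', hn, ?_⟩
    -- the vertex opposite to the common facet is unique
    by_contra hev
    have h1 : e t' ∈ t.erase v := mem_erase.2 ⟨hev, (he t' hn).1⟩
    refine hne (Finset.eq_of_subset_of_card_le (fun a ha => ?_)
      (by rw [(isElement ht).card, (isElement ht').card])).symm
    by_cases hav : a = e t'
    · exact hav ▸ hsub h1
    · exact (he t' hn).2.2.2 (mem_erase.2 ⟨hav, ha⟩)

theorem card_neighbours_le (hd : 1 ≤ d) (ht : t ∈ 𝒯.elements) :
    (𝒯.neighbours t).card ≤ d + 1 := by
  classical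
  have key : ∀ t' ∈ 𝒯.neighbours t, ∃ v ∈ t, t' ∈ 𝒯.elements ∧ t' ≠ t ∧ t.erase v ⊆ t' := by
    intro t' h
    rw [mem_neighbours_iff hd ht] at h
    obtain ⟨h1, h2, v, hv, h3⟩ := h
    exact ⟨v, hv, h1, h2, by convert h3⟩
  choose! e he using key
  rw [← (isElement ht).card]
  refine Finset.card_le_card_of_injOn e (fun t' h => (he t' h).1) ?_
  intro t₁ h₁ t₂ h₂ h
  exact neighbour_unique hd ht (he t₁ h₁).2.1 (he t₂ h₂).2.1 (he t₁ h₁).2.2.1 (he t₂ h₂).2.2.1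
    (he t₁ h₁).1 (he t₁ h₁).2.2.2 (h ▸ (he t₂ h₂).2.2.2)

theorem sum_neighbours_comm (F : Finset (Vec d) → Finset (Vec d) → ℝ) :
    ∑ t ∈ 𝒯.elements, ∑ t' ∈ 𝒯.neighbours t, F t t' =
      ∑ t ∈ 𝒯.elements, ∑ t' ∈ 𝒯.neighbours t, F t' t := by
  classical
  refine Finset.sum_comm' fun t t' => ?_
  constructor
  · exact fun ⟨h1, h2⟩ => ⟨neighbours_symm h1 h2, (mem_neighbours.1 h2).1⟩
  · exact fun ⟨h1, h2⟩ => ⟨(mem_neighbours.1 h1).1, neighbours_symm h2 h1⟩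

end Triangulation

theorem agrad_sum_bary (ht : IsElement t) (θ : Vec d → ℝ)
    (ha : a ∈ t) (hb : b ∈ t) :
    inner ℝ (∑ c ∈ t, θ c • agrad (bary t c)) (a - b) = θ a - θ b := by
  classical
  rw [sum_inner]
  simp_rw [real_inner_smul_left, inner_agrad, ht.bary_linear_sub, mul_sub]
  rw [sum_sub_distrib]
  congr 1
  · rw [sum_eq_single a, ht.bary_self ha, mul_one]
    · intro c hc hca
      rw [ht.bary_of_ne hc ha hca, mul_zero]
    · exact fun h => absurd ha h
  · rw [sum_eq_single b, ht.bary_self hb, mul_one]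
    · intro c hc hca
      rw [ht.bary_of_ne hc hb hca, mul_zero]
    · exact fun h => absurd hb h

theorem abs_sub_nodal_le (ht : IsElement t) (θ : Vec d → ℝ)
    (ha : a ∈ t) (hb : b ∈ t) :
    |θ a - θ b| ≤ diam (simplex t) * ‖∑ c ∈ t, θ c • agrad (bary t c)‖ := by
  rw [← agrad_sum_bary ht θ ha hb]
  refine (abs_real_inner_le_norm _ _).trans ?_
  rw [mul_comm]
  refine mul_le_mul_of_nonneg_right ?_ (norm_nonneg _)
  rw [← dist_eq_norm]
  exact dist_le_diam_of_mem (isCompact_simplex t).isBounded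
    (vertex_mem_simplex ha) (vertex_mem_simplex hb)

theorem extendFrom_eq_of_eqOn (ht : IsElement t) {q p : Vec d → Vec d}
    (hp : Continuous p) (h : ∀ x ∈ interior (simplex t), q x = p x)
    (hx : x ∈ simplex t) : traceFrom t q x = p x := by
  refine extendFrom_eq ?_ ?_
  · rw [(convex_simplex t).closure_interior_eq_closure_of_nonempty_interior
      ⟨_, ht.centroid_mem_interior⟩]
    exact subset_closure hx
  · refine (hp.continuousAt.mono_left nhdsWithin_le_nhds).congr' ?_
    filter_upwards [self_mem_nhdsWithin] with y hy using (h y hy).symm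

/-- The constant of the oscillation bound. -/
noncomputable def oscConst (d : ℕ) (σ : ℝ) : ℝ :=
  2 * (d + 2) * ((d + 1) ^ 2 * σ ^ 2 * (1 + d * (crossConst d * σ ^ (d - 1))))

/-- Cauchy–Schwarz with at most `n` neighbours for each index. -/
theorem sum_sq_le_of_sq_le {ι : Type*} {S : Finset ι} {N : ι → Finset ι} {n : ℕ}
    (hN : ∀ i ∈ S, (N i).card ≤ n) {X : ι → ℝ} {Z : ι → ι → ℝ} {α y : ι → ℝ} {γ : ι → ι → ℝ}
    {κ : ℝ} (hy : ∀ i ∈ S, 0 ≤ y i) (hα : ∀ i ∈ S, 0 ≤ α i)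
    (hγ : ∀ i ∈ S, ∀ j ∈ N i, 0 ≤ γ i j) (hκ : 0 ≤ κ)
    (hX : ∀ i ∈ S, X i ^ 2 ≤ κ * α i * y i) (hZ : ∀ i ∈ S, ∀ j ∈ N i, Z i j ^ 2 ≤ κ * γ i j * y i) :
    (∑ i ∈ S, (X i + ∑ j ∈ N i, Z i j)) ^ 2 ≤
      2 * (n + 1) * κ * (∑ i ∈ S, (α i + ∑ j ∈ N i, γ i j)) * ∑ i ∈ S, y i := by
  have key : ∀ i ∈ S, (X i + ∑ j ∈ N i, Z i j) ^ 2 ≤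
      (2 * (n + 1) * κ * (α i + ∑ j ∈ N i, γ i j)) * y i := by
    intro i hi
    have h1 : (X i + ∑ j ∈ N i, Z i j) ^ 2 ≤ 2 * X i ^ 2 + 2 * (∑ j ∈ N i, Z i j) ^ 2 := by
      nlinarith [sq_nonneg (X i - ∑ j ∈ N i, Z i j)]
    have h2 : (∑ j ∈ N i, Z i j) ^ 2 ≤ n * ∑ j ∈ N i, Z i j ^ 2 := by
      refine sq_sum_le_card_mul_sum_sq.trans ?_
      exact mul_le_mul_of_nonneg_right (by exact_mod_cast hN i hi)
        (sum_nonneg fun j _ => sq_nonneg _)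
    have h3 : ∑ j ∈ N i, Z i j ^ 2 ≤ κ * (∑ j ∈ N i, γ i j) * y i := by
      rw [mul_sum, sum_mul]
      exact sum_le_sum (hZ i hi)
    have h4 : (n : ℝ) * ∑ j ∈ N i, Z i j ^ 2 ≤ n * (κ * (∑ j ∈ N i, γ i j) * y i) :=
      mul_le_mul_of_nonneg_left h3 (Nat.cast_nonneg _)
    have h5 := hX i hi
    have h6 : 0 ≤ n * (κ * α i * y i) := by
      have := hy i hi; have := hα i hi; positivity
    have h7 : 0 ≤ κ * (∑ j ∈ N i, γ i j) * y i :=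
      mul_nonneg (mul_nonneg hκ (sum_nonneg (hγ i hi))) (hy i hi)
    nlinarith
  have h0 : ∀ i ∈ S, 0 ≤ 2 * (n + 1) * κ * (α i + ∑ j ∈ N i, γ i j) := fun i hi => by
    have := hα i hi
    have := sum_nonneg (hγ i hi)
    positivity
  have h8 := Finset.sum_sq_le_sum_mul_sum_of_sq_le_mul S h0 hy key
  rwa [← mul_sum] at h8

theorem IsElement.integral_sum_chi_eq_zero (ht : IsElement t) {S : Set (Vec d)}
    {μ : Measure (Vec d)} (hS : MeasurableSet S) (hsub : S ⊆ simplex t) (hfin : μ S ≠ ⊤)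
    (h : ∀ a ∈ t, ∫ x in S, chi t a x ∂μ = 0) (θ : Vec d → ℝ) :
    ∫ x in S, ∑ a ∈ t, θ a * chi t a x ∂μ = 0 := by
  rw [integral_finsetSum _ fun a ha => ?_]
  · exact sum_eq_zero fun a ha => by rw [integral_const_mul, h a ha, mul_zero]
  · refine (Measure.integrableOn_of_bounded (M := 1) hfin
      (ht.measurable_chi ha).aestronglyMeasurable ?_).const_mul _
    filter_upwards [ae_restrict_mem hS] with x hx using ht.abs_chi_le_one ha (hsub hx)

open Classical in
/-- The residual of the finite volume solution, tested with a continuous piecewise affine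
function, is bounded by the oscillations. -/
theorem sq_residual_le (hd : 2 ≤ d) (hσ : 0 < σ)
    (hΩ : IsLipschitzDomain Ω) (hreg : 𝒯.IsShapeRegular σ) (hκ : κ.Admissible 𝒯)
    {f : Vec d → ℝ} (hf : MemLp f 2 (volume.restrict Ω)) {u : H1 Ω} (hu : κ.IsFVMSolution 𝒯 f u)
    {w : H1 Ω} {θ : Vec d → ℝ} (hθ : ∀ a, a ∉ Ω → θ a = 0)
    (hval : ∀ t ∈ 𝒯.elements, ∀ᵐ x ∂volume.restrict (simplex t),
      w.val x = ∑ a ∈ t, θ a * bary t a x)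
    (hgrad : ∀ t ∈ 𝒯.elements, ∀ᵐ x ∂volume.restrict (simplex t),
      w.grad x = ∑ a ∈ t, θ a • agrad (bary t a)) :
    ((∫ x in Ω, f x * w.val x) - κ.form u w) ^ 2 ≤
      oscConst d σ * κ.oscSq 𝒯 f u.val * ∫ x in Ω, ‖w.grad x‖ ^ 2 := by
  have hd1 : 1 ≤ d := by omega
  obtain ⟨p, β, hp, hβ, hβe, hpe⟩ := exists_flux_extension hκ hu.1
  have hmain := residual_identity hd hΩ hκ hf hu hp hβ hβe hpe hθ hval hgrad
  set W : Finset (Vec d) → Vec d → ℝ := fun t x => ∑ a ∈ t, θ a * chi t a x with hW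
  set q : Finset (Vec d) → Vec d → Vec d := fun t x => -p t x + u.val x • β x with hq
  set n : Finset (Vec d) → Finset (Vec d) → Vec d := fun t t' =>
    unitNormal (commonFacet t t') (t'.centroid ℝ id - t.centroid ℝ id) with hn
  have hqL : ∀ t ∈ 𝒯.elements, ∃ K, LipschitzOnWith K (q t) (simplex t) := fun t ht =>
    lipschitzOnWith_flux hu.1 ht (hp t ht) hβ
  -- the facets on the boundary do not contribute; the others belong to pairs of neighbours
  set I : Finset (Vec d) → Finset (Vec d) → ℝ := fun t t' =>
    ∫ x in commonFacet t t', inner ℝ (n t t') (q t x) * W t x ∂μHE[d - 1] with hI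
  have hfac : ∀ t ∈ 𝒯.elements, ∑ c ∈ t, ‖agrad (bary t c)‖⁻¹ * ∫ x in facet t c,
      inner ℝ (agrad (bary t c)) (q t x) * W t x ∂μHE[d - 1] =
      ∑ t' ∈ 𝒯.neighbours t, -I t t' := by
    intro t ht
    have e := isElement ht
    refine Triangulation.sum_facets_eq hd1 ht (fun v hv hun => ?_) fun v hv t' ht' hne hsub => ?_
    · have hdis := Triangulation.facet_disjoint_of_unshared hΩ.isOpen hd1 ht hv hun
      have : ∫ x in facet t v, inner ℝ (agrad (bary t v)) (q t x) * W t x ∂μHE[d - 1] = 0 := by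
        refine (setIntegral_congr_fun isClosed_facet.measurableSet
          (g := fun _ => (0 : ℝ)) fun x hx => ?_).trans (by simp)
        have : W t x = 0 := by
          refine sum_eq_zero fun a ha => ?_
          by_cases hav : a = v
          · rw [hav, Triangulation.chi_apex_facet ht hv hx, mul_zero]
          · have haF : a ∈ facet t v :=
              ⟨vertex_mem_simplex ha, e.bary_of_ne hv ha (Ne.symm hav)⟩
            rw [hθ a (disjoint_left.1 hdis haF), zero_mul]
        simp only [this, mul_zero]
      rw [this, mul_zero]
    · obtain ⟨h1, h2, -⟩ := Triangulation.neighbour_normal hd1 ht ht' hne hv hsub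
      simp only [hI, hn]
      rw [h2, h1, ← integral_const_mul, ← integral_neg]
      refine integral_congr_ae (.of_forall fun x => ?_)
      simp only [inner_neg_left, real_inner_smul_left]
      ring
  have hnb : ∀ t ∈ 𝒯.elements, ∀ t' ∈ 𝒯.neighbours t, ∃ v ∈ t, t' ∈ 𝒯.elements ∧ t' ≠ t ∧
      t.erase v ⊆ t' := by
    intro t ht t' ht'
    obtain ⟨h1, h2, v, hv, h3⟩ := (Triangulation.mem_neighbours_iff hd1 ht).1 ht'
    exact ⟨v, hv, h1, h2, h3⟩
  -- the jump in terms of the continuous extensions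
  have hjump : ∀ t ∈ 𝒯.elements, ∀ t' ∈ 𝒯.neighbours t, ∀ x ∈ commonFacet t t',
      κ.jump t t' u.val x = inner ℝ (n t t') (p t x - p t' x) := by
    intro t ht t' ht' x hx
    obtain ⟨v, hv, ht'e, -, -⟩ := hnb t ht t' ht'
    obtain ⟨K, hK⟩ := hp t ht
    obtain ⟨K', hK'⟩ := hp t' ht'e
    have hxt : x ∈ simplex t := convexHull_mono (by simp) hx
    have hxt' : x ∈ simplex t' := convexHull_mono (by simp) hx
    rw [Coefficients.jump, extendFrom_eq_of_eqOn (isElement ht) hK.continuous (hpe t ht) hxt,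
      extendFrom_eq_of_eqOn (isElement ht'e) hK'.continuous (hpe t' ht'e) hxt',
      real_inner_comm]
  have hWb : ∀ t ∈ 𝒯.elements, ∀ c ∈ t, ∀ᵐ x ∂(μHE[d - 1] : Measure (Vec d)).restrict (facet t c),
      |W t x| ≤ (d + 1) * (diam (simplex t) * ‖∑ c ∈ t, θ c • agrad (bary t c)‖) :=
    fun t ht c hc => by
    have e := isElement ht
    exact e.ae_abs_sum_chi_le isClosed_facet.measurableSet (fun x hx => hx.1)
      (e.measure_facet_lt_top hd hc) (fun a ha => e.integral_facet_chi hd hc ha) θ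
      fun a ha b hb => abs_sub_nodal_le e θ ha hb
  have hWm : ∀ t ∈ 𝒯.elements, Measurable (W t) := fun t ht =>
    Finset.measurable_fun_sum _ fun a ha =>
      ((isElement ht).measurable_chi ha).const_mul _
  -- each interior facet is counted from both sides, hence the factor `1 / 2`
  set Z : Finset (Vec d) → Finset (Vec d) → ℝ := fun t t' =>
    (-1 / 2) * ∫ x in commonFacet t t', κ.jump t t' u.val x * W t x ∂μHE[d - 1] with hZ
  have hIJ : ∀ t ∈ 𝒯.elements, ∀ t' ∈ 𝒯.neighbours t, I t t' + I t' t =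
      2 * Z t t' := by
    intro t ht t' ht'
    obtain ⟨v, hv, ht'e, hne, hsub⟩ := hnb t ht t' ht'
    have e := isElement ht
    obtain ⟨h1, h2, h3⟩ := Triangulation.neighbour_normal hd1 ht ht'e hne hv hsub
    have hnn : n t' t = -n t t' := by simp only [hn]; rw [h3, h2, neg_neg]
    have hsub1 : commonFacet t t' ⊆ simplex t := convexHull_mono (by simp)
    have hsub2 : commonFacet t t' ⊆ simplex t' := convexHull_mono (by simp)
    have i : ∀ s ∈ 𝒯.elements, commonFacet t t' ⊆ simplex s →
        IntegrableOn (fun x => inner ℝ (n t t') (q s x) * W t x) (commonFacet t t') μHE[d - 1] := by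
      intro s hs hss
      obtain ⟨K, hK⟩ := hqL s hs
      rw [h1] at hss ⊢
      exact integrableOn_mul_of_bounded (e.integrableOn_facet hd hv
        (g := fun x => inner ℝ (n t t') (q s x))
        (continuousOn_const.inner (hK.continuousOn.mono hss))) (hWm t ht) (hWb t ht v hv)
    have hI' : I t' t =
        -∫ x in commonFacet t t', inner ℝ (n t t') (q t' x) * W t x ∂μHE[d - 1] := by
      simp only [hI]
      rw [hnn, Triangulation.commonFacet_comm, ← integral_neg, h1]
      refine setIntegral_congr_fun isClosed_facet.measurableSet fun x hx => ?_
      simp only [inner_neg_left, hW]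
      rw [Triangulation.sum_chi_eq hd1 ht ht'e hne hv hsub hx θ]
      ring
    rw [hI', ← sub_eq_add_neg]
    simp only [hI, hZ]
    rw [← integral_sub (i t ht hsub1) (i t' ht'e hsub2), ← mul_assoc, ← integral_const_mul, h1]
    refine setIntegral_congr_fun isClosed_facet.measurableSet fun x hx => ?_
    rw [← h1] at hx
    simp only [hjump t ht t' ht' x hx, hq, inner_add_right, inner_sub_right, inner_neg_right]
    ring
  have hsum : (∫ x in Ω, f x * w.val x) - κ.form u w = ∑ t ∈ 𝒯.elements,
      ((∫ x in simplex t, κ.residual f u.val x * W t x) + ∑ t' ∈ 𝒯.neighbours t, Z t t') := by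
    have e1 : ∑ t ∈ 𝒯.elements, ∑ t' ∈ 𝒯.neighbours t, I t t' = ∑ t ∈ 𝒯.elements,
        ∑ t' ∈ 𝒯.neighbours t, Z t t' := by
      have e2 := Triangulation.sum_neighbours_comm (𝒯 := 𝒯) I
      have e3 : ∑ t ∈ 𝒯.elements, ∑ t' ∈ 𝒯.neighbours t, I t t' +
          ∑ t ∈ 𝒯.elements, ∑ t' ∈ 𝒯.neighbours t, I t' t =
          2 * ∑ t ∈ 𝒯.elements, ∑ t' ∈ 𝒯.neighbours t, Z t t' := by
        rw [← sum_add_distrib, mul_sum]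
        refine sum_congr rfl fun t ht => ?_
        rw [← sum_add_distrib, mul_sum]
        refine sum_congr rfl fun t' ht' => ?_
        exact hIJ t ht t' ht'
      linarith
    rw [hmain, sum_add_distrib, ← e1, sum_sub_distrib,
      sum_congr rfl hfac]
    simp only [sum_neg_distrib, sub_neg_eq_add]
    rfl
  set G := crossConst d * σ ^ (d - 1) with hG
  set k : ℝ := (d + 1) ^ 2 * σ ^ 2 * (1 + d * G) with hk
  set y : Finset (Vec d) → ℝ := fun t =>
    volume.real (simplex t) * ‖∑ c ∈ t, θ c • agrad (bary t c)‖ ^ 2 with hy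
  have hG0 : 0 ≤ G := mul_nonneg crossConst_nonneg (by positivity)
  have hysum : ∫ x in Ω, ‖w.grad x‖ ^ 2 = ∑ t ∈ 𝒯.elements, y t := by
    rw [Triangulation.integral_eq_sum (𝒯 := 𝒯) hΩ (integrable_norm_sq w.memLp_grad)]
    refine sum_congr rfl fun t ht => ?_
    simp only [hy]
    rw [← smul_eq_mul, ← setIntegral_const]
    refine integral_congr_ae ?_
    filter_upwards [hgrad t ht] with x hx
    rw [hx]
  have hk0 : 0 ≤ k := by positivity
  rw [hsum, hysum, Coefficients.oscSq]
  have hfin := sum_sq_le_of_sq_le (S := 𝒯.elements) (N := 𝒯.neighbours) (n := d + 1)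
    (fun t ht => Triangulation.card_neighbours_le hd1 ht)
    (X := fun t => ∫ x in simplex t, κ.residual f u.val x * W t x)
    (Z := Z)
    (α := fun t => meshSize t ^ 2 * meanDeviationSq volume (simplex t) (κ.residual f u.val))
    (γ := fun t t' => meshSize t *
      meanDeviationSq μHE[d - 1] (commonFacet t t') (κ.jump t t' u.val))
    (y := y) (κ := k) (fun t _ => by positivity)
    (fun t _ => mul_nonneg (sq_nonneg _) (integral_nonneg fun x => sq_nonneg _))
    (fun t ht t' _ => mul_nonneg (isElement ht).meshSize_pos.le
      (integral_nonneg fun x => sq_nonneg _)) hk0 ?_ ?_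
  · simp only [← mul_sum] at hfin ⊢
    refine hfin.trans (le_of_eq ?_)
    simp only [Coefficients.localOscSq, oscConst, ← hG, ← hk]
    push_cast
    ring
  · intro t ht
    have e := isElement ht
    have hRL : MemLp (κ.residual f u.val) 2 (volume.restrict (simplex t)) := by
      obtain ⟨K, hK⟩ := hqL t ht
      obtain ⟨C, hC⟩ := exists_abs_divergence_le hK
      have h1 : MemLp (divergence (q t)) 2 (volume.restrict (simplex t)) :=
        MemLp.of_bound (measurable_divergence _).aestronglyMeasurable C hC
      refine ((memLp_simplex hΩ ht (memLp_source hκ hf u)).sub h1).ae_eq ?_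
      filter_upwards [ae_mem_interior_simplex] with x hx
      have hdiv : divergence (κ.flux u.val) x = divergence (q t) x := by
        refine divergence_congr_of_eqOn (P := interior (simplex t)) (fun y hy => ?_) ?_
        · simp only [Coefficients.flux, hq, hpe t ht y hy,
            hβe (interior_simplex_subset hΩ ht hy)]
        · rwa [interior_interior]
      simp only [Coefficients.residual, hdiv, Pi.sub_apply]
      ring
    have hb := e.ae_abs_sum_chi_le (μ := volume) (isClosed_simplex t).measurableSet
      Subset.rfl (isCompact_simplex t).measure_lt_top
      (fun a ha => e.integral_chi hd1 ha) θ fun a ha b hb => abs_sub_nodal_le e θ ha hb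
    -- `W t` has mean zero, so the mean of the residual does not matter
    have h0 : ∫ x in simplex t, W t x = 0 := e.integral_sum_chi_eq_zero
      (isClosed_simplex t).measurableSet subset_rfl (isCompact_simplex t).measure_lt_top.ne
      (fun a ha => e.integral_chi hd1 ha) θ
    refine (sq_integral_mul_le_meanDeviationSq
      (isCompact_simplex t).measure_lt_top hRL
      (hWm t ht).aestronglyMeasurable hb h0).trans ?_
    have hdiam : diam (simplex t) ^ 2 ≤ σ ^ 2 * meshSize t ^ 2 := by
      rw [← mul_pow]
      exact pow_le_pow_left₀ diam_nonneg (hreg t ht) 2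
    have hdev : 0 ≤ meanDeviationSq volume (simplex t) (κ.residual f u.val) :=
      integral_nonneg fun x => sq_nonneg _
    set dev := meanDeviationSq volume (simplex t) (κ.residual f u.val)
    calc dev * (((d + 1) * (diam (simplex t) *
          ‖∑ c ∈ t, θ c • agrad (bary t c)‖)) ^ 2 * volume.real (simplex t))
        = (d + 1) ^ 2 * (diam (simplex t) ^ 2 * (dev * y t)) := by simp only [hy]; ring
      _ ≤ (d + 1) ^ 2 * ((σ ^ 2 * meshSize t ^ 2) * (dev * y t)) := by
          gcongr
      _ = ((d + 1) ^ 2 * σ ^ 2 * 1) * (meshSize t ^ 2 * dev) * y t := by ring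
      _ ≤ k * (meshSize t ^ 2 * dev) * y t := by
          have : (0 : ℝ) ≤ d * G := by positivity
          rw [hk]
          gcongr
          linarith
  · intro t ht t' ht'
    have e := isElement ht
    obtain ⟨v, hv, ht'e, hne, hsub⟩ := hnb t ht t' ht'
    obtain ⟨h1, -, -⟩ := Triangulation.neighbour_normal hd1 ht ht'e hne hv hsub
    have hmu := e.measure_facet_lt_top hd hv
    have hJL : MemLp (κ.jump t t' u.val) 2
        ((μHE[d - 1] : Measure (Vec d)).restrict (commonFacet t t')) := by
      obtain ⟨K, hK⟩ := hp t ht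
      obtain ⟨K', hK'⟩ := hp t' ht'e
      have hcont : Continuous fun x => (inner ℝ (n t t') (p t x - p t' x) : ℝ) :=
        continuous_const.inner (hK.continuous.sub hK'.continuous)
      obtain ⟨C, hC⟩ := (IsElement.isCompact_facet (t := t) (v := v)).exists_bound_of_continuousOn
        hcont.continuousOn
      rw [h1]
      have : IsFiniteMeasure ((μHE[d - 1] : Measure (Vec d)).restrict (facet t v)) :=
        ⟨by simpa using hmu⟩
      have hm := isClosed_facet (t := t) (v := v) |>.measurableSet
      have h2 : MemLp (fun x => (inner ℝ (n t t') (p t x - p t' x) : ℝ)) 2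
          ((μHE[d - 1] : Measure (Vec d)).restrict (facet t v)) :=
        MemLp.of_bound hcont.aestronglyMeasurable C
          (by filter_upwards [ae_restrict_mem hm] with x hx using hC x hx)
      refine h2.ae_eq ?_
      filter_upwards [ae_restrict_mem hm] with x hx
      exact (hjump t ht t' ht' x (h1 ▸ hx)).symm
    have h0 : ∫ x in facet t v, W t x ∂μHE[d - 1] = 0 :=
      e.integral_sum_chi_eq_zero isClosed_facet.measurableSet (fun x hx => hx.1) hmu.ne
        (fun a ha => e.integral_facet_chi hd hv ha) θ
    have h3 := sq_integral_mul_le_meanDeviationSq hmu (h1 ▸ hJL)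
      (hWm t ht).aestronglyMeasurable (hWb t ht v hv) h0
    rw [← h1] at h3
    have hmf : (μHE[d - 1] : Measure (Vec d)).real (commonFacet t t') * meshSize t ≤
        d * G * volume.real (simplex t) := by
      rw [h1, e.measure_facet hd hv]
      have := e.norm_agrad_mul_meshSize_le hd hv (hreg t ht)
      calc ‖agrad (bary t v)‖ * (d * volume.real (simplex t)) * meshSize t
          = (‖agrad (bary t v)‖ * meshSize t) * (d * volume.real (simplex t)) := by ring
        _ ≤ G * (d * volume.real (simplex t)) := by gcongr
        _ = _ := by ring
    have hdiam : diam (simplex t) ^ 2 ≤ σ ^ 2 * meshSize t ^ 2 := by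
      rw [← mul_pow]
      exact pow_le_pow_left₀ diam_nonneg (hreg t ht) 2
    have hdev : 0 ≤ meanDeviationSq μHE[d - 1] (commonFacet t t') (κ.jump t t' u.val) :=
      integral_nonneg fun x => sq_nonneg _
    set dev := meanDeviationSq μHE[d - 1] (commonFacet t t') (κ.jump t t' u.val)
    set A := ‖∑ c ∈ t, θ c • agrad (bary t c)‖
    set m := (μHE[d - 1] : Measure (Vec d)).real (commonFacet t t')
    have hms := e.meshSize_pos
    set J := ∫ x in commonFacet t t', κ.jump t t' u.val x * W t x ∂μHE[d - 1]
    calc (-1 / 2 * J) ^ 2 ≤ J ^ 2 := by nlinarith [sq_nonneg J]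
      _ ≤ dev * (((d + 1) * (diam (simplex t) * A)) ^ 2 * m) := h3
      _ = (d + 1) ^ 2 * dev * A ^ 2 * m * diam (simplex t) ^ 2 := by ring
      _ ≤ (d + 1) ^ 2 * dev * A ^ 2 * m * (σ ^ 2 * meshSize t ^ 2) := by gcongr
      _ = (d + 1) ^ 2 * dev * A ^ 2 * σ ^ 2 * meshSize t * (m * meshSize t) := by ring
      _ ≤ (d + 1) ^ 2 * dev * A ^ 2 * σ ^ 2 * meshSize t * (d * G * volume.real (simplex t)) := by
          gcongr
      _ = ((d + 1) ^ 2 * σ ^ 2 * (d * G)) * (meshSize t * dev) * y t := by simp only [hy]; ring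
      _ ≤ k * (meshSize t * dev) * y t := by
          rw [hk]
          gcongr
          linarith

/-! ### The Hilbert space `H¹₀` -/

theorem integrable_inner_of_memLp {α E : Type*} [MeasurableSpace α] {μ : Measure α}
    [NormedAddCommGroup E] [InnerProductSpace ℝ E] {F G : α → E} (hF : MemLp F 2 μ)
    (hG : MemLp G 2 μ) : Integrable (fun x => (inner ℝ (F x) (G x) : ℝ)) μ := by
  refine (L2.integrable_inner (𝕜 := ℝ) (hF.toLp F) (hG.toLp G)).congr ?_
  filter_upwards [hF.coeFn_toLp, hG.coeFn_toLp] with x h1 h2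
  rw [h1, h2]

namespace IsTest

variable {φ ψ : Vec d → ℝ}

theorem lin (hφ : IsTest Ω φ) (hψ : IsTest Ω ψ) (α β : ℝ) :
    IsTest Ω (fun x => α * φ x + β * ψ x) := by
  refine ⟨(contDiff_const.mul hφ.1).add (contDiff_const.mul hψ.1), ?_, ?_⟩
  · exact (hφ.2.1.mul_left (f := fun _ => α)).add (hψ.2.1.mul_left (f := fun _ => β))
  · refine (tsupport_add (fun x => α * φ x) (fun x => β * ψ x)).trans (union_subset ?_ ?_)
    · exact (tsupport_mul_subset_right (f := fun _ => α) (g := φ)).trans hφ.2.2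
    · exact (tsupport_mul_subset_right (f := fun _ => β) (g := ψ)).trans hψ.2.2

theorem contDiff_one (hφ : IsTest Ω φ) : ContDiff ℝ 1 φ := hφ.1.of_le (by exact_mod_cast le_top)

theorem differentiableAt (hφ : IsTest Ω φ) (x : Vec d) : DifferentiableAt ℝ φ x :=
  (hφ.contDiff_one.differentiable (by norm_num)) x

theorem gradient_lin (hφ : IsTest Ω φ) (hψ : IsTest Ω ψ) (α β : ℝ) (x : Vec d) :
    gradient (fun x => α * φ x + β * ψ x) x = α • gradient φ x + β • gradient ψ x := by
  refine HasGradientAt.gradient ?_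
  rw [hasGradientAt_iff_hasFDerivAt]
  have h1 := (hφ.differentiableAt x).hasGradientAt.hasFDerivAt.const_smul α
  have h2 := (hψ.differentiableAt x).hasGradientAt.hasFDerivAt.const_smul β
  rw [map_add, map_smulₛₗ, map_smulₛₗ]
  exact h1.add h2

theorem inner_gradient (hφ : IsTest Ω φ) (x v : Vec d) :
    inner ℝ (gradient φ x) v = fderiv ℝ φ x v := by
  have h := (hφ.differentiableAt x).hasGradientAt.hasFDerivAt.fderiv
  rw [h]; rfl

theorem gradient_apply (hφ : IsTest Ω φ) (x : Vec d) (i : Fin d) :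
    gradient φ x i = fderiv ℝ φ x (unitVec i) := by
  rw [← hφ.inner_gradient, real_inner_comm, unitVec_inner]

theorem continuous_gradient (hφ : IsTest Ω φ) : Continuous (gradient φ) :=
  (InnerProductSpace.toDual ℝ (Vec d)).symm.continuous.comp
    (hφ.contDiff_one.continuous_fderiv (by norm_num))

theorem hasCompactSupport_gradient (hφ : IsTest Ω φ) : HasCompactSupport (gradient φ) :=
  (hφ.2.1.fderiv ℝ).comp_left (g := fun L => (InnerProductSpace.toDual ℝ (Vec d)).symm L)
    (by simp)

theorem eq_zero_of_notMem (hφ : IsTest Ω φ) (hx : x ∉ Ω) :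
    φ x = 0 ∧ fderiv ℝ φ x = 0 := by
  have h : x ∉ tsupport φ := fun h => hx (hφ.2.2 h)
  refine ⟨image_eq_zero_of_notMem_tsupport h, ?_⟩
  have := notMem_subset (support_fderiv_subset ℝ) h
  simpa using this

theorem gradient_eq_zero_of_notMem (hφ : IsTest Ω φ) (hx : x ∉ Ω) :
    gradient φ x = 0 := by
  rw [gradient, (hφ.eq_zero_of_notMem hx).2, map_zero]

theorem memLp_fderiv (hφ : IsTest Ω φ) (v : Vec d) (μ : Measure (Vec d))
    [IsFiniteMeasureOnCompacts μ] :
    MemLp (fun x => fderiv ℝ φ x v) 2 μ := by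
  refine Continuous.memLp_of_hasCompactSupport
    ((hφ.contDiff_one.continuous_fderiv (by norm_num)).clm_apply continuous_const) ?_
  exact (hφ.2.1.fderiv ℝ).comp_left (g := fun L : Vec d →L[ℝ] ℝ => L v) (by simp)

theorem memLp (hφ : IsTest Ω φ) (μ : Measure (Vec d)) [IsFiniteMeasureOnCompacts μ] :
    MemLp φ 2 μ :=
  hφ.1.continuous.memLp_of_hasCompactSupport hφ.2.1

theorem memLp_gradient (hφ : IsTest Ω φ) (μ : Measure (Vec d)) [IsFiniteMeasureOnCompacts μ] :
    MemLp (gradient φ) 2 μ :=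
  hφ.continuous_gradient.memLp_of_hasCompactSupport hφ.hasCompactSupport_gradient

end IsTest

namespace H1

theorem ext_fields {u v : H1 Ω} (h1 : u.val = v.val) (h2 : u.grad = v.grad) : u = v := by
  cases u; cases v
  subst h1; subst h2
  rfl

/-- A linear combination in `H¹(Ω)`. -/
noncomputable def lin (α β : ℝ) (u v : H1 Ω) : H1 Ω where
  val x := α * u.val x + β * v.val x
  grad x := α • u.grad x + β • v.grad x
  memLp_val := (u.memLp_val.const_mul α).add (v.memLp_val.const_mul β)
  memLp_grad := (u.memLp_grad.const_smul α).add (v.memLp_grad.const_smul β)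
  weak i φ hφ := by
    have hu := u.weak i φ hφ
    have hv := v.weak i φ hφ
    have i1 : ∀ w : H1 Ω, Integrable (fun x => w.val x * fderiv ℝ φ x (unitVec i))
        (volume.restrict Ω) := fun w =>
      MemLp.integrable_mul (p := 2) (q := 2) w.memLp_val (hφ.memLp_fderiv _ _)
    have i2 : ∀ w : H1 Ω, Integrable (fun x => w.grad x i * φ x) (volume.restrict Ω) := fun w =>
      MemLp.integrable_mul (p := 2) (q := 2) (w.memLp_grad.eval_piLp i) (hφ.memLp _)
    have e1 : ∫ x in Ω, (α * u.val x + β * v.val x) * fderiv ℝ φ x (unitVec i) =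
        ∫ x in Ω, (α * (u.val x * fderiv ℝ φ x (unitVec i)) +
          β * (v.val x * fderiv ℝ φ x (unitVec i))) :=
      integral_congr_ae (.of_forall fun x => by ring)
    have e2 : ∫ x in Ω, (α • u.grad x + β • v.grad x) i * φ x =
        ∫ x in Ω, (α * (u.grad x i * φ x) + β * (v.grad x i * φ x)) :=
      integral_congr_ae (.of_forall fun x => by
        simp only [PiLp.add_apply, PiLp.smul_apply, smul_eq_mul]; ring)
    rw [e1, e2, integral_add ((i1 u).const_mul _) ((i1 v).const_mul _),
      integral_add ((i2 u).const_mul _) ((i2 v).const_mul _), integral_const_mul,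
      integral_const_mul, integral_const_mul, integral_const_mul, hu, hv]
    ring

/-- A test function as an element of `H¹(Ω)`. -/
noncomputable def ofTest {φ : Vec d → ℝ} (hφ : IsTest Ω φ) : H1 Ω where
  val := φ
  grad := gradient φ
  memLp_val := hφ.memLp _
  memLp_grad := hφ.memLp_gradient _
  weak i ψ hψ := by
    have e1 : ∫ x in Ω, φ x * fderiv ℝ ψ x (unitVec i) = ∫ x, φ x * fderiv ℝ ψ x (unitVec i) :=
      setIntegral_eq_integral_of_forall_compl_eq_zero fun x hx => by
        rw [(hφ.eq_zero_of_notMem hx).1, zero_mul]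
    have e2 : ∫ x in Ω, gradient φ x i * ψ x = ∫ x, fderiv ℝ φ x (unitVec i) * ψ x := by
      simp_rw [hφ.gradient_apply]
      exact setIntegral_eq_integral_of_forall_compl_eq_zero fun x hx => by
        rw [(hψ.eq_zero_of_notMem hx).1, mul_zero]
    rw [e1, e2]
    refine integral_mul_fderiv_eq_neg_fderiv_mul_of_integrable ?_ ?_ ?_
      (fun x _ => hφ.differentiableAt x) (fun x _ => hψ.differentiableAt x)
    · exact MemLp.integrable_mul (p := 2) (q := 2) (hφ.memLp_fderiv _ _) (hψ.memLp _)
    · exact MemLp.integrable_mul (p := 2) (q := 2) (hφ.memLp _) (hψ.memLp_fderiv _ _)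
    · exact MemLp.integrable_mul (p := 2) (q := 2) (hφ.memLp _) (hψ.memLp _)

theorem inH10_ofTest {φ : Vec d → ℝ} (hφ : IsTest Ω φ) : (ofTest hφ).InH10 :=
  ⟨fun _ => φ, fun _ => hφ, by simp [ofTest], by simp [ofTest]⟩

/-- The space `L²(Ω) × L²(Ω)^d` with its Hilbert space structure. -/
abbrev Ambient (Ω : Set (Vec d)) : Type :=
  WithLp 2 (Lp ℝ 2 (volume.restrict Ω) × Lp (Vec d) 2 (volume.restrict Ω))

/-- The embedding of `H¹(Ω)` by `v ↦ (v, ∇v)`. -/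
noncomputable def toAmbient (v : H1 Ω) : Ambient Ω :=
  WithLp.toLp 2 (v.memLp_val.toLp v.val, v.memLp_grad.toLp v.grad)

theorem toAmbient_lin (α β : ℝ) (u v : H1 Ω) :
    toAmbient (lin α β u v) = α • toAmbient u + β • toAmbient v := by
  apply WithLp.ofLp_injective
  rfl

theorem toAmbient_eq_iff {u v : H1 Ω} : toAmbient u = toAmbient v ↔
    u.val =ᵐ[volume.restrict Ω] v.val ∧ u.grad =ᵐ[volume.restrict Ω] v.grad := by
  rw [← MemLp.toLp_eq_toLp_iff u.memLp_val v.memLp_val,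
    ← MemLp.toLp_eq_toLp_iff u.memLp_grad v.memLp_grad]
  constructor
  · intro h
    exact ⟨congrArg WithLp.fst h, congrArg WithLp.snd h⟩
  · rintro ⟨h1, h2⟩
    rw [toAmbient, toAmbient, h1, h2]

theorem norm_toLp_sq {E : Type*} [NormedAddCommGroup E] [InnerProductSpace ℝ E]
    {α : Type*} [MeasurableSpace α] {μ : Measure α} {F : α → E} (hF : MemLp F 2 μ) :
    ‖hF.toLp F‖ ^ 2 = ∫ x, ‖F x‖ ^ 2 ∂μ := by
  rw [← real_inner_self_eq_norm_sq, L2.inner_def]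
  refine integral_congr_ae ?_
  filter_upwards [hF.coeFn_toLp] with x hx
  rw [hx, real_inner_self_eq_norm_sq]

theorem norm_toAmbient_sq (v : H1 Ω) : ‖toAmbient v‖ ^ 2 = h1NormSq Ω v.val v.grad := by
  rw [WithLp.prod_norm_sq_eq_of_L2, h1NormSq]
  refine congrArg₂ (· + ·) ?_ (norm_toLp_sq v.memLp_grad)
  refine (norm_toLp_sq v.memLp_val).trans ?_
  simp

theorem norm_toAmbient (v : H1 Ω) : ‖toAmbient v‖ = √(h1NormSq Ω v.val v.grad) := by
  rw [← norm_toAmbient_sq, Real.sqrt_sq (norm_nonneg _)]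

theorem tendsto_toLp_iff {ι α E : Type*} [MeasurableSpace α] {μ : Measure α}
    [NormedAddCommGroup E] {l : Filter ι} {F : ι → α → E} {f : α → E} (hF : ∀ n, MemLp (F n) 2 μ)
    (hf : MemLp f 2 μ) : Tendsto (fun n => (hF n).toLp (F n)) l (𝓝 (hf.toLp f)) ↔
      Tendsto (fun n => eLpNorm (fun x => f x - F n x) 2 μ) l (𝓝 0) := by
  rw [Lp.tendsto_Lp_iff_tendsto_eLpNorm'' F hF f hf]
  have e : ∀ n, eLpNorm (F n - f) 2 μ = eLpNorm (fun x => f x - F n x) 2 μ := fun n =>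
    eLpNorm_sub_comm _ _ _ _
  simp_rw [e]

theorem tendsto_toAmbient_iff {ι : Type*} {l : Filter ι} {v : ι → H1 Ω} {u : H1 Ω} :
    Tendsto (fun n => toAmbient (v n)) l (𝓝 (toAmbient u)) ↔
      Tendsto (fun n => eLpNorm (fun x => u.val x - (v n).val x) 2 (volume.restrict Ω)) l (𝓝 0) ∧
      Tendsto (fun n => eLpNorm (fun x => u.grad x - (v n).grad x) 2 (volume.restrict Ω))
        l (𝓝 0) := by
  rw [← tendsto_toLp_iff (fun n => (v n).memLp_val) u.memLp_val,
    ← tendsto_toLp_iff (fun n => (v n).memLp_grad) u.memLp_grad]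
  refine Iff.trans (b := Tendsto (fun n => ((v n).memLp_val.toLp (v n).val,
    (v n).memLp_grad.toLp (v n).grad)) l (𝓝 (u.memLp_val.toLp u.val, u.memLp_grad.toLp u.grad)))
    ⟨((WithLp.prod_continuous_ofLp 2 _ _).tendsto _).comp,
      ((WithLp.prod_continuous_toLp 2 _ _).tendsto _).comp⟩ ?_
  rw [nhds_prod_eq, tendsto_prod_iff']

/-- The test functions as a subspace of `L²(Ω) × L²(Ω)^d`. -/
noncomputable def testSubmodule (Ω : Set (Vec d)) : Submodule ℝ (Ambient Ω) where
  carrier := {x | ∃ (φ : Vec d → ℝ) (hφ : IsTest Ω φ), toAmbient (ofTest hφ) = x}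
  zero_mem' := by
    have h0 : IsTest Ω (fun _ => (0 : ℝ)) :=
      ⟨contDiff_const, HasCompactSupport.zero, by simp [tsupport]⟩
    refine ⟨_, h0, ?_⟩
    have h2 : lin 0 0 (ofTest h0) (ofTest h0) = ofTest h0 := by
      have : gradient (fun _ : Vec d => (0 : ℝ)) = 0 := by
        ext1 x; simp [gradient]
      refine ext_fields (funext fun x => ?_) (funext fun x => ?_)
      · simp [lin, ofTest]
      · simp [lin, ofTest, this]
    rw [← h2, toAmbient_lin, zero_smul, zero_add]
  add_mem' := by
    rintro _ _ ⟨φ, hφ, rfl⟩ ⟨ψ, hψ, rfl⟩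
    refine ⟨_, hφ.lin hψ 1 1, ?_⟩
    rw [← one_smul ℝ (toAmbient (ofTest hφ)), ← one_smul ℝ (toAmbient (ofTest hψ)),
      ← toAmbient_lin]
    congr 1
    exact ext_fields rfl (funext fun x => hφ.gradient_lin hψ 1 1 x)
  smul_mem' := by
    rintro c _ ⟨φ, hφ, rfl⟩
    refine ⟨_, hφ.lin hφ c 0, ?_⟩
    have h : c • toAmbient (ofTest hφ) =
        c • toAmbient (ofTest hφ) + (0 : ℝ) • toAmbient (ofTest hφ) := by
      rw [zero_smul, add_zero]
    rw [h, ← toAmbient_lin]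
    congr 1
    exact ext_fields rfl (funext fun x => hφ.gradient_lin hφ c 0 x)

/-- `H¹₀(Ω)` as a closed subspace of `L²(Ω) × L²(Ω)^d`. -/
noncomputable def space (Ω : Set (Vec d)) : Submodule ℝ (Ambient Ω) :=
  (testSubmodule Ω).topologicalClosure

theorem toAmbient_mem_space {v : H1 Ω} (hv : v.InH10) : toAmbient v ∈ space Ω := by
  obtain ⟨φ, hφ, h1, h2⟩ := hv
  have h : Tendsto (fun n => toAmbient (ofTest (hφ n))) atTop (𝓝 (toAmbient v)) :=
    tendsto_toAmbient_iff.2 ⟨h1, h2⟩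
  exact mem_closure_of_tendsto h (.of_forall fun n => ⟨_, hφ n, rfl⟩)

theorem tendsto_integral_mul {α : Type*} [MeasurableSpace α] {μ : Measure α} {F : ℕ → α → ℝ}
    {f g : α → ℝ} (hF : ∀ n, MemLp (F n) 2 μ) (hf : MemLp f 2 μ) (hg : MemLp g 2 μ)
    (h : Tendsto (fun n => eLpNorm (fun x => f x - F n x) 2 μ) atTop (𝓝 0)) :
    Tendsto (fun n => ∫ x, F n x * g x ∂μ) atTop (𝓝 (∫ x, f x * g x ∂μ)) := by
  have h1 := (tendsto_toLp_iff hF hf).2 h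
  have h2 : ∀ k : α → ℝ, ∀ hk : MemLp k 2 μ, inner ℝ (hg.toLp g) (hk.toLp k) =
      ∫ x, k x * g x ∂μ := by
    intro k hk
    rw [L2.inner_def]
    refine integral_congr_ae ?_
    filter_upwards [hk.coeFn_toLp, hg.coeFn_toLp] with x hx1 hx2
    rw [hx1, hx2]; simp
  have h3 := (continuous_const (y := hg.toLp g)).inner (𝕜 := ℝ) (continuous_id) |>.tendsto
    (hf.toLp f) |>.comp h1
  simp only [Function.comp_def, id] at h3
  rw [h2] at h3
  simpa only [h2] using h3

/-- The closure of the test functions consists of `H¹₀` functions. -/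
theorem exists_of_mem_space {x : Ambient Ω} (hx : x ∈ space Ω) :
    ∃ v : H1 Ω, v.InH10 ∧ toAmbient v = x := by
  obtain ⟨y, hy, hlim⟩ := mem_closure_iff_seq_limit.1 hx
  choose φ hφ hφy using hy
  have e1 : MemLp.toLp (x.fst : Vec d → ℝ) (Lp.memLp x.fst) = x.fst := Lp.toLp_coeFn _ _
  have e2 : MemLp.toLp (x.snd : Vec d → Vec d) (Lp.memLp x.snd) = x.snd := Lp.toLp_coeFn _ _
  obtain rfl : (fun n => toAmbient (ofTest (hφ n))) = y := funext hφy
  have h := ((WithLp.prod_continuous_ofLp 2 _ _).tendsto x).comp hlim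
  have l1 := (continuous_fst.tendsto _).comp h
  have l2 := (continuous_snd.tendsto _).comp h
  have l1' : Tendsto (fun n => eLpNorm (fun y => x.fst y - φ n y) 2 (volume.restrict Ω)) atTop
      (𝓝 0) :=
    (tendsto_toLp_iff (fun n => (hφ n).memLp _) (Lp.memLp x.fst)).1 (by rw [e1]; exact l1)
  have l2' : Tendsto (fun n => eLpNorm (fun y => x.snd y - gradient (φ n) y) 2
      (volume.restrict Ω)) atTop (𝓝 0) :=
    (tendsto_toLp_iff (fun n => (hφ n).memLp_gradient _) (Lp.memLp x.snd)).1
      (by rw [e2]; exact l2)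
  refine ⟨⟨x.fst, x.snd, Lp.memLp _, Lp.memLp _, fun i ψ hψ => ?_⟩, ⟨φ, hφ, l1', l2'⟩, ?_⟩
  · have t1 := tendsto_integral_mul (fun n => (hφ n).memLp _) (Lp.memLp x.fst)
      (hψ.memLp_fderiv (unitVec i) _) l1'
    have l3 : Tendsto (fun n => eLpNorm (fun y => x.snd y i - gradient (φ n) y i) 2
        (volume.restrict Ω)) atTop (𝓝 0) := by
      refine tendsto_of_tendsto_of_tendsto_of_le_of_le tendsto_const_nhds l2' (fun _ => zero_le)
        fun n => eLpNorm_mono fun y => ?_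
      have := PiLp.norm_apply_le (x.snd y - gradient (φ n) y) i
      simpa using this
    have t2 := tendsto_integral_mul
      (fun n => ((hφ n).memLp_gradient (volume.restrict Ω)).eval_piLp i)
      ((Lp.memLp x.snd).eval_piLp i) (hψ.memLp (volume.restrict Ω)) l3
    have h3 : ∀ n, ∫ y in Ω, φ n y * fderiv ℝ ψ y (unitVec i) =
        -∫ y in Ω, gradient (φ n) y i * ψ y := fun n => (ofTest (hφ n)).weak i ψ hψ
    have t3 := t2.neg.congr fun n => (h3 n).symm
    exact tendsto_nhds_unique t1 t3
  · apply WithLp.ofLp_injective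
    change (MemLp.toLp (x.fst : Vec d → ℝ) (Lp.memLp x.fst),
      MemLp.toLp (x.snd : Vec d → Vec d) (Lp.memLp x.snd)) = _
    rw [e1, e2]
    rfl

theorem inH10_of_toAmbient_mem {v : H1 Ω} (h : v.toAmbient ∈ space Ω) : v.InH10 := by
  obtain ⟨w, ⟨φ, hφ, h1, h2⟩, hw⟩ := exists_of_mem_space h
  have hlim := tendsto_toAmbient_iff (v := fun n => ofTest (hφ n)).2 ⟨h1, h2⟩
  rw [hw] at hlim
  have h3 := tendsto_toAmbient_iff.1 hlim
  exact ⟨φ, hφ, h3.1, h3.2⟩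

theorem InH10.lin {u v : H1 Ω} (hu : u.InH10) (hv : v.InH10) (α β : ℝ) :
    (H1.lin α β u v).InH10 := by
  refine inH10_of_toAmbient_mem ?_
  rw [toAmbient_lin]
  exact Submodule.add_mem _ (Submodule.smul_mem _ _ (toAmbient_mem_space hu))
    (Submodule.smul_mem _ _ (toAmbient_mem_space hv))

end H1

/-! ### The bilinear form and the dual problem -/

theorem aestronglyMeasurable_finsetSum {α ι β : Type*} [MeasurableSpace α] [TopologicalSpace β]
    [TopologicalSpace.PseudoMetrizableSpace β] {S : Finset ι} {μ : ι → Measure α} {f : α → β}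
    (h : ∀ i ∈ S, AEStronglyMeasurable f (μ i)) : AEStronglyMeasurable f (∑ i ∈ S, μ i) := by
  classical
  have : ∑ i ∈ S, μ i = Measure.sum fun i : {i // i ∈ S} => μ i.1 := by
    rw [Measure.sum_fintype]
    exact (sum_coe_sort S μ).symm
  rw [this]
  exact AEStronglyMeasurable.sum_measure fun i => h i.1 i.2

theorem exists_norm_le_of_lipschitzOnWith {E F : Type*} [PseudoMetricSpace E]
    [SeminormedAddCommGroup F] {f : E → F} {K : ℝ≥0} {S : Set E} (hf : LipschitzOnWith K f S)
    (hS : Bornology.IsBounded S) : ∃ C : ℝ, ∀ x ∈ S, ‖f x‖ ≤ C := by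
  rcases S.eq_empty_or_nonempty with h | ⟨x₀, hx₀⟩
  · exact ⟨0, by simp [h]⟩
  refine ⟨K * diam S + ‖f x₀‖, fun x hx => ?_⟩
  have h1 := hf.dist_le_mul x hx x₀ hx₀
  have h2 : (K : ℝ) * dist x x₀ ≤ K * diam S :=
    mul_le_mul_of_nonneg_left (dist_le_diam_of_mem hS hx hx₀) K.2
  rw [dist_eq_norm] at h1
  linarith [norm_le_norm_sub_add (f x) (f x₀)]

namespace Coefficients

theorem memLp_top_A (hΩ : IsLipschitzDomain Ω) (hκ : κ.Admissible 𝒯) :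
    MemLp κ.A ⊤ (volume.restrict Ω) := by
  have hb : ∀ t ∈ 𝒯.elements, ∃ C : ℝ, ∀ x ∈ interior (simplex t), ‖κ.A x‖ ≤ C := by
    intro t ht
    obtain ⟨K, hK⟩ := hκ.A_lipschitz t ht
    exact exists_norm_le_of_lipschitzOnWith hK
      ((isCompact_simplex t).isBounded.subset interior_subset)
  choose! C hC using hb
  refine memLp_top_of_bound ?_ (∑ t ∈ 𝒯.elements, |C t|) ?_
  · rw [Triangulation.restrict_eq_sum (𝒯 := 𝒯) hΩ]
    refine aestronglyMeasurable_finsetSum fun t ht => ?_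
    obtain ⟨K, hK⟩ := hκ.A_lipschitz t ht
    obtain ⟨A', hA', hAe⟩ := hK.extend_finite_dimension
    refine ⟨A', hA'.continuous.stronglyMeasurable, ?_⟩
    filter_upwards [ae_mem_interior_simplex] with x hx using hAe hx
  · rw [Triangulation.restrict_eq_sum (𝒯 := 𝒯) hΩ, ae_finsetSum_measure_iff]
    intro t ht
    filter_upwards [ae_mem_interior_simplex] with x hx
    exact ((hC t ht x hx).trans (le_abs_self _)).trans
      (single_le_sum (f := fun t => |C t|) (fun _ _ => abs_nonneg _) ht)

theorem memLp_top_b (hΩ : IsLipschitzDomain Ω) (hκ : κ.Admissible 𝒯) :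
    MemLp κ.b ⊤ (volume.restrict Ω) := by
  obtain ⟨K, hK⟩ := hκ.b_lipschitz
  obtain ⟨C, hC⟩ := exists_norm_le_of_lipschitzOnWith hK hΩ.isBounded
  refine memLp_top_of_bound (hK.continuousOn.aestronglyMeasurable hΩ.isOpen.measurableSet) C ?_
  filter_upwards [ae_restrict_mem hΩ.isOpen.measurableSet] with x hx
    using hC x hx

theorem memLp_flux (hΩ : IsLipschitzDomain Ω) (hκ : κ.Admissible 𝒯) (v : H1 Ω) :
    MemLp (fun x => κ.A x (v.grad x) - v.val x • κ.b x) 2 (volume.restrict Ω) := by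
  have h1 : MemLp (fun x => v.val x • κ.b x) 2 (volume.restrict Ω) :=
    (memLp_top_b hΩ hκ).smul v.memLp_val (r := 2)
  have h2 := (ContinuousLinearMap.id ℝ (Vec d →L[ℝ] Vec d)).memLp_of_bilin (r := 2)
    (memLp_top_A hΩ hκ) v.memLp_grad
  exact MemLp.sub h2 h1

theorem integrable_form (hΩ : IsLipschitzDomain Ω) (hκ : κ.Admissible 𝒯) (v w : H1 Ω) :
    Integrable (fun x => (inner ℝ (κ.A x (v.grad x) - v.val x • κ.b x) (w.grad x) : ℝ))
      (volume.restrict Ω) ∧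
    Integrable (fun x => κ.c x * v.val x * w.val x) (volume.restrict Ω) :=
  ⟨integrable_inner_of_memLp (memLp_flux hΩ hκ v) w.memLp_grad,
    MemLp.integrable_mul (p := 2) (q := 2) (memLp_top_mul hκ.c_memLp v.memLp_val) w.memLp_val⟩

theorem integral_linearCombination {F G : Vec d → ℝ} {μ : Measure (Vec d)} (hF : Integrable F μ)
    (hG : Integrable G μ) (α β : ℝ) :
    ∫ x, (α * F x + β * G x) ∂μ = α * ∫ x, F x ∂μ + β * ∫ x, G x ∂μ := by
  rw [integral_add (hF.const_mul _) (hG.const_mul _), integral_const_mul, integral_const_mul]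

theorem form_lin_left (hΩ : IsLipschitzDomain Ω) (hκ : κ.Admissible 𝒯) (α β : ℝ) (u v w : H1 Ω) :
    κ.form (H1.lin α β u v) w = α * κ.form u w + β * κ.form v w := by
  obtain ⟨iu1, iu2⟩ := integrable_form hΩ hκ u w
  obtain ⟨iv1, iv2⟩ := integrable_form hΩ hκ v w
  have e1 : ∫ x in Ω, (inner ℝ (κ.A x ((H1.lin α β u v).grad x) -
      (H1.lin α β u v).val x • κ.b x) (w.grad x) : ℝ) =
      ∫ x in Ω, (α * inner ℝ (κ.A x (u.grad x) - u.val x • κ.b x) (w.grad x) +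
        β * inner ℝ (κ.A x (v.grad x) - v.val x • κ.b x) (w.grad x)) := by
    refine integral_congr_ae (.of_forall fun x => ?_)
    simp only [H1.lin, map_add, map_smul]
    rw [← real_inner_smul_left, ← real_inner_smul_left, ← inner_add_left]
    congr 1
    module
  have e2 : ∫ x in Ω, κ.c x * (H1.lin α β u v).val x * w.val x =
      ∫ x in Ω, (α * (κ.c x * u.val x * w.val x) + β * (κ.c x * v.val x * w.val x)) := by
    refine integral_congr_ae (.of_forall fun x => ?_)
    simp only [H1.lin]; ring
  rw [form, e1, e2, integral_linearCombination iu1 iv1, integral_linearCombination iu2 iv2, form,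
    form]
  ring

theorem form_lin_right (hΩ : IsLipschitzDomain Ω) (hκ : κ.Admissible 𝒯) (α β : ℝ)
    (w u v : H1 Ω) :
    κ.form w (H1.lin α β u v) = α * κ.form w u + β * κ.form w v := by
  obtain ⟨iu1, iu2⟩ := integrable_form hΩ hκ w u
  obtain ⟨iv1, iv2⟩ := integrable_form hΩ hκ w v
  have e1 : ∫ x in Ω, (inner ℝ (κ.A x (w.grad x) - w.val x • κ.b x)
      ((H1.lin α β u v).grad x) : ℝ) =
      ∫ x in Ω, (α * inner ℝ (κ.A x (w.grad x) - w.val x • κ.b x) (u.grad x) +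
        β * inner ℝ (κ.A x (w.grad x) - w.val x • κ.b x) (v.grad x)) := by
    refine integral_congr_ae (.of_forall fun x => ?_)
    simp only [H1.lin, inner_add_right, inner_smul_right]
  have e2 : ∫ x in Ω, κ.c x * w.val x * (H1.lin α β u v).val x =
      ∫ x in Ω, (α * (κ.c x * w.val x * u.val x) + β * (κ.c x * w.val x * v.val x)) := by
    refine integral_congr_ae (.of_forall fun x => ?_)
    simp only [H1.lin]; ring
  rw [form, e1, e2, integral_linearCombination iu1 iv1, integral_linearCombination iu2 iv2, form,
    form]
  ring

theorem form_congr {u u' w w' : H1 Ω} (hu : u.toAmbient = u'.toAmbient)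
    (hw : w.toAmbient = w'.toAmbient) : κ.form u w = κ.form u' w' := by
  obtain ⟨h1, h2⟩ := H1.toAmbient_eq_iff.1 hu
  obtain ⟨h3, h4⟩ := H1.toAmbient_eq_iff.1 hw
  rw [form, form]
  congr 1
  · refine integral_congr_ae ?_
    filter_upwards [h1, h2, h4] with x e1 e2 e4
    rw [e1, e2, e4]
  · refine integral_congr_ae ?_
    filter_upwards [h1, h3] with x e1 e2
    rw [e1, e2]

end Coefficients

/-- The Poincaré-Friedrichs inequality for test functions. -/
theorem IsTest.poincare (hd : 1 ≤ d) (hb : Bornology.IsBounded Ω) {D : ℝ}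
    (hD : diam Ω ≤ D) {φ : Vec d → ℝ} (hφ : IsTest Ω φ) :
    ∫ x, φ x ^ 2 ≤ 4 * D ^ 2 * ∫ x, ‖gradient φ x‖ ^ 2 := by
  rcases Ω.eq_empty_or_nonempty with hΩ | ⟨x₀, hx₀⟩
  · have : φ = 0 := funext fun x => (hφ.eq_zero_of_notMem (x := x) (by rw [hΩ]; simp)).1
    rw [this]
    simp only [Pi.zero_apply, ne_eq, OfNat.ofNat_ne_zero, not_false_eq_true, zero_pow,
      integral_zero]
    exact mul_nonneg (by positivity) (integral_nonneg fun x => by positivity)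
  set i : Fin d := ⟨0, hd⟩
  set P := ∫ x, φ x ^ 2 with hP
  set Q := ∫ x, ‖gradient φ x‖ ^ 2
  have hP0 : 0 ≤ P := integral_nonneg fun x => sq_nonneg _
  have hL : MemLp φ 2 := hφ.memLp _
  have hG : MemLp (fun x => fderiv ℝ φ x (unitVec i)) 2 := hφ.memLp_fderiv _ _
  -- integrate by parts against the coordinate function
  have hcoord : ∀ x : Vec d, HasFDerivAt (fun x : Vec d => x i - x₀ i)
      (EuclideanSpace.proj i : Vec d →L[ℝ] ℝ) x := fun x =>
    ((EuclideanSpace.proj i : Vec d →L[ℝ] ℝ).hasFDerivAt (x := x)).sub_const (x₀ i)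
  have hmem : MemLp (fun x => (x i - x₀ i) * φ x) 2 := by
    refine Continuous.memLp_of_hasCompactSupport ?_ hφ.2.1.mul_left
    exact ((EuclideanSpace.proj i : Vec d →L[ℝ] ℝ).continuous.sub continuous_const).mul
      hφ.1.continuous
  have hsq : ∀ x, HasFDerivAt (fun x => φ x ^ 2) ((2 * φ x) • fderiv ℝ φ x) x := fun x => by
    have := (hφ.differentiableAt x).hasFDerivAt.pow 2
    simpa using this
  have hibp : ∫ x, (x i - x₀ i) * fderiv ℝ (fun x => φ x ^ 2) x (unitVec i) =
      -∫ x, fderiv ℝ (fun x : Vec d => x i - x₀ i) x (unitVec i) * φ x ^ 2 := by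
    refine integral_mul_fderiv_eq_neg_fderiv_mul_of_integrable ?_ ?_ ?_
      (fun x _ => (hcoord x).differentiableAt) (fun x _ => (hsq x).differentiableAt)
    · simp_rw [(hcoord _).fderiv]
      exact hL.integrable_sq.const_mul _
    · refine ((hmem.integrable_mul hG).const_mul 2).congr (.of_forall fun x => ?_)
      simp only [(hsq x).fderiv, smul_apply, smul_eq_mul, Pi.mul_apply]
      ring
    · refine (hmem.integrable_mul hL).congr (.of_forall fun x => ?_)
      simp only [Pi.mul_apply]; ring
  have h1 : P = -∫ x, 2 * ((x i - x₀ i) * φ x * fderiv ℝ φ x (unitVec i)) := by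
    have e1 : ∫ x, fderiv ℝ (fun x : Vec d => x i - x₀ i) x (unitVec i) * φ x ^ 2 = P := by
      refine integral_congr_ae (.of_forall fun x => ?_)
      simp only [(hcoord x).fderiv]
      simp [unitVec]
    rw [e1] at hibp
    rw [← neg_eq_iff_eq_neg, ← hibp]
    refine integral_congr_ae (.of_forall fun x => ?_)
    simp only [(hsq x).fderiv, smul_apply, smul_eq_mul]
    ring
  have h2 : P ^ 2 ≤ 4 * ((∫ x, ((x i - x₀ i) * φ x) ^ 2) *
      ∫ x, (fderiv ℝ φ x (unitVec i)) ^ 2) := by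
    rw [h1, integral_const_mul, neg_sq, mul_pow]
    have := sq_integral_mul_le hmem hG
    linarith
  have h3 : ∫ x, ((x i - x₀ i) * φ x) ^ 2 ≤ D ^ 2 * P := by
    rw [hP, ← integral_const_mul]
    refine integral_mono hmem.integrable_sq (hL.integrable_sq.const_mul _) fun x => ?_
    by_cases hx : x ∈ Ω
    · have : |x i - x₀ i| ≤ D := by
        have h4 := PiLp.norm_apply_le (x - x₀) i
        rw [← dist_eq_norm] at h4
        exact (h4.trans (dist_le_diam_of_mem hb hx hx₀)).trans hD
      simp only [mul_pow]
      refine mul_le_mul_of_nonneg_right ?_ (sq_nonneg _)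
      exact sq_le_sq' (by linarith [neg_abs_le (x i - x₀ i)]) ((le_abs_self _).trans this)
    · simp [(hφ.eq_zero_of_notMem hx).1]
  have h4 : ∫ x, (fderiv ℝ φ x (unitVec i)) ^ 2 ≤ Q := by
    refine integral_mono hG.integrable_sq
      (integrable_norm_sq (hφ.memLp_gradient volume)) fun x => ?_
    simp only
    rw [← hφ.gradient_apply, ← sq_abs (gradient φ x i)]
    exact pow_le_pow_left₀ (abs_nonneg _) (PiLp.norm_apply_le (gradient φ x) i) 2
  have h5 : P ^ 2 ≤ 4 * ((D ^ 2 * P) * Q) := by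
    refine h2.trans ?_
    gcongr
  rcases hP0.eq_or_lt with h | h
  · rw [← h]; positivity
  · nlinarith

theorem IsTest.integral_eq {φ : Vec d → ℝ} (hφ : IsTest Ω φ) :
    (∫ x in Ω, φ x ^ 2 = ∫ x, φ x ^ 2) ∧
      ∫ x in Ω, ‖gradient φ x‖ ^ 2 = ∫ x, ‖gradient φ x‖ ^ 2 := by
  constructor
  · exact setIntegral_eq_integral_of_forall_compl_eq_zero fun x hx => by
      rw [(hφ.eq_zero_of_notMem hx).1]; norm_num
  · exact setIntegral_eq_integral_of_forall_compl_eq_zero fun x hx => by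
      rw [hφ.gradient_eq_zero_of_notMem hx]; norm_num

theorem H1.tendsto_norm_fst_snd {v : H1 Ω} {u : ℕ → H1 Ω}
    (h : Tendsto (fun n => (u n).toAmbient) atTop (𝓝 v.toAmbient)) :
    Tendsto (fun n => ∫ x in Ω, (u n).val x ^ 2) atTop (𝓝 (∫ x in Ω, v.val x ^ 2)) ∧
    Tendsto (fun n => ∫ x in Ω, ‖(u n).grad x‖ ^ 2) atTop (𝓝 (∫ x in Ω, ‖v.grad x‖ ^ 2)) := by
  have e1 : ∀ w : H1 Ω, ‖w.toAmbient.fst‖ ^ 2 = ∫ x in Ω, w.val x ^ 2 := fun w =>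
    (norm_toLp_sq w.memLp_val).trans (by simp)
  have e2 : ∀ w : H1 Ω, ‖w.toAmbient.snd‖ ^ 2 = ∫ x in Ω, ‖w.grad x‖ ^ 2 := fun w =>
    norm_toLp_sq w.memLp_grad
  have h0 := ((WithLp.prod_continuous_ofLp 2 _ _).tendsto v.toAmbient).comp h
  have h1 := (((continuous_fst.tendsto _).comp h0).norm).pow 2
  have h2 := (((continuous_snd.tendsto _).comp h0).norm).pow 2
  simp_rw [← e1, ← e2]
  exact ⟨h1, h2⟩

/-- The Poincaré-Friedrichs inequality. -/
theorem H1.InH10.poincare (hd : 1 ≤ d) (hb : Bornology.IsBounded Ω) {D : ℝ}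
    (hD : diam Ω ≤ D) {v : H1 Ω} (hv : v.InH10) :
    ∫ x in Ω, v.val x ^ 2 ≤ 4 * D ^ 2 * ∫ x in Ω, ‖v.grad x‖ ^ 2 := by
  obtain ⟨φ, hφ, h1, h2⟩ := hv
  have h := H1.tendsto_norm_fst_snd
    (H1.tendsto_toAmbient_iff (v := fun n => H1.ofTest (hφ n)) (u := v) |>.2 ⟨h1, h2⟩)
  refine le_of_tendsto_of_tendsto' h.1 (h.2.const_mul _) fun n => ?_
  have h3 := (hφ n).integral_eq
  have h4 := (hφ n).poincare hd hb hD
  rw [← h3.1, ← h3.2] at h4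
  exact h4

/-- Coercivity of the bilinear form, for test functions. -/
theorem Coefficients.form_ofTest_ge
    (hΩ : IsLipschitzDomain Ω) (hκ : κ.Admissible 𝒯) {lmin lmax : ℝ}
    (hA : ∀ᵐ x ∂volume.restrict Ω, ∀ v : Vec d,
      lmin * ‖v‖ ^ 2 ≤ inner ℝ v (κ.A x v) ∧ inner ℝ v (κ.A x v) ≤ lmax * ‖v‖ ^ 2)
    {φ : Vec d → ℝ} (hφ : IsTest Ω φ) :
    lmin * ∫ x in Ω, ‖gradient φ x‖ ^ 2 ≤ κ.form (H1.ofTest hφ) (H1.ofTest hφ) := by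
  obtain ⟨K, hK⟩ := hκ.b_lipschitz
  obtain ⟨β, hβ, hβe⟩ := hK.extend_finite_dimension
  have hsq : ∀ x, HasFDerivAt (fun x => φ x ^ 2) ((2 * φ x) • fderiv ℝ φ x) x := fun x => by
    have := (hφ.differentiableAt x).hasFDerivAt.pow 2
    simpa using this
  have hsqc : HasCompactSupport fun x => φ x ^ 2 :=
    hφ.2.1.comp_left (g := fun y : ℝ => y ^ 2) (by simp)
  obtain ⟨L, hL⟩ := (hφ.contDiff_one.pow 2).lipschitzWith_of_hasCompactSupport hsqc (by norm_num)
  -- the skew part of the convection term drops out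
  have hibp := integral_divergence_mul hβ hL hsqc
  have e1 : ∫ x, divergence β x * φ x ^ 2 = ∫ x in Ω, divergence κ.b x * φ x ^ 2 := by
    rw [← setIntegral_eq_integral_of_forall_compl_eq_zero (s := Ω)
      (f := fun x => divergence β x * φ x ^ 2) fun x hx => by
        rw [(hφ.eq_zero_of_notMem hx).1]; simp]
    refine setIntegral_congr_fun hΩ.isOpen.measurableSet fun x hx => ?_
    rw [divergence_congr_of_eqOn hβe (by rwa [hΩ.isOpen.interior_eq])]
  have e2 : ∫ x, ∑ k, lineDeriv ℝ (fun x => φ x ^ 2) x (unitVec k) * β x k =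
      ∫ x in Ω, 2 * (φ x * inner ℝ (κ.b x) (gradient φ x)) := by
    rw [← setIntegral_eq_integral_of_forall_compl_eq_zero (s := Ω)
      (f := fun x => ∑ k, lineDeriv ℝ (fun x => φ x ^ 2) x (unitVec k) * β x k) fun x hx => by
        simp only [((hsq x).hasLineDerivAt _).lineDeriv]
        simp [(hφ.eq_zero_of_notMem hx).1]]
    refine setIntegral_congr_fun hΩ.isOpen.measurableSet fun x hx => ?_
    simp only [((hsq x).hasLineDerivAt _).lineDeriv]
    rw [hβe hx, inner_eq_sum, mul_sum, mul_sum]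
    refine sum_congr rfl fun k _ => ?_
    rw [hφ.gradient_apply]
    simp only [smul_apply, smul_eq_mul]
    ring
  rw [e1, e2, integral_const_mul] at hibp
  have hGL := hφ.memLp_gradient (volume.restrict Ω)
  have hVL := hφ.memLp (volume.restrict Ω)
  have hAG := (ContinuousLinearMap.id ℝ (Vec d →L[ℝ] Vec d)).memLp_of_bilin (r := 2)
    (memLp_top_A hΩ hκ) hGL
  have hbV : MemLp (fun x => φ x • κ.b x) 2 (volume.restrict Ω) :=
    (memLp_top_b hΩ hκ).smul hVL (r := 2)
  have i1 : Integrable (fun x => (inner ℝ (κ.A x (gradient φ x)) (gradient φ x) : ℝ))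
      (volume.restrict Ω) := integrable_inner_of_memLp hAG hGL
  have i2 : Integrable (fun x => (inner ℝ (φ x • κ.b x) (gradient φ x) : ℝ))
      (volume.restrict Ω) := integrable_inner_of_memLp hbV hGL
  have i3 : Integrable (fun x => κ.c x * φ x * φ x) (volume.restrict Ω) :=
    MemLp.integrable_mul (p := 2) (q := 2) (memLp_top_mul hκ.c_memLp hVL) hVL
  have i4 : Integrable (fun x => divergence κ.b x * φ x ^ 2) (volume.restrict Ω) := by
    have h1 : Integrable (fun x => φ x ^ 2 * divergence β x) (volume.restrict Ω) :=
      hVL.integrable_sq.mul_bdd (c := d * ((lipschitzExtensionConstant (Vec d) * K : ℝ≥0) : ℝ))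
        (measurable_divergence β).aestronglyMeasurable
        (.of_forall fun x => abs_divergence_le hβ x)
    refine h1.congr ?_
    filter_upwards [ae_restrict_mem hΩ.isOpen.measurableSet] with x hx
    rw [divergence_congr_of_eqOn hβe (by rwa [hΩ.isOpen.interior_eq]), mul_comm]
  have e3 : κ.form (H1.ofTest hφ) (H1.ofTest hφ) =
      (∫ x in Ω, inner ℝ (κ.A x (gradient φ x)) (gradient φ x)) +
        ∫ x in Ω, ((1 / 2) * (divergence κ.b x * φ x ^ 2) + κ.c x * φ x * φ x) := by
    rw [integral_add (i4.const_mul _) i3, integral_const_mul, hibp, Coefficients.form]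
    have e4 : ∫ x in Ω, (inner ℝ (κ.A x ((H1.ofTest hφ).grad x) -
        (H1.ofTest hφ).val x • κ.b x) ((H1.ofTest hφ).grad x) : ℝ) =
        (∫ x in Ω, inner ℝ (κ.A x (gradient φ x)) (gradient φ x)) -
          ∫ x in Ω, inner ℝ (φ x • κ.b x) (gradient φ x) := by
      rw [← integral_sub i1 i2]
      exact integral_congr_ae (.of_forall fun x => by
        simp only [H1.ofTest, inner_sub_left])
    have e5 : ∫ x in Ω, (inner ℝ (φ x • κ.b x) (gradient φ x) : ℝ) =
        ∫ x in Ω, φ x * inner ℝ (κ.b x) (gradient φ x) :=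
      integral_congr_ae (.of_forall fun x => by simp only [real_inner_smul_left])
    rw [e4, e5]
    simp only [H1.ofTest]
    ring
  rw [e3, ← integral_const_mul]
  have h1 : ∫ x in Ω, lmin * ‖gradient φ x‖ ^ 2 ≤
      ∫ x in Ω, inner ℝ (κ.A x (gradient φ x)) (gradient φ x) := by
    refine integral_mono_ae ((integrable_norm_sq hGL).const_mul _) i1 ?_
    filter_upwards [hA] with x hx
    rw [real_inner_comm]
    exact (hx _).1
  have h2 : 0 ≤ ∫ x in Ω, ((1 / 2) * (divergence κ.b x * φ x ^ 2) + κ.c x * φ x * φ x) := by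
    refine integral_nonneg_of_ae ?_
    filter_upwards [hκ.nonneg] with x hx
    have : 1 / 2 * (divergence κ.b x * φ x ^ 2) + κ.c x * φ x * φ x =
        (1 / 2 * divergence κ.b x + κ.c x) * φ x ^ 2 := by ring
    rw [this]
    exact mul_nonneg hx (sq_nonneg _)
  linarith

/-- The theorem of Lax and Milgram on the closure of a subspace, with coercivity assumed on the
subspace itself. -/
theorem exists_forall_eq_inner {H : Type*} [NormedAddCommGroup H] [InnerProductSpace ℝ H]
    [CompleteSpace H] (S : Submodule ℝ H)
    (b : S.topologicalClosure →ₗ[ℝ] S.topologicalClosure →ₗ[ℝ] ℝ) {M α : ℝ}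
    (hM : ∀ x y, |b x y| ≤ M * ‖x‖ * ‖y‖) (hα : 0 < α)
    (hb : ∀ x : S.topologicalClosure, (x : H) ∈ S → α * ‖x‖ ^ 2 ≤ b x x) (G : H) :
    ∃ w, ∀ y : S.topologicalClosure, b w y = inner ℝ G (y : H) := by
  have hVc : IsClosed (S.topologicalClosure : Set H) := Submodule.isClosed_topologicalClosure _
  have : CompleteSpace S.topologicalClosure := hVc.completeSpace_coe
  let B : S.topologicalClosure →L[ℝ] S.topologicalClosure →L[ℝ] ℝ :=
    b.mkContinuous₂ M hM
  have hB : ∀ x y, B x y = b x y := fun x y => rfl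
  have hcoer : IsCoercive B := by
    refine ⟨α, hα, fun x => ?_⟩
    obtain ⟨y, hy, hlim⟩ := mem_closure_iff_seq_limit.1 x.2
    let z : ℕ → S.topologicalClosure := fun n => ⟨y n, S.le_topologicalClosure (hy n)⟩
    have hz : Tendsto z atTop (𝓝 x) := by
      rw [tendsto_subtype_rng]
      exact hlim
    have h1 : Tendsto (fun n => B (z n) (z n)) atTop (𝓝 (B x x)) :=
      ((B.continuous.clm_apply continuous_id).tendsto x).comp hz
    have h2 : Tendsto (fun n => α * ‖z n‖ * ‖z n‖) atTop
        (𝓝 (α * ‖x‖ * ‖x‖)) := (hz.norm.const_mul _).mul hz.norm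
    refine le_of_tendsto_of_tendsto' h2 h1 fun n => ?_
    rw [mul_assoc, ← sq]
    exact hb (z n) (hy n)
  let r : S.topologicalClosure := (InnerProductSpace.toDual ℝ S.topologicalClosure).symm
    ((innerSL ℝ G).comp S.topologicalClosure.subtypeL)
  have hr : ∀ y : S.topologicalClosure, inner ℝ r y = inner ℝ G (y : H) := fun y => by
    rw [InnerProductSpace.toDual_symm_apply]; rfl
  refine ⟨hcoer.continuousLinearEquivOfBilin.symm r, fun y => ?_⟩
  rw [← hr, ← hB, ← hcoer.continuousLinearEquivOfBilin_apply,
    ContinuousLinearEquiv.apply_symm_apply]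

theorem H1.inner_toAmbient {g : Vec d → ℝ} (hg : MemLp g 2 (volume.restrict Ω))
    (v : H1 Ω) :
    inner ℝ (WithLp.toLp 2 (hg.toLp g, 0) : H1.Ambient Ω) v.toAmbient =
      ∫ x in Ω, g x * v.val x := by
  have h3 : inner ℝ (hg.toLp g) (v.memLp_val.toLp v.val) = ∫ x in Ω, g x * v.val x := by
    rw [L2.inner_def]
    refine integral_congr_ae ?_
    filter_upwards [hg.coeFn_toLp, v.memLp_val.coeFn_toLp] with x h1 h2
    rw [h1, h2]; simp [mul_comm]
  have h2 : inner ℝ (0 : Lp (Vec d) 2 (volume.restrict Ω)) (v.memLp_grad.toLp v.grad) = (0 : ℝ) :=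
    inner_zero_left _
  rw [WithLp.prod_inner_apply]
  exact (congrArg₂ (· + ·) h3 h2).trans (add_zero _)

/-- The dual problem is solvable, by the theorem of Lax and Milgram. -/
theorem Coefficients.exists_isDualSolution (hd : 1 ≤ d) (hΩ : IsLipschitzDomain Ω)
    (hκ : κ.Admissible 𝒯) {M : ℝ}
    (hM : κ.IsFormBound Ω M) {g : Vec d → ℝ} (hg : MemLp g 2 (volume.restrict Ω)) :
    ∃ φ : H1 Ω, κ.IsDualSolution g φ := by
  obtain ⟨lmin, hlmin, lmax, -, hA⟩ := hκ.A_bounds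
  have hrep' : ∀ x : H1.space Ω, ∃ v : H1 Ω, v.InH10 ∧ v.toAmbient = (x : H1.Ambient Ω) :=
    fun x => H1.exists_of_mem_space x.2
  choose rep hrep1 hrep2 using hrep'
  have hadd : ∀ x y : H1.space Ω, (rep (x + y)).toAmbient =
      (H1.lin 1 1 (rep x) (rep y)).toAmbient := fun x y => by
    rw [hrep2, H1.toAmbient_lin, hrep2, hrep2, one_smul, one_smul, Submodule.coe_add]
  have hsmul : ∀ (c : ℝ) (x : H1.space Ω), (rep (c • x)).toAmbient =
      (H1.lin c 0 (rep x) (rep x)).toAmbient := fun c x => by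
    rw [hrep2, H1.toAmbient_lin, hrep2, zero_smul, add_zero, Submodule.coe_smul]
  -- the form with swapped arguments
  let B₀ : H1.space Ω →ₗ[ℝ] H1.space Ω →ₗ[ℝ] ℝ :=
    LinearMap.mk₂ ℝ (fun x y => κ.form (rep y) (rep x))
    (fun x x' y => by rw [form_congr rfl (hadd x x'), form_lin_right hΩ hκ, one_mul, one_mul])
    (fun c x y => by
      rw [form_congr rfl (hsmul c x), form_lin_right hΩ hκ, smul_eq_mul, zero_mul, add_zero])
    (fun x y y' => by rw [form_congr (hadd y y') rfl, form_lin_left hΩ hκ, one_mul, one_mul])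
    (fun c x y => by
      rw [form_congr (hsmul c y) rfl, form_lin_left hΩ hκ, smul_eq_mul, zero_mul, add_zero])
  have hB₀ : ∀ x y : H1.space Ω, B₀ x y = κ.form (rep y) (rep x) := fun x y => rfl
  have hnorm : ∀ x : H1.space Ω, √(h1NormSq Ω (rep x).val (rep x).grad) = ‖x‖ := fun x => by
    rw [← H1.norm_toAmbient, hrep2, Submodule.coe_norm]
  have hbound : ∀ x y : H1.space Ω, |B₀ x y| ≤ M * ‖x‖ * ‖y‖ := fun x y => by
    have := hM (rep y) (rep x) (hrep1 y) (hrep1 x)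
    rw [hnorm, hnorm] at this
    rw [hB₀]
    linarith
  -- coercivity on test functions, by Poincaré's inequality
  have hcoer : ∀ x : H1.space Ω, (x : H1.Ambient Ω) ∈ H1.testSubmodule Ω →
      lmin / (4 * diam Ω ^ 2 + 1) * ‖x‖ ^ 2 ≤ B₀ x x := by
    intro x hx
    obtain ⟨φ, hφ, hφx⟩ := hx
    have h3 : B₀ x x = κ.form (H1.ofTest hφ) (H1.ofTest hφ) := by
      have := (hrep2 x).trans hφx.symm
      rw [hB₀]
      exact form_congr this this
    have h4 := form_ofTest_ge hΩ hκ hA hφ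
    have h5 := (H1.inH10_ofTest hφ).poincare hd hΩ.isBounded le_rfl
    have h6 : ‖x‖ ^ 2 = h1NormSq Ω φ (gradient φ) := by
      rw [Submodule.coe_norm, ← hφx, H1.norm_toAmbient_sq]
      rfl
    have h7 : ‖x‖ ^ 2 ≤ (4 * diam Ω ^ 2 + 1) * ∫ x in Ω, ‖gradient φ x‖ ^ 2 := by
      rw [h6, h1NormSq]
      simp only [H1.ofTest] at h5
      linarith
    rw [h3, div_mul_eq_mul_div, div_le_iff₀ (by positivity)]
    calc lmin * ‖x‖ ^ 2 ≤
          lmin * ((4 * diam Ω ^ 2 + 1) * ∫ x in Ω, ‖gradient φ x‖ ^ 2) := by gcongr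
      _ = (lmin * ∫ x in Ω, ‖gradient φ x‖ ^ 2) * (4 * diam Ω ^ 2 + 1) := by ring
      _ ≤ _ := by gcongr
  obtain ⟨w, hw⟩ := exists_forall_eq_inner (H1.testSubmodule Ω) B₀ hbound (by positivity) hcoer
    (WithLp.toLp 2 (hg.toLp g, 0))
  refine ⟨rep w, hrep1 w, fun v hv => ?_⟩
  refine Eq.trans ?_ ((hw ⟨v.toAmbient, H1.toAmbient_mem_space hv⟩).trans
    (H1.inner_toAmbient hg v))
  exact form_congr (hrep2 ⟨v.toAmbient, H1.toAmbient_mem_space hv⟩).symm rfl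

/-! ### The Poincaré inequality on convex sets -/

/-- Jensen's inequality. -/
theorem enorm_integral_sq_le {α E : Type*} [MeasurableSpace α] {μ : Measure α}
    [IsProbabilityMeasure μ] [NormedAddCommGroup E] [NormedSpace ℝ E] (f : α → E) :
    ‖∫ x, f x ∂μ‖ₑ ^ 2 ≤ ∫⁻ x, ‖f x‖ₑ ^ 2 ∂μ := by
  by_cases hf : AEStronglyMeasurable f μ
  · have h1 := enorm_integral_le_lintegral_enorm (μ := μ) f
    have h2 := eLpNorm_le_eLpNorm_of_exponent_le (μ := μ) (p := 1) (q := 2) (f := f)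
      (by norm_num) hf
    rw [eLpNorm_one_eq_lintegral_enorm] at h2
    have h3 : eLpNorm f 2 μ ^ 2 = ∫⁻ x, ‖f x‖ₑ ^ 2 ∂μ := by
      have := eLpNorm_nnreal_pow_eq_lintegral (μ := μ) (f := f) (p := 2) (by norm_num)
      simp only [NNReal.coe_ofNat, ENNReal.rpow_ofNat] at this
      exact_mod_cast this
    rw [← h3]
    exact pow_le_pow_left₀ zero_le (h1.trans h2) 2
  · rw [integral_undef fun h => hf h.1]
    simp

theorem IsTest.comp_sub {K K' : Set (Vec d)} {ψ : Vec d → ℝ} (hψ : IsTest K' ψ)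
    (h : ∀ x ∈ K', x + a ∈ K) : IsTest K fun y => ψ (y - a) := by
  have e : (fun y => ψ (y - a)) = ψ ∘ Homeomorph.subRight a := rfl
  refine ⟨hψ.1.comp (contDiff_id.sub contDiff_const), ?_, ?_⟩
  · rw [e]
    exact hψ.2.1.comp_homeomorph _
  · rw [e]
    intro y hy
    have h1 : y - a ∈ tsupport ψ :=
      tsupport_comp_subset_preimage ψ (Homeomorph.subRight a).continuous hy
    simpa using h _ (hψ.2.2 h1)

theorem measurePreserving_add_smul (h : Vec d) (ν : Measure ℝ) [SFinite ν] :
    MeasurePreserving (fun p : ℝ × Vec d => (p.1, p.2 + p.1 • h)) (ν.prod volume)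
      (ν.prod volume) :=
  (MeasurePreserving.id ν).skew_product (g := fun t x => x + t • h)
    (by unfold Function.uncurry; fun_prop)
    (.of_forall fun t => (measurePreserving_add_right volume (t • h)).map_eq)

/-- The fundamental theorem of calculus along the segments of a convex set, for the weak derivative
`D` of `g` in the direction `h`. -/
theorem ae_sub_eq_integral {K : Set (Vec d)} (hK : IsOpen K) (hc : Convex ℝ K) {g D : Vec d → ℝ}
    {h : Vec d} (hg : Integrable g) (hD : Integrable D)
    (hw : ∀ ψ, IsTest K ψ → ∫ x, g x * fderiv ℝ ψ x h = -∫ x, D x * ψ x) :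
    ∀ᵐ x, x ∈ K → x + h ∈ K → g (x + h) - g x = ∫ t in Icc (0 : ℝ) 1, D (x + t • h) := by
  set ν : Measure ℝ := volume.restrict (Icc (0 : ℝ) 1) with hν
  have : IsProbabilityMeasure ν := ⟨by simp [hν]⟩
  set U : Set (Vec d) := K ∩ (fun x => x + h) ⁻¹' K
  have hUo : IsOpen U := hK.inter (hK.preimage (continuous_add_const h))
  have hUK : ∀ t ∈ Icc (0 : ℝ) 1, ∀ x ∈ U, x + t • h ∈ K := fun t ht x hx => by
    have := hc.add_smul_sub_mem hx.1 hx.2 ht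
    simpa using this
  have hDp : Integrable (fun p : ℝ × Vec d => D (p.2 + p.1 • h)) (ν.prod volume) :=
    (measurePreserving_add_smul h ν).integrable_comp_of_integrable (hD.comp_snd ν)
  have hgh : Integrable fun x => g (x + h) := hg.comp_add_right h
  have hP : Integrable fun x => ∫ t, D (x + t • h) ∂ν := hDp.integral_prod_right
  have hFi : Integrable fun x => g (x + h) - g x - ∫ t, D (x + t • h) ∂ν := (hgh.sub hg).sub hP
  -- test the difference of both sides and move the derivative by Fubini's theorem
  have key := hUo.ae_eq_zero_of_integral_contDiff_smul_eq_zero (μ := volume)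
    (f := fun x => g (x + h) - g x - ∫ t, D (x + t • h) ∂ν)
    (hFi.locallyIntegrable.locallyIntegrableOn U) ?_
  · filter_upwards [key] with x hx h1 h2
    linarith [hx ⟨h1, h2⟩]
  intro ψ hψ1 hψ2 hψ3
  have hψ : IsTest U ψ := ⟨hψ1, hψ2, hψ3⟩
  obtain ⟨C, hC⟩ := hψ1.continuous.bounded_above_of_compact_support hψ2
  have hC' : ∃ C', ∀ x, ‖fderiv ℝ ψ x h‖ ≤ C' := by
    obtain ⟨C', hC'⟩ := (hψ.contDiff_one.continuous_fderiv
      (by norm_num)).bounded_above_of_compact_support (hψ2.fderiv ℝ)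
    exact ⟨C' * ‖h‖, fun x => (ContinuousLinearMap.le_opNorm _ _).trans
      (mul_le_mul_of_nonneg_right (hC' x) (norm_nonneg _))⟩
  obtain ⟨C', hC'⟩ := hC'
  have hdc : Continuous fun x => fderiv ℝ ψ x h :=
    (hψ.contDiff_one.continuous_fderiv (by norm_num)).clm_apply continuous_const
  have i1 : Integrable fun x => ψ x * g (x + h) :=
    hgh.bdd_mul hψ1.continuous.aestronglyMeasurable (.of_forall hC)
  have i2 : Integrable fun x => ψ x * g x :=
    hg.bdd_mul hψ1.continuous.aestronglyMeasurable (.of_forall hC)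
  have i3 : Integrable fun x => ψ x * ∫ t, D (x + t • h) ∂ν :=
    hP.bdd_mul hψ1.continuous.aestronglyMeasurable (.of_forall hC)
  have i4 : Integrable fun x => ψ (x - h) * g x :=
    hg.bdd_mul (hψ1.continuous.comp (continuous_sub_right h)).aestronglyMeasurable
      (.of_forall fun x => hC _)
  have i12 : Integrable fun x => ψ x * g (x + h) - ψ x * g x := i1.sub i2
  have e1 : ∫ x, ψ x • (g (x + h) - g x - ∫ t, D (x + t • h) ∂ν) =
      (∫ x, ψ x * g (x + h)) - (∫ x, ψ x * g x) - ∫ x, ψ x * ∫ t, D (x + t • h) ∂ν := by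
    rw [← integral_sub i1 i2, ← integral_sub i12 i3]
    refine integral_congr_ae (.of_forall fun x => ?_)
    simp only [smul_eq_mul]; ring
  have e2 : ∫ x, ψ x * g (x + h) = ∫ y, ψ (y - h) * g y := by
    rw [← integral_add_right_eq_self (fun y => ψ (y - h) * g y) h]
    simp
  -- the fundamental theorem of calculus for the test function
  have e3 : ∀ y, ψ (y - h) - ψ y = -∫ t, fderiv ℝ ψ (y - t • h) h ∂ν := by
    intro y
    have h1 : ∀ t ∈ uIcc (0 : ℝ) 1, HasDerivAt (fun t : ℝ => ψ (y - t • h))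
        (-(fderiv ℝ ψ (y - t • h) h)) t := fun t _ => by
      have h2 : HasDerivAt (fun t : ℝ => y - t • h) (-h) t := by
        simpa using ((hasDerivAt_id t).smul_const h).const_sub y
      have := (hψ.differentiableAt (y - t • h)).hasFDerivAt.comp_hasDerivAt t h2
      rw [map_neg] at this
      exact this
    have h3 := intervalIntegral.integral_eq_sub_of_hasDerivAt h1
      (((hdc.comp (by fun_prop)).neg).intervalIntegrable _ _)
    simp only [one_smul, zero_smul, sub_zero] at h3
    rw [← h3, intervalIntegral.integral_of_le zero_le_one, hν, integral_Icc_eq_integral_Ioc,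
      integral_neg]
  have e4 : (∫ y, ψ (y - h) * g y) - ∫ y, ψ y * g y =
      -∫ y, ∫ t, g y * fderiv ℝ ψ (y - t • h) h ∂ν := by
    rw [← integral_sub i4 i2, ← integral_neg]
    refine integral_congr_ae (.of_forall fun y => ?_)
    simp only
    rw [integral_const_mul, ← sub_mul, e3]; ring
  have i5 : Integrable (Function.uncurry fun (t : ℝ) (y : Vec d) =>
      g y * fderiv ℝ ψ (y - t • h) h) (ν.prod volume) := by
    refine (hg.comp_snd ν).mul_bdd (c := C') ?_ (.of_forall fun p => hC' _)
    exact (hdc.comp (by fun_prop)).aestronglyMeasurable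
  have i6 : Integrable (Function.uncurry fun (t : ℝ) (x : Vec d) =>
      ψ x * D (x + t • h)) (ν.prod volume) :=
    hDp.bdd_mul (f := fun p : ℝ × Vec d => ψ p.2)
      (hψ1.continuous.comp continuous_snd).aestronglyMeasurable (.of_forall fun p => hC _)
  have e5 : ∀ᵐ t ∂ν, -∫ y, g y * fderiv ℝ ψ (y - t • h) h = ∫ x, ψ x * D (x + t • h) := by
    filter_upwards [ae_restrict_mem measurableSet_Icc] with t ht
    have h1 := hw _ (hψ.comp_sub (hUK t ht))
    simp only [fderiv_comp_sub] at h1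
    rw [h1, neg_neg, ← integral_add_right_eq_self (fun y => D y * ψ (y - t • h)) (t • h)]
    refine integral_congr_ae (.of_forall fun x => ?_)
    simp only [add_sub_cancel_right]; ring
  have e6 : ∫ x, ψ x * ∫ t, D (x + t • h) ∂ν = ∫ x, ∫ t, ψ x * D (x + t • h) ∂ν :=
    integral_congr_ae (.of_forall fun x => (integral_const_mul _ _).symm)
  rw [e1, e2, e4, e6, ← integral_integral_swap i5, ← integral_integral_swap i6, ← integral_neg,
    integral_congr_ae e5, sub_self]

/-- Differences are controlled by the weak directional derivative. -/
theorem lintegral_sub_sq_le {K : Set (Vec d)} (hK : IsOpen K) (hc : Convex ℝ K) {g D : Vec d → ℝ}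
    {h : Vec d} (hg : Integrable g) (hD : Integrable D)
    (hw : ∀ ψ, IsTest K ψ → ∫ x, g x * fderiv ℝ ψ x h = -∫ x, D x * ψ x) :
    ∫⁻ x in K ∩ (fun x => x + h) ⁻¹' K, ‖g (x + h) - g x‖ₑ ^ 2 ≤ ∫⁻ x, ‖D x‖ₑ ^ 2 := by
  set ν : Measure ℝ := volume.restrict (Icc (0 : ℝ) 1) with hν
  have : IsProbabilityMeasure ν := ⟨by simp [hν]⟩
  have hUo : IsOpen (K ∩ (fun x => x + h) ⁻¹' K) :=
    hK.inter (hK.preimage (continuous_add_const h))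
  have hm : AEMeasurable (Function.uncurry fun (t : ℝ) (x : Vec d) => ‖D (x + t • h)‖ₑ ^ 2)
      (ν.prod volume) :=
    (((measurePreserving_add_smul h ν).integrable_comp_of_integrable
      (hD.comp_snd ν)).1.enorm).pow_const 2
  calc ∫⁻ x in K ∩ (fun x => x + h) ⁻¹' K, ‖g (x + h) - g x‖ₑ ^ 2
      ≤ ∫⁻ x in K ∩ (fun x => x + h) ⁻¹' K, ∫⁻ t, ‖D (x + t • h)‖ₑ ^ 2 ∂ν := by
        refine lintegral_mono_ae ?_
        filter_upwards [ae_restrict_of_ae (ae_sub_eq_integral hK hc hg hD hw),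
          ae_restrict_mem hUo.measurableSet] with x hx hxU
        rw [hx hxU.1 hxU.2]
        exact enorm_integral_sq_le _
    _ ≤ ∫⁻ x, ∫⁻ t, ‖D (x + t • h)‖ₑ ^ 2 ∂ν := setLIntegral_le_lintegral _ _
    _ = ∫⁻ t, ∫⁻ x, ‖D (x + t • h)‖ₑ ^ 2 ∂volume ∂ν := (lintegral_lintegral_swap hm).symm
    _ = ∫⁻ _t, (∫⁻ x, ‖D x‖ₑ ^ 2) ∂ν := by
        refine lintegral_congr fun t => ?_
        exact lintegral_add_right_eq_self (fun x => ‖D x‖ₑ ^ 2) (t • h)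
    _ = ∫⁻ x, ‖D x‖ₑ ^ 2 := by simp

/-- The Poincaré inequality on a bounded convex set, as an estimate of a double integral. -/
theorem lintegral_lintegral_sub_sq_le {K : Set (Vec d)} (hK : IsOpen K) (hc : Convex ℝ K)
    (hb : Bornology.IsBounded K) {g : Vec d → ℝ} {Q : Vec d → Vec d} (hg : IntegrableOn g K)
    (hQ : IntegrableOn Q K) (hw : ∀ i, IsWeakPartial K i g fun x => Q x i) :
    ∫⁻ x in K, ∫⁻ y in K, ‖g x - g y‖ₑ ^ 2 ≤
      volume (closedBall (0 : Vec d) (diam K)) *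
        (ENNReal.ofReal (diam K) ^ 2 * ∫⁻ x in K, ‖Q x‖ₑ ^ 2) := by
  have hKm := hK.measurableSet
  set G := K.indicator g with hG
  have hGi : Integrable G := hg.integrable_indicator hKm
  set δ := diam K
  have hdir : ∀ h : Vec d, Integrable (K.indicator fun x => (inner ℝ (Q x) h : ℝ)) := fun h =>
    IntegrableOn.integrable_indicator (Integrable.inner_const hQ h) hKm
  have hw' : ∀ h : Vec d, ∀ ψ, IsTest K ψ → ∫ x, G x * fderiv ℝ ψ x h =
      -∫ x, K.indicator (fun x => (inner ℝ (Q x) h : ℝ)) x * ψ x := by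
    intro h ψ hψ
    have hφc : Continuous (fderiv ℝ ψ) := hψ.contDiff_one.continuous_fderiv (by norm_num)
    obtain ⟨C, hC⟩ := hψ.1.continuous.bounded_above_of_compact_support hψ.2.1
    obtain ⟨C', hC'⟩ := hφc.bounded_above_of_compact_support (hψ.2.1.fderiv ℝ)
    have j1 : ∀ i, IntegrableOn (fun x => g x * fderiv ℝ ψ x (unitVec i)) K := fun i =>
      Integrable.mul_bdd (c := C' * ‖(unitVec i : Vec d)‖) hg
        (hφc.clm_apply continuous_const).aestronglyMeasurable
        (.of_forall fun x => (ContinuousLinearMap.le_opNorm _ _).trans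
          (mul_le_mul_of_nonneg_right (hC' x) (norm_nonneg _)))
    have j2 : ∀ i, IntegrableOn (fun x => Q x i * ψ x) K := fun i =>
      Integrable.mul_bdd (c := C) (hQ.eval_piLp i) hψ.1.continuous.aestronglyMeasurable
        (.of_forall hC)
    have hh : h = ∑ i, h i • unitVec i := by
      ext j
      simp [unitVec, Finset.sum_apply, Pi.single_apply]
    have e1 : ∫ x, G x * fderiv ℝ ψ x h =
        ∫ x in K, ∑ i, h i * (g x * fderiv ℝ ψ x (unitVec i)) := by
      rw [← integral_indicator hKm]
      refine integral_congr_ae (.of_forall fun x => ?_)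
      by_cases hx : x ∈ K
      · simp only [hG, indicator_of_mem hx]
        conv_lhs => rw [hh, map_sum]
        rw [mul_sum]
        refine sum_congr rfl fun i _ => ?_
        rw [map_smul, smul_eq_mul]; ring
      · simp [hG, indicator_of_notMem hx]
    have e2 : ∫ x, K.indicator (fun x => (inner ℝ (Q x) h : ℝ)) x * ψ x =
        ∫ x in K, ∑ i, h i * (Q x i * ψ x) := by
      rw [← integral_indicator hKm]
      refine integral_congr_ae (.of_forall fun x => ?_)
      by_cases hx : x ∈ K
      · simp only [indicator_of_mem hx]
        rw [inner_eq_sum, sum_mul]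
        exact sum_congr rfl fun i _ => by ring
      · simp [indicator_of_notMem hx]
    rw [e1, e2, integral_finsetSum _ fun i _ => (j1 i).const_mul _,
      integral_finsetSum _ fun i _ => (j2 i).const_mul _, ← sum_neg_distrib]
    refine sum_congr rfl fun i _ => ?_
    rw [integral_const_mul, integral_const_mul, hw i ψ hψ]; ring
  -- substitute `y = x + h` and estimate for fixed `h`
  set F : Vec d → Vec d → ℝ≥0∞ := fun x y =>
    K.indicator 1 x * K.indicator 1 y * ‖G x - G y‖ₑ ^ 2 with hF
  have hFm : AEMeasurable (Function.uncurry F) (volume.prod volume) := by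
    have m1 : AEMeasurable (fun p : Vec d × Vec d => ‖G p.1 - G p.2‖ₑ ^ 2)
        (volume.prod volume) :=
      ((hGi.1.comp_fst.sub hGi.1.comp_snd).enorm).pow_const 2
    have m2 : Measurable (K.indicator (1 : Vec d → ℝ≥0∞)) := measurable_one.indicator hKm
    exact ((m2.comp measurable_fst).mul (m2.comp measurable_snd)).aemeasurable.mul m1
  have s1 : ∫⁻ x in K, ∫⁻ y in K, ‖g x - g y‖ₑ ^ 2 = ∫⁻ x, ∫⁻ h, F x (x + h) := by
    rw [← lintegral_indicator hKm]
    refine lintegral_congr fun x => ?_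
    rw [lintegral_add_left_eq_self (F x) x]
    by_cases hx : x ∈ K
    · rw [indicator_of_mem hx, ← lintegral_indicator hKm]
      refine lintegral_congr fun y => ?_
      by_cases hy : y ∈ K
      · simp [hF, hG, hx, hy]
      · simp [hF, hy]
    · simp [hF, hx]
  have s2 : ∫⁻ x, ∫⁻ h, F x (x + h) = ∫⁻ h, ∫⁻ x, F x (x + h) :=
    lintegral_lintegral_swap
      (hFm.comp_quasiMeasurePreserving
        (measurePreserving_prod_add volume volume).quasiMeasurePreserving)
  have s3 : ∀ h, ∫⁻ x, F x (x + h) ≤ (closedBall (0 : Vec d) δ).indicator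
      (fun _ => ENNReal.ofReal δ ^ 2 * ∫⁻ x in K, ‖Q x‖ₑ ^ 2) h := by
    intro h
    have hUo : IsOpen (K ∩ (fun x => x + h) ⁻¹' K) :=
      hK.inter (hK.preimage (continuous_add_const h))
    have e1 : ∫⁻ x, F x (x + h) =
        ∫⁻ x in K ∩ (fun x => x + h) ⁻¹' K, ‖G (x + h) - G x‖ₑ ^ 2 := by
      rw [← lintegral_indicator hUo.measurableSet]
      refine lintegral_congr fun x => ?_
      by_cases hx : x ∈ K
      · by_cases hy : x + h ∈ K
        · rw [indicator_of_mem (show x ∈ K ∩ (fun x => x + h) ⁻¹' K from ⟨hx, hy⟩)]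
          simp only [hF, indicator_of_mem hx, indicator_of_mem hy, Pi.one_apply, one_mul]
          rw [enorm_sub_rev]
        · rw [indicator_of_notMem fun h => hy h.2]
          simp [hF, hy]
      · rw [indicator_of_notMem fun h => hx h.1]
        simp [hF, hx]
    rw [e1]
    by_cases hh : h ∈ closedBall (0 : Vec d) δ
    · rw [indicator_of_mem hh]
      refine (lintegral_sub_sq_le hK hc hGi (hdir h) (hw' h)).trans ?_
      rw [← lintegral_const_mul' _ _ (by finiteness), ← lintegral_indicator hKm]
      refine lintegral_mono fun x => ?_
      by_cases hx : x ∈ K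
      · simp only [indicator_of_mem hx]
        rw [← mul_pow]
        refine pow_le_pow_left₀ zero_le ?_ 2
        rw [← ofReal_norm, ← ofReal_norm, ← ENNReal.ofReal_mul diam_nonneg]
        refine ENNReal.ofReal_le_ofReal ?_
        rw [mul_comm]
        refine (norm_inner_le_norm _ _).trans ?_
        exact mul_le_mul_of_nonneg_left (by simpa using hh) (norm_nonneg _)
      · simp [hx]
    · rw [indicator_of_notMem hh]
      have : K ∩ (fun x => x + h) ⁻¹' K = ∅ := by
        refine eq_empty_of_forall_notMem fun x hx => hh ?_
        have := dist_le_diam_of_mem hb hx.2 hx.1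
        simpa [dist_eq_norm] using this
      rw [this]; simp
  rw [s1, s2]
  refine (lintegral_mono s3).trans ?_
  rw [lintegral_indicator measurableSet_closedBall, setLIntegral_const, mul_comm]

/-! ### Mean deviations and fractional regularity -/

theorem IsTest.mono {Ω K : Set (Vec d)} (hK : K ⊆ Ω) {ψ : Vec d → ℝ} (hψ : IsTest K ψ) :
    IsTest Ω ψ := ⟨hψ.1, hψ.2.1, hψ.2.2.trans hK⟩

theorem IsWeakPartial.mono {Ω K : Set (Vec d)} (hΩ : IsOpen Ω) (hK : K ⊆ Ω) {i : Fin d}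
    {v w : Vec d → ℝ} (h : IsWeakPartial Ω i v w) : IsWeakPartial K i v w := by
  intro ψ hψ
  have e1 : ∫ x in Ω, v x * fderiv ℝ ψ x (unitVec i) = ∫ x in K, v x * fderiv ℝ ψ x (unitVec i) :=
    setIntegral_eq_of_subset_of_forall_sdiff_eq_zero hΩ.measurableSet hK fun x hx => by
      rw [(hψ.eq_zero_of_notMem hx.2).2]; simp
  have e2 : ∫ x in Ω, w x * ψ x = ∫ x in K, w x * ψ x :=
    setIntegral_eq_of_subset_of_forall_sdiff_eq_zero hΩ.measurableSet hK fun x hx => by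
      rw [(hψ.eq_zero_of_notMem hx.2).1, mul_zero]
  rw [← e1, ← e2]
  exact h ψ (hψ.mono hK)

/-- The deviation from the mean is controlled by differences. -/
theorem lintegral_sub_average_sq_le {E : Type*} [NormedAddCommGroup E] [NormedSpace ℝ E]
    [CompleteSpace E] {T : Set (Vec d)} (h0 : volume T ≠ 0) (h1 : volume T ≠ ⊤) {F : Vec d → E}
    (hF : IntegrableOn F T) :
    ∫⁻ x in T, ‖F x - ⨍ y in T, F y‖ₑ ^ 2 ≤
      (volume T)⁻¹ * ∫⁻ x in T, ∫⁻ y in T, ‖F x - F y‖ₑ ^ 2 := by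
  rw [← lintegral_const_mul' _ _ (ENNReal.inv_ne_top.2 h0)]
  refine lintegral_mono fun x => ?_
  set ν := (volume T)⁻¹ • volume.restrict T with hν
  have hp : IsProbabilityMeasure ν := ⟨by simp [hν, ENNReal.inv_mul_cancel h0 h1]⟩
  have hi : Integrable F ν := Integrable.smul_measure hF (ENNReal.inv_ne_top.2 h0)
  have e : F x - ⨍ y in T, F y = ∫ y, (F x - F y) ∂ν := by
    rw [integral_sub (integrable_const _) hi, integral_const, probReal_univ, one_smul,
      setAverage_eq']
  rw [e]
  refine (enorm_integral_sq_le _).trans_eq ?_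
  rw [hν, lintegral_smul_measure, smul_eq_mul]

/-- The squared deviation in `L²` of `F` from its mean over the simplex `t`. -/
noncomputable def deviation {E : Type*} [NormedAddCommGroup E] [NormedSpace ℝ E]
    (t : Finset (Vec d)) (F : Vec d → E) : ℝ :=
  ∫ x in simplex t, ‖F x - ⨍ y in simplex t, F y‖ ^ 2

theorem deviation_nonneg {E : Type*} [NormedAddCommGroup E] [NormedSpace ℝ E]
    (t : Finset (Vec d)) (F : Vec d → E) : 0 ≤ deviation t F :=
  integral_nonneg fun x => by positivity

theorem ofReal_deviation {E : Type*} [NormedAddCommGroup E] [NormedSpace ℝ E] {F : Vec d → E}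
    (hF : MemLp F 2 (volume.restrict (simplex t))) :
    ENNReal.ofReal (deviation t F) =
      ∫⁻ x in simplex t, ‖F x - ⨍ y in simplex t, F y‖ₑ ^ 2 := by
  have h : MemLp (fun x => F x - ⨍ y in simplex t, F y) 2 (volume.restrict (simplex t)) :=
    hF.sub (memLp_const _)
  rw [deviation, ofReal_integral_eq_lintegral_ofReal
    (integrable_norm_sq h)
    (.of_forall fun x => by positivity)]
  refine lintegral_congr fun x => ?_
  rw [ENNReal.ofReal_pow (norm_nonneg _), ofReal_norm]

/-- The constant of the Poincaré and regularity estimates on shape regular simplices. -/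
noncomputable def regConst (d : ℕ) (σ : ℝ) : ℝ :=
  (volume.real (ball (0 : Vec d) 1) + 1) * (σ + 1) ^ (d + 2)

theorem regConst_pos (hσ : 0 < σ) : 0 < regConst d σ := by
  have : 0 ≤ volume.real (ball (0 : Vec d) 1) := measureReal_nonneg
  unfold regConst
  positivity

theorem volume_simplex_eq (hd : 1 ≤ d) (ht : IsElement t) :
    volume (simplex t) = ENNReal.ofReal (meshSize t ^ d) := by
  rw [ht.meshSize_pow hd, ofReal_measureReal (isCompact_simplex t).measure_lt_top.ne]

theorem restrict_interior_simplex (t : Finset (Vec d)) :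
    volume.restrict (interior (simplex t)) = volume.restrict (simplex t) :=
  Measure.restrict_congr_set (interior_ae_eq_of_null_frontier
    ((convex_simplex t).addHaar_frontier volume))

/-- The Poincaré inequality on a shape regular simplex. -/
theorem IsElement.deviation_le (hd : 1 ≤ d) (ht : IsElement t)
    (hσt : diam (simplex t) ≤ σ * meshSize t) {g : Vec d → ℝ}
    {Q : Vec d → Vec d} (hg : MemLp g 2 (volume.restrict (simplex t)))
    (hQ : MemLp Q 2 (volume.restrict (simplex t)))
    (hw : ∀ i, IsWeakPartial (interior (simplex t)) i g fun x => Q x i) :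
    ENNReal.ofReal (deviation t g) ≤
      ENNReal.ofReal (regConst d σ * meshSize t ^ 2) * ∫⁻ x in simplex t, ‖Q x‖ₑ ^ 2 := by
  have hT := (isCompact_simplex t).isBounded
  have hh := ht.meshSize_pos
  set h := meshSize t
  set K := interior (simplex t) with hK
  have hr : volume.restrict K = volume.restrict (simplex t) := restrict_interior_simplex t
  have hdiam : diam K ≤ σ * h := (Metric.diam_mono interior_subset hT).trans hσt
  have hv := volume_simplex_eq hd ht
  have h1 := lintegral_lintegral_sub_sq_le isOpen_interior
    (convex_simplex t).interior (hT.subset interior_subset)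
    (g := g) (Q := Q) (by rw [IntegrableOn, hr]; exact hg.integrable (by norm_num))
    (by rw [IntegrableOn, hr]; exact hQ.integrable (by norm_num)) hw
  rw [← hK, hr] at h1
  have h2 := lintegral_sub_average_sq_le (T := simplex t) (F := g)
    (by rw [hv]; simpa using by positivity) (by rw [hv]; exact ENNReal.ofReal_ne_top)
    (hg.integrable (by norm_num))
  rw [ofReal_deviation hg]
  refine (h2.trans (mul_le_mul_right h1 _)).trans ?_
  rw [← mul_assoc, ← mul_assoc]
  refine mul_le_mul_left ?_ _
  have hδ : 0 ≤ diam K := diam_nonneg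
  rw [hv, Measure.addHaar_closedBall _ _ diam_nonneg, finrank_euclideanSpace_fin,
    ← ofReal_measureReal (s := ball (0 : Vec d) 1) Metric.isBounded_ball.measure_lt_top.ne,
    ← ENNReal.ofReal_inv_of_pos (by positivity), ← ENNReal.ofReal_pow hδ,
    ← ENNReal.ofReal_mul (by positivity), ← ENNReal.ofReal_mul (by positivity),
    ← ENNReal.ofReal_mul (by positivity)]
  refine ENNReal.ofReal_le_ofReal ?_
  rw [mul_assoc, inv_mul_le_iff₀ (by positivity)]
  calc diam K ^ d * volume.real (ball (0 : Vec d) 1) * diam K ^ 2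
      = volume.real (ball (0 : Vec d) 1) * diam K ^ (d + 2) := by ring
    _ ≤ (volume.real (ball (0 : Vec d) 1) + 1) * ((σ + 1) * h) ^ (d + 2) := by
        gcongr
        · linarith
        · exact hdiam.trans (by nlinarith)
    _ = h ^ d * (regConst d σ * h ^ 2) := by rw [regConst, mul_pow]; ring

theorem enorm_sq_eq_sum (v : Vec d) : ‖v‖ₑ ^ 2 = ∑ j, ‖v j‖ₑ ^ 2 := by
  rw [← ofReal_norm, ← ENNReal.ofReal_pow (norm_nonneg _), EuclideanSpace.norm_sq_eq,
    ENNReal.ofReal_sum_of_nonneg fun _ _ => by positivity]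
  refine sum_congr rfl fun j _ => ?_
  rw [ENNReal.ofReal_pow (norm_nonneg _), ofReal_norm]

theorem deviation_eq_sum {G : Vec d → Vec d}
    (hG : MemLp G 2 (volume.restrict (simplex t))) :
    deviation t G = ∑ j, deviation t fun x => G x j := by
  have hm : ∀ j, (⨍ y in simplex t, G y) j = ⨍ y in simplex t, G y j := fun j => by
    rw [setAverage_eq, setAverage_eq, PiLp.smul_apply,
      eval_integral_piLp fun i => (hG.eval_piLp i).integrable (by norm_num)]
  have hi : ∀ j, Integrable (fun x => ‖G x j - ⨍ y in simplex t, G y j‖ ^ 2)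
      (volume.restrict (simplex t)) := fun j =>
    integrable_norm_sq ((hG.eval_piLp j).sub (memLp_const _))
  simp only [deviation]
  rw [← integral_finsetSum _ fun j _ => hi j]
  refine integral_congr_ae (.of_forall fun x => ?_)
  simp only [EuclideanSpace.norm_sq_eq, PiLp.sub_apply, hm]

theorem Triangulation.meshSize_le_max (ht : t ∈ 𝒯.elements) : meshSize t ≤ 𝒯.maxMeshSize :=
  le_ciSup (f := fun t : 𝒯.elements => meshSize t.1) (Set.finite_range _).bddAbove ⟨t, ht⟩

/-- The deviations of the gradient from its elementwise means are controlled by the fractional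
Sobolev seminorm. -/
theorem Triangulation.sum_deviation_le (hd : 1 ≤ d)
    (hΩ : IsLipschitzDomain Ω) (hσ : 0 < σ) (hreg : 𝒯.IsShapeRegular σ) {s : ℝ}
    (hs : 0 < s) (hs1 : s ≤ 1) {G : Vec d → Vec d} (hG : MemLp G 2 (volume.restrict Ω)) :
    ENNReal.ofReal (∑ t ∈ 𝒯.elements, deviation t G) ≤
      ENNReal.ofReal (regConst d σ * 𝒯.maxMeshSize ^ (2 * s)) * sobolevSeminormSq Ω s G := by
  -- `s = 1`: Poincaré's inequality; `s < 1`: `|x - y| ≤ σ h` on an element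
  obtain ⟨x₀, hx₀⟩ := hΩ.isConnected.nonempty
  obtain ⟨t₀, ht₀, -⟩ := exists_mem_simplex (𝒯 := 𝒯) (subset_closure hx₀)
  have hm : 0 < 𝒯.maxMeshSize := (isElement ht₀).meshSize_pos.trans_le (meshSize_le_max ht₀)
  have hC := regConst_pos (d := d) hσ
  have hGt : ∀ t ∈ 𝒯.elements, MemLp G 2 (volume.restrict (simplex t)) := fun t ht =>
    hG.mono_measure (restrict_simplex_le hΩ ht)
  rw [ENNReal.ofReal_sum_of_nonneg fun _ _ => deviation_nonneg _ _]
  unfold sobolevSeminormSq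
  split_ifs with h1
  · rw [← ENNReal.div_le_iff' (by simpa using by positivity) ENNReal.ofReal_ne_top]
    refine le_iInf₂ fun H hH => ?_
    rw [ENNReal.div_le_iff' (by simpa using by positivity) ENNReal.ofReal_ne_top]
    have e1 : ∑ i, ∑ j, ∫⁻ x in Ω, ‖H i j x‖ₑ ^ 2 =
        ∑ t ∈ 𝒯.elements, ∑ j, ∫⁻ x in simplex t, ‖WithLp.toLp 2 fun i => H i j x‖ₑ ^ 2 := by
      simp_rw [lintegral_eq_sum (𝒯 := 𝒯) hΩ]
      rw [sum_comm, sum_comm (s := 𝒯.elements)]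
      refine sum_congr rfl fun j _ => ?_
      rw [sum_comm]
      refine sum_congr rfl fun t ht => ?_
      rw [← lintegral_finsetSum' _ fun i _ =>
        (((hH i j).1.mono_measure (restrict_simplex_le hΩ ht)).1.enorm).pow_const 2]
      refine lintegral_congr fun x => ?_
      rw [enorm_sq_eq_sum]
    rw [e1, mul_sum]
    refine sum_le_sum fun t ht => ?_
    rw [deviation_eq_sum (hGt t ht),
      ENNReal.ofReal_sum_of_nonneg fun _ _ => deviation_nonneg _ _, mul_sum]
    refine sum_le_sum fun j _ => ?_
    have hQ : MemLp (fun x => WithLp.toLp 2 fun i => H i j x) 2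
        (volume.restrict (simplex t)) :=
      MemLp.of_eval_piLp fun i => (hH i j).1.mono_measure (restrict_simplex_le hΩ ht)
    refine ((isElement ht).deviation_le hd (hreg t ht) ((hGt t ht).eval_piLp j) hQ
      fun i => (hH i j).2.mono hΩ.isOpen (interior_simplex_subset hΩ ht)).trans ?_
    refine mul_le_mul_left (ENNReal.ofReal_le_ofReal ?_) _
    have h2 : 𝒯.maxMeshSize ^ (2 * s) = 𝒯.maxMeshSize ^ 2 := by
      rw [h1, mul_one]; exact_mod_cast Real.rpow_natCast _ 2
    rw [h2]
    have := meshSize_le_max ht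
    have := (isElement ht).meshSize_pos
    gcongr
  · rw [lintegral_eq_sum (𝒯 := 𝒯) hΩ, mul_sum]
    refine sum_le_sum fun t ht => ?_
    have hte := isElement ht
    have hv := volume_simplex_eq hd hte
    have hh := hte.meshSize_pos
    have hσt := hreg t ht
    have hTb := (isCompact_simplex t).isBounded
    have hTm := (isClosed_simplex t).measurableSet
    set p : ℝ := d + 2 * s with hp
    have hp0 : 0 < p := by positivity
    rw [ofReal_deviation (hGt t ht)]
    have h2 := lintegral_sub_average_sq_le (T := simplex t) (F := G)
      (by rw [hv]; simpa using by positivity) (by rw [hv]; exact ENNReal.ofReal_ne_top)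
      ((hGt t ht).integrable (by norm_num))
    have h3 : ∫⁻ x in simplex t, ∫⁻ y in simplex t, ‖G x - G y‖ₑ ^ 2 ≤
        ENNReal.ofReal ((σ * meshSize t) ^ p) *
          ∫⁻ x in simplex t, ∫⁻ y in Ω, ‖G x - G y‖ₑ ^ 2 / ‖x - y‖ₑ ^ p := by
      rw [← lintegral_const_mul' _ _ ENNReal.ofReal_ne_top]
      refine setLIntegral_mono_ae' hTm (.of_forall fun x hx => ?_)
      refine le_trans ?_ (mul_le_mul_right
        (lintegral_mono' (restrict_simplex_le hΩ ht) le_rfl) _)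
      rw [← lintegral_const_mul' _ _ ENNReal.ofReal_ne_top]
      refine setLIntegral_mono_ae' hTm (.of_forall fun y hy => ?_)
      rcases eq_or_ne x y with rfl | hxy
      · simp
      have h0 : 0 < ‖x - y‖ := norm_pos_iff.2 (sub_ne_zero.2 hxy)
      have h4 : ‖x - y‖ₑ ^ p ≤ ENNReal.ofReal ((σ * meshSize t) ^ p) := by
        rw [← ofReal_norm, ENNReal.ofReal_rpow_of_pos h0]
        refine ENNReal.ofReal_le_ofReal (Real.rpow_le_rpow h0.le ?_ hp0.le)
        rw [← dist_eq_norm]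
        exact (dist_le_diam_of_mem hTb hx hy).trans hσt
      have h5 : ‖x - y‖ₑ ^ p ≠ 0 := by
        rw [← ofReal_norm, ENNReal.ofReal_rpow_of_pos h0]
        simpa using Real.rpow_pos_of_pos h0 p
      have h6 : ‖x - y‖ₑ ^ p ≠ ⊤ := ne_top_of_le_ne_top ENNReal.ofReal_ne_top h4
      calc ‖G x - G y‖ₑ ^ 2 = ‖x - y‖ₑ ^ p * (‖G x - G y‖ₑ ^ 2 / ‖x - y‖ₑ ^ p) :=
            (ENNReal.mul_div_cancel h5 h6).symm
        _ ≤ _ := mul_le_mul_left h4 _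
    refine (h2.trans (mul_le_mul_right h3 _)).trans ?_
    rw [← mul_assoc]
    refine mul_le_mul_left ?_ _
    rw [hv, ← ENNReal.ofReal_inv_of_pos (by positivity), ← ENNReal.ofReal_mul (by positivity)]
    refine ENNReal.ofReal_le_ofReal ?_
    rw [inv_mul_le_iff₀ (by positivity), Real.mul_rpow hσ.le hh.le, hp, Real.rpow_add hh,
      Real.rpow_natCast]
    have h7 : σ ^ ((d : ℝ) + 2 * s) ≤ regConst d σ := by
      calc σ ^ ((d : ℝ) + 2 * s) ≤ (σ + 1) ^ ((d : ℝ) + 2 * s) :=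
            Real.rpow_le_rpow hσ.le (by linarith) hp0.le
        _ ≤ (σ + 1) ^ (((d + 2 : ℕ) : ℝ)) :=
            Real.rpow_le_rpow_of_exponent_le (by linarith) (by push_cast; linarith)
        _ = (σ + 1) ^ (d + 2) := Real.rpow_natCast _ _
        _ ≤ regConst d σ := by
          rw [regConst]
          refine le_mul_of_one_le_left (by positivity) ?_
          linarith [measureReal_nonneg (μ := volume) (s := ball (0 : Vec d) 1)]
    have h8 : meshSize t ^ (2 * s) ≤ 𝒯.maxMeshSize ^ (2 * s) :=
      Real.rpow_le_rpow hh.le (meshSize_le_max ht) (by positivity)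
    calc σ ^ ((d : ℝ) + 2 * s) * (meshSize t ^ d * meshSize t ^ (2 * s))
        ≤ regConst d σ * (meshSize t ^ d * 𝒯.maxMeshSize ^ (2 * s)) := by gcongr
      _ = _ := by ring

/-! ### Lipschitz functions in `H¹₀` -/

/-- A local Lipschitz bound with uniform constant is global, by convexity. -/
theorem lipschitzWith_of_eventually {E : Type*} [NormedAddCommGroup E] [NormedSpace ℝ E]
    {f : E → ℝ} {L : ℝ≥0} (h : ∀ x, ∀ᶠ y in 𝓝 x, |f y - f x| ≤ L * ‖y - x‖) :
    LipschitzWith L f := by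
  have hc : Continuous f := by
    refine continuous_iff_continuousAt.2 fun x => ?_
    rw [ContinuousAt, tendsto_iff_norm_sub_tendsto_zero]
    have h2 : Tendsto (fun y => (L : ℝ) * ‖y - x‖) (𝓝 x) (𝓝 0) := by
      have : Continuous fun y : E => (L : ℝ) * ‖y - x‖ := by fun_prop
      simpa using this.tendsto x
    exact squeeze_zero' (.of_forall fun _ => norm_nonneg _) (h x) h2
  have key : ∀ x y, f y - f x ≤ L * ‖y - x‖ := by
    intro x y
    have hl : Continuous fun s : ℝ => x + s • (y - x) := by fun_prop
    have h1 := image_le_of_liminf_slope_right_le_deriv_boundary (a := 0) (b := 1)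
      (f := fun s : ℝ => f (x + s • (y - x)) - f x) (B := fun s => L * ‖y - x‖ * s)
      (B' := fun _ => L * ‖y - x‖) ((hc.comp hl).sub continuous_const).continuousOn (by simp)
      (by fun_prop) (fun s _ => by
        simpa using ((hasDerivAt_id s).const_mul (L * ‖y - x‖)).hasDerivWithinAt)
      (fun s _ r hr => by
        refine Eventually.frequently ?_
        have h2 := (hl.tendsto s).eventually (h (x + s • (y - x)))
        filter_upwards [nhdsWithin_le_nhds h2, self_mem_nhdsWithin] with z hz (hsz : s < z)
        rw [slope_def_field]
        refine lt_of_le_of_lt ?_ hr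
        rw [div_le_iff₀ (sub_pos.2 hsz)]
        have h3 : x + z • (y - x) - (x + s • (y - x)) = (z - s) • (y - x) := by module
        rw [h3, norm_smul, Real.norm_eq_abs, abs_of_pos (sub_pos.2 hsz)] at hz
        linarith [(le_abs_self _).trans hz])
    have h2 := h1 (right_mem_Icc.2 zero_le_one)
    simpa using h2
  refine LipschitzWith.of_dist_le_mul fun x y => ?_
  rw [Real.dist_eq, dist_eq_norm, abs_le]
  have := key x y
  rw [norm_sub_rev] at this
  exact ⟨by linarith, key y x⟩

theorem gradient_apply_eq (f : Vec d → ℝ) (x : Vec d) (i : Fin d) :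
    gradient f x i = fderiv ℝ f x (unitVec i) := by
  rw [← unitVec_inner, real_inner_comm, gradient, InnerProductSpace.toDual_symm_apply]

theorem norm_gradient (f : Vec d → ℝ) (x : Vec d) : ‖gradient f x‖ = ‖fderiv ℝ f x‖ := by
  rw [gradient, LinearIsometryEquiv.norm_map]

theorem measurable_gradient (f : Vec d → ℝ) : Measurable (gradient f) :=
  (InnerProductSpace.toDual ℝ (Vec d)).symm.continuous.measurable.comp (measurable_fderiv ℝ f)

/-- A Lipschitz function on a bounded set as an element of `H¹(Ω)`. -/
noncomputable def H1.ofLipschitz (hb : Bornology.IsBounded Ω) (hΩ : IsOpen Ω)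
    {f : Vec d → ℝ} {L : ℝ≥0} (hf : LipschitzWith L f) : H1 Ω where
  val := f
  grad := gradient f
  memLp_val := by
    have : IsFiniteMeasure (volume.restrict Ω) := ⟨by simpa using hb.measure_lt_top⟩
    obtain ⟨C, hC⟩ := exists_norm_le_of_lipschitzOnWith (hf.lipschitzOnWith (s := Ω)) hb
    refine MemLp.of_bound hf.continuous.aestronglyMeasurable C ?_
    filter_upwards [ae_restrict_mem hΩ.measurableSet] with x hx using hC x hx
  memLp_grad := by
    have : IsFiniteMeasure (volume.restrict Ω) := ⟨by simpa using hb.measure_lt_top⟩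
    refine MemLp.of_bound (measurable_gradient f).aestronglyMeasurable L
      (.of_forall fun x => ?_)
    rw [norm_gradient]
    exact norm_fderiv_le_of_lipschitz ℝ hf
  weak i ψ hψ := by
    obtain ⟨L', hL'⟩ := hψ.contDiff_one.lipschitzWith_of_hasCompactSupport hψ.2.1 (by norm_num)
    have h := LipschitzWith.integral_lineDeriv_mul_eq (μ := volume) hf hL' hψ.2.1 (unitVec i)
    have e1 : ∫ x in Ω, f x * fderiv ℝ ψ x (unitVec i) =
        -∫ x, lineDeriv ℝ ψ x (-unitVec i) * f x := by
      rw [← integral_neg, setIntegral_eq_integral_of_forall_compl_eq_zero fun x hx => by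
        rw [(hψ.eq_zero_of_notMem hx).2]; simp]
      refine integral_congr_ae (.of_forall fun x => ?_)
      simp only
      rw [(hψ.differentiableAt x).lineDeriv_eq_fderiv, map_neg]; ring
    have e2 : ∫ x in Ω, gradient f x i * ψ x = ∫ x, lineDeriv ℝ f x (unitVec i) * ψ x := by
      rw [setIntegral_eq_integral_of_forall_compl_eq_zero fun x hx => by
        rw [(hψ.eq_zero_of_notMem hx).1, mul_zero]]
      refine integral_congr_ae ?_
      filter_upwards [hf.ae_differentiableAt] with x hx
      rw [gradient_apply_eq, hx.lineDeriv_eq_fderiv]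
    rw [e1, e2, h]

/-- Dominated convergence in `L²`. -/
theorem tendsto_eLpNorm_of_bounded {α E : Type*} [MeasurableSpace α] {μ : Measure α}
    [IsFiniteMeasure μ] [NormedAddCommGroup E] {F : ℕ → α → E} {f : α → E} {C : ℝ}
    (hF : ∀ n, AEStronglyMeasurable (F n) μ) (hf : AEStronglyMeasurable f μ)
    (hC : ∀ n, ∀ᵐ x ∂μ, ‖f x - F n x‖ ≤ C)
    (h : ∀ᵐ x ∂μ, Tendsto (fun n => F n x) atTop (𝓝 (f x))) :
    Tendsto (fun n => eLpNorm (fun x => f x - F n x) 2 μ) atTop (𝓝 0) := by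
  have e : ∀ n, eLpNorm (fun x => f x - F n x) 2 μ =
      (∫⁻ x, ‖f x - F n x‖ₑ ^ (2 : ℝ) ∂μ) ^ (1 / 2 : ℝ) := fun n => by
    rw [eLpNorm_eq_lintegral_rpow_enorm_toReal (by norm_num) (by norm_num)]
    simp
  simp_rw [e]
  have h1 : Tendsto (fun n => ∫⁻ x, ‖f x - F n x‖ₑ ^ (2 : ℝ) ∂μ) atTop (𝓝 (∫⁻ _, 0 ∂μ)) := by
    refine tendsto_lintegral_of_dominated_convergence' (fun _ => ENNReal.ofReal C ^ (2 : ℝ))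
      (fun n => ((hf.sub (hF n)).enorm).pow_const _) (fun n => ?_) ?_ ?_
    · filter_upwards [hC n] with x hx
      refine ENNReal.rpow_le_rpow ?_ (by norm_num)
      rw [← ofReal_norm]
      exact ENNReal.ofReal_le_ofReal hx
    · rw [lintegral_const]
      exact ENNReal.mul_ne_top (by finiteness) (measure_ne_top _ _)
    · filter_upwards [h] with x hx
      have h2 := ((tendsto_const_nhds (x := f x)).sub hx).enorm
      rw [sub_self, enorm_zero] at h2
      have h3 := (ENNReal.continuous_rpow_const (y := 2)).tendsto 0 |>.comp h2
      simpa [Function.comp_def] using h3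
  have h2 := (ENNReal.continuous_rpow_const (y := 1 / 2)).tendsto _ |>.comp h1
  simpa [Function.comp_def] using h2

theorem H1.inH10_of_tendsto {v : H1 Ω} {u : ℕ → H1 Ω} (hu : ∀ n, (u n).InH10)
    (h1 : Tendsto (fun n => eLpNorm (fun x => v.val x - (u n).val x) 2 (volume.restrict Ω))
      atTop (𝓝 0))
    (h2 : Tendsto (fun n => eLpNorm (fun x => v.grad x - (u n).grad x) 2 (volume.restrict Ω))
      atTop (𝓝 0)) : v.InH10 := by
  refine inH10_of_toAmbient_mem ?_
  have hc : IsClosed (H1.space Ω : Set (Ambient Ω)) := Submodule.isClosed_topologicalClosure _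
  exact hc.mem_of_tendsto (tendsto_toAmbient_iff.2 ⟨h1, h2⟩)
    (.of_forall fun n => toAmbient_mem_space (hu n))

open Convolution in
/-- Mollification commutes with differentiation of Lipschitz functions. -/
theorem fderiv_convolution_eq (ρ : ContDiffBump (0 : Vec d)) {f : Vec d → ℝ} {L : ℝ≥0}
    (hf : LipschitzWith L f) (x v : Vec d) :
    fderiv ℝ (ρ.normed volume ⋆[ContinuousLinearMap.lsmul ℝ ℝ, volume] f) x v =
      (ρ.normed volume ⋆[ContinuousLinearMap.lsmul ℝ ℝ, volume] fun y => fderiv ℝ f y v) x := by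
  set φ := ρ.normed volume
  have hφ : ContDiff ℝ 1 φ := ρ.contDiff_normed
  have hφc : HasCompactSupport φ := ρ.hasCompactSupport_normed
  have hfl : LocallyIntegrable f := hf.continuous.locallyIntegrable
  rw [← convolution_flip, (hφc.hasFDerivAt_convolution_right
    (ContinuousLinearMap.lsmul ℝ ℝ).flip hfl hφ x).fderiv,
    convolution_precompR_apply _ hfl (hφc.fderiv ℝ) (hφ.continuous_fderiv (by norm_num)),
    convolution_flip, convolution_lsmul, convolution_lsmul]
  obtain ⟨L', hL'⟩ := hφ.lipschitzWith_of_hasCompactSupport hφc (by norm_num)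
  have hf' : LipschitzWith L fun y => f (x - y) := by
    have : LipschitzWith (L * 1) fun y => f (x - y) :=
      hf.comp (LipschitzWith.of_dist_le_mul fun y z => by
        simp [dist_eq_norm, norm_sub_rev])
    simpa using this
  have h := LipschitzWith.integral_lineDeriv_mul_eq (μ := volume) hf' hL' hφc v
  have e1 : ∫ y, fderiv ℝ φ y v • f (x - y) = -∫ y, lineDeriv ℝ φ y (-v) * f (x - y) := by
    rw [← integral_neg]
    refine integral_congr_ae (.of_forall fun y => ?_)
    simp only
    rw [(hφ.differentiable (by norm_num) y).lineDeriv_eq_fderiv, map_neg, smul_eq_mul]; ring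
  rw [e1, ← h, ← integral_neg]
  refine integral_congr_ae ?_
  have hd : ∀ᵐ y, DifferentiableAt ℝ f (x - y) :=
    (Measure.measurePreserving_sub_left volume x).quasiMeasurePreserving.ae hf.ae_differentiableAt
  filter_upwards [hd] with y hy
  have h1 : HasFDerivAt (fun y => f (x - y)) ((fderiv ℝ f (x - y)).comp (-.id ℝ (Vec d))) y :=
    hy.hasFDerivAt.comp y ((hasFDerivAt_id y).const_sub x)
  rw [(h1.hasLineDerivAt v).lineDeriv]
  simp [mul_comm]

open Convolution in
/-- By mollification. -/
theorem H1.inH10_of_hasCompactSupport (hb : Bornology.IsBounded Ω)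
    (hΩ : IsOpen Ω) {f : Vec d → ℝ} {L : ℝ≥0} (hf : LipschitzWith L f)
    (hc : HasCompactSupport f) (hs : tsupport f ⊆ Ω) : (H1.ofLipschitz hb hΩ hf).InH10 := by
  obtain ⟨δ, hδ, hδΩ⟩ := hc.isCompact.exists_cthickening_subset_open hΩ hs
  have hfin : IsFiniteMeasure (volume.restrict Ω) := ⟨by simpa using hb.measure_lt_top⟩
  have hpos : ∀ n : ℕ, 0 < δ / (n + 1) := fun n => by positivity
  let ρ : ℕ → ContDiffBump (0 : Vec d) := fun n =>
    ⟨δ / (n + 1) / 2, δ / (n + 1), half_pos (hpos n), half_lt_self (hpos n)⟩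
  have hρ : Tendsto (fun n => (ρ n).rOut) atTop (𝓝 0) := by
    have := (tendsto_one_div_add_atTop_nhds_zero_nat (𝕜 := ℝ)).const_mul δ
    simpa [ρ, div_eq_mul_inv] using this
  set F : ℕ → Vec d → ℝ := fun n =>
    (ρ n).normed volume ⋆[ContinuousLinearMap.lsmul ℝ ℝ, volume] f with hF
  have hsupp : ∀ n, Function.support (F n) ⊆ Metric.cthickening δ (tsupport f) := by
    intro n x hx
    obtain ⟨y, hy, z, hz, rfl⟩ := support_convolution_subset _ hx
    rw [(ρ n).support_normed_eq] at hy
    refine Metric.mem_cthickening_of_dist_le _ z _ _ (subset_tsupport f hz) ?_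
    have h1 : dist y 0 < δ / (n + 1) := hy
    have h2 : δ / (n + 1) ≤ δ := div_le_self hδ.le (by linarith [n.cast_nonneg (α := ℝ)])
    rw [dist_zero_right] at h1
    rw [dist_eq_norm, add_sub_cancel_right]
    linarith
  have htest : ∀ n, IsTest Ω (F n) := by
    intro n
    have h1 : tsupport (F n) ⊆ Metric.cthickening δ (tsupport f) :=
      closure_minimal (hsupp n) Metric.isClosed_cthickening
    exact ⟨(ρ n).hasCompactSupport_normed.contDiff_convolution_left _ (ρ n).contDiff_normed
      hf.continuous.locallyIntegrable,
      hc.isCompact.cthickening.of_isClosed_subset (isClosed_tsupport _) h1, h1.trans hδΩ⟩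
  have hmd : ∀ v, Measurable fun y => fderiv ℝ f y v := fun v => measurable_fderiv_apply_const ℝ f v
  have hle : ∀ v x, ‖fderiv ℝ f x v‖ ≤ L * ‖v‖ := fun v x =>
    (ContinuousLinearMap.le_opNorm _ _).trans
      (mul_le_mul_of_nonneg_right (norm_fderiv_le_of_lipschitz ℝ hf) (norm_nonneg _))
  refine ⟨F, htest, ?_, ?_⟩
  · refine tendsto_eLpNorm_of_bounded (C := L * δ)
      (fun n => (htest n).1.continuous.aestronglyMeasurable)
      hf.continuous.aestronglyMeasurable (fun n => .of_forall fun x => ?_)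
      (.of_forall fun x =>
        ContDiffBump.convolution_tendsto_right_of_continuous hρ hf.continuous x)
    have h2 : δ / (n + 1) ≤ δ := div_le_self hδ.le (by linarith [n.cast_nonneg (α := ℝ)])
    rw [← dist_eq_norm, dist_comm]
    refine ContDiffBump.dist_normed_convolution_le hf.continuous.aestronglyMeasurable
      fun y hy => (hf.dist_le_mul y x).trans ?_
    exact mul_le_mul_of_nonneg_left ((Metric.mem_ball.1 hy).le.trans h2) L.2
  · have hcoord : ∀ i, ∀ᵐ x, Tendsto (fun n => gradient (F n) x i) atTop (𝓝 (gradient f x i)) := by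
      intro i
      have h1 : LocallyIntegrable fun y => fderiv ℝ f y (unitVec i) := by
        refine (locallyIntegrable_const (L * ‖(unitVec i : Vec d)‖)).mono
          (hmd _).aestronglyMeasurable (.of_forall fun x => ?_)
        exact (hle _ x).trans (le_abs_self _)
      filter_upwards [ContDiffBump.ae_convolution_tendsto_right_of_locallyIntegrable (K := 2)
        (μ := volume) hρ (.of_forall fun n => by simp only [ρ]; linarith) h1] with x hx
      simp_rw [gradient_apply_eq]
      refine hx.congr fun n => ?_
      exact (fderiv_convolution_eq (ρ n) hf x (unitVec i)).symm
    refine tendsto_eLpNorm_of_bounded (C := ∑ i : Fin d, 2 * (L * ‖(unitVec i : Vec d)‖))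
      (fun n => (measurable_gradient _).aestronglyMeasurable)
      (measurable_gradient _).aestronglyMeasurable (fun n => .of_forall fun x => ?_) ?_
    · have h1 : ∀ v : Vec d, ‖v‖ ≤ ∑ i, ‖v i‖ := fun v => by
        conv_lhs => rw [← sum_mul_unitVec v]
        refine (norm_sum_le _ _).trans_eq (sum_congr rfl fun i _ => ?_)
        rw [norm_smul, norm_unitVec, mul_one]
      refine (h1 _).trans (sum_le_sum fun i _ => ?_)
      change ‖gradient f x i - gradient (F n) x i‖ ≤ _
      rw [gradient_apply_eq, gradient_apply_eq, hF, fderiv_convolution_eq (ρ n) hf x (unitVec i),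
        ← dist_eq_norm, dist_comm]
      refine ContDiffBump.dist_normed_convolution_le (hmd _).aestronglyMeasurable fun y _ => ?_
      rw [dist_eq_norm]
      have := norm_sub_le (fderiv ℝ f y (unitVec i)) (fderiv ℝ f x (unitVec i))
      linarith [hle (unitVec i) y, hle (unitVec i) x]
    · refine ae_restrict_of_ae ?_
      filter_upwards [ae_all_iff.2 hcoord] with x hx
      have h1 : Tendsto (fun n => ∑ i, gradient (F n) x i • (unitVec i : Vec d)) atTop
          (𝓝 (∑ i, gradient f x i • (unitVec i : Vec d))) :=
        tendsto_finsetSum _ fun i _ => (hx i).smul_const _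
      simp only [sum_mul_unitVec] at h1
      exact h1

/-- A nonnegative Lipschitz function that vanishes outside of `Ω` is in `H¹₀(Ω)`: cut it off near
the zero set. -/
theorem H1.inH10_of_nonneg (hb : Bornology.IsBounded Ω)
    (hΩ : IsOpen Ω) {f : Vec d → ℝ} {L : ℝ≥0} (hf : LipschitzWith L f) (h0 : ∀ x, 0 ≤ f x)
    (hs : ∀ x ∉ Ω, f x = 0) : (H1.ofLipschitz hb hΩ hf).InH10 := by
  have hfin : IsFiniteMeasure (volume.restrict Ω) := ⟨by simpa using hb.measure_lt_top⟩
  set ε : ℕ → ℝ := fun n => 1 / ((n : ℝ) + 1) with hε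
  have hεpos : ∀ n, 0 < ε n := fun n => by positivity
  have hε1 : ∀ n, ε n ≤ 1 := fun n => by
    rw [hε]
    exact div_le_self zero_le_one (by linarith [n.cast_nonneg (α := ℝ)])
  have hεlim : Tendsto ε atTop (𝓝 0) := tendsto_one_div_add_atTop_nhds_zero_nat
  -- cut off at height `ε n`, which makes the support compact in `Ω`
  set F : ℕ → Vec d → ℝ := fun n x => max (f x - ε n) 0 with hF
  have hL : ∀ n, LipschitzWith L (F n) := fun n => by
    have : LipschitzWith L fun x => f x - ε n := LipschitzWith.of_dist_le_mul fun x y => by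
      simpa using hf.dist_le_mul x y
    exact this.max_const 0
  have hsupp : ∀ n, tsupport (F n) ⊆ {x | ε n ≤ f x} := fun n =>
    closure_minimal (fun x hx => by
      by_contra h
      have h' : f x < ε n := not_le.1 h
      exact hx (max_eq_right (by linarith))) (isClosed_le continuous_const hf.continuous)
  have hsub : ∀ n, {x | ε n ≤ f x} ⊆ Ω := fun n x (hx : ε n ≤ f x) => by
    by_contra h
    rw [hs x h] at hx
    linarith [hεpos n]
  have hcs : ∀ n, HasCompactSupport (F n) := fun n =>
    Metric.isCompact_of_isClosed_isBounded (isClosed_tsupport _)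
      (hb.subset ((hsupp n).trans (hsub n)))
  -- zeros of `f` are minima, so the gradient vanishes there
  have hgrad : ∀ x, Tendsto (fun n => gradient (F n) x) atTop (𝓝 (gradient f x)) := by
    intro x
    refine tendsto_const_nhds.congr' ?_
    rcases (h0 x).eq_or_lt with hx | hx
    · refine .of_forall fun n => ?_
      have h1 : fderiv ℝ f x = 0 :=
        IsLocalMin.fderiv_eq_zero (.of_forall fun y => hx ▸ h0 y)
      have h2 : F n =ᶠ[𝓝 x] fun _ => 0 := by
        have h3 : ∀ᶠ y in 𝓝 x, f y < ε n :=
          hf.continuous.continuousAt.eventually_lt continuousAt_const (hx ▸ hεpos n)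
        filter_upwards [h3] with y hy
        exact max_eq_right (by linarith)
      simp only [gradient]
      rw [h1, h2.fderiv_eq]
      simp
    · filter_upwards [hεlim.eventually_lt_const hx] with n hn
      have h2 : F n =ᶠ[𝓝 x] fun y => f y - ε n := by
        have h3 : ∀ᶠ y in 𝓝 x, ε n < f y :=
          continuousAt_const.eventually_lt hf.continuous.continuousAt hn
        filter_upwards [h3] with y hy
        exact max_eq_left (by linarith)
      simp only [gradient]
      rw [h2.fderiv_eq, fderiv_sub_const]
  refine H1.inH10_of_tendsto (fun n => H1.inH10_of_hasCompactSupport hb hΩ (hL n) (hcs n)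
    ((hsupp n).trans (hsub n))) ?_ ?_
  · refine tendsto_eLpNorm_of_bounded (C := 1) (fun n => (hL n).continuous.aestronglyMeasurable)
      hf.continuous.aestronglyMeasurable (fun n => .of_forall fun x => ?_)
      (.of_forall fun x => ?_)
    · change |f x - max (f x - ε n) 0| ≤ 1
      have := h0 x; have := hε1 n; have := hεpos n
      rcases max_cases (f x - ε n) 0 with ⟨h, h'⟩ | ⟨h, h'⟩ <;> rw [h, abs_le] <;>
        constructor <;> linarith
    · have h1 : Tendsto (fun n => max (f x - ε n) 0) atTop (𝓝 (max (f x - 0) 0)) :=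
        Filter.Tendsto.max (hεlim.const_sub (f x)) tendsto_const_nhds
      rw [sub_zero, max_eq_left (h0 x)] at h1
      exact h1
  · refine tendsto_eLpNorm_of_bounded (C := L + L)
      (fun n => (measurable_gradient _).aestronglyMeasurable)
      (measurable_gradient _).aestronglyMeasurable (fun n => .of_forall fun x => ?_)
      (.of_forall hgrad)
    change ‖gradient f x - gradient (F n) x‖ ≤ _
    refine (norm_sub_le _ _).trans ?_
    rw [norm_gradient, norm_gradient]
    exact add_le_add (norm_fderiv_le_of_lipschitz ℝ hf) (norm_fderiv_le_of_lipschitz ℝ (hL n))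

/-- A Lipschitz function that vanishes outside of `Ω` is in `H¹₀(Ω)`. -/
theorem H1.inH10_ofLipschitz (hb : Bornology.IsBounded Ω)
    (hΩ : IsOpen Ω) {f : Vec d → ℝ} {L : ℝ≥0} (hf : LipschitzWith L f)
    (hs : ∀ x ∉ Ω, f x = 0) : (H1.ofLipschitz hb hΩ hf).InH10 := by
  have hp : LipschitzWith L fun x => max (f x) 0 := hf.max_const 0
  have hn : LipschitzWith L fun x => max (-f x) 0 := hf.neg.max_const 0
  have h1 := H1.inH10_of_nonneg hb hΩ hp (fun x => le_max_right _ _) fun x hx => by simp [hs x hx]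
  have h2 := H1.inH10_of_nonneg hb hΩ hn (fun x => le_max_right _ _) fun x hx => by simp [hs x hx]
  have h3 := h1.lin h2 1 (-1)
  have e : (H1.ofLipschitz hb hΩ hf).toAmbient =
      (H1.lin 1 (-1) (H1.ofLipschitz hb hΩ hp) (H1.ofLipschitz hb hΩ hn)).toAmbient := by
    have hfe : ∀ x, f x = 1 * max (f x) 0 + -1 * max (-f x) 0 := fun x => by
      have := max_zero_sub_max_neg_zero_eq_self (f x)
      linarith
    refine H1.toAmbient_eq_iff.2 ⟨Eventually.of_forall hfe, ?_⟩
    refine ae_restrict_of_ae ?_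
    filter_upwards [hp.ae_differentiableAt, hn.ae_differentiableAt] with x hxp hxn
    have h4 : HasFDerivAt f ((1 : ℝ) • fderiv ℝ (fun x => max (f x) 0) x +
        (-1 : ℝ) • fderiv ℝ (fun x => max (-f x) 0) x) x := by
      have := (hxp.hasFDerivAt.const_smul (1 : ℝ)).add (hxn.hasFDerivAt.const_smul (-1 : ℝ))
      exact this.congr_of_eventuallyEq (.of_forall hfe)
    change gradient f x = (1 : ℝ) • gradient _ x + (-1 : ℝ) • gradient _ x
    simp only [gradient]
    rw [h4.fderiv, map_add, map_smulₛₗ, map_smulₛₗ]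
    rfl
  refine H1.inH10_of_toAmbient_mem ?_
  rw [e]
  exact H1.toAmbient_mem_space h3

/-! ### Continuous piecewise affine functions -/

/-- The affine function with the vertex values `θ` on the simplex `t`. -/
noncomputable def nodal (t : Finset (Vec d)) (θ : Vec d → ℝ) : Vec d →ᵃ[ℝ] ℝ :=
  ∑ a ∈ t, θ a • bary t a

theorem nodal_apply (t : Finset (Vec d)) (θ : Vec d → ℝ) (x : Vec d) :
    nodal t θ x = ∑ a ∈ t, θ a * bary t a x := by
  classical
  have h : ∀ s : Finset (Vec d), (∑ a ∈ s, θ a • bary t a) x = ∑ a ∈ s, θ a * bary t a x := by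
    intro s
    induction s using Finset.induction_on with
    | empty => simp
    | insert a s ha ih => rw [Finset.sum_insert ha, Finset.sum_insert ha, ← ih]; simp
  exact h t

theorem agrad_nodal (t : Finset (Vec d)) (θ : Vec d → ℝ) :
    agrad (nodal t θ) = ∑ a ∈ t, θ a • agrad (bary t a) := by
  refine ext_inner_right ℝ fun v => ?_
  rw [sum_inner]
  simp_rw [real_inner_smul_left]
  have h1 : ∀ f : Vec d →ᵃ[ℝ] ℝ, inner ℝ (agrad f) v = f v - f 0 := fun f => by
    rw [affine_sub_eq_inner, sub_zero]
  simp_rw [h1, nodal_apply, ← sum_sub_distrib, mul_sub]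

/-- Nodal values that vanish outside of `Ω` define an element of `H¹₀(Ω)` which is affine on every
element. -/
theorem Triangulation.exists_of_nodal (𝒯 : Triangulation Ω)
    (hΩ : IsLipschitzDomain Ω) {θ : Vec d → ℝ} (hθ : ∀ a, a ∉ Ω → θ a = 0) :
    ∃ w : H1 Ω, w.InH10 ∧ (∀ t ∈ 𝒯.elements, ∀ x ∈ simplex t, w.val x = nodal t θ x) ∧
      ∀ t ∈ 𝒯.elements, ∀ x ∈ interior (simplex t), w.grad x = agrad (nodal t θ) := by
  classical
  set w : Vec d → ℝ := fun x =>
    if h : ∃ t ∈ 𝒯.elements, x ∈ simplex t then nodal h.choose θ x else 0 with hw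
  have hval : ∀ t ∈ 𝒯.elements, ∀ x ∈ simplex t, w x = nodal t θ x := by
    intro t ht x hx
    have h : ∃ t ∈ 𝒯.elements, x ∈ simplex t := ⟨t, ht, hx⟩
    simp only [hw, dif_pos h]
    obtain ⟨h1, h2⟩ := h.choose_spec
    set t' := h.choose
    rw [nodal_apply, nodal_apply, ← sum_subset Finset.inter_subset_left (s₁ := t' ∩ t),
      ← sum_subset Finset.inter_subset_right (s₁ := t' ∩ t)]
    · refine sum_congr rfl fun a ha => ?_
      rw [(bary_inter h1 ht h2 hx (Finset.mem_inter.1 ha).1).1 (Finset.mem_inter.1 ha).2]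
    · intro a ha hna
      rw [(bary_inter ht h1 hx h2 ha).2 fun h => hna (Finset.mem_inter.2 ⟨h, ha⟩), mul_zero]
    · intro a ha hna
      rw [(bary_inter h1 ht h2 hx ha).2 fun h => hna (Finset.mem_inter.2 ⟨ha, h⟩), mul_zero]
  have hzero : ∀ x ∉ Ω, w x = 0 := by
    intro x hx
    by_cases h : ∃ t ∈ 𝒯.elements, x ∈ simplex t
    · obtain ⟨t, ht, hxt⟩ := h
      rw [hval t ht x hxt, nodal_apply]
      refine sum_eq_zero fun a ha => ?_
      by_cases haΩ : a ∈ Ω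
      · have h1 := ((isElement ht).mem_simplex.1 hxt) a ha
        rcases h1.eq_or_lt with h2 | h2
        · rw [← h2, mul_zero]
        · exact absurd (mem_of_bary_pos hΩ haΩ ht ha hxt h2) hx
      · rw [hθ a haΩ, zero_mul]
    · simp only [hw, dif_neg h]
  set L : ℝ≥0 := ∑ t ∈ 𝒯.elements, ‖agrad (nodal t θ)‖₊ with hL
  have hlip : ∀ t ∈ 𝒯.elements, ∀ x y, |nodal t θ y - nodal t θ x| ≤ L * ‖y - x‖ := by
    intro t ht x y
    have h1 := (affine_lipschitz (nodal t θ)).dist_le_mul y x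
    rw [Real.dist_eq, dist_eq_norm] at h1
    refine h1.trans (mul_le_mul_of_nonneg_right ?_ (norm_nonneg _))
    exact_mod_cast single_le_sum (f := fun t => ‖agrad (nodal t θ)‖₊)
      (fun _ _ => zero_le) ht
  -- near every point, the function is made up of the pieces that are active at this point
  have hwL : LipschitzWith L w := by
    refine lipschitzWith_of_eventually fun x => ?_
    have h1 : ∀ᶠ y in 𝓝 x, ∀ t ∈ 𝒯.elements, x ∉ simplex t → y ∉ simplex t := by
      rw [eventually_all_finset]
      intro t _
      by_cases h : x ∈ simplex t
      · simp [h]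
      · filter_upwards [(isClosed_simplex t).isOpen_compl.mem_nhds h] with y hy _ using hy
    have h2 : ∀ᶠ y in 𝓝 x, x ∈ Ω → y ∈ Ω := by
      by_cases h : x ∈ Ω
      · filter_upwards [hΩ.isOpen.mem_nhds h] with y hy _ using hy
      · simp [h]
    filter_upwards [h1, h2] with y hy hyΩ
    by_cases h : ∃ t ∈ 𝒯.elements, y ∈ simplex t
    · obtain ⟨t, ht, hyt⟩ := h
      have hxt : x ∈ simplex t := by_contra fun h => hy t ht h hyt
      rw [hval t ht x hxt, hval t ht y hyt]
      exact hlip t ht x y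
    · have hyn : y ∉ Ω := fun hy' => h (exists_mem_simplex (subset_closure hy'))
      rw [hzero y hyn, hzero x fun hx => hyn (hyΩ hx), sub_self, abs_zero]
      positivity
  refine ⟨H1.ofLipschitz hΩ.isBounded hΩ.isOpen hwL, H1.inH10_ofLipschitz _ _ hwL hzero, hval,
    fun t ht x hx => ?_⟩
  exact gradient_eq_of_eqOn_affine (fun y hy => hval t ht y hy) hx

/-! ### Local affine approximation -/

/-- The affine function with the gradient `m` and the value `c` at the origin. -/
noncomputable def affineOf (m : Vec d) (c : ℝ) : Vec d →ᵃ[ℝ] ℝ :=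
  (innerₗ (Vec d) m).toAffineMap + AffineMap.const ℝ (Vec d) c

theorem affineOf_apply (m : Vec d) (c : ℝ) (x : Vec d) : affineOf m c x = inner ℝ m x + c := by
  simp [affineOf]

theorem agrad_affineOf (m : Vec d) (c : ℝ) : agrad (affineOf m c) = m := by
  refine ext_inner_right ℝ fun v => ?_
  have h := affine_sub_eq_inner (affineOf m c) v 0
  rw [sub_zero, affineOf_apply, affineOf_apply, inner_zero_right] at h
  rw [← h]; ring

/-- Approximation of an `H¹`-function by an affine function on an element. -/
theorem Triangulation.exists_affine_approx (hd : 1 ≤ d)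
    (hΩ : IsLipschitzDomain Ω) (hσ : 0 < σ) (hreg : 𝒯.IsShapeRegular σ) (v : H1 Ω)
    (ht : t ∈ 𝒯.elements) :
    ∃ p : Vec d →ᵃ[ℝ] ℝ, agrad p = ⨍ x in simplex t, v.grad x ∧
      ∫ x in simplex t, (v.val x - p x) ^ 2 ≤
        regConst d σ * meshSize t ^ 2 * deviation t v.grad := by
  have hle := restrict_simplex_le hΩ ht
  have hKΩ := interior_simplex_subset hΩ ht
  have hKb : Bornology.IsBounded (interior (simplex t)) :=
    (isCompact_simplex t).isBounded.subset interior_subset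
  set m := ⨍ x in simplex t, v.grad x with hm
  -- Poincaré's inequality for `v - ℓ`, where `ℓ` has the mean gradient
  set ℓ := affineOf m 0 with hℓ
  have hr := restrict_interior_simplex t
  let wℓ : H1 (interior (simplex t)) := H1.ofLipschitz hKb isOpen_interior (affine_lipschitz ℓ)
  have hgℓ : ∀ x, gradient ℓ x = m := fun x => by
    rw [gradient_eq_of_eqOn_affine (S := univ) (fun y _ => rfl) (by simp), agrad_affineOf]
  have hv := v.memLp_val.mono_measure hle
  have hG := v.memLp_grad.mono_measure hle
  have hℓL : MemLp ℓ 2 (volume.restrict (simplex t)) := hr ▸ wℓ.memLp_val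
  have hQ : MemLp (fun x => v.grad x - m) 2 (volume.restrict (simplex t)) :=
    hG.sub (memLp_const _)
  have hg : MemLp (fun x => v.val x - ℓ x) 2 (volume.restrict (simplex t)) := hv.sub hℓL
  have hw : ∀ i, IsWeakPartial (interior (simplex t)) i (fun x => v.val x - ℓ x)
      fun x => (v.grad x - m) i := by
    intro i
    let vK : H1 (interior (simplex t)) :=
      ⟨v.val, v.grad, hr ▸ hv, hr ▸ hG, fun i => (v.weak i).mono hΩ.isOpen hKΩ⟩
    have h := (H1.lin 1 (-1) vK wℓ).weak i
    have e1 : (H1.lin 1 (-1) vK wℓ).val = fun x => v.val x - ℓ x := by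
      funext x
      change 1 * v.val x + -1 * ℓ x = _
      ring
    have e2 : (H1.lin 1 (-1) vK wℓ).grad = fun x => v.grad x - m := by
      funext x
      change (1 : ℝ) • v.grad x + (-1 : ℝ) • gradient ℓ x = _
      rw [hgℓ]; module
    rw [e1, e2] at h
    exact h
  have h := (isElement ht).deviation_le hd (hreg t ht) hg hQ hw
  have hC := regConst_pos (d := d) hσ
  have h0 := deviation_nonneg t v.grad
  have e : ∫⁻ x in simplex t, ‖v.grad x - m‖ₑ ^ 2 = ENNReal.ofReal (deviation t v.grad) :=
    (ofReal_deviation hG).symm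
  rw [e, ← ENNReal.ofReal_mul (by positivity), ENNReal.ofReal_le_ofReal_iff (by positivity)] at h
  refine ⟨affineOf m (⨍ y in simplex t, (v.val y - ℓ y)), agrad_affineOf _ _, ?_⟩
  refine le_trans (le_of_eq ?_) h
  rw [deviation]
  refine integral_congr_ae (.of_forall fun x => ?_)
  simp only [affineOf_apply, hℓ, Real.norm_eq_abs, sq_abs]
  ring

theorem tendsto_integral_norm_sub_sq {α E : Type*} [MeasurableSpace α] {μ : Measure α}
    [NormedAddCommGroup E] [InnerProductSpace ℝ E] {F : ℕ → α → E} {f g : α → E}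
    (hF : ∀ n, MemLp (F n) 2 μ) (hf : MemLp f 2 μ) (hg : MemLp g 2 μ)
    (h : Tendsto (fun n => eLpNorm (fun x => f x - F n x) 2 μ) atTop (𝓝 0)) :
    Tendsto (fun n => ∫ x, ‖F n x - g x‖ ^ 2 ∂μ) atTop (𝓝 (∫ x, ‖f x - g x‖ ^ 2 ∂μ)) := by
  have h1 : Tendsto (fun n => (hF n).toLp (F n)) atTop (𝓝 (hf.toLp f)) := by
    rw [Lp.tendsto_Lp_iff_tendsto_eLpNorm'' _ hF f hf]
    have e : ∀ n, eLpNorm (F n - f) 2 μ = eLpNorm (fun x => f x - F n x) 2 μ := fun n =>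
      eLpNorm_sub_comm _ _ _ _
    simpa only [e] using h
  have h2 : ∀ k : α → E, ∀ hk : MemLp k 2 μ, ‖hk.toLp k - hg.toLp g‖ ^ 2 =
      ∫ x, ‖k x - g x‖ ^ 2 ∂μ := fun k hk => by
    rw [← MemLp.toLp_sub hk hg]
    exact H1.norm_toLp_sq (hk.sub hg)
  have h3 := ((h1.sub_const (hg.toLp g)).norm).pow 2
  simpa only [h2] using h3

/-- The quantity that controls, on the element `t`, the boundary values of `v - p`, for `p` affine
with gradient `m`. -/
noncomputable def traceSq (t : Finset (Vec d)) (v : Vec d → ℝ) (G : Vec d → Vec d)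
    (p : Vec d →ᵃ[ℝ] ℝ) : ℝ :=
  (d + 1) * (∫ x in simplex t, ‖v x - p x‖ ^ 2) +
    diam (simplex t) ^ 2 * ∫ x in simplex t, ‖G x - agrad p‖ ^ 2

theorem traceSq_nonneg (t : Finset (Vec d)) (v : Vec d → ℝ) (G : Vec d → Vec d)
    (p : Vec d →ᵃ[ℝ] ℝ) : 0 ≤ traceSq t v G p := by
  have h1 : 0 ≤ ∫ x in simplex t, ‖v x - p x‖ ^ 2 := integral_nonneg fun x => by positivity
  have h2 : 0 ≤ ∫ x in simplex t, ‖G x - agrad p‖ ^ 2 := integral_nonneg fun x => by positivity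
  unfold traceSq
  positivity

theorem tendsto_traceSq
    (hle : volume.restrict (simplex t) ≤ volume.restrict Ω) {v : H1 Ω} {φ : ℕ → Vec d → ℝ}
    (hφ : ∀ n, IsTest Ω (φ n))
    (h1 : Tendsto (fun n => eLpNorm (fun x => v.val x - φ n x) 2 (volume.restrict Ω)) atTop (𝓝 0))
    (h2 : Tendsto (fun n => eLpNorm (fun x => v.grad x - gradient (φ n) x) 2 (volume.restrict Ω))
      atTop (𝓝 0)) (p : Vec d →ᵃ[ℝ] ℝ) :
    Tendsto (fun n => traceSq t (φ n) (gradient (φ n)) p) atTop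
      (𝓝 (traceSq t v.val v.grad p)) := by
  have hp : MemLp p 2 (volume.restrict (simplex t)) := by
    have hK : ContinuousOn p (simplex t) := (affine_continuous p).continuousOn
    obtain ⟨C, hC⟩ := (isCompact_simplex t).exists_bound_of_continuousOn hK
    refine MemLp.of_bound (affine_continuous p).aestronglyMeasurable C ?_
    filter_upwards [ae_restrict_mem (isClosed_simplex t).measurableSet] with x hx
      using hC x hx
  have l1 := tendsto_integral_norm_sub_sq (fun n => (hφ n).memLp (volume.restrict (simplex t)))
    (v.memLp_val.mono_measure hle) hp
    (tendsto_of_tendsto_of_tendsto_of_le_of_le tendsto_const_nhds h1 (fun _ => zero_le)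
      fun n => eLpNorm_mono_measure _ hle)
  have l2 := tendsto_integral_norm_sub_sq
    (fun n => (hφ n).memLp_gradient (volume.restrict (simplex t)))
    (v.memLp_grad.mono_measure hle) (memLp_const (agrad p))
    (tendsto_of_tendsto_of_tendsto_of_le_of_le tendsto_const_nhds h2 (fun _ => zero_le)
      fun n => eLpNorm_mono_measure _ hle)
  exact (l1.const_mul _).add (l2.const_mul _)

namespace IsElement

variable {u : Vec d}

theorem integral_facet_sub_sq_le (hd : 2 ≤ d) (ht : IsElement t) (hu : u ∈ t)
    {ψ : Vec d → ℝ} (hψ : IsTest Ω ψ) (p : Vec d →ᵃ[ℝ] ℝ) :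
    ∫ x in facet t u, (ψ x - p x) ^ 2 ∂μHE[d - 1] ≤
      ‖agrad (bary t u)‖ * traceSq t ψ (gradient ψ) p := by
  have h := ht.integral_facet_sq_le hd hu (hψ.contDiff_one.sub (contDiff_affine p))
  refine h.trans (le_of_eq ?_)
  rw [traceSq]
  simp only [Real.norm_eq_abs (ψ _ - p _), sq_abs]
  congr 3
  · refine integral_congr_ae (.of_forall fun x => ?_)
    simp only
    have h1 : fderiv ℝ (fun x => ψ x - p x) x = fderiv ℝ ψ x - fderiv ℝ p x :=
      fderiv_sub (hψ.differentiableAt x) (hasFDerivAt_affine p x).differentiableAt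
    have h2 : gradient (fun x => ψ x - p x) x = gradient ψ x - agrad p := by
      rw [gradient, h1, map_sub, (hasFDerivAt_affine p x).fderiv]; rfl
    rw [← h2, norm_gradient]

theorem measure_facet_pos (hd : 2 ≤ d) (ht : IsElement t) (hu : u ∈ t) :
    0 < ‖agrad (bary t u)‖ * volume.real (simplex t) :=
  mul_pos (ht.norm_agrad_bary_pos (by omega) hu) ht.volume_simplex_pos

/-- Vertex values on a facet where the approximated function vanishes. -/
theorem sq_vertex_le_of_disjoint (hd : 2 ≤ d) (ht : IsElement t) (hu : u ∈ t) (hz : z ∈ t)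
    (hzu : z ≠ u) (hdis : Disjoint (facet t u) Ω) {ψ : Vec d → ℝ}
    (hψ : IsTest Ω ψ) (p : Vec d →ᵃ[ℝ] ℝ) :
    p z ^ 2 ≤ 16 * 4 ^ d * (traceSq t ψ (gradient ψ) p / volume.real (simplex t)) := by
  have h1 := ht.sq_vertex_le_facet hd hu hz hzu p
  have h2 := ht.integral_facet_sub_sq_le hd hu hψ p
  have e : ∫ x in facet t u, (ψ x - p x) ^ 2 ∂μHE[d - 1] =
      ∫ x in facet t u, p x ^ 2 ∂μHE[d - 1] := by
    refine setIntegral_congr_fun isClosed_facet.measurableSet fun x hx => ?_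
    rw [(hψ.eq_zero_of_notMem (disjoint_left.1 hdis hx)).1]; ring
  rw [e] at h2
  have hF := ht.measure_facet_pos hd hu
  have hV := ht.volume_simplex_pos
  refine le_of_mul_le_mul_left ?_ hF
  calc _ ≤ 16 * 4 ^ d * ∫ x in facet t u, p x ^ 2 ∂μHE[d - 1] := h1
    _ ≤ 16 * 4 ^ d * (‖agrad (bary t u)‖ * traceSq t ψ (gradient ψ) p) := by gcongr
    _ = _ := by field_simp

/-- Vertex values, on a common facet of two simplices, of the difference of two affine
functions. -/
theorem sq_vertex_sub_le (hd : 2 ≤ d) (ht : IsElement t) (hu : u ∈ t) (hz : z ∈ t)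
    (hzu : z ≠ u) {u' : Vec d} (ht' : IsElement t') (hu' : u' ∈ t')
    (hf : facet t u = facet t' u') {ψ : Vec d → ℝ}
    (hψ : IsTest Ω ψ) (p p' : Vec d →ᵃ[ℝ] ℝ) :
    (p z - p' z) ^ 2 ≤ 32 * 4 ^ d * (traceSq t ψ (gradient ψ) p / volume.real (simplex t) +
      traceSq t' ψ (gradient ψ) p' / volume.real (simplex t')) := by
  have h1 := ht.sq_vertex_le_facet hd hu hz hzu (p - p')
  have h2 := ht.integral_facet_sub_sq_le hd hu hψ p
  have h3 := ht'.integral_facet_sub_sq_le hd hu' hψ p'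
  rw [← hf] at h3
  have hc : ∀ q : Vec d →ᵃ[ℝ] ℝ, IntegrableOn (fun x => (ψ x - q x) ^ 2) (facet t u) μHE[d - 1] :=
    fun q => ht.integrableOn_facet hd hu
      (((hψ.1.continuous.sub (affine_continuous q)).pow 2).continuousOn)
  have h4 : ∫ x in facet t u, (p - p') x ^ 2 ∂μHE[d - 1] ≤
      2 * (∫ x in facet t u, (ψ x - p x) ^ 2 ∂μHE[d - 1]) +
        2 * ∫ x in facet t u, (ψ x - p' x) ^ 2 ∂μHE[d - 1] := by
    rw [← integral_const_mul, ← integral_const_mul,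
      ← integral_add ((hc p).const_mul 2) ((hc p').const_mul 2)]
    refine integral_mono (ht.integrableOn_facet hd hu
      ((affine_continuous (p - p')).pow 2).continuousOn)
      (((hc p).const_mul 2).add ((hc p').const_mul 2)) fun x => ?_
    simp only [AffineMap.coe_sub, Pi.sub_apply]
    nlinarith [sq_nonneg ((ψ x - p x) + (ψ x - p' x))]
  -- both sides are proportional to the measure of the common facet
  have hm : ‖agrad (bary t u)‖ * volume.real (simplex t) =
      ‖agrad (bary t' u')‖ * volume.real (simplex t') := by
    have e1 := ht.measure_facet hd hu
    have e2 := ht'.measure_facet hd hu'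
    rw [hf, e2] at e1
    have hd0 : (d : ℝ) ≠ 0 := by exact_mod_cast (by omega : d ≠ 0)
    have : (d : ℝ) * (‖agrad (bary t u)‖ * volume.real (simplex t)) =
        d * (‖agrad (bary t' u')‖ * volume.real (simplex t')) := by linarith
    exact mul_left_cancel₀ hd0 this
  have hF := ht.measure_facet_pos hd hu
  have hV := ht.volume_simplex_pos
  have hV' := ht'.volume_simplex_pos
  refine le_of_mul_le_mul_left ?_ hF
  have h5 : ‖agrad (bary t u)‖ * volume.real (simplex t) * (p z - p' z) ^ 2 ≤
      16 * 4 ^ d * (2 * (‖agrad (bary t u)‖ * traceSq t ψ (gradient ψ) p) +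
        2 * (‖agrad (bary t' u')‖ * traceSq t' ψ (gradient ψ) p')) := by
    refine h1.trans ?_
    gcongr
    linarith
  refine h5.trans (le_of_eq ?_)
  have e1 : ‖agrad (bary t u)‖ * volume.real (simplex t) *
      (traceSq t ψ (gradient ψ) p / volume.real (simplex t)) =
      ‖agrad (bary t u)‖ * traceSq t ψ (gradient ψ) p := by
    field_simp
  have e2 : ‖agrad (bary t u)‖ * volume.real (simplex t) *
      (traceSq t' ψ (gradient ψ) p' / volume.real (simplex t')) =
      ‖agrad (bary t' u')‖ * traceSq t' ψ (gradient ψ) p' := by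
    rw [hm]; field_simp
  rw [mul_left_comm (‖agrad (bary t u)‖ * volume.real (simplex t)), mul_add, mul_add, e1, e2]
  ring

end IsElement

/-! ### Stars of nodes -/

namespace Triangulation

/-- The number of elements of a shape regular triangulation with a common vertex is bounded: up to
null sets, they divide a small ball into disjoint cones of a minimal volume. -/
theorem card_star_le (hd : 1 ≤ d) (hσ : 0 < σ) (hreg : 𝒯.IsShapeRegular σ) (z : Vec d) :
    ((𝒯.star z).card : ℝ) ≤ volume.real (closedBall (0 : Vec d) 1) * σ ^ d := by
  rcases (𝒯.star z).eq_empty_or_nonempty with h | hne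
  · rw [h]
    simpa using by positivity
  have hdiam : ∀ t ∈ 𝒯.star z, 0 < diam (simplex t) := by
    intro t ht
    obtain ⟨ht, hz⟩ := mem_star.1 ht
    obtain ⟨b, hb, hbz⟩ := (isElement ht).exists_ne hd z
    exact (dist_pos.2 hbz).trans_le (dist_le_diam_of_mem
      (isCompact_simplex t).isBounded (vertex_mem_simplex hb) (vertex_mem_simplex hz))
  -- shrunk to diameter `ρ` about `z`, all elements fit into one ball of radius `ρ`
  set ρ := (𝒯.star z).inf' hne fun t => diam (simplex t) with hρ
  have hρpos : 0 < ρ := by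
    rw [hρ, Finset.lt_inf'_iff]
    exact hdiam
  set A : Finset (Vec d) → Set (Vec d) := fun t => simplex t ∩ closedBall z ρ with hA
  have hAm : ∀ t, MeasurableSet (A t) := fun t =>
    (isClosed_simplex t).measurableSet.inter measurableSet_closedBall
  have hvol : ∀ t ∈ 𝒯.star z, ENNReal.ofReal (ρ ^ d / σ ^ d) ≤ volume (A t) := by
    intro t ht
    have hdt := hdiam t ht
    have hρt : ρ ≤ diam (simplex t) := Finset.inf'_le _ ht
    obtain ⟨ht, hz⟩ := mem_star.1 ht
    have hzt : z ∈ simplex t := vertex_mem_simplex hz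
    set ε := ρ / diam (simplex t) with hε
    have hε0 : 0 < ε := by positivity
    have hε1 : ε ≤ 1 := (div_le_one hdt).2 hρt
    have hsub : AffineMap.homothety z ε '' simplex t ⊆ A t := by
      rintro _ ⟨y, hy, rfl⟩
      rw [AffineMap.homothety_apply, vsub_eq_sub, vadd_eq_add, add_comm]
      refine ⟨(convex_simplex t).add_smul_sub_mem hzt hy ⟨hε0.le, hε1⟩, ?_⟩
      rw [Metric.mem_closedBall, dist_eq_norm, add_sub_cancel_left, norm_smul, Real.norm_eq_abs,
        abs_of_pos hε0, ← dist_eq_norm]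
      have := dist_le_diam_of_mem (isCompact_simplex t).isBounded hy hzt
      calc ε * dist y z ≤ ε * diam (simplex t) := by gcongr
        _ = ρ := by rw [hε]; field_simp
    refine le_trans ?_ (measure_mono hsub)
    have hh := (isElement ht).meshSize_pos
    rw [Measure.addHaar_image_homothety, finrank_euclideanSpace_fin,
      volume_simplex_eq hd (isElement ht), ← ENNReal.ofReal_mul (abs_nonneg _)]
    refine ENNReal.ofReal_le_ofReal ?_
    rw [abs_of_pos (by positivity), hε, ← mul_pow, ← div_pow]
    refine pow_le_pow_left₀ (by positivity) ?_ d
    rw [div_mul_eq_mul_div, div_le_div_iff₀ hσ hdt]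
    have := hreg t ht
    nlinarith
  have hdisj := restrict_biUnion_finset_ae (μ := volume) (𝒯.star z) (D := A) (fun t _ => hAm t)
    fun t ht t' ht' hne => measure_mono_null (inter_subset_inter inter_subset_left
      inter_subset_left) (volume_inter_eq_zero (mem_star.1 ht).1 (mem_star.1 ht').1 hne)
  have h1 : ∑ t ∈ 𝒯.star z, volume (A t) ≤ volume (closedBall z ρ) := by
    have e := congrArg (fun μ : Measure (Vec d) => μ univ) hdisj
    simp only [Measure.restrict_apply_univ, Measure.finsetSum_apply] at e
    rw [← e]
    exact measure_mono (iUnion₂_subset fun t _ => inter_subset_right)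
  have h2 := (sum_le_sum hvol).trans h1
  rw [sum_const, Measure.addHaar_closedBall' _ _ hρpos.le, finrank_euclideanSpace_fin,
    ← ofReal_measureReal (s := closedBall (0 : Vec d) 1)
      Metric.isBounded_closedBall.measure_lt_top.ne, nsmul_eq_mul, ← ENNReal.ofReal_natCast,
    ← ENNReal.ofReal_mul (by positivity), ← ENNReal.ofReal_mul (by positivity),
    ENNReal.ofReal_le_ofReal_iff (by positivity), mul_div_assoc', div_le_iff₀ (by positivity)] at h2
  have h3 : 0 < ρ ^ d := by positivity
  refine le_of_mul_le_mul_left ?_ h3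
  linarith

/-- The sizes of elements with a common edge are comparable. -/
theorem meshSize_le_of_edge (hd : 2 ≤ d) (hreg : 𝒯.IsShapeRegular σ)
    (ht : t ∈ 𝒯.elements) (ht' : t' ∈ 𝒯.elements) (ha : a ∈ t) (ha' : a ∈ t') (hb : b ∈ t)
    (hb' : b ∈ t') (hab : a ≠ b) :
    meshSize t ≤ |crossConst d * σ ^ (d - 1) * σ| * meshSize t' := by
  have e := isElement ht
  have h1 := e.one_le_norm_agrad_mul_dist ha hb hab
  have h2 := e.norm_agrad_mul_meshSize_le hd ha (hreg t ht)
  have h3 : dist a b ≤ σ * meshSize t' := (dist_le_diam_of_mem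
    (isCompact_simplex t').isBounded (vertex_mem_simplex ha')
      (vertex_mem_simplex hb')).trans (hreg t' ht')
  have hh := e.meshSize_pos
  have hh' := (isElement ht').meshSize_pos
  have h4 : 0 ≤ crossConst d * σ ^ (d - 1) := (by positivity : (0 : ℝ) ≤ _).trans h2
  calc meshSize t ≤ ‖agrad (bary t a)‖ * dist a b * meshSize t := by nlinarith
    _ = ‖agrad (bary t a)‖ * meshSize t * dist a b := by ring
    _ ≤ crossConst d * σ ^ (d - 1) * (σ * meshSize t') := by gcongr
    _ = (crossConst d * σ ^ (d - 1) * σ) * meshSize t' := by ring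
    _ ≤ _ := by gcongr; exact le_abs_self _

open Classical in
/-- The graph of the elements with the vertex `z`, where the elements that share a facet (with the
vertex `z`) are adjacent. -/
noncomputable def starGraph (𝒯 : Triangulation Ω) (z : Vec d) :
    SimpleGraph (Finset (Vec d)) where
  Adj t t' := t ∈ 𝒯.star z ∧ t' ∈ 𝒯.star z ∧ t ≠ t' ∧ (t ∩ t').card = d
  symm := ⟨fun t t' h => ⟨h.2.1, h.1, h.2.2.1.symm, by rw [Finset.inter_comm]; exact h.2.2.2⟩⟩
  loopless := ⟨fun _ h => h.2.2.1 rfl⟩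

/-- The component of `t` in the star of `z`. -/
noncomputable def component (𝒯 : Triangulation Ω) (z : Vec d) (t : Finset (Vec d)) :
    Finset (Finset (Vec d)) :=
  let : DecidablePred fun t' => (𝒯.starGraph z).Reachable t t' := Classical.decPred _
  (𝒯.star z).filter fun t' => (𝒯.starGraph z).Reachable t t'

theorem mem_component : t' ∈ 𝒯.component z t ↔
    t' ∈ 𝒯.star z ∧ (𝒯.starGraph z).Reachable t t' := by
  let : DecidablePred fun t' => (𝒯.starGraph z).Reachable t t' := Classical.decPred _
  exact Finset.mem_filter

theorem component_subset : 𝒯.component z t ⊆ 𝒯.star z := fun _ h => (mem_component.1 h).1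

theorem mem_star_of_reachable (ht : t ∈ 𝒯.star z) (h : (𝒯.starGraph z).Reachable t t') :
    t' ∈ 𝒯.star z := by
  obtain ⟨p⟩ := h
  induction p with
  | nil => exact ht
  | cons hadj _ ih => exact ih hadj.2.1

theorem _root_.SimpleGraph.Walk.abs_sub_le_sum {V : Type*} {G : SimpleGraph V} {q e : V → ℝ}
    (h : ∀ u w, G.Adj u w → |q u - q w| ≤ e u + e w) {u w : V} (p : G.Walk u w) :
    |q u - q w| + e u + e w ≤ 2 * (p.support.map e).sum := by
  induction p with
  | nil => simp [two_mul]
  | @cons u x w hadj p ih =>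
    have h1 := h _ _ hadj
    have h2 := abs_sub_le (q u) (q x) (q w)
    rw [SimpleGraph.Walk.support_cons, List.map_cons, List.sum_cons]
    linarith

/-- A quantity with controlled differences between adjacent elements. -/
theorem abs_sub_le_sum_component {q e : Finset (Vec d) → ℝ} (he : ∀ t, 0 ≤ e t)
    (h : ∀ u w, (𝒯.starGraph z).Adj u w → |q u - q w| ≤ e u + e w) (ht : t ∈ 𝒯.star z)
    (ht' : t' ∈ 𝒯.component z t) :
    |q t - q t'| + e t + e t' ≤ 2 * ∑ s ∈ 𝒯.component z t, e s := by
  classical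
  obtain ⟨-, hr⟩ := mem_component.1 ht'
  obtain ⟨p, hp⟩ := hr.exists_isPath
  refine (p.abs_sub_le_sum h).trans (mul_le_mul_of_nonneg_left ?_ zero_le_two)
  rw [← List.sum_toFinset _ hp.support_nodup]
  refine Finset.sum_le_sum_of_subset_of_nonneg (fun s hs => ?_) fun _ _ _ => he _
  have h1 : (𝒯.starGraph z).Reachable t s := ⟨p.takeUntil s (List.mem_toFinset.1 hs)⟩
  exact mem_component.2 ⟨mem_star_of_reachable ht h1, h1⟩

/-- The sizes of the elements in a component of a star are comparable. -/
theorem meshSize_le_of_component (hd : 2 ≤ d) (hreg : 𝒯.IsShapeRegular σ)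
    (ht : t ∈ 𝒯.star z) (ht' : t' ∈ 𝒯.component z t) :
    meshSize t ≤
      (1 + |crossConst d * σ ^ (d - 1) * σ|) ^ (𝒯.component z t).card * meshSize t' := by
  classical
  set c := 1 + |crossConst d * σ ^ (d - 1) * σ| with hc
  have hc1 : 1 ≤ c := by rw [hc]; linarith [abs_nonneg (crossConst d * σ ^ (d - 1) * σ)]
  have hpos : ∀ s ∈ 𝒯.star z, 0 < meshSize s := fun s hs =>
    (isElement (mem_star.1 hs).1).meshSize_pos
  have hle : ∀ s s', (𝒯.starGraph z).Adj s s' → meshSize s ≤ c * meshSize s' := by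
    intro s s' hadj
    obtain ⟨hs, hs', -, hcard⟩ := hadj
    have hz : z ∈ s ∩ s' := Finset.mem_inter.2 ⟨(mem_star.1 hs).2, (mem_star.1 hs').2⟩
    obtain ⟨b, hb, hbz⟩ := Finset.exists_mem_ne (by omega : 1 < (s ∩ s').card) z
    have h1 := meshSize_le_of_edge hd hreg (mem_star.1 hs).1 (mem_star.1 hs').1
      (Finset.mem_inter.1 hz).1 (Finset.mem_inter.1 hz).2 (Finset.mem_inter.1 hb).1
      (Finset.mem_inter.1 hb).2 hbz.symm
    refine h1.trans (mul_le_mul_of_nonneg_right ?_ (hpos s' hs').le)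
    rw [hc]; linarith
  have hlog : ∀ s s', (𝒯.starGraph z).Adj s s' →
      Real.log (meshSize s) - Real.log (meshSize s') ≤ Real.log c := by
    intro s s' hadj
    have h1 := Real.log_le_log (hpos s hadj.1) (hle s s' hadj)
    rw [Real.log_mul (by positivity) (hpos s' hadj.2.1).ne'] at h1
    linarith
  have h0 : 0 ≤ Real.log c := Real.log_nonneg hc1
  have h := abs_sub_le_sum_component (q := fun s => Real.log (meshSize s))
    (e := fun _ => Real.log c / 2) (fun _ => by positivity) (fun u w hadj => by
      rw [abs_le]
      have h1 := hlog u w hadj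
      have h2 := hlog w u hadj.symm
      constructor <;> linarith) ht ht'
  rw [sum_const, nsmul_eq_mul] at h
  have h1 : Real.log (meshSize t) ≤
      Real.log (c ^ (𝒯.component z t).card * meshSize t') := by
    rw [Real.log_mul (by positivity) (hpos t' (component_subset ht')).ne', Real.log_pow]
    have := (le_abs_self (Real.log (meshSize t) - Real.log (meshSize t')))
    linarith
  exact (Real.log_le_log_iff (hpos t ht)
    (mul_pos (by positivity) (hpos t' (component_subset ht')))).1 h1

/-- Adjacent elements in a star have a facet in common. -/
theorem exists_facet_of_adj (hd : 1 ≤ d) (h : (𝒯.starGraph z).Adj t t') :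
    ∃ u ∈ t, ∃ u' ∈ t', z ≠ u ∧ facet t u = facet t' u' := by
  classical
  obtain ⟨hs, hs', hne, hcard⟩ := h
  obtain ⟨ht, hz⟩ := mem_star.1 hs
  obtain ⟨ht', hz'⟩ := mem_star.1 hs'
  have e := isElement ht
  obtain ⟨u, hu, hut⟩ : ∃ u ∈ t, u ∉ t' := by
    by_contra! hcon
    have : t ∩ t' = t := Finset.inter_eq_left.2 hcon
    rw [this, e.card] at hcard
    omega
  have hsub : t.erase u ⊆ t' := by
    have h1 : t ∩ t' ⊆ t.erase u := fun y hy => mem_erase.2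
      ⟨fun h => hut (h ▸ (Finset.mem_inter.1 hy).2), (Finset.mem_inter.1 hy).1⟩
    have h2 := Finset.eq_of_subset_of_card_le h1
      (by rw [hcard, card_erase_of_mem hu, e.card]; simp)
    rw [← h2]
    exact Finset.inter_subset_right
  obtain ⟨u', hu', -, hee, -⟩ := exists_apex hd ht ht' (Ne.symm hne) hu hsub
  refine ⟨u, hu, u', hu', fun h => hut (h ▸ hz'), ?_⟩
  rw [e.facet_eq_simplex_erase hu, (isElement ht').facet_eq_simplex_erase hu', hee]

/-- The component of an element in the star of a node `z` is the whole star if `z ∈ Ω`, and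
otherwise contains an element with a facet on the boundary which has the vertex `z`. -/
theorem component_dichotomy (hd : 2 ≤ d) (hΩ : IsLipschitzDomain Ω) (ht : t ∈ 𝒯.star z) :
    (z ∈ Ω ∧ 𝒯.component z t = 𝒯.star z) ∨
      (z ∉ Ω ∧ ∃ s ∈ 𝒯.component z t, ∃ u ∈ s, z ≠ u ∧ Disjoint (facet s u) Ω) := by
  classical
  by_cases hcl : ∀ s ∈ 𝒯.component z t, ∀ v ∈ s, v ≠ z →
      ∃ s' ∈ 𝒯.elements, s' ≠ s ∧ s.erase v ⊆ s'
  · left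
    have h := star_eq_of_closed hd (S := 𝒯.component z t) component_subset
      ⟨t, mem_component.2 ⟨ht, SimpleGraph.Reachable.refl _⟩⟩ ?_
    · refine ⟨hΩ.interior_closure_subset
        (mem_interior_iff_mem_nhds.2 (mem_of_superset h.1 ?_)), h.2⟩
      exact iUnion₂_subset fun s hs => simplex_subset_closure (mem_star.1 (component_subset hs)).1
    · intro s hs v hv hvz
      obtain ⟨s', hs', hne, hsub⟩ := hcl s hs v hv hvz
      obtain ⟨hse, hzs⟩ := mem_star.1 (component_subset hs)
      have hs'z : s' ∈ 𝒯.star z :=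
        mem_star.2 ⟨hs', hsub (mem_erase.2 ⟨hvz.symm, hzs⟩)⟩
      obtain ⟨-, -, -, -, hi, -⟩ := exists_apex (by omega) hse hs' hne hv hsub
      have hadj : (𝒯.starGraph z).Adj s s' := ⟨component_subset hs, hs'z, hne.symm, by
        rw [hi, card_erase_of_mem hv, (isElement hse).card]; rfl⟩
      exact ⟨s', mem_component.2 ⟨hs'z, (mem_component.1 hs).2.trans hadj.reachable⟩,
        hne, hsub⟩
  · right
    push Not at hcl
    obtain ⟨s, hs, u, hu, huz, hun⟩ := hcl
    obtain ⟨hse, hzs⟩ := mem_star.1 (component_subset hs)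
    have hdis := facet_disjoint_of_unshared hΩ.isOpen (by omega) hse hu fun s' hs' hsub => by
      by_contra hne
      exact hun s' hs' hne hsub
    have hzf : z ∈ facet s u :=
      ⟨vertex_mem_simplex hzs, (isElement hse).bary_of_ne hu hzs huz⟩
    exact ⟨disjoint_left.1 hdis hzf, s, hs, u, hu, huz.symm, hdis⟩

end Triangulation

/-! ### Quasi-interpolation -/

/-- An upper bound for the number of elements with a common vertex. -/
noncomputable def starCard (d : ℕ) (σ : ℝ) : ℕ :=
  ⌈volume.real (closedBall (0 : Vec d) 1) * σ ^ d⌉₊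

/-- A bound for the quotient of the sizes of elements in the same component of a star. -/
noncomputable def starRatio (d : ℕ) (σ : ℝ) : ℝ :=
  (1 + |crossConst d * σ ^ (d - 1) * σ|) ^ starCard d σ

/-- The constant in the estimate of squared vertex values of local affine approximations. -/
noncomputable def vertexConst (d : ℕ) (σ : ℝ) : ℝ :=
  32 * 4 ^ d * ((d + 1) * regConst d σ + σ ^ 2)

/-- The constant in the estimate of the nodal errors of the quasi-interpolant. -/
noncomputable def nodalConst (d : ℕ) (σ : ℝ) : ℝ :=
  4 * starCard d σ * (starRatio d σ ^ (d - 2) * vertexConst d σ)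

/-- The constant of the quasi-interpolation estimate. -/
noncomputable def interpConst (d : ℕ) (σ : ℝ) : ℝ :=
  2 + 2 * ((d + 1) * ((crossConst d * σ ^ (d - 1)) ^ 2 * nodalConst d σ) *
    (starCard d σ * (d + 1)))

theorem one_le_starRatio : 1 ≤ starRatio d σ :=
  one_le_pow₀ (by linarith [abs_nonneg (crossConst d * σ ^ (d - 1) * σ)])

theorem vertexConst_nonneg (hσ : 0 < σ) : 0 ≤ vertexConst d σ := by
  have := (regConst_pos (d := d) hσ).le
  unfold vertexConst; positivity

theorem nodalConst_nonneg (hσ : 0 < σ) : 0 ≤ nodalConst d σ := by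
  have := vertexConst_nonneg (d := d) hσ
  have := one_le_starRatio (d := d) (σ := σ)
  unfold nodalConst; positivity

namespace Triangulation

/-- Nodal values from local approximations `p` with controlled jumps, which are small on the
boundary. -/
theorem exists_nodal_values (hd : 2 ≤ d) (hΩ : IsLipschitzDomain Ω)
    {p : Finset (Vec d) → Vec d →ᵃ[ℝ] ℝ} {e : Finset (Vec d) → ℝ} (he : ∀ t, 0 ≤ e t)
    (hadj : ∀ z t t', (𝒯.starGraph z).Adj t t' → |p t z - p t' z| ≤ e t + e t')
    (hbd : ∀ z, ∀ t ∈ 𝒯.star z, ∀ u ∈ t, z ≠ u → Disjoint (facet t u) Ω → |p t z| ≤ e t) :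
    ∃ θ : Vec d → ℝ, (∀ a ∉ Ω, θ a = 0) ∧ ∀ z, ∀ t ∈ 𝒯.star z,
      |p t z - θ z| ≤ 2 * ∑ s ∈ 𝒯.component z t, e s := by
  classical
  have hT : ∀ z, ∃ s, (𝒯.star z).Nonempty → s ∈ 𝒯.star z := fun z => by
    by_cases h : (𝒯.star z).Nonempty
    · exact ⟨h.choose, fun _ => h.choose_spec⟩
    · exact ⟨∅, fun h' => absurd h' h⟩
  choose T hT using hT
  refine ⟨fun z => if z ∈ Ω then p (T z) z else 0, fun a ha => if_neg ha, fun z t ht => ?_⟩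
  rcases component_dichotomy hd hΩ ht with ⟨hz, hC⟩ | ⟨hz, s, hs, u, hu, hzu, hdis⟩
  · simp only [if_pos hz]
    have h := abs_sub_le_sum_component (q := fun t => p t z) he (hadj z) ht
      (by rw [hC]; exact hT z ⟨t, ht⟩ : T z ∈ 𝒯.component z t)
    linarith [he t, he (T z)]
  · simp only [if_neg hz, sub_zero]
    have h := abs_sub_le_sum_component (q := fun t => p t z) he (hadj z) ht hs
    have h1 := hbd z s (component_subset hs) u hu hzu hdis
    have h2 : |p t z| ≤ |p t z - p s z| + |p s z| := by
      simpa using abs_add_le (p t z - p s z) (p s z)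
    linarith [he t]

theorem card_component_le (hd : 1 ≤ d) (hσ : 0 < σ) (hreg : 𝒯.IsShapeRegular σ) :
    (𝒯.component z t).card ≤ starCard d σ ∧ (𝒯.star z).card ≤ starCard d σ := by
  have h : (𝒯.star z).card ≤ starCard d σ := by
    have := (card_star_le hd hσ hreg z).trans (Nat.le_ceil _)
    exact_mod_cast this
  exact ⟨(Finset.card_le_card component_subset).trans h, h⟩

/-- From the bounds on the nodal errors of local approximations to a scaled one. -/
theorem pow_mul_sq_le (hd : 2 ≤ d) (hσ : 0 < σ) (hreg : 𝒯.IsShapeRegular σ)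
    {E V : Finset (Vec d) → ℝ} (hE : ∀ t, 0 ≤ E t) (hV : ∀ t, 0 ≤ V t)
    (hEV : ∀ t ∈ 𝒯.elements,
      meshSize t ^ d * E t ≤ vertexConst d σ * meshSize t ^ 2 * V t)
    (ht : t ∈ 𝒯.star z) {y : ℝ} (hy : |y| ≤ 2 * ∑ s ∈ 𝒯.component z t, √(E s)) :
    meshSize t ^ d * y ^ 2 ≤ meshSize t ^ 2 * (nodalConst d σ * ∑ s ∈ 𝒯.star z, V s) := by
  have hd2 : d = 2 + (d - 2) := by omega
  have hh := (isElement (mem_star.1 ht).1).meshSize_pos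
  have hR := one_le_starRatio (d := d) (σ := σ)
  have h1 : y ^ 2 ≤ 4 * (starCard d σ * ∑ s ∈ 𝒯.component z t, E s) := by
    have h2 : y ^ 2 ≤ (2 * ∑ s ∈ 𝒯.component z t, √(E s)) ^ 2 := by
      rw [← sq_abs]
      exact pow_le_pow_left₀ (abs_nonneg _) hy 2
    have h3 := sq_sum_le_card_mul_sum_sq (s := 𝒯.component z t) (f := fun s => √(E s))
    simp_rw [Real.sq_sqrt (hE _)] at h3
    have h4 : ((𝒯.component z t).card : ℝ) ≤ starCard d σ := by
      exact_mod_cast (card_component_le (by omega) hσ hreg).1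
    have h5 : 0 ≤ ∑ s ∈ 𝒯.component z t, E s := sum_nonneg fun s _ => hE s
    have h6 := mul_le_mul_of_nonneg_right h4 h5
    nlinarith
  have h2 : ∀ s ∈ 𝒯.component z t,
      meshSize t ^ d * E s ≤
        meshSize t ^ 2 * (starRatio d σ ^ (d - 2) * vertexConst d σ * V s) := by
    intro s hs
    have hse := (mem_star.1 (component_subset hs)).1
    have hhs := (isElement hse).meshSize_pos
    have h3 : meshSize t ≤ starRatio d σ * meshSize s := by
      refine (meshSize_le_of_component hd hreg ht hs).trans
        (mul_le_mul_of_nonneg_right ?_ hhs.le)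
      exact pow_le_pow_right₀ (by linarith [abs_nonneg (crossConst d * σ ^ (d - 1) * σ)])
        (card_component_le (by omega) hσ hreg).1
    have h4 : meshSize s ^ (d - 2) * E s ≤ vertexConst d σ * V s := by
      have h5 := hEV s hse
      -- divide by `h²`: as `d - 2 ≥ 0`, sizes of elements in the star can be exchanged
      have h6 : meshSize s ^ d = meshSize s ^ 2 * meshSize s ^ (d - 2) := by
        rw [← pow_add, ← hd2]
      rw [h6] at h5
      refine le_of_mul_le_mul_left ?_ (by positivity : 0 < meshSize s ^ 2)
      linarith
    have h6 : meshSize t ^ d = meshSize t ^ 2 * meshSize t ^ (d - 2) := by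
      rw [← pow_add, ← hd2]
    rw [h6, mul_assoc]
    refine mul_le_mul_of_nonneg_left ?_ (by positivity)
    calc meshSize t ^ (d - 2) * E s ≤ (starRatio d σ * meshSize s) ^ (d - 2) * E s :=
          mul_le_mul_of_nonneg_right (pow_le_pow_left₀ hh.le h3 _) (hE s)
      _ = starRatio d σ ^ (d - 2) * (meshSize s ^ (d - 2) * E s) := by rw [mul_pow]; ring
      _ ≤ starRatio d σ ^ (d - 2) * (vertexConst d σ * V s) :=
          mul_le_mul_of_nonneg_left h4 (by positivity)
      _ = _ := by ring
  have hvc := vertexConst_nonneg (d := d) hσ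
  calc meshSize t ^ d * y ^ 2
      ≤ meshSize t ^ d * (4 * (starCard d σ * ∑ s ∈ 𝒯.component z t, E s)) :=
        mul_le_mul_of_nonneg_left h1 (by positivity)
    _ = 4 * starCard d σ * ∑ s ∈ 𝒯.component z t, meshSize t ^ d * E s := by
        rw [← mul_sum]; ring
    _ ≤ 4 * starCard d σ * ∑ s ∈ 𝒯.component z t,
          meshSize t ^ 2 * (starRatio d σ ^ (d - 2) * vertexConst d σ * V s) :=
        mul_le_mul_of_nonneg_left (sum_le_sum h2) (by positivity)
    _ ≤ 4 * starCard d σ * ∑ s ∈ 𝒯.star z,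
          meshSize t ^ 2 * (starRatio d σ ^ (d - 2) * vertexConst d σ * V s) := by
        refine mul_le_mul_of_nonneg_left (Finset.sum_le_sum_of_subset_of_nonneg component_subset
          fun s _ _ => ?_) (by positivity)
        have := hV s
        positivity
    _ = _ := by
        rw [nodalConst, ← mul_sum, ← mul_sum]; ring

/-- Every element belongs to boundedly many stars. -/
theorem sum_sum_star_le (hd : 1 ≤ d) (hσ : 0 < σ) (hreg : 𝒯.IsShapeRegular σ)
    {V : Finset (Vec d) → ℝ} (hV : ∀ t, 0 ≤ V t) :
    ∑ t ∈ 𝒯.elements, ∑ z ∈ t, ∑ s ∈ 𝒯.star z, V s ≤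
      starCard d σ * (d + 1) * ∑ t ∈ 𝒯.elements, V t := by
  classical
  have hswap : ∀ f : Finset (Vec d) → Vec d → ℝ, ∑ t ∈ 𝒯.elements, ∑ z ∈ t, f t z =
      ∑ z ∈ 𝒯.elements.biUnion id, ∑ t ∈ 𝒯.star z, f t z := fun f =>
    Finset.sum_comm' fun t z => by
      simp only [Finset.mem_biUnion, id, mem_star]
      exact ⟨fun h => ⟨h, t, h⟩, fun h => h.1⟩
  rw [hswap]
  calc ∑ z ∈ 𝒯.elements.biUnion id, ∑ _t ∈ 𝒯.star z, ∑ s ∈ 𝒯.star z, V s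
      ≤ ∑ z ∈ 𝒯.elements.biUnion id, starCard d σ * ∑ s ∈ 𝒯.star z, V s := by
        refine sum_le_sum fun z _ => ?_
        rw [sum_const, nsmul_eq_mul]
        refine mul_le_mul_of_nonneg_right ?_ (sum_nonneg fun s _ => hV s)
        exact_mod_cast (card_component_le (t := ∅) hd hσ hreg).2
    _ = starCard d σ * ∑ t ∈ 𝒯.elements, ∑ _z ∈ t, V t := by
        rw [← mul_sum, hswap fun t _ => V t]
    _ = _ := by
        have h : ∀ t ∈ 𝒯.elements, ∑ _z ∈ t, V t = (d + 1) * V t := fun t ht => by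
          rw [sum_const, (isElement ht).card, nsmul_eq_mul]; push_cast; ring
        rw [sum_congr rfl h, ← mul_sum]
        ring

end Triangulation

theorem traceSq_le (hσt : diam (simplex t) ≤ σ * meshSize t)
    {v : Vec d → ℝ} {G : Vec d → Vec d} {p : Vec d →ᵃ[ℝ] ℝ}
    (hp : agrad p = ⨍ x in simplex t, G x)
    (hv : ∫ x in simplex t, (v x - p x) ^ 2 ≤ regConst d σ * meshSize t ^ 2 * deviation t G) :
    traceSq t v G p ≤ ((d + 1) * regConst d σ + σ ^ 2) * meshSize t ^ 2 * deviation t G := by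
  have h0 := deviation_nonneg t G
  have h1 : diam (simplex t) ^ 2 ≤ (σ * meshSize t) ^ 2 :=
    pow_le_pow_left₀ diam_nonneg hσt 2
  have e : ∫ x in simplex t, ‖G x - agrad p‖ ^ 2 = deviation t G := by rw [deviation, hp]
  rw [traceSq, e]
  simp only [Real.norm_eq_abs, sq_abs]
  have h2 := mul_le_mul_of_nonneg_right h1 h0
  have h3 := mul_le_mul_of_nonneg_left hv (by positivity : (0 : ℝ) ≤ d + 1)
  calc _ ≤ (d + 1) * (regConst d σ * meshSize t ^ 2 * deviation t G) +
        (σ * meshSize t) ^ 2 * deviation t G := add_le_add h3 h2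
    _ = _ := by ring

/-- The quasi-interpolation estimate: a function in `H¹₀(Ω)` is approximated by a continuous
piecewise affine one as well as its gradient is by piecewise constants. -/
theorem H1.InH10.exists_interpolant (hd : 2 ≤ d)
    (hΩ : IsLipschitzDomain Ω) (hσ : 0 < σ) (hreg : 𝒯.IsShapeRegular σ) {v : H1 Ω}
    (hv : v.InH10) :
    ∃ θ : Vec d → ℝ, (∀ a ∉ Ω, θ a = 0) ∧
      ∑ t ∈ 𝒯.elements, ∫ x in simplex t, ‖v.grad x - agrad (nodal t θ)‖ ^ 2 ≤
        interpConst d σ * ∑ t ∈ 𝒯.elements, deviation t v.grad := by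
  classical
  have hd1 : 1 ≤ d := by omega
  have hp' : ∀ t, ∃ p : Vec d →ᵃ[ℝ] ℝ, t ∈ 𝒯.elements →
      agrad p = ⨍ x in simplex t, v.grad x ∧ ∫ x in simplex t, (v.val x - p x) ^ 2 ≤
        regConst d σ * meshSize t ^ 2 * deviation t v.grad := fun t => by
    by_cases ht : t ∈ 𝒯.elements
    · obtain ⟨p, hp⟩ := Triangulation.exists_affine_approx hd1 hΩ hσ hreg v ht
      exact ⟨p, fun _ => hp⟩
    · exact ⟨0, fun h => absurd h ht⟩
  choose p hp using hp'
  set V : Finset (Vec d) → ℝ := fun t => deviation t v.grad with hVdef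
  have hV : ∀ t, 0 ≤ V t := fun t => deviation_nonneg _ _
  set E : Finset (Vec d) → ℝ := fun t =>
    32 * 4 ^ d * (traceSq t v.val v.grad (p t) / volume.real (simplex t)) with hEdef
  have hE : ∀ t, 0 ≤ E t := fun t => by
    have h1 := traceSq_nonneg t v.val v.grad (p t)
    have h2 : 0 ≤ volume.real (simplex t) := measureReal_nonneg
    simp only [hEdef]
    positivity
  have hEV : ∀ t ∈ 𝒯.elements, meshSize t ^ d * E t ≤ vertexConst d σ * meshSize t ^ 2 * V t := by
    intro t ht
    have h1 := traceSq_le (hreg t ht) (hp t ht).1 (hp t ht).2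
    have h2 := (isElement ht).volume_simplex_pos
    rw [(isElement ht).meshSize_pow hd1]
    calc volume.real (simplex t) * E t = 32 * 4 ^ d * traceSq t v.val v.grad (p t) := by
          simp only [hEdef]; field_simp
      _ ≤ 32 * 4 ^ d * (((d + 1) * regConst d σ + σ ^ 2) * meshSize t ^ 2 * V t) := by gcongr
      _ = _ := by rw [vertexConst]; ring
  -- facet values of `v` are only used for test functions, then passed to the limit
  obtain ⟨φ, hφ, hφ1, hφ2⟩ := id hv
  have hlim : ∀ t ∈ 𝒯.elements, Tendsto (fun n => traceSq t (φ n) (gradient (φ n)) (p t) /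
      volume.real (simplex t)) atTop
        (𝓝 (traceSq t v.val v.grad (p t) / volume.real (simplex t))) := fun t ht =>
    (tendsto_traceSq (Triangulation.restrict_simplex_le hΩ ht) hφ hφ1 hφ2 (p t)).div_const _
  have hadj : ∀ z t t', (𝒯.starGraph z).Adj t t' → |p t z - p t' z| ≤ √(E t) + √(E t') := by
    intro z t t' h
    obtain ⟨u, hu, u', hu', hzu, hf⟩ := Triangulation.exists_facet_of_adj hd1 h
    obtain ⟨ht, hz⟩ := mem_star.1 h.1
    obtain ⟨ht', hz'⟩ := mem_star.1 h.2.1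
    have h1 : (p t z - p t' z) ^ 2 ≤ E t + E t' := by
      have h2 : (p t z - p t' z) ^ 2 ≤ 32 * 4 ^ d *
          (traceSq t v.val v.grad (p t) / volume.real (simplex t) +
            traceSq t' v.val v.grad (p t') / volume.real (simplex t')) :=
        ge_of_tendsto' (((hlim t ht).add (hlim t' ht')).const_mul (32 * 4 ^ d)) fun n =>
          (isElement ht).sq_vertex_sub_le hd hu hz hzu
            (isElement ht') hu' hf (hφ n) (p t) (p t')
      rw [mul_add] at h2
      exact h2
    refine abs_le_of_sq_le_sq (h1.trans ?_) (by positivity)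
    have h3 := Real.sq_sqrt (hE t)
    have h4 := Real.sq_sqrt (hE t')
    have h5 := mul_nonneg (Real.sqrt_nonneg (E t)) (Real.sqrt_nonneg (E t'))
    nlinarith
  have hbd : ∀ z, ∀ t ∈ 𝒯.star z, ∀ u ∈ t, z ≠ u → Disjoint (facet t u) Ω →
      |p t z| ≤ √(E t) := by
    intro z t ht u hu hzu hdis
    obtain ⟨ht, hz⟩ := mem_star.1 ht
    have h2 : p t z ^ 2 ≤ 16 * 4 ^ d *
        (traceSq t v.val v.grad (p t) / volume.real (simplex t)) :=
      ge_of_tendsto' ((hlim t ht).const_mul (16 * 4 ^ d)) fun n =>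
        (isElement ht).sq_vertex_le_of_disjoint hd hu hz hzu hdis (hφ n) (p t)
    refine Real.abs_le_sqrt (h2.trans ?_)
    have := hE t
    simp only [hEdef] at this ⊢
    linarith
  -- `E t` is the squared error that crossing a facet of `t` may add at a vertex
  obtain ⟨θ, hθ0, hθ⟩ := Triangulation.exists_nodal_values hd hΩ (fun t => Real.sqrt_nonneg (E t))
    hadj hbd
  refine ⟨θ, hθ0, ?_⟩
  set c := crossConst d * σ ^ (d - 1) with hc
  have hloc : ∀ t ∈ 𝒯.elements, ∫ x in simplex t, ‖v.grad x - agrad (nodal t θ)‖ ^ 2 ≤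
      2 * V t + 2 * ((d + 1) * (c ^ 2 * nodalConst d σ) * ∑ z ∈ t, ∑ s ∈ 𝒯.star z, V s) := by
    intro t ht
    have e := isElement ht
    have hh := e.meshSize_pos
    have hGm := v.memLp_grad.mono_measure (Triangulation.restrict_simplex_le hΩ ht)
    have hi : ∀ m : Vec d, Integrable (fun x => ‖v.grad x - m‖ ^ 2)
        (volume.restrict (simplex t)) := fun m =>
      integrable_norm_sq (hGm.sub (memLp_const m))
    have h1 : ∫ x in simplex t, ‖v.grad x - agrad (nodal t θ)‖ ^ 2 ≤
        2 * V t + 2 * (meshSize t ^ d * ‖agrad (p t) - agrad (nodal t θ)‖ ^ 2) := by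
      have e1 : V t = ∫ x in simplex t, ‖v.grad x - agrad (p t)‖ ^ 2 := by
        rw [(hp t ht).1]; rfl
      have e2 : meshSize t ^ d * ‖agrad (p t) - agrad (nodal t θ)‖ ^ 2 =
          ∫ _x in simplex t, ‖agrad (p t) - agrad (nodal t θ)‖ ^ 2 := by
        rw [setIntegral_const, e.meshSize_pow hd1, smul_eq_mul]
      rw [e1, e2, ← integral_const_mul, ← integral_const_mul,
        ← integral_add ((hi _).const_mul 2) ((integrable_const _).const_mul 2)]
      refine integral_mono (hi _) (((hi _).const_mul 2).add ((integrable_const _).const_mul 2))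
        fun x => ?_
      have h2 : ‖v.grad x - agrad (nodal t θ)‖ ≤
          ‖v.grad x - agrad (p t)‖ + ‖agrad (p t) - agrad (nodal t θ)‖ :=
        norm_sub_le_norm_sub_add_norm_sub _ _ _
      have h3 := pow_le_pow_left₀ (norm_nonneg _) h2 2
      simp only
      nlinarith [sq_nonneg (‖v.grad x - agrad (p t)‖ - ‖agrad (p t) - agrad (nodal t θ)‖)]
    have h2 : agrad (p t) - agrad (nodal t θ) = ∑ z ∈ t, (p t z - θ z) • agrad (bary t z) := by
      have e1 : p t = nodal t (p t) := e.affine_ext fun b hb => by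
        rw [nodal_apply]
        exact e.affine_eq_sum (p t) b
      conv_lhs => rw [e1]
      rw [agrad_nodal, agrad_nodal, ← sum_sub_distrib]
      exact sum_congr rfl fun z _ => (sub_smul _ _ _).symm
    have h3 : ‖agrad (p t) - agrad (nodal t θ)‖ ^ 2 ≤
        (d + 1) * ∑ z ∈ t, (p t z - θ z) ^ 2 * ‖agrad (bary t z)‖ ^ 2 := by
      rw [h2]
      have h4 := pow_le_pow_left₀ (norm_nonneg _)
        (norm_sum_le t fun z => (p t z - θ z) • agrad (bary t z)) 2
      refine h4.trans (sq_sum_le_card_mul_sum_sq.trans_eq ?_)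
      rw [e.card]
      push_cast
      congr 1
      refine sum_congr rfl fun z _ => ?_
      rw [norm_smul, mul_pow, Real.norm_eq_abs, sq_abs]
    have h4 : meshSize t ^ d * ‖agrad (p t) - agrad (nodal t θ)‖ ^ 2 ≤
        (d + 1) * (c ^ 2 * nodalConst d σ) * ∑ z ∈ t, ∑ s ∈ 𝒯.star z, V s := by
      calc _ ≤ meshSize t ^ d *
            ((d + 1) * ∑ z ∈ t, (p t z - θ z) ^ 2 * ‖agrad (bary t z)‖ ^ 2) := by gcongr
        _ = (d + 1) * ∑ z ∈ t, meshSize t ^ d * (p t z - θ z) ^ 2 * ‖agrad (bary t z)‖ ^ 2 := by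
            rw [mul_left_comm, mul_sum]
            simp_rw [mul_assoc]
        _ ≤ (d + 1) * ∑ z ∈ t, c ^ 2 * nodalConst d σ * ∑ s ∈ 𝒯.star z, V s := by
            refine mul_le_mul_of_nonneg_left (sum_le_sum fun z hz => ?_) (by positivity)
            have hzs : t ∈ 𝒯.star z := mem_star.2 ⟨ht, hz⟩
            have h5 := Triangulation.pow_mul_sq_le hd hσ hreg hE hV hEV hzs (hθ z t hzs)
            have h6 := e.norm_agrad_mul_meshSize_le hd hz (hreg t ht)
            have h7 := pow_le_pow_left₀ (by positivity) h6 2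
            have h8 : 0 ≤ nodalConst d σ * ∑ s ∈ 𝒯.star z, V s :=
              mul_nonneg (nodalConst_nonneg hσ) (sum_nonneg fun s _ => hV s)
            calc _ ≤ meshSize t ^ 2 * (nodalConst d σ * ∑ s ∈ 𝒯.star z, V s) *
                  ‖agrad (bary t z)‖ ^ 2 := mul_le_mul_of_nonneg_right h5 (by positivity)
              _ = (‖agrad (bary t z)‖ * meshSize t) ^ 2 *
                  (nodalConst d σ * ∑ s ∈ 𝒯.star z, V s) := by ring
              _ ≤ c ^ 2 * (nodalConst d σ * ∑ s ∈ 𝒯.star z, V s) :=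
                  mul_le_mul_of_nonneg_right h7 h8
              _ = _ := by ring
        _ = _ := by rw [← mul_sum]; ring
    linarith
  refine (sum_le_sum hloc).trans ?_
  rw [sum_add_distrib, ← mul_sum, ← mul_sum, ← mul_sum]
  have h1 := Triangulation.sum_sum_star_le hd1 hσ hreg hV
  have h2 := nodalConst_nonneg (d := d) hσ
  have h3 := mul_le_mul_of_nonneg_left h1
    (by positivity : 0 ≤ 2 * ((d + 1) * (c ^ 2 * nodalConst d σ)))
  calc _ ≤ 2 * ∑ t ∈ 𝒯.elements, V t + 2 * ((d + 1) * (c ^ 2 * nodalConst d σ)) *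
        (starCard d σ * (d + 1) * ∑ t ∈ 𝒯.elements, V t) := by linarith
    _ = _ := by rw [interpConst, ← hc]; ring

/-! ### The duality argument -/

theorem oscConst_nonneg (hσ : 0 < σ) : 0 ≤ oscConst d σ := by
  have := crossConst_nonneg (d := d)
  unfold oscConst; positivity

theorem interpConst_nonneg (hσ : 0 < σ) : 0 ≤ interpConst d σ := by
  have := nodalConst_nonneg (d := d) hσ
  unfold interpConst; positivity

theorem Coefficients.oscSq_nonneg (κ : Coefficients d) (f v : Vec d → ℝ) :
    0 ≤ κ.oscSq 𝒯 f v := by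
  have h : ∀ (μ : Measure (Vec d)) τ g, 0 ≤ meanDeviationSq μ τ g := fun μ τ g =>
    integral_nonneg fun _ => sq_nonneg _
  refine sum_nonneg fun t _ => ?_
  have h1 : 0 ≤ meshSize t := Real.rpow_nonneg measureReal_nonneg _
  exact add_nonneg (mul_nonneg (sq_nonneg _) (h _ _ _))
    (mul_nonneg h1 (sum_nonneg fun t' _ => h _ _ _))

theorem Triangulation.maxMeshSize_nonneg : 0 ≤ 𝒯.maxMeshSize :=
  Real.iSup_nonneg fun _ => Real.rpow_nonneg measureReal_nonneg _

/-- The mesh size is bounded in terms of the shape regularity and the diameter of the domain. -/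
theorem Triangulation.maxMeshSize_le (hd : 2 ≤ d) (hΩ : IsLipschitzDomain Ω) {σ D : ℝ}
    (hσ : 0 < σ) (hD : 0 < D) (hreg : 𝒯.IsShapeRegular σ) (hdiam : diam Ω ≤ D) :
    𝒯.maxMeshSize ≤ crossConst d * σ ^ (d - 1) * D := by
  have hc := crossConst_nonneg (d := d)
  refine Real.iSup_le (fun ⟨t, ht⟩ => ?_) (by positivity)
  have e := isElement ht
  obtain ⟨a, ha, b, hb, hab⟩ := Finset.one_lt_card.1 (by rw [e.card]; omega : 1 < t.card)
  have h1 := e.one_le_norm_agrad_mul_dist ha hb hab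
  have h2 := e.norm_agrad_mul_meshSize_le hd ha (hreg t ht)
  have h3 : dist a b ≤ D := by
    rw [← Metric.diam_closure] at hdiam
    exact (dist_le_diam_of_mem hΩ.isBounded.closure
      (simplex_subset_closure ht (vertex_mem_simplex ha))
      (simplex_subset_closure ht (vertex_mem_simplex hb))).trans hdiam
  have hh := e.meshSize_pos
  calc meshSize t ≤ ‖agrad (bary t a)‖ * dist a b * meshSize t :=
        le_mul_of_one_le_left hh.le h1
    _ = ‖agrad (bary t a)‖ * meshSize t * dist a b := by ring
    _ ≤ crossConst d * σ ^ (d - 1) * D := by gcongr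

/-- A function with a regular dual problem as right-hand side is approximated, in the seminorm of
`H¹`, by functions to which the bound for the residual of the finite volume solution applies. -/
theorem Triangulation.exists_discrete_approx (hd : 2 ≤ d) (hΩ : IsLipschitzDomain Ω)
    (hσ : 0 < σ) (hreg : 𝒯.IsShapeRegular σ) {s : ℝ} (hs : 0 < s) (hs1 : s ≤ 1) {φ : H1 Ω}
    (hφ : φ.InH10) {B : ℝ} (hB : 0 ≤ B) (hreg' : φ.sobolevNormSq s ≤ ENNReal.ofReal B) :
    ∃ (w : H1 Ω) (θ : Vec d → ℝ), w.InH10 ∧ (∀ a ∉ Ω, θ a = 0) ∧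
      (∀ t ∈ 𝒯.elements, ∀ᵐ x ∂volume.restrict (simplex t),
        w.val x = ∑ a ∈ t, θ a * bary t a x) ∧
      (∀ t ∈ 𝒯.elements, ∀ᵐ x ∂volume.restrict (simplex t),
        w.grad x = ∑ a ∈ t, θ a • agrad (bary t a)) ∧
      ∫ x in Ω, ‖φ.grad x - w.grad x‖ ^ 2 ≤
        interpConst d σ * (regConst d σ * 𝒯.maxMeshSize ^ (2 * s) * B) := by
  obtain ⟨θ, hθ, hle⟩ := hφ.exists_interpolant hd hΩ hσ hreg
  obtain ⟨w, hw, hval, hgrad⟩ := 𝒯.exists_of_nodal hΩ hθ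
  have hR := (regConst_pos (d := d) hσ).le
  have hm := Real.rpow_nonneg 𝒯.maxMeshSize_nonneg (2 * s)
  refine ⟨w, θ, hw, hθ, fun t ht => ?_, fun t ht => ?_, ?_⟩
  · filter_upwards [ae_restrict_mem (isClosed_simplex t).measurableSet] with x hx
    rw [hval t ht x hx, nodal_apply]
  · filter_upwards [ae_mem_interior_simplex] with x hx
    rw [hgrad t ht x hx, agrad_nodal]
  have hint : Integrable (fun x => ‖φ.grad x - w.grad x‖ ^ 2) (volume.restrict Ω) :=
    integrable_norm_sq (φ.memLp_grad.sub w.memLp_grad)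
  have h1 : ∫ x in Ω, ‖φ.grad x - w.grad x‖ ^ 2 =
      ∑ t ∈ 𝒯.elements, ∫ x in simplex t, ‖φ.grad x - agrad (nodal t θ)‖ ^ 2 := by
    rw [integral_eq_sum (𝒯 := 𝒯) hΩ hint]
    refine sum_congr rfl fun t ht => integral_congr_ae ?_
    filter_upwards [ae_mem_interior_simplex] with x hx
    rw [hgrad t ht x hx]
  rw [h1]
  refine hle.trans (mul_le_mul_of_nonneg_left ?_ (interpConst_nonneg hσ))
  refine (ENNReal.ofReal_le_ofReal_iff (by positivity)).1 ?_
  calc _ ≤ _ := sum_deviation_le (by omega) hΩ hσ hreg hs hs1 φ.memLp_grad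
    _ ≤ ENNReal.ofReal (regConst d σ * 𝒯.maxMeshSize ^ (2 * s)) * ENNReal.ofReal B := by
        gcongr
        exact le_add_self.trans hreg'
    _ = _ := (ENNReal.ofReal_mul (by positivity)).symm

/-- The constant of the `L²`-estimate. -/
noncomputable def auxConst (d : ℕ) (σ D M Cdual : ℝ) : ℝ :=
  let K := interpConst d σ * (regConst d σ * Cdual ^ 2)
  2 * (M ^ 2 * ((4 * D ^ 2 + 1) * K)) +
    2 * (oscConst d σ * (2 * Cdual ^ 2 + 2 * (K * (1 + crossConst d * σ ^ (d - 1) * D) ^ 2))) + 1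

theorem auxConst_pos {σ D M Cdual : ℝ} (hσ : 0 < σ) (hD : 0 < D) : 0 < auxConst d σ D M Cdual := by
  have := oscConst_nonneg (d := d) hσ
  have := interpConst_nonneg (d := d) hσ
  have := (regConst_pos (d := d) hσ).le
  have := crossConst_nonneg (d := d)
  unfold auxConst; positivity

/-- If `Y = T₁ + T₂` and the squares of both summands are multiples of `Y`, then `Y` itself is
bounded by the factors. -/
theorem le_two_mul_add_of_sq_le {Y T₁ T₂ a b : ℝ} (hY : Y = T₁ + T₂) (ha : 0 ≤ a) (hb : 0 ≤ b)
    (h1 : T₁ ^ 2 ≤ a * Y) (h2 : T₂ ^ 2 ≤ b * Y) : Y ≤ 2 * a + 2 * b := by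
  rcases le_or_gt Y 0 with h | h
  · linarith
  · refine le_of_mul_le_mul_right ?_ h
    rw [hY] at h1 h2 ⊢
    nlinarith [sq_nonneg (T₁ - T₂)]

/-- The `L²`-estimate. The difference `e` of the exact and the discrete solution is tested with
the solution `φ` of the dual problem with right-hand side `e`. A discrete approximation `w` of `φ`
splits `‖e‖² = 𝒜(e, φ - w) + 𝒜(e, w)`. The first summand is small since `w` is close to `φ`, the
second is the residual of the finite volume solution at `w`. -/
theorem l2NormSq_sub_le (hd : 2 ≤ d) {σ D M Cdual : ℝ} (hσ : 0 < σ) (hD : 0 < D)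
    (hΩ : IsLipschitzDomain Ω) (hdiam : diam Ω ≤ D)
    (hreg : 𝒯.IsShapeRegular σ) (hκ : κ.Admissible 𝒯)
    (hM : κ.IsFormBound Ω M) {s : ℝ} (hs : 0 < s) (hs1 : s ≤ 1)
    (hdual : κ.IsDualRegular Ω s Cdual) {f : Vec d → ℝ} (hf : MemLp f 2 (volume.restrict Ω))
    {u u' : H1 Ω} (hu : κ.IsWeakSolution f u) (hu' : κ.IsFVMSolution 𝒯 f u') :
    l2NormSq Ω (fun x => u.val x - u'.val x) ≤ auxConst d σ D M Cdual *
      (𝒯.maxMeshSize ^ (2 * s) *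
        h1NormSq Ω (fun x => u.val x - u'.val x) (fun x => u.grad x - u'.grad x) +
      κ.oscSq 𝒯 f u'.val) := by
  have hd1 : 1 ≤ d := by omega
  set e := H1.lin 1 (-1) u u' with he
  have he0 : e.InH10 := hu.1.lin hu'.1.1 _ _
  have hev : (fun x => u.val x - u'.val x) = e.val := by
    funext x; simp only [he, H1.lin]; ring
  have heg : (fun x => u.grad x - u'.grad x) = e.grad := by
    funext x; simp only [he, H1.lin]; module
  rw [hev, heg]
  set Y := l2NormSq Ω e.val with hY
  set E := h1NormSq Ω e.val e.grad with hE
  set q := 𝒯.maxMeshSize ^ (2 * s) with hq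
  have hY0 : 0 ≤ Y := integral_nonneg fun _ => sq_nonneg _
  have hE0 : 0 ≤ E := add_nonneg hY0 (integral_nonneg fun _ => sq_nonneg _)
  have hq0 : 0 ≤ q := Real.rpow_nonneg 𝒯.maxMeshSize_nonneg _
  have hc := crossConst_nonneg (d := d)
  have hR := (regConst_pos (d := d) hσ).le
  have hI := interpConst_nonneg (d := d) hσ
  have hO := oscConst_nonneg (d := d) hσ
  have ho := κ.oscSq_nonneg (𝒯 := 𝒯) f u'.val
  set H := crossConst d * σ ^ (d - 1) * D with hH
  have hH0 : 0 ≤ H := by positivity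
  have hqH : q ≤ (1 + H) ^ 2 := by
    have h1 := 𝒯.maxMeshSize_le hd hΩ hσ hD hreg hdiam
    calc q ≤ (1 + H) ^ (2 * s) :=
          Real.rpow_le_rpow 𝒯.maxMeshSize_nonneg (by linarith) (by positivity)
      _ ≤ (1 + H) ^ (2 : ℝ) :=
          Real.rpow_le_rpow_of_exponent_le (by linarith) (by linarith)
      _ = _ := Real.rpow_two _
  -- the dual solution with the error as data, and its discrete approximation `w`
  obtain ⟨φ, hφ⟩ := κ.exists_isDualSolution hd1 hΩ hκ hM e.memLp_val
  have hφr := hdual e.val e.memLp_val φ hφ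
  obtain ⟨w, θ, hw, hθ, hwv, hwg, hle⟩ := 𝒯.exists_discrete_approx hd hΩ hσ hreg hs hs1 hφ.1
    (B := Cdual ^ 2 * Y) (by positivity) hφr
  set K := interpConst d σ * (regConst d σ * Cdual ^ 2) with hK
  have hK0 : 0 ≤ K := by positivity
  set G := ∫ x in Ω, ‖φ.grad x - w.grad x‖ ^ 2 with hG
  have hG1 : G ≤ K * q * Y := hle.trans_eq (by rw [hK]; ring)
  set r := H1.lin 1 (-1) φ w with hr
  have hr0 : r.InH10 := hφ.1.lin hw _ _
  have hrg : ∫ x in Ω, ‖r.grad x‖ ^ 2 = G := by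
    refine integral_congr_ae (ae_of_all _ fun x => ?_)
    have : r.grad x = φ.grad x - w.grad x := by simp only [hr, H1.lin]; module
    simp only [this]
  have hrn : h1NormSq Ω r.val r.grad ≤ (4 * D ^ 2 + 1) * (K * q * Y) := by
    have h1 := hr0.poincare hd1 hΩ.isBounded hdiam
    rw [hrg] at h1
    unfold h1NormSq
    rw [hrg]
    nlinarith [sq_nonneg D]
  have hφn : ∫ x in Ω, ‖φ.grad x‖ ^ 2 ≤ Cdual ^ 2 * Y := by
    have h1 := (ENNReal.ofReal_le_ofReal_iff (by positivity)).1 (le_self_add.trans hφr)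
    have h2 : 0 ≤ ∫ x in Ω, φ.val x ^ 2 := integral_nonneg fun _ => sq_nonneg _
    unfold h1NormSq at h1
    linarith
  have hwn : ∫ x in Ω, ‖w.grad x‖ ^ 2 ≤ (2 * Cdual ^ 2 + 2 * (K * (1 + H) ^ 2)) * Y := by
    have hi : ∀ v : H1 Ω, Integrable (fun x => ‖v.grad x‖ ^ 2) (volume.restrict Ω) := fun v =>
      integrable_norm_sq v.memLp_grad
    have h1 : ∫ x in Ω, ‖w.grad x‖ ^ 2 ≤
        ∫ x in Ω, (2 * ‖φ.grad x‖ ^ 2 + 2 * ‖r.grad x‖ ^ 2) := by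
      refine integral_mono (hi w) (((hi φ).const_mul 2).add ((hi r).const_mul 2)) fun x => ?_
      have h2 : w.grad x = φ.grad x - r.grad x := by simp only [hr, H1.lin]; module
      have h3 := pow_le_pow_left₀ (norm_nonneg _) (norm_sub_le (φ.grad x) (r.grad x)) 2
      simp only [h2]
      nlinarith [sq_nonneg (‖φ.grad x‖ - ‖r.grad x‖)]
    rw [integral_add ((hi φ).const_mul 2) ((hi r).const_mul 2), integral_const_mul,
      integral_const_mul, hrg] at h1
    have h2 : K * q * Y ≤ K * (1 + H) ^ 2 * Y := by gcongr
    linarith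
  have hsplit : Y = κ.form e r + κ.form e w := by
    have h1 := hφ.2 e he0
    have h2 := Coefficients.form_lin_right hΩ hκ 1 (-1) e φ w
    rw [← hr] at h2
    have h3 : Y = ∫ x in Ω, e.val x * e.val x :=
      integral_congr_ae (ae_of_all _ fun x => sq (e.val x))
    linarith
  have hT1 : κ.form e r ^ 2 ≤ M ^ 2 * E * ((4 * D ^ 2 + 1) * (K * q)) * Y := by
    have h1 := pow_le_pow_left₀ (abs_nonneg _) (hM e r he0 hr0) 2
    have hr1 : 0 ≤ h1NormSq Ω r.val r.grad :=
      add_nonneg (integral_nonneg fun _ => sq_nonneg _) (integral_nonneg fun _ => sq_nonneg _)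
    rw [sq_abs, mul_pow, mul_pow, Real.sq_sqrt hE0, Real.sq_sqrt hr1] at h1
    have h2 := mul_le_mul_of_nonneg_left hrn (by positivity : 0 ≤ M ^ 2 * E)
    linarith
  have hT2 : κ.form e w ^ 2 ≤ oscConst d σ * κ.oscSq 𝒯 f u'.val *
      (2 * Cdual ^ 2 + 2 * (K * (1 + H) ^ 2)) * Y := by
    have h1 := sq_residual_le hd hσ hΩ hreg hκ hf hu' hθ hwv hwg
    have h2 := Coefficients.form_lin_left hΩ hκ 1 (-1) u u' w
    rw [← he, hu.2 w hw] at h2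
    have h3 : κ.form e w = (∫ x in Ω, f x * w.val x) - κ.form u' w := by linarith
    rw [h3]
    have h4 := mul_le_mul_of_nonneg_left hwn (mul_nonneg hO ho)
    linarith
  have hmain := le_two_mul_add_of_sq_le hsplit (by positivity) (by positivity) hT1 hT2
  have hA : auxConst d σ D M Cdual = 2 * (M ^ 2 * ((4 * D ^ 2 + 1) * K)) +
    2 * (oscConst d σ * (2 * Cdual ^ 2 + 2 * (K * (1 + H) ^ 2))) + 1 := rfl
  rw [hA]
  set A := 2 * (M ^ 2 * ((4 * D ^ 2 + 1) * K)) with hAdef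
  set B := 2 * (oscConst d σ * (2 * Cdual ^ 2 + 2 * (K * (1 + H) ^ 2))) with hBdef
  have hA0 : 0 ≤ A := by positivity
  have hB0 : 0 ≤ B := by positivity
  have h5 : 0 ≤ q * E := by positivity
  calc Y ≤ A * (q * E) + B * κ.oscSq 𝒯 f u'.val := by rw [hAdef, hBdef]; linarith
    _ ≤ (A + B + 1) * (q * E) + (A + B + 1) * κ.oscSq 𝒯 f u'.val := by gcongr <;> linarith
    _ = _ := by ring

end FVM

theorem mainTheorem4 (d : ℕ) (hd : d = 2 ∨ d = 3) (σ D M Cdual : ℝ)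
    (hσ : 0 < σ) (hD : 0 < D) (hM : 0 < M) (hCdual : 0 < Cdual) :
    ∃ Caux : ℝ, 0 < Caux ∧
      ∀ (Ω : Set (FVM.Vec d)), FVM.IsLipschitzDomain Ω → Metric.diam Ω ≤ D →
      ∀ (𝒯 : FVM.Triangulation Ω), 𝒯.IsShapeRegular σ →
      ∀ (κ : FVM.Coefficients d), κ.Admissible 𝒯 → κ.IsFormBound Ω M →
      ∀ s : ℝ, 0 < s → s ≤ 1 → κ.IsDualRegular Ω s Cdual →
      ∀ f : FVM.Vec d → ℝ, MemLp f 2 (volume.restrict Ω) →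
      ∀ u : FVM.H1 Ω, κ.IsWeakSolution f u →
      ∀ u' : FVM.H1 Ω, κ.IsFVMSolution 𝒯 f u' →
        Caux⁻¹ * FVM.l2NormSq Ω (fun x => u.val x - u'.val x) ≤
          𝒯.maxMeshSize ^ (2 * s) *
              FVM.h1NormSq Ω (fun x => u.val x - u'.val x) (fun x => u.grad x - u'.grad x) +
            κ.oscSq 𝒯 f u'.val := by
  have hd2 : 2 ≤ d := by omega
  have hC := FVM.auxConst_pos (d := d) (M := M) (Cdual := Cdual) hσ hD
  refine ⟨FVM.auxConst d σ D M Cdual, hC, fun Ω hΩ hdiam 𝒯 hreg κ hκ hκM s hs hs1 hdual f hf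
    u hu u' hu' => ?_⟩
  rw [inv_mul_le_iff₀ hC]
  exact FVM.l2NormSq_sub_le hd2 hσ hD hΩ hdiam hreg hκ hκM hs hs1 hdual hf hu hu'
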